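/- Let $\mathbf S$ be a site. A strictly commutative Picard $\mathbf S$-stack is an $\mathbf S$-stack in groupoids with an addition functor $+$ and natural isomorphisms $\sigma$ (associativity) and $\tau$ (commutativity, with $\tau_{a,a}=\mathrm{id}$) which make each fiber a strictly commutative Picard category. An additive functor is a cartesian functor $F$ with natural isomorphisms $F(a+b)\cong F(a)+F(b)$ compatible with $\sigma$ and $\tau$. A morphism of additive functors is a natural transformation over $\mathbf S$ compatible with these isomorphisms. Let $\mathcal P,\mathcal Q$ be strictly commutative Picard $\mathbf S$-stacks. An extension of $\mathcal P$ by $\mathcal Q$ consists of a strictly commutative Picard $\mathbf S$-stack $\mathcal E$, additive functors $I:\mathcal Q\to\mathcal E$ and $J:\mathcal E\to\mathcal P$, and an isomorphism of additive functors $J\circ I\cong 0$, such that $\pi_0(J)$ is an epimorphism of sheaves and $I$ induces an equivalence $\mathcal Q\cong\ker(J)=\mathcal E\times_{\mathcal P}\mathbf 1$. Two extensions $\mathcal E,\mathcal E'$ of $\mathcal P$ by $\mathcal Q$ are equivalent if there is an additive functor $F:\mathcal E\to\mathcal E'$ with isomorphisms of additive functors $J'\circ F\cong J$ and $F\circ I\cong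 I'$ which are compatible with $J\circ I\cong 0$ and $J'\circ I'\cong 0$. The pull-back $F^*\mathcal E$ of an extension $\mathcal E$ of $\mathcal P$ by $\mathcal Q$ via an additive functor $F:\mathcal P'\to\mathcal P$ is the fibered product $\mathcal E\times_{\mathcal P}\mathcal P'$, an extension of $\mathcal P'$ by $\mathcal Q$. The push-down $H_*\mathcal E$ via an additive functor $H:\mathcal Q\to\mathcal Q'$ is the fibered sum of $\mathcal E$ and $\mathcal Q'$ under $\mathcal Q$, an extension of $\mathcal P$ by $\mathcal Q'$. This fibered sum is the stack generated by the following fibered category: the objects over $U$ are the pairs $(e,q')$ with $e\in\mathcal E(U)$, $q'\in\mathcal Q'(U)$; the arrows $(e_1,q_1')\to(e_2,q_2')$ over $U$ are the isomorphism classes of triplets $(q,\alpha,\beta)$ with $q\in\mathcal Q(U)$, $\alpha:e_1+I(q)\to e_2$ and $\beta:q_1'\to q_2'+H(q)$; the addition is componentwise. For extensions $\mathcal E,\mathcal E'$ of $\mathcal P$ by $\mathcal Q$, the product $\mathcal E\times\mathcal E'$ is an extension of $\mathcal P\times\mathcal P$ by $\mathcal Q\times\mathcal Q$. The sum is defined by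 $\mathcal E+\mathcal E'=D^*(+)_*(\mathcal E\times\mathcal E')$, where $D:\mathcal P\to\mathcal P\times\mathcal P$ is the diagonal and $+:\mathcal Q\times\mathcal Q\to\mathcal Q$ is the addition of $\mathcal Q$. Lemma. Equivalence of extensions of $\mathcal P$ by $\mathcal Q$ is an equivalence relation. The sum of any two extensions of $\mathcal P$ by $\mathcal Q$ exists, its equivalence class depends only on the classes of the two summands, and it makes the set of equivalence classes of extensions of $\mathcal P$ by $\mathcal Q$ an abelian group (the law is associative and commutative, with neutral element and inverses). The neutral element is the class of the split extension $\mathcal P\times\mathcal Q$, with $I(q)=(0,q)$ and $J(p,q)=p$. -/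

import Mathlib

open CategoryTheory

universe w v u

namespace PicardStacks

/-- Points of the total category of a fibered category whose fiber over `U` has objects `Obj U`. -/
structure Tot {C : Type u} (Obj : C → Type w) where
  /-- the object of the base over which the point lies -/
  {base : C}
  /-- the object of the fiber -/
  pt : Obj base

/-- A category fibered in groupoids over `C`: a category structure on the points `Tot Obj`, a
projection `π` to `C`, liftings of morphisms of `C` with given target, and all morphisms are
cartesian. -/
structure FibGpd (C : Type u) [Category.{v} C] where
  Obj : C → Type (max u v w)
  [cat : Category.{max u v w} (Tot Obj)]
  π : ∀ {U V : C} {x : Obj U} {y : Obj V}, ((Tot.mk x : Tot Obj) ⟶ Tot.mk y) → (U ⟶ V)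
  π_id : ∀ {U : C} (x : Obj U), π (𝟙 (Tot.mk x)) = 𝟙 U
  π_comp : ∀ {U V W : C} {x : Obj U} {y : Obj V} {z : Obj W}
    (φ : (Tot.mk x : Tot Obj) ⟶ Tot.mk y) (ψ : (Tot.mk y : Tot Obj) ⟶ Tot.mk z),
    π (φ ≫ ψ) = π φ ≫ π ψ
  exists_lift : ∀ {U V : C} (f : U ⟶ V) (y : Obj V),
    ∃ (x : Obj U) (φ : (Tot.mk x : Tot Obj) ⟶ Tot.mk y), π φ = f
  cartesian : ∀ {U V W : C} {x : Obj U} {y : Obj V} {z : Obj W}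
    (φ : (Tot.mk x : Tot Obj) ⟶ Tot.mk z) (ψ : (Tot.mk y : Tot Obj) ⟶ Tot.mk z) (h : U ⟶ V),
    h ≫ π ψ = π φ → ∃! χ : (Tot.mk x : Tot Obj) ⟶ Tot.mk y, π χ = h ∧ χ ≫ ψ = φ

attribute [instance] FibGpd.cat
attribute [simp] FibGpd.π_id FibGpd.π_comp

namespace FibGpd

variable {C : Type u} [Category.{v} C] (P : FibGpd.{w} C)

/-- Morphisms of the total category between points given by objects of the fibers. -/
abbrev Hom {U V : C} (x : P.Obj U) (y : P.Obj V) : Type (max u v w) :=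
  (Tot.mk x : Tot P.Obj) ⟶ Tot.mk y

/-- Morphisms of the fiber over `U`: the morphisms lying over the identity of `U`. -/
@[ext] structure FHom {U : C} (x y : P.Obj U) : Type (max u v w) where
  /-- the underlying morphism of the total category -/
  val : P.Hom x y
  property : P.π val = 𝟙 U

/-- The fiber category `P(U)`. -/
instance fiberCategory (U : C) : Category.{max u v w} (P.Obj U) where
  Hom x y := P.FHom x y
  id x := ⟨𝟙 _, P.π_id _⟩
  comp f g := ⟨f.1 ≫ g.1, by rw [P.π_comp, f.2, g.2]; exact Category.id_comp _⟩
  id_comp f := FHom.ext (Category.id_comp _)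
  comp_id f := FHom.ext (Category.comp_id _)
  assoc f g h := FHom.ext (Category.assoc _ _ _)

variable {P}

theorem fhom_eq {U : C} {x y : P.Obj U} {f g : x ⟶ y} (h : f.1 = g.1) : f = g :=
  FHom.ext h

@[simp] theorem id_val {U : C} (x : P.Obj U) : (𝟙 x : x ⟶ x).1 = 𝟙 (Tot.mk (Obj := P.Obj) x) := rfl
@[simp] theorem comp_val {U : C} {x y z : P.Obj U} (f : x ⟶ y) (g : y ⟶ z) :
    (f ≫ g).1 = f.1 ≫ g.1 := rfl

theorem hom_ext {U V W : C} {x : P.Obj U} {y : P.Obj V} {z : P.Obj W} {φ φ' : P.Hom x y}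
    (ψ : P.Hom y z) (h : P.π φ = P.π φ')
    (h' : φ ≫ ψ = φ' ≫ ψ) : φ = φ' := by
  obtain ⟨χ, -, hu⟩ := P.cartesian (φ' ≫ ψ) ψ (P.π φ') (P.π_comp _ _).symm
  rw [hu φ ⟨h, h'⟩, hu φ' ⟨rfl, rfl⟩]

theorem exists_inv {U : C} {x y : P.Obj U} (φ : P.FHom x y) :
    ∃ ψ : P.FHom y x, φ.1 ≫ ψ.1 = 𝟙 _ ∧ ψ.1 ≫ φ.1 = 𝟙 _ := by
  obtain ⟨ψ, ⟨h1, h2⟩, -⟩ := P.cartesian (𝟙 (Tot.mk y)) φ.1 (𝟙 U)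
    (by rw [φ.2, P.π_id]; exact Category.id_comp _)
  refine ⟨⟨ψ, h1⟩, hom_ext φ.1 ?_ ?_, h2⟩
  · rw [P.π_comp, h1, φ.2, P.π_id]; exact Category.id_comp _
  · rw [Category.assoc, h2]; simp

instance {U : C} {x y : P.Obj U} (φ : x ⟶ y) : IsIso φ := by
  obtain ⟨ψ, h1, h2⟩ := exists_inv φ
  exact ⟨ψ, fhom_eq h1, fhom_eq h2⟩

/-- The inverse of a morphism of the fiber. -/
noncomputable def finv {U : C} {x y : P.Obj U} (φ : P.FHom x y) : P.FHom y x :=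
  (exists_inv φ).choose

@[simp] theorem fhom_finv {U : C} {x y : P.Obj U} (φ : P.FHom x y) : φ.1 ≫ (finv φ).1 = 𝟙 _ :=
  (exists_inv φ).choose_spec.1
@[simp] theorem finv_fhom {U : C} {x y : P.Obj U} (φ : P.FHom x y) : (finv φ).1 ≫ φ.1 = 𝟙 _ :=
  (exists_inv φ).choose_spec.2
@[simp] theorem fhom_finv_assoc {U : C} {x y : P.Obj U} (φ : P.FHom x y) {Z : Tot P.Obj}
    (h : Tot.mk x ⟶ Z) : φ.1 ≫ (finv φ).1 ≫ h = h := by rw [← Category.assoc]; simp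
@[simp] theorem finv_fhom_assoc {U : C} {x y : P.Obj U} (φ : P.FHom x y) {Z : Tot P.Obj}
    (h : Tot.mk y ⟶ Z) : (finv φ).1 ≫ φ.1 ≫ h = h := by rw [← Category.assoc]; simp
instance isIso_val {U : C} {x y : P.Obj U} (φ : P.FHom x y) : IsIso φ.1 :=
  ⟨(finv φ).1, fhom_finv φ, finv_fhom φ⟩
@[simp] theorem π_val {U : C} {x y : P.Obj U} (φ : P.FHom x y) : P.π φ.1 = 𝟙 U := φ.2

variable (P)

/-- Cartesian sections of `P` over the sieve `R` of `U`, i.e. cartesian functors over `C` from `R`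
(a full subcategory of `C / U`) to `P`. -/
structure Sec {U : C} (R : Sieve U) where
  obj : ∀ {V : C} (f : V ⟶ U), R f → P.Obj V
  map : ∀ {V W : C} {f : V ⟶ U} {k : W ⟶ U} (hf : R f) (hk : R k) (g : W ⟶ V), g ≫ f = k →
    P.Hom (obj k hk) (obj f hf)
  π_map : ∀ {V W : C} {f : V ⟶ U} {k : W ⟶ U} (hf : R f) (hk : R k) (g : W ⟶ V) (h : g ≫ f = k),
    P.π (map hf hk g h) = g
  map_id : ∀ {V : C} {f : V ⟶ U} (hf : R f), map hf hf (𝟙 V) (Category.id_comp f) = 𝟙 _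
  map_comp : ∀ {V W T : C} {f : V ⟶ U} {k : W ⟶ U} {l : T ⟶ U} (hf : R f) (hk : R k) (hl : R l)
    (g : W ⟶ V) (h : g ≫ f = k) (g' : T ⟶ W) (h' : g' ≫ k = l),
    map hf hl (g' ≫ g) (by rw [Category.assoc, h, h']) = map hk hl g' h' ≫ map hf hk g h

variable {P} in
/-- Morphisms of cartesian sections. -/
@[ext] structure Sec.Hom {U : C} {R : Sieve U} (s t : P.Sec R) where
  app : ∀ {V : C} (f : V ⟶ U) (hf : R f), P.FHom (s.obj f hf) (t.obj f hf)
  naturality : ∀ {V W : C} {f : V ⟶ U} {k : W ⟶ U} (hf : R f) (hk : R k) (g : W ⟶ V)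
    (h : g ≫ f = k), s.map hf hk g h ≫ (app f hf).1 = (app k hk).1 ≫ t.map hf hk g h

instance {U : C} (R : Sieve U) : Category.{max u v w} (P.Sec R) where
  Hom s t := Sec.Hom s t
  id s := ⟨fun f hf => ⟨𝟙 _, P.π_id _⟩, by intros; simp⟩
  comp a b := ⟨fun f hf => ⟨(a.app f hf).1 ≫ (b.app f hf).1, by simp⟩, by
    intros; rw [← Category.assoc, a.naturality, Category.assoc, b.naturality, Category.assoc]⟩
  id_comp a := Sec.Hom.ext (by funext V f hf; exact FHom.ext (Category.id_comp _))
  comp_id a := Sec.Hom.ext (by funext V f hf; exact FHom.ext (Category.comp_id _))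
  assoc a b c := Sec.Hom.ext (by funext V f hf; exact FHom.ext (Category.assoc _ _ _))

/-- Restriction of cartesian sections from `C / U` (the maximal sieve) to a sieve. -/
def restrict {U : C} (R : Sieve U) : P.Sec (⊤ : Sieve U) ⥤ P.Sec R where
  obj s :=
    { obj := fun f _ => s.obj f trivial
      map := fun _ _ g h => s.map trivial trivial g h
      π_map := fun _ _ g h => s.π_map trivial trivial g h
      map_id := fun _ => s.map_id trivial
      map_comp := fun _ _ _ g h g' h' => s.map_comp trivial trivial trivial g h g' h' }
  map a := ⟨fun f _ => a.app f trivial, fun _ _ g h => a.naturality trivial trivial g h⟩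

/-- `P` is a stack for the topology `J`: for every covering sieve `R` of `U`, restriction
`Cart(C / U, P) ⥤ Cart(R, P)` is an equivalence of categories. -/
def IsStack (J : GrothendieckTopology C) : Prop :=
  ∀ (U : C) (R : Sieve U), R ∈ J U → (P.restrict R).IsEquivalence

end FibGpd

/-- A category fibered in groupoids over `C` whose fibers are strictly commutative Picard
categories, with cartesian addition `add`, associativity `σ` and commutativity `τ`. Strict
commutativity is `τ_self`. The neutral object `zero` (with its restriction maps `zeroMap` and the
isomorphisms `zeroAdd`), which is determined up to a unique isomorphism by the other data, is part
of the structure. -/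
structure PicardFib (C : Type u) [Category.{v} C] extends FibGpd.{w} C where
  add : ∀ {U : C}, Obj U → Obj U → Obj U
  addMap : ∀ {U V : C} {x x' : Obj U} {y y' : Obj V} (φ : toFibGpd.Hom x y)
    (ψ : toFibGpd.Hom x' y'), π φ = π ψ → toFibGpd.Hom (add x x') (add y y')
  π_addMap : ∀ {U V : C} {x x' : Obj U} {y y' : Obj V} (φ : toFibGpd.Hom x y)
    (ψ : toFibGpd.Hom x' y') (h : π φ = π ψ), π (addMap φ ψ h) = π φ
  addMap_id : ∀ {U : C} (x x' : Obj U),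
    addMap (𝟙 (Tot.mk x)) (𝟙 (Tot.mk x')) ((π_id _).trans (π_id _).symm) = 𝟙 (Tot.mk (add x x'))
  addMap_comp : ∀ {U V W : C} {x x' : Obj U} {y y' : Obj V} {z z' : Obj W}
    (φ : toFibGpd.Hom x y) (φ' : toFibGpd.Hom y z) (ψ : toFibGpd.Hom x' y')
    (ψ' : toFibGpd.Hom y' z') (h : π φ = π ψ) (h' : π φ' = π ψ'),
    addMap (φ ≫ φ') (ψ ≫ ψ') (by rw [π_comp, π_comp, h, h']) = addMap φ ψ h ≫ addMap φ' ψ' h'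
  σ : ∀ {U : C} (x y z : Obj U), toFibGpd.FHom (add (add x y) z) (add x (add y z))
  σ_natural : ∀ {U V : C} {x y z : Obj U} {x' y' z' : Obj V} (φ : toFibGpd.Hom x x')
    (ψ : toFibGpd.Hom y y') (χ : toFibGpd.Hom z z') (h : π φ = π ψ) (h' : π ψ = π χ),
    addMap (addMap φ ψ h) χ (by rw [π_addMap, h, h']) ≫ (σ x' y' z').1 =
      (σ x y z).1 ≫ addMap φ (addMap ψ χ h') (by rw [π_addMap, h])
  τ : ∀ {U : C} (x y : Obj U), toFibGpd.FHom (add x y) (add y x)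
  τ_natural : ∀ {U V : C} {x y : Obj U} {x' y' : Obj V} (φ : toFibGpd.Hom x x')
    (ψ : toFibGpd.Hom y y') (h : π φ = π ψ),
    addMap φ ψ h ≫ (τ x' y').1 = (τ x y).1 ≫ addMap ψ φ h.symm
  pentagon : ∀ {U : C} (x y z t : Obj U),
    addMap (σ x y z).1 (𝟙 (Tot.mk t)) ((σ x y z).2.trans (π_id _).symm) ≫ (σ x (add y z) t).1 ≫
      addMap (𝟙 (Tot.mk x)) (σ y z t).1 ((π_id _).trans (σ y z t).2.symm) =
    (σ (add x y) z t).1 ≫ (σ x y (add z t)).1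
  hexagon : ∀ {U : C} (x y z : Obj U),
    (σ x y z).1 ≫ (τ x (add y z)).1 ≫ (σ y z x).1 =
      addMap (τ x y).1 (𝟙 (Tot.mk z)) ((τ x y).2.trans (π_id _).symm) ≫ (σ y x z).1 ≫
        addMap (𝟙 (Tot.mk y)) (τ x z).1 ((π_id _).trans (τ x z).2.symm)
  τ_τ : ∀ {U : C} (x y : Obj U), (τ x y).1 ≫ (τ y x).1 = 𝟙 (Tot.mk (add x y))
  τ_self : ∀ {U : C} (x : Obj U), (τ x x).1 = 𝟙 (Tot.mk (add x x))
  zero : ∀ U : C, Obj U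
  zeroMap : ∀ {U V : C} (f : U ⟶ V), toFibGpd.Hom (zero U) (zero V)
  π_zeroMap : ∀ {U V : C} (f : U ⟶ V), π (zeroMap f) = f
  zeroMap_id : ∀ U : C, zeroMap (𝟙 U) = 𝟙 (Tot.mk (zero U))
  zeroMap_comp : ∀ {U V W : C} (f : U ⟶ V) (g : V ⟶ W),
    zeroMap (f ≫ g) = zeroMap f ≫ zeroMap g
  zeroAdd : ∀ {U : C} (x : Obj U), toFibGpd.FHom (add (zero U) x) x
  zeroAdd_natural : ∀ {U V : C} {x : Obj U} {y : Obj V} (φ : toFibGpd.Hom x y),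
    addMap (zeroMap (π φ)) φ (π_zeroMap _) ≫ (zeroAdd y).1 = (zeroAdd x).1 ≫ φ
  triangle : ∀ {U : C} (x y : Obj U),
    (σ x (zero U) y).1 ≫ addMap (𝟙 (Tot.mk x)) (zeroAdd y).1 ((π_id _).trans (zeroAdd y).2.symm) =
      addMap (τ x (zero U)).1 (𝟙 (Tot.mk y)) ((τ x (zero U)).2.trans (π_id _).symm) ≫
        addMap (zeroAdd x).1 (𝟙 (Tot.mk y)) ((zeroAdd x).2.trans (π_id _).symm)
  exists_neg : ∀ {U : C} (x : Obj U), ∃ y : Obj U, Nonempty (toFibGpd.FHom (add x y) (zero U))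

attribute [simp] PicardFib.π_addMap PicardFib.addMap_id PicardFib.τ_τ PicardFib.τ_self
  PicardFib.π_zeroMap PicardFib.zeroMap_id

/-- A strictly commutative Picard stack over the site `(C, J)`. -/
structure PicardStack {C : Type u} [Category.{v} C] (J : GrothendieckTopology C) extends
    PicardFib.{w} C where
  isStack : toFibGpd.IsStack J

namespace PicardFib

variable {C : Type u} [Category.{v} C] (P : PicardFib.{w} C)

/-- Sum of two morphisms of a fiber. -/
def addF {U : C} {x x' y y' : P.Obj U} (φ : P.FHom x y) (ψ : P.FHom x' y') :
    P.FHom (P.add x x') (P.add y y') :=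
  ⟨P.addMap φ.1 ψ.1 (by simp), by simp⟩

theorem addMap_congr {U V : C} {x x' : P.Obj U} {y y' : P.Obj V} {φ₁ φ₂ : P.Hom x y}
    {ψ₁ ψ₂ : P.Hom x' y'} (h : P.π φ₁ = P.π ψ₁) (hφ : φ₁ = φ₂) (hψ : ψ₁ = ψ₂) :
    P.addMap φ₁ ψ₁ h = P.addMap φ₂ ψ₂ (hφ ▸ hψ ▸ h) := by subst hφ hψ; rfl

open FibGpd

/-- The fibers are symmetric monoidal categories. -/
noncomputable instance (U : C) : MonoidalCategoryStruct (P.Obj U) where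
  tensorObj x y := P.add x y
  whiskerLeft x _ _ f := P.addF (⟨𝟙 _, P.π_id _⟩ : P.FHom x x) f
  whiskerRight f y := P.addF f (⟨𝟙 _, P.π_id _⟩ : P.FHom y y)
  tensorHom f g := P.addF f g
  tensorUnit := P.zero U
  associator x y z := asIso (X := P.add (P.add x y) z) (Y := P.add x (P.add y z)) (P.σ x y z)
  leftUnitor x := asIso (X := P.add (P.zero U) x) (Y := x) (P.zeroAdd x)
  rightUnitor x := asIso (X := P.add x (P.zero U)) (Y := x)
    (FHom.mk ((P.τ x (P.zero U)).1 ≫ (P.zeroAdd x).1) (by simp) : P.FHom _ _)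

noncomputable instance (U : C) : MonoidalCategory (P.Obj U) :=
  MonoidalCategory.ofTensorHom
    (id_tensorHom_id := fun x y => fhom_eq (P.addMap_id x y))
    (id_tensorHom := fun _ _ _ _ => rfl)
    (tensorHom_id := fun _ _ => rfl)
    (tensorHom_comp_tensorHom := fun f g f' g' =>
      fhom_eq (P.addMap_comp f.1 f'.1 g.1 g'.1 (f.2.trans g.2.symm) (f'.2.trans g'.2.symm)).symm)
    (associator_naturality := fun f g h =>
      fhom_eq (P.σ_natural f.1 g.1 h.1 (f.2.trans g.2.symm) (g.2.trans h.2.symm)))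
    (leftUnitor_naturality := fun {x y} f => fhom_eq (by
      have := P.zeroAdd_natural f.1
      refine Eq.trans ?_ this
      exact congrArg (· ≫ (P.zeroAdd y).1) (P.addMap_congr _
        (by rw [f.2, P.zeroMap_id]; rfl) rfl)))
    (rightUnitor_naturality := fun {x y} f => fhom_eq (by
      have := P.zeroAdd_natural f.1
      refine Eq.trans (Category.assoc _ _ _).symm ?_
      refine Eq.trans (congrArg (· ≫ (P.zeroAdd y).1)
        (P.τ_natural f.1 (𝟙 (Tot.mk (P.zero U))) (by rw [f.2]; simp))) ?_
      refine (Category.assoc _ _ _).trans (Eq.trans ?_ (Category.assoc _ _ _).symm)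
      refine congrArg ((P.τ x (P.zero U)).1 ≫ ·) (Eq.trans ?_ this)
      exact congrArg (· ≫ (P.zeroAdd y).1) (P.addMap_congr _
        (by rw [f.2, P.zeroMap_id]) rfl)))
    (pentagon := fun x y z t => fhom_eq (P.pentagon x y z t))
    (triangle := fun x y => fhom_eq ((P.triangle x y).trans (by
      rw [← P.addMap_comp]
      exact P.addMap_congr _ rfl (Category.comp_id _))))

open MonoidalCategory in
/-- The commutativity constraint, as an isomorphism of the fiber. -/
def braid {U : C} (x y : P.Obj U) : x ⊗ y ≅ y ⊗ x :=
  ⟨P.τ x y, P.τ y x, fhom_eq (P.τ_τ x y), fhom_eq (P.τ_τ y x)⟩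

noncomputable instance (U : C) : SymmetricCategory (P.Obj U) where
  braiding x y := P.braid x y
  braiding_naturality_right x y z f := fhom_eq (P.τ_natural (𝟙 (Tot.mk x)) f.1 (by rw [f.2]; simp))
  braiding_naturality_left f z := fhom_eq (P.τ_natural f.1 (𝟙 (Tot.mk z)) (by rw [f.2]; simp))
  hexagon_forward x y z := fhom_eq (P.hexagon x y z)
  hexagon_reverse x y z := by
    open MonoidalCategory in
    have h : α_ z x y ≪≫ P.braid z (x ⊗ y) ≪≫ α_ x y z =
      whiskerRightIso (P.braid z x) y ≪≫ α_ x z y ≪≫ whiskerLeftIso x (P.braid z y) :=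
      Iso.ext (fhom_eq (P.hexagon z x y))
    have h' := congrArg Iso.inv h
    simp only [Iso.trans_inv, Category.assoc] at h'
    exact h'
  symmetry x y := fhom_eq (P.τ_τ x y)



variable {P}

open MonoidalCategory in
instance {U : C} (x : P.Obj U) : (tensorRight x).IsEquivalence := by
  obtain ⟨y, ⟨φ⟩⟩ := P.exists_neg x
  let e : x ⊗ y ≅ 𝟙_ (P.Obj U) := asIso (X := P.add x y) (Y := P.zero U) φ
  let e₁ : tensorRight x ⋙ tensorRight y ≅ 𝟭 (P.Obj U) :=
    (tensorRightTensor x y).symm ≪≫ (tensoringRight _).mapIso e ≪≫ rightUnitorNatIso _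
  let e₂ : tensorRight y ⋙ tensorRight x ≅ 𝟭 (P.Obj U) :=
    (tensorRightTensor y x).symm ≪≫ (tensoringRight _).mapIso (β_ y x ≪≫ e) ≪≫
      rightUnitorNatIso _
  exact (CategoryTheory.Equivalence.mk _ _ e₁.symm e₂).isEquivalence_functor

end PicardFib

/-- Additive functors: (cartesian) functors over `C` with isomorphisms
`sum : F (x + y) ≅ F x + F y`, natural and compatible with associativity and commutativity.
As all morphisms of the source and target are cartesian, so is each functor over `C`. -/
structure AddFunctor {C : Type u} [Category.{v} C] (P Q : PicardFib.{w} C) where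
  obj : ∀ {U : C}, P.Obj U → Q.Obj U
  map : ∀ {U V : C} {x : P.Obj U} {y : P.Obj V}, P.Hom x y → Q.Hom (obj x) (obj y)
  π_map : ∀ {U V : C} {x : P.Obj U} {y : P.Obj V} (φ : P.Hom x y), Q.π (map φ) = P.π φ
  map_id : ∀ {U : C} (x : P.Obj U), map (𝟙 (Tot.mk x)) = 𝟙 (Tot.mk (obj x))
  map_comp : ∀ {U V W : C} {x : P.Obj U} {y : P.Obj V} {z : P.Obj W} (φ : P.Hom x y)
    (ψ : P.Hom y z), map (φ ≫ ψ) = map φ ≫ map ψ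
  sum : ∀ {U : C} (x y : P.Obj U), Q.FHom (obj (P.add x y)) (Q.add (obj x) (obj y))
  sum_natural : ∀ {U V : C} {x x' : P.Obj U} {y y' : P.Obj V} (φ : P.Hom x y)
    (ψ : P.Hom x' y') (h : P.π φ = P.π ψ),
    map (P.addMap φ ψ h) ≫ (sum y y').1 =
      (sum x x').1 ≫ Q.addMap (map φ) (map ψ) (by rw [π_map, π_map, h])
  map_σ : ∀ {U : C} (x y z : P.Obj U),
    map (P.σ x y z).1 ≫ (sum x (P.add y z)).1 ≫
        Q.addMap (𝟙 (Tot.mk (obj x))) (sum y z).1 (by simp) =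
      (sum (P.add x y) z).1 ≫ Q.addMap (sum x y).1 (𝟙 (Tot.mk (obj z))) (by simp) ≫
        (Q.σ (obj x) (obj y) (obj z)).1
  map_τ : ∀ {U : C} (x y : P.Obj U),
    map (P.τ x y).1 ≫ (sum y x).1 = (sum x y).1 ≫ (Q.τ (obj x) (obj y)).1

attribute [simp] AddFunctor.π_map AddFunctor.map_id AddFunctor.map_comp

namespace AddFunctor

open FibGpd PicardFib

variable {C : Type u} [Category.{v} C] {P Q R : PicardFib.{w} C}

/-- Morphisms of additive functors. They are all isomorphisms, because their components are
morphisms of fibers. -/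
@[ext] structure Hom (F G : AddFunctor P Q) where
  app : ∀ {U : C} (x : P.Obj U), Q.FHom (F.obj x) (G.obj x)
  naturality : ∀ {U V : C} {x : P.Obj U} {y : P.Obj V} (φ : P.Hom x y),
    F.map φ ≫ (app y).1 = (app x).1 ≫ G.map φ
  app_add : ∀ {U : C} (x y : P.Obj U),
    (app (P.add x y)).1 ≫ (G.sum x y).1 =
      (F.sum x y).1 ≫ Q.addMap (app x).1 (app y).1 (by simp)

/-- Action of an additive functor on the morphisms of the fibers. -/
def fmap (F : AddFunctor P Q) {U : C} {x y : P.Obj U} (φ : P.FHom x y) :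
    Q.FHom (F.obj x) (F.obj y) := ⟨F.map φ.1, by simp⟩

/-- The functor induced by an additive functor on the fibers over `U`. -/
def fiberFunctor (F : AddFunctor P Q) (U : C) : P.Obj U ⥤ Q.Obj U where
  obj x := F.obj x
  map φ := F.fmap φ
  map_id x := fhom_eq (F.map_id x)
  map_comp φ ψ := fhom_eq (F.map_comp φ.1 ψ.1)

/-- An additive functor is an equivalence (of fibered categories) if it is so on each fiber. -/
def IsEquivalence (F : AddFunctor P Q) : Prop := ∀ U : C, (F.fiberFunctor U).IsEquivalence

/-- The identity additive functor. -/
def id (P : PicardFib.{w} C) : AddFunctor P P where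
  obj x := x
  map φ := φ
  π_map _ := rfl
  map_id _ := rfl
  map_comp _ _ := rfl
  sum x y := ⟨𝟙 _, P.π_id _⟩
  sum_natural _ _ _ := by simp
  map_σ x y z := by simp
  map_τ x y := by simp

/-- The composite `G ∘ F`. -/
def comp (G : AddFunctor Q R) (F : AddFunctor P Q) : AddFunctor P R where
  obj x := G.obj (F.obj x)
  map φ := G.map (F.map φ)
  π_map _ := by simp
  map_id _ := by simp
  map_comp _ _ := by simp
  sum x y := ⟨G.map (F.sum x y).1 ≫ (G.sum _ _).1, by simp⟩
  sum_natural φ ψ h := by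
    rw [← Category.assoc, ← G.map_comp, F.sum_natural φ ψ h, G.map_comp, Category.assoc,
      G.sum_natural, Category.assoc]
  map_σ x y z := by
    have e1 : R.addMap (𝟙 (Tot.mk (G.obj (F.obj x)))) (G.map (F.sum y z).1 ≫ (G.sum _ _).1)
        (by simp) = R.addMap (G.map (𝟙 (Tot.mk (F.obj x)))) (G.map (F.sum y z).1) (by simp) ≫
          R.addMap (𝟙 _) (G.sum _ _).1 (by simp) := by
      rw [← R.addMap_comp]
      exact R.addMap_congr _ (by simp) rfl
    have e2 : R.addMap (G.map (F.sum x y).1 ≫ (G.sum _ _).1) (𝟙 (Tot.mk (G.obj (F.obj z))))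
        (by simp) = R.addMap (G.map (F.sum x y).1) (G.map (𝟙 (Tot.mk (F.obj z)))) (by simp) ≫
          R.addMap (G.sum _ _).1 (𝟙 _) (by simp) := by
      rw [← R.addMap_comp]
      exact R.addMap_congr _ rfl (by simp)
    have h2 := G.sum_natural (𝟙 (Tot.mk (F.obj x))) (F.sum y z).1 (by simp)
    have h3 := G.sum_natural (F.sum x y).1 (𝟙 (Tot.mk (F.obj z))) (by simp)
    have h1 := congrArg (fun t => G.map t) (F.map_σ x y z)
    simp only [G.map_comp] at h1
    have h4 := G.map_σ (F.obj x) (F.obj y) (F.obj z)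
    simp only [Category.assoc]
    rw [e1, e2]
    simp only [Category.assoc]
    rw [← reassoc_of% h2, reassoc_of% h1, h4, reassoc_of% h3]
  map_τ x y := by
    rw [← Category.assoc, ← G.map_comp, F.map_τ, G.map_comp, Category.assoc, G.map_τ,
      Category.assoc]



section Unit

open MonoidalCategory

variable (F : AddFunctor P Q) {U : C}

/-- The isomorphism `F (x + y) ≅ F x + F y` in the monoidal notation of the fibers. -/
def sumF (x y : P.Obj U) :
    (F.fiberFunctor U).obj (x ⊗ y) ⟶ (F.fiberFunctor U).obj x ⊗ (F.fiberFunctor U).obj y :=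
  F.sum x y

theorem sumF_left {x y : P.Obj U} (f : x ⟶ y) (z : P.Obj U) :
    (F.fiberFunctor U).map (f ▷ z) ≫ F.sumF y z =
      F.sumF x z ≫ (F.fiberFunctor U).map f ▷ (F.fiberFunctor U).obj z :=
  fhom_eq ((F.sum_natural f.1 (𝟙 (Tot.mk z)) (f.2.trans (P.π_id _).symm)).trans
    (congrArg ((F.sum x z).1 ≫ ·) (Q.addMap_congr _ rfl (F.map_id z))))

theorem sumF_right (z : P.Obj U) {x y : P.Obj U} (f : x ⟶ y) :
    (F.fiberFunctor U).map (z ◁ f) ≫ F.sumF z y =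
      F.sumF z x ≫ (F.fiberFunctor U).obj z ◁ (F.fiberFunctor U).map f :=
  fhom_eq ((F.sum_natural (𝟙 (Tot.mk z)) f.1 ((P.π_id _).trans f.2.symm)).trans
    (congrArg ((F.sum z x).1 ≫ ·) (Q.addMap_congr _ (F.map_id z) rfl)))

theorem sumF_assoc (x y z : P.Obj U) :
    (F.fiberFunctor U).map (α_ x y z).hom ≫ F.sumF x (y ⊗ z) ≫
        (F.fiberFunctor U).obj x ◁ F.sumF y z =
      F.sumF (x ⊗ y) z ≫ F.sumF x y ▷ (F.fiberFunctor U).obj z ≫ (α_ _ _ _).hom :=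
  fhom_eq (F.map_σ x y z)

variable (U) in
/-- The canonical isomorphism `F 0 ≅ 0`. -/
noncomputable def unitF : (F.fiberFunctor U).obj (𝟙_ (P.Obj U)) ⟶ 𝟙_ (Q.Obj U) :=
  (tensorRight ((F.fiberFunctor U).obj (𝟙_ (P.Obj U)))).preimage
    (inv (F.sumF _ _) ≫ (F.fiberFunctor U).map (λ_ (𝟙_ (P.Obj U))).hom ≫ (λ_ _).inv)

theorem unitF_spec : F.sumF _ _ ≫ F.unitF U ▷ (F.fiberFunctor U).obj (𝟙_ (P.Obj U)) ≫ (λ_ _).hom =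
    (F.fiberFunctor U).map (λ_ (𝟙_ (P.Obj U))).hom := by
  have h := (tensorRight ((F.fiberFunctor U).obj (𝟙_ (P.Obj U)))).map_preimage
    (inv (F.sumF _ _) ≫ (F.fiberFunctor U).map (λ_ (𝟙_ (P.Obj U))).hom ≫ (λ_ _).inv)
  change F.unitF U ▷ (F.fiberFunctor U).obj (𝟙_ (P.Obj U)) = _ at h
  rw [h]; simp

theorem unitF_unique (v : (F.fiberFunctor U).obj (𝟙_ (P.Obj U)) ⟶ 𝟙_ (Q.Obj U))
    (hv : F.sumF _ _ ≫ v ▷ (F.fiberFunctor U).obj (𝟙_ (P.Obj U)) ≫ (λ_ _).hom =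
      (F.fiberFunctor U).map (λ_ (𝟙_ (P.Obj U))).hom) : v = F.unitF U := by
  apply (tensorRight ((F.fiberFunctor U).obj (𝟙_ (P.Obj U)))).map_injective
  change v ▷ _ = F.unitF U ▷ _
  rw [← F.unitF_spec, cancel_epi, cancel_mono] at hv
  exact hv

theorem unitF_left (x : P.Obj U) :
    F.sumF (𝟙_ _) x ≫ F.unitF U ▷ (F.fiberFunctor U).obj x ≫ (λ_ _).hom =
      (F.fiberFunctor U).map (λ_ x).hom := by
  let Φ := F.fiberFunctor U
  have key : F.sumF (𝟙_ _) (𝟙_ _ ⊗ x) ≫ F.unitF U ▷ Φ.obj (𝟙_ _ ⊗ x) ≫ (λ_ _).hom =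
      Φ.map (λ_ (𝟙_ _ ⊗ x)).hom := by
    rw [← cancel_mono (F.sumF (𝟙_ _) x), ← cancel_epi (Φ.map (α_ (𝟙_ _) (𝟙_ _) x).hom)]
    have h1 := F.sumF_assoc (𝟙_ _) (𝟙_ _) x
    have h2 := F.sumF_left (λ_ (𝟙_ (P.Obj U))).hom x
    rw [← F.unitF_spec] at h2
    have h3 : Φ.map (α_ (𝟙_ _) (𝟙_ _) x).hom ≫ Φ.map (λ_ (𝟙_ _ ⊗ x)).hom =
        Φ.map ((λ_ (𝟙_ _)).hom ▷ x) := by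
      rw [← Φ.map_comp]; congr 1; monoidal
    rw [reassoc_of% h3]
    refine Eq.trans ?_ h2.symm
    have h4 : F.unitF U ▷ Φ.obj (𝟙_ _ ⊗ x) ≫ (λ_ _).hom ≫ F.sumF (𝟙_ _) x =
        (Φ.obj (𝟙_ _) ◁ F.sumF (𝟙_ _) x) ≫ F.unitF U ▷ _ ≫ (λ_ _).hom := by
      rw [whisker_exchange_assoc, leftUnitor_naturality]
    simp only [Category.assoc]
    rw [h4, reassoc_of% h1]
    simp only [comp_whiskerRight, Category.assoc]
    congr 2
    monoidal
  have hn : Φ.map (𝟙_ _ ◁ (λ_ x).hom) ≫ F.sumF (𝟙_ _) x ≫ F.unitF U ▷ Φ.obj x ≫ (λ_ _).hom =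
      Φ.map (λ_ (𝟙_ _ ⊗ x)).hom ≫ Φ.map (λ_ x).hom := by
    have h5 := F.sumF_right (𝟙_ _) (λ_ x).hom
    rw [reassoc_of% h5, ← key]
    simp only [Category.assoc]
    rw [whisker_exchange_assoc, leftUnitor_naturality]
  rw [← cancel_epi (Φ.map (𝟙_ _ ◁ (λ_ x).hom)), hn, ← Φ.map_comp, ← Φ.map_comp,
    leftUnitor_naturality]

end Unit

variable (F : AddFunctor P Q)

/-- The canonical isomorphism `F 0 ≅ 0`. -/
noncomputable def unit (U : C) : Q.FHom (F.obj (P.zero U)) (Q.zero U) := F.unitF U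

theorem unit_left {U : C} (x : P.Obj U) :
    (F.sum (P.zero U) x).1 ≫ Q.addMap (F.unit U).1 (𝟙 (Tot.mk (F.obj x))) (by simp) ≫
      (Q.zeroAdd (F.obj x)).1 = F.map (P.zeroAdd x).1 :=
  congrArg FHom.val (F.unitF_left x)

theorem unit_unique {U : C} (v : Q.FHom (F.obj (P.zero U)) (Q.zero U))
    (hv : (F.sum (P.zero U) (P.zero U)).1 ≫ Q.addMap v.1 (𝟙 (Tot.mk (F.obj (P.zero U)))) (by simp) ≫
      (Q.zeroAdd (F.obj (P.zero U))).1 = F.map (P.zeroAdd (P.zero U)).1) : v = F.unit U :=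
  F.unitF_unique v (fhom_eq hv)

/-- The canonical isomorphisms `F 0 ≅ 0` are compatible with restriction. -/
theorem unit_natural {U V : C} (f : U ⟶ V) :
    F.map (P.zeroMap f) ≫ (F.unit V).1 = (F.unit U).1 ≫ Q.zeroMap f := by
  obtain ⟨u, ⟨hu, hu'⟩, -⟩ := Q.cartesian (F.map (P.zeroMap f) ≫ (F.unit V).1) (Q.zeroMap f) (𝟙 U)
    (by simp)
  have : (⟨u, hu⟩ : Q.FHom _ _) = F.unit U := by
    apply F.unit_unique
    refine hom_ext (F.map (P.zeroMap f)) (by simp [hu]) ?_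
    simp only [Category.assoc]
    rw [← Q.zeroAdd_natural, ← F.map_comp, ← P.zeroAdd_natural, F.map_comp, ← F.unit_left]
    have h := F.sum_natural (P.zeroMap (P.π (P.zeroMap f))) (P.zeroMap f) (by simp)
    rw [reassoc_of% h]
    congr 1
    rw [← Category.assoc, ← Category.assoc, ← Q.addMap_comp, ← Q.addMap_comp]
    congr 1
    refine Q.addMap_congr _ ?_ (by simp)
    simp [hu']
  rw [← hu', ← this]

theorem unit_add {U : C} : (F.sum (P.zero U) (P.zero U)).1 ≫
    Q.addMap (F.unit U).1 (F.unit U).1 rfl ≫ (Q.zeroAdd (Q.zero U)).1 =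
      F.map (P.zeroAdd (P.zero U)).1 ≫ (F.unit U).1 := by
  have h : Q.addMap (F.unit U).1 (F.unit U).1 rfl =
      Q.addMap (F.unit U).1 (𝟙 (Tot.mk (F.obj (P.zero U)))) (by simp) ≫
        Q.addMap (Q.zeroMap (Q.π (F.unit U).1)) (F.unit U).1 (by simp) := by
    rw [← Q.addMap_comp]
    exact Q.addMap_congr _ (by simp) (by simp)
  rw [h, Category.assoc, Q.zeroAdd_natural, ← F.unit_left]
  simp only [Category.assoc]

end AddFunctor

namespace AddFunctor

open FibGpd PicardFib

variable {C : Type u} [Category.{v} C] (P Q : PicardFib.{w} C)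

open MonoidalCategory in
/-- The trivial additive functor. -/
noncomputable def zero : AddFunctor P Q where
  obj {U} _ := Q.zero U
  map φ := Q.zeroMap (P.π φ)
  π_map _ := by simp
  map_id _ := by simp
  map_comp _ _ := by simp [Q.zeroMap_comp]
  sum {U} _ _ := finv (Q.zeroAdd (Q.zero U))
  sum_natural {U V _ _ _ _} φ ψ h := by
    have h1 := Q.zeroAdd_natural (Q.zeroMap (P.π φ))
    rw [← cancel_mono (Q.zeroAdd (Q.zero V)).1, ← cancel_epi (Q.zeroAdd (Q.zero U)).1]
    simp only [Category.assoc, finv_fhom, fhom_finv_assoc, Category.comp_id]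
    rw [P.π_addMap, ← h1]
    exact congrArg (· ≫ _) (Q.addMap_congr _ (by simp) (by rw [h]))
  map_σ {U} x y z := by
    have : (λ_ (𝟙_ (Q.Obj U))).inv ≫ 𝟙_ (Q.Obj U) ◁ (λ_ (𝟙_ (Q.Obj U))).inv =
        (λ_ (𝟙_ (Q.Obj U))).inv ≫ (λ_ (𝟙_ (Q.Obj U))).inv ▷ 𝟙_ (Q.Obj U) ≫ (α_ _ _ _).hom := by
      monoidal
    have h := congrArg FHom.val this
    have e : (λ_ (𝟙_ (Q.Obj U))).inv = finv (Q.zeroAdd (Q.zero U)) := by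
      rw [← cancel_mono (λ_ (𝟙_ (Q.Obj U))).hom, Iso.inv_hom_id]
      exact fhom_eq (finv_fhom (Q.zeroAdd (Q.zero U))).symm
    rw [e] at h
    rw [(P.σ x y z).2, Q.zeroMap_id, Category.id_comp]
    exact h
  map_τ x y := by simp

end AddFunctor

namespace FibGpd

variable {C : Type u} [Category.{v} C] (P P' : FibGpd.{w} C)

/-- Morphisms of the product: pairs of morphisms over the same morphism of `C`. -/
@[ext] structure ProdHom {U V : C} (x : P.Obj U × P'.Obj U) (y : P.Obj V × P'.Obj V) : Type (max u v w) where
  fst : P.Hom x.1 y.1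
  snd : P'.Hom x.2 y.2
  eq : P.π fst = P'.π snd

instance prodCategory : Category.{max u v w} (Tot (fun U => P.Obj U × P'.Obj U)) where
  Hom X Y := ProdHom P P' X.pt Y.pt
  id X := ⟨𝟙 _, 𝟙 _, by simp⟩
  comp f g := ⟨f.fst ≫ g.fst, f.snd ≫ g.snd, by simp [f.eq, g.eq]⟩
  id_comp f := by ext <;> simp
  comp_id f := by ext <;> simp
  assoc f g h := by ext <;> simp

/-- The product of two categories fibered in groupoids. -/
def prod : FibGpd.{w} C where
  Obj U := P.Obj U × P'.Obj U
  cat := prodCategory P P'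
  π φ := P.π (ProdHom.fst φ)
  π_id x := P.π_id x.1
  π_comp φ ψ := P.π_comp (ProdHom.fst φ) (ProdHom.fst ψ)
  exists_lift f y := by
    obtain ⟨x, φ, hφ⟩ := P.exists_lift f y.1
    obtain ⟨x', φ', hφ'⟩ := P'.exists_lift f y.2
    exact ⟨(x, x'), ⟨φ, φ', hφ.trans hφ'.symm⟩, hφ⟩
  cartesian φ ψ h e := by
    obtain ⟨χ, ⟨h1, h2⟩, hu⟩ := P.cartesian (ProdHom.fst φ) (ProdHom.fst ψ) h e
    obtain ⟨χ', ⟨h1', h2'⟩, hu'⟩ := P'.cartesian (ProdHom.snd φ) (ProdHom.snd ψ) h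
      (by rw [← ProdHom.eq φ, ← ProdHom.eq ψ]; exact e)
    refine ⟨⟨χ, χ', h1.trans h1'.symm⟩, ⟨h1, ProdHom.ext h2 h2'⟩, ?_⟩
    rintro ⟨a, b, hab⟩ ⟨k1, k2⟩
    have k3 := congrArg ProdHom.fst k2
    have k4 := congrArg ProdHom.snd k2
    exact ProdHom.ext (hu a ⟨k1, k3⟩) (hu' b ⟨hab.symm.trans k1, k4⟩)

end FibGpd

namespace PicardFib

open FibGpd

variable {C : Type u} [Category.{v} C] (P P' : PicardFib.{w} C)

/-- The product `P × P'`, with componentwise addition. -/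
def prod : PicardFib.{w} C where
  toFibGpd := P.toFibGpd.prod P'.toFibGpd
  add x y := (P.add x.1 y.1, P'.add x.2 y.2)
  addMap φ ψ h := ⟨P.addMap φ.fst ψ.fst h,
    P'.addMap φ.snd ψ.snd (by rw [← φ.eq, ← ψ.eq]; exact h), (P.π_addMap _ _ _).trans (φ.eq.trans (P'.π_addMap _ _ _).symm)⟩
  π_addMap _ _ _ := P.π_addMap _ _ _
  addMap_id x x' := ProdHom.ext (P.addMap_id _ _) (P'.addMap_id _ _)
  addMap_comp φ φ' ψ ψ' h h' := ProdHom.ext (P.addMap_comp _ _ _ _ _ _)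
    (P'.addMap_comp _ _ _ _ (by rw [← φ.eq, ← ψ.eq]; exact h) (by rw [← φ'.eq, ← ψ'.eq]; exact h'))
  σ x y z := ⟨⟨(P.σ x.1 y.1 z.1).1, (P'.σ x.2 y.2 z.2).1, by simp⟩, (P.σ x.1 y.1 z.1).2⟩
  σ_natural φ ψ χ h h' := ProdHom.ext (P.σ_natural _ _ _ _ _)
    (P'.σ_natural _ _ _ (by rw [← φ.eq, ← ψ.eq]; exact h) (by rw [← χ.eq, ← ψ.eq]; exact h'))
  τ x y := ⟨⟨(P.τ x.1 y.1).1, (P'.τ x.2 y.2).1, by simp⟩, (P.τ x.1 y.1).2⟩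
  τ_natural φ ψ h := ProdHom.ext (P.τ_natural _ _ _)
    (P'.τ_natural _ _ (by rw [← φ.eq, ← ψ.eq]; exact h))
  pentagon x y z t := ProdHom.ext (P.pentagon _ _ _ _) (P'.pentagon _ _ _ _)
  hexagon x y z := ProdHom.ext (P.hexagon _ _ _) (P'.hexagon _ _ _)
  τ_τ x y := ProdHom.ext (P.τ_τ _ _) (P'.τ_τ _ _)
  τ_self x := ProdHom.ext (P.τ_self _) (P'.τ_self _)
  zero U := (P.zero U, P'.zero U)
  zeroMap f := ⟨P.zeroMap f, P'.zeroMap f, by simp⟩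
  π_zeroMap f := P.π_zeroMap f
  zeroMap_id U := ProdHom.ext (P.zeroMap_id U) (P'.zeroMap_id U)
  zeroMap_comp f g := ProdHom.ext (P.zeroMap_comp f g) (P'.zeroMap_comp f g)
  zeroAdd x := ⟨⟨(P.zeroAdd x.1).1, (P'.zeroAdd x.2).1, by simp⟩, (P.zeroAdd x.1).2⟩
  zeroAdd_natural φ := ProdHom.ext (P.zeroAdd_natural φ.fst)
    ((congrArg (· ≫ _) (P'.addMap_congr _ (congrArg P'.zeroMap φ.eq) rfl)).trans (P'.zeroAdd_natural φ.snd))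
  triangle x y := ProdHom.ext (P.triangle _ _) (P'.triangle _ _)
  exists_neg x := by
    obtain ⟨y, ⟨φ⟩⟩ := P.exists_neg x.1
    obtain ⟨y', ⟨φ'⟩⟩ := P'.exists_neg x.2
    exact ⟨(y, y'), ⟨⟨⟨φ.1, φ'.1, by simp⟩, φ.2⟩⟩⟩


end PicardFib

namespace FibGpd

variable {C : Type u} [Category.{v} C] {P P' : FibGpd.{w} C} {U : C} {R : Sieve U}

/-- Components of a section of a product. -/
def prodFst (s : (P.prod P').Sec R) : P.Sec R where
  obj f hf := (s.obj f hf).1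
  map hf hk g h := (s.map hf hk g h).fst
  π_map hf hk g h := s.π_map hf hk g h
  map_id hf := congrArg ProdHom.fst (s.map_id hf)
  map_comp hf hk hl g h g' h' := congrArg ProdHom.fst (s.map_comp hf hk hl g h g' h')

def prodSnd (s : (P.prod P').Sec R) : P'.Sec R where
  obj f hf := (s.obj f hf).2
  map hf hk g h := (s.map hf hk g h).snd
  π_map hf hk g h := (ProdHom.eq (s.map hf hk g h)).symm.trans (s.π_map hf hk g h)
  map_id hf := congrArg ProdHom.snd (s.map_id hf)
  map_comp hf hk hl g h g' h' := congrArg ProdHom.snd (s.map_comp hf hk hl g h g' h')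

def prodHomFst {s t : (P.prod P').Sec R} (a : s ⟶ t) : prodFst s ⟶ prodFst t where
  app f hf := ⟨ProdHom.fst (Sec.Hom.app a f hf).1, (Sec.Hom.app a f hf).2⟩
  naturality hf hk g h := congrArg ProdHom.fst (Sec.Hom.naturality a hf hk g h)

def prodHomSnd {s t : (P.prod P').Sec R} (a : s ⟶ t) : prodSnd s ⟶ prodSnd t where
  app f hf := ⟨ProdHom.snd (Sec.Hom.app a f hf).1,
    (ProdHom.eq (Sec.Hom.app a f hf).1).symm.trans (Sec.Hom.app a f hf).2⟩
  naturality hf hk g h := congrArg ProdHom.snd (Sec.Hom.naturality a hf hk g h)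

def prodHomMk {s t : (P.prod P').Sec R} (a : prodFst s ⟶ prodFst t) (b : prodSnd s ⟶ prodSnd t) :
    s ⟶ t where
  app f hf := ⟨⟨(Sec.Hom.app a f hf).1, (Sec.Hom.app b f hf).1,
    (Sec.Hom.app a f hf).2.trans (Sec.Hom.app b f hf).2.symm⟩, (Sec.Hom.app a f hf).2⟩
  naturality hf hk g h := ProdHom.ext (Sec.Hom.naturality a hf hk g h)
    (Sec.Hom.naturality b hf hk g h)

def prodMk (s : P.Sec R) (t : P'.Sec R) : (P.prod P').Sec R where
  obj f hf := (s.obj f hf, t.obj f hf)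
  map hf hk g h := ⟨s.map hf hk g h, t.map hf hk g h,
    (s.π_map hf hk g h).trans (t.π_map hf hk g h).symm⟩
  π_map hf hk g h := s.π_map hf hk g h
  map_id hf := ProdHom.ext (s.map_id hf) (t.map_id hf)
  map_comp hf hk hl g h g' h' := ProdHom.ext (s.map_comp hf hk hl g h g' h')
    (t.map_comp hf hk hl g h g' h')

theorem sec_hom_ext {s t : P.Sec R} {a b : s ⟶ t}
    (h : ∀ {V : C} (f : V ⟶ U) (hf : R f), (Sec.Hom.app a f hf).1 = (Sec.Hom.app b f hf).1) :
    a = b :=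
  Sec.Hom.ext (by funext V f hf; exact FHom.ext (h f hf))

/-- All morphisms of sections are isomorphisms. -/
instance isIso_sec {s t : P.Sec R} (a : s ⟶ t) : IsIso a := by
  refine ⟨⟨fun f hf => finv (Sec.Hom.app a f hf), ?_⟩, ?_, ?_⟩
  · intro V W f k hf hk g h
    rw [← cancel_mono (Sec.Hom.app a f hf).1, ← cancel_epi (Sec.Hom.app a k hk).1]
    have := Sec.Hom.naturality a hf hk g h
    simp [this]
  · exact sec_hom_ext fun f hf => fhom_finv _
  · exact sec_hom_ext fun f hf => finv_fhom _

theorem IsStack.prod {J : GrothendieckTopology C} (hP : P.IsStack J) (hP' : P'.IsStack J) :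
    (P.prod P').IsStack J := by
  intro U R hR
  have h := hP U R hR
  have h' := hP' U R hR
  refine { faithful := ⟨?_⟩, full := ⟨?_⟩, essSurj := ⟨?_⟩ }
  · intro s t a b hab
    have h1 : prodHomFst a = prodHomFst b := (P.restrict R).map_injective
      (congrArg prodHomFst hab)
    have h2 : prodHomSnd a = prodHomSnd b := (P'.restrict R).map_injective
      (congrArg prodHomSnd hab)
    exact (congrArg₂ prodHomMk h1 h2 : prodHomMk (prodHomFst a) (prodHomSnd a) = _)
  · intro s t a
    obtain ⟨b, hb⟩ := (P.restrict R).map_surjective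
      (X := prodFst s) (Y := prodFst t) (prodHomFst a)
    obtain ⟨b', hb'⟩ := (P'.restrict R).map_surjective
      (X := prodSnd s) (Y := prodSnd t) (prodHomSnd a)
    refine ⟨prodHomMk b b', ?_⟩
    exact (congrArg₂ (fun x y => prodHomMk (s := ((P.prod P').restrict R).obj s)
      (t := ((P.prod P').restrict R).obj t) x y) hb hb' : _)
  · intro s
    obtain ⟨t, ⟨e⟩⟩ := Functor.EssSurj.mem_essImage (F := P.restrict R) (prodFst s)
    obtain ⟨t', ⟨e'⟩⟩ := Functor.EssSurj.mem_essImage (F := P'.restrict R) (prodSnd s)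
    exact ⟨prodMk t t', ⟨asIso (prodHomMk (s := ((P.prod P').restrict R).obj (prodMk t t'))
      (t := s) e.hom e'.hom)⟩⟩

end FibGpd

namespace AddFunctor

open FibGpd PicardFib

variable {C : Type u} [Category.{v} C] {P P' Q : PicardFib.{w} C}
  (G : AddFunctor P Q) (F : AddFunctor P' Q)

/-- Objects of the fibered product: triplets `(p, p', f)` with `f : G p ≅ F p'`. -/
structure FibObj (U : C) : Type (max u v w) where
  fst : P.Obj U
  snd : P'.Obj U
  iso : Q.FHom (G.obj fst) (F.obj snd)

variable {G F} in
/-- Morphisms of the fibered product: pairs of morphisms over the same morphism of `C`, compatible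
with the given isomorphisms. -/
@[ext] structure FibHom {U V : C} (x : FibObj G F U) (y : FibObj G F V) : Type (max u v w) where
  fst : P.Hom x.fst y.fst
  snd : P'.Hom x.snd y.snd
  eq : P.π fst = P'.π snd
  comm : G.map fst ≫ y.iso.1 = x.iso.1 ≫ F.map snd

instance fibCategory : Category.{max u v w} (Tot (FibObj G F)) where
  Hom X Y := FibHom X.pt Y.pt
  id X := ⟨𝟙 _, 𝟙 _, by simp, by simp⟩
  comp f g := ⟨f.fst ≫ g.fst, f.snd ≫ g.snd, by simp [f.eq, g.eq], by
    rw [G.map_comp, F.map_comp, Category.assoc, g.comm, ← Category.assoc, f.comm, Category.assoc]⟩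
  id_comp f := by ext <;> simp
  comp_id f := by ext <;> simp
  assoc f g h := by ext <;> simp

/-- The category fibered in groupoids underlying the fibered product. -/
def fibGpd : FibGpd.{w} C where
  Obj U := FibObj G F U
  cat := fibCategory G F
  π φ := P.π (FibHom.fst φ)
  π_id x := P.π_id x.fst
  π_comp φ ψ := P.π_comp (FibHom.fst φ) (FibHom.fst ψ)
  exists_lift f y := by
    obtain ⟨x, φ, hφ⟩ := P.exists_lift f y.fst
    obtain ⟨x', φ', hφ'⟩ := P'.exists_lift f y.snd
    obtain ⟨e, ⟨he, he'⟩, -⟩ := Q.cartesian (G.map φ ≫ y.iso.1) (F.map φ') (𝟙 _)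
      (by simp [hφ, hφ'])
    exact ⟨⟨x, x', ⟨e, he⟩⟩, ⟨φ, φ', hφ.trans hφ'.symm, he'.symm⟩, hφ⟩
  cartesian {U V W x y z} φ ψ h e := by
    obtain ⟨χ, ⟨h1, h2⟩, hu⟩ := P.cartesian (FibHom.fst φ) (FibHom.fst ψ) h e
    obtain ⟨χ', ⟨h1', h2'⟩, hu'⟩ := P'.cartesian (FibHom.snd φ) (FibHom.snd ψ) h
      (by rw [← FibHom.eq φ, ← FibHom.eq ψ]; exact e)
    have hc : G.map χ ≫ y.iso.1 = x.iso.1 ≫ F.map χ' := by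
      apply hom_ext (F.map (FibHom.snd ψ))
      · simp [h1, h1']
      · have h3 := FibHom.comm ψ
        have h4 := FibHom.comm φ
        rw [Category.assoc, Category.assoc, ← F.map_comp, h2', ← h3, ← Category.assoc,
          ← G.map_comp, h2, h4]
    refine ⟨⟨χ, χ', h1.trans h1'.symm, hc⟩, ⟨h1, FibHom.ext h2 h2'⟩, ?_⟩
    rintro ⟨a, b, hab, hab'⟩ ⟨k1, k2⟩
    have k3 := congrArg FibHom.fst k2
    have k4 := congrArg FibHom.snd k2
    exact FibHom.ext (hu a ⟨k1, k3⟩) (hu' b ⟨hab.symm.trans k1, k4⟩)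

variable {G F}

section Isos

open MonoidalCategory

variable {U : C}

/-- The isomorphism `G (p + r) ≅ G p + G r ≅ F p' + F r' ≅ F (p' + r')`. -/
noncomputable def isoAdd {p r : P.Obj U} {p' r' : P'.Obj U}
    (a : (G.fiberFunctor U).obj p ⟶ (F.fiberFunctor U).obj p')
    (b : (G.fiberFunctor U).obj r ⟶ (F.fiberFunctor U).obj r') :
    (G.fiberFunctor U).obj (p ⊗ r) ⟶ (F.fiberFunctor U).obj (p' ⊗ r') :=
  G.sumF p r ≫ (a ⊗ₘ b) ≫ inv (F.sumF p' r')

theorem isoAdd_sumF {p r : P.Obj U} {p' r' : P'.Obj U}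
    (a : (G.fiberFunctor U).obj p ⟶ (F.fiberFunctor U).obj p')
    (b : (G.fiberFunctor U).obj r ⟶ (F.fiberFunctor U).obj r') :
    isoAdd a b ≫ F.sumF p' r' = G.sumF p r ≫ (a ⊗ₘ b) := by
  simp [isoAdd]

theorem isoAdd_σ {p q r : P.Obj U} {p' q' r' : P'.Obj U}
    (a : (G.fiberFunctor U).obj p ⟶ (F.fiberFunctor U).obj p')
    (b : (G.fiberFunctor U).obj q ⟶ (F.fiberFunctor U).obj q')
    (c : (G.fiberFunctor U).obj r ⟶ (F.fiberFunctor U).obj r') :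
    (G.fiberFunctor U).map (α_ p q r).hom ≫ isoAdd a (isoAdd b c) =
      isoAdd (isoAdd a b) c ≫ (F.fiberFunctor U).map (α_ p' q' r').hom := by
  rw [← cancel_mono (F.sumF p' (q' ⊗ r')), ← cancel_mono (_ ◁ F.sumF q' r')]
  have h1 := G.sumF_assoc p q r
  have h2 := F.sumF_assoc p' q' r'
  simp only [Category.assoc]
  rw [h2, reassoc_of% isoAdd_sumF a (isoAdd b c), reassoc_of% isoAdd_sumF (isoAdd a b) c]
  have e1 : (a ⊗ₘ isoAdd b c) ≫ _ ◁ F.sumF q' r' = _ ◁ G.sumF q r ≫ (a ⊗ₘ (b ⊗ₘ c)) := by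
    rw [← id_tensorHom, ← id_tensorHom, tensorHom_comp_tensorHom, tensorHom_comp_tensorHom,
      isoAdd_sumF]
    simp
  have e2 : (isoAdd a b ⊗ₘ c) ≫ F.sumF p' q' ▷ _ = G.sumF p q ▷ _ ≫ ((a ⊗ₘ b) ⊗ₘ c) := by
    rw [← tensorHom_id, ← tensorHom_id, tensorHom_comp_tensorHom, tensorHom_comp_tensorHom,
      isoAdd_sumF]
    simp
  rw [e1, reassoc_of% e2, reassoc_of% h1, associator_naturality]

theorem isoAdd_τ {p q : P.Obj U} {p' q' : P'.Obj U}
    (a : (G.fiberFunctor U).obj p ⟶ (F.fiberFunctor U).obj p')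
    (b : (G.fiberFunctor U).obj q ⟶ (F.fiberFunctor U).obj q') :
    (G.fiberFunctor U).map (β_ p q).hom ≫ isoAdd b a =
      isoAdd a b ≫ (F.fiberFunctor U).map (β_ p' q').hom := by
  have h1 : (G.fiberFunctor U).map (β_ p q).hom ≫ G.sumF q p = G.sumF p q ≫ (β_ _ _).hom :=
    fhom_eq (G.map_τ p q)
  have h2 : (F.fiberFunctor U).map (β_ p' q').hom ≫ F.sumF q' p' = F.sumF p' q' ≫ (β_ _ _).hom :=
    fhom_eq (F.map_τ p' q')
  rw [← cancel_mono (F.sumF q' p'), Category.assoc, Category.assoc, h2, isoAdd_sumF,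
    reassoc_of% isoAdd_sumF, reassoc_of% h1, BraidedCategory.braiding_naturality]

variable (G F U) in
/-- The isomorphism `G 0 ≅ 0 ≅ F 0`. -/
noncomputable def isoZero : (G.fiberFunctor U).obj (𝟙_ _) ⟶ (F.fiberFunctor U).obj (𝟙_ _) :=
  G.unitF U ≫ inv (F.unitF U)

theorem isoZero_unitF : isoZero G F U ≫ F.unitF U = G.unitF U := by
  simp [isoZero]

theorem isoAdd_zero {p : P.Obj U} {p' : P'.Obj U}
    (a : (G.fiberFunctor U).obj p ⟶ (F.fiberFunctor U).obj p') :
    (G.fiberFunctor U).map (λ_ p).hom ≫ a =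
      isoAdd (isoZero G F U) a ≫ (F.fiberFunctor U).map (λ_ p').hom := by
  rw [← G.unitF_left, ← F.unitF_left, reassoc_of% isoAdd_sumF]
  simp only [Category.assoc]
  congr 1
  rw [← leftUnitor_naturality, tensorHom_def', ← isoZero_unitF (F := F)]
  simp only [Category.assoc, comp_whiskerRight]
  rw [← comp_whiskerRight_assoc, ← comp_whiskerRight_assoc, isoZero_unitF, whisker_exchange_assoc]

theorem exists_iso_neg {p r : P.Obj U} {p' r' : P'.Obj U}
    (a : (G.fiberFunctor U).obj p ⟶ (F.fiberFunctor U).obj p') (φ : p ⊗ r ⟶ 𝟙_ _)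
    (φ' : p' ⊗ r' ⟶ 𝟙_ _) :
    ∃ b : (G.fiberFunctor U).obj r ⟶ (F.fiberFunctor U).obj r',
      (G.fiberFunctor U).map φ ≫ isoZero G F U =
        isoAdd a b ≫ (F.fiberFunctor U).map φ' := by
  let e : (G.fiberFunctor U).obj p ⊗ (G.fiberFunctor U).obj r ⟶
      (G.fiberFunctor U).obj p ⊗ (F.fiberFunctor U).obj r' :=
    inv (G.sumF p r) ≫ (G.fiberFunctor U).map φ ≫ isoZero G F U ≫
      inv ((F.fiberFunctor U).map φ') ≫ F.sumF p' r' ≫ inv a ▷ _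
  obtain ⟨b, hb⟩ := (tensorRight ((G.fiberFunctor U).obj p)).map_surjective
    ((β_ _ _).inv ≫ e ≫ (β_ _ _).hom)
  have hb' : (G.fiberFunctor U).obj p ◁ b = e := by
    rw [← cancel_mono (β_ _ _).hom, BraidedCategory.braiding_naturality_right,
      ← cancel_epi (β_ _ _).inv, Iso.inv_hom_id_assoc]
    exact hb
  refine ⟨b, ?_⟩
  rw [isoAdd, tensorHom_def', hb']
  simp [e]

end Isos

/-- Sum of two objects of the fibered product. -/
noncomputable def fibAdd {U : C} (x y : FibObj G F U) : FibObj G F U where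
  fst := P.add x.fst y.fst
  snd := P'.add x.snd y.snd
  iso := isoAdd x.iso y.iso

variable (G F) in
/-- The neutral object of the fibered product. -/
noncomputable def fibZero (U : C) : FibObj G F U where
  fst := P.zero U
  snd := P'.zero U
  iso := isoZero G F U

theorem square_of {X X' Y Z : Tot Q.Obj} {V : C} {y' z' : Q.Obj V} {g : X ⟶ X'}
    {a : X' ⟶ Tot.mk y'} {b : X ⟶ Y} {f : Y ⟶ Tot.mk y'} {s : Y ⟶ Z} (s' : Q.FHom y' z')
    {t : X ⟶ Z} {t' : X' ⟶ Tot.mk z'} {m : Z ⟶ Tot.mk z'} (h1 : a ≫ s'.1 = t')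
    (h2 : b ≫ s = t) (h3 : f ≫ s'.1 = s ≫ m) (h4 : g ≫ t' = t ≫ m) : g ≫ a = b ≫ f := by
  rw [← cancel_mono s'.1, Category.assoc, Category.assoc, h1, h3, h4, reassoc_of% h2]

theorem isoZero_natural {U V : C} (f : U ⟶ V) :
    G.map (P.zeroMap f) ≫ (isoZero G F V).1 = (isoZero G F U).1 ≫ F.map (P'.zeroMap f) :=
  square_of (F.unit V) (congrArg FHom.val isoZero_unitF) (congrArg FHom.val isoZero_unitF)
    (F.unit_natural f) (G.unit_natural f)

theorem isoAdd_natural {U V : C} {x x' : FibObj G F U} {y y' : FibObj G F V} (φ : FibHom x y)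
    (ψ : FibHom x' y') (h : P.π φ.fst = P.π ψ.fst) :
    G.map (P.addMap φ.fst ψ.fst h) ≫ (isoAdd y.iso y'.iso).1 = (isoAdd x.iso x'.iso).1 ≫
      F.map (P'.addMap φ.snd ψ.snd (by rw [← φ.eq, ← ψ.eq]; exact h)) := by
  have h2 : G.map (P.addMap φ.fst ψ.fst h) ≫ (G.sum _ _).1 ≫
      Q.addMap y.iso.1 y'.iso.1 (by simp) = ((G.sum _ _).1 ≫ Q.addMap x.iso.1 x'.iso.1 (by simp)) ≫
        Q.addMap (F.map φ.snd) (F.map ψ.snd) (by simp [← φ.eq, ← ψ.eq, h]) := by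
    rw [← Category.assoc, G.sum_natural, Category.assoc, Category.assoc, ← Q.addMap_comp,
      ← Q.addMap_comp]
    exact congrArg _ (Q.addMap_congr _ φ.comm ψ.comm)
  exact square_of (F.sum _ _) (congrArg FHom.val (isoAdd_sumF y.iso y'.iso))
    (congrArg FHom.val (isoAdd_sumF x.iso x'.iso)) (F.sum_natural φ.snd ψ.snd _) h2

theorem fib_neg {U : C} (x : FibObj G F U) : ∃ y : FibObj G F U,
    ∃ φ : P.FHom (P.add x.fst y.fst) (P.zero U), ∃ φ' : P'.FHom (P'.add x.snd y.snd) (P'.zero U),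
      G.map φ.1 ≫ (isoZero G F U).1 = (isoAdd x.iso y.iso).1 ≫ F.map φ'.1 := by
  obtain ⟨r, ⟨φ⟩⟩ := P.exists_neg x.fst
  obtain ⟨r', ⟨φ'⟩⟩ := P'.exists_neg x.snd
  obtain ⟨b, hb⟩ := exists_iso_neg x.iso φ φ'
  exact ⟨⟨r, r', b⟩, φ, φ', congrArg FHom.val hb⟩

variable (G F)

/-- The fibered product of `P` and `P'` over `Q` via `G` and `F`. -/
noncomputable def fibProd : PicardFib.{w} C where
  toFibGpd := fibGpd G F
  add x y := fibAdd x y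
  addMap φ ψ h := ⟨P.addMap φ.fst ψ.fst h,
    P'.addMap φ.snd ψ.snd (by rw [← φ.eq, ← ψ.eq]; exact h),
    (P.π_addMap _ _ _).trans (φ.eq.trans (P'.π_addMap _ _ _).symm), isoAdd_natural φ ψ h⟩
  π_addMap _ _ _ := P.π_addMap _ _ _
  addMap_id x x' := FibHom.ext (P.addMap_id _ _) (P'.addMap_id _ _)
  addMap_comp φ φ' ψ ψ' h h' := FibHom.ext (P.addMap_comp _ _ _ _ _ _)
    (P'.addMap_comp _ _ _ _ (by rw [← φ.eq, ← ψ.eq]; exact h) (by rw [← φ'.eq, ← ψ'.eq]; exact h'))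
  σ x y z := ⟨⟨(P.σ x.fst y.fst z.fst).1, (P'.σ x.snd y.snd z.snd).1, (FHom.property _).trans (FHom.property _).symm,
    congrArg FHom.val (isoAdd_σ x.iso y.iso z.iso)⟩,
    (P.σ x.fst y.fst z.fst).2⟩
  σ_natural φ ψ χ h h' := FibHom.ext (P.σ_natural _ _ _ _ _)
    (P'.σ_natural _ _ _ (by rw [← φ.eq, ← ψ.eq]; exact h) (by rw [← χ.eq, ← ψ.eq]; exact h'))
  τ x y := ⟨⟨(P.τ x.fst y.fst).1, (P'.τ x.snd y.snd).1, (FHom.property _).trans (FHom.property _).symm,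
    congrArg FHom.val (isoAdd_τ x.iso y.iso)⟩,
    (P.τ x.fst y.fst).2⟩
  τ_natural φ ψ h := FibHom.ext (P.τ_natural _ _ _)
    (P'.τ_natural _ _ (by rw [← φ.eq, ← ψ.eq]; exact h))
  pentagon x y z t := FibHom.ext (P.pentagon _ _ _ _) (P'.pentagon _ _ _ _)
  hexagon x y z := FibHom.ext (P.hexagon _ _ _) (P'.hexagon _ _ _)
  τ_τ x y := FibHom.ext (P.τ_τ _ _) (P'.τ_τ _ _)
  τ_self x := FibHom.ext (P.τ_self _) (P'.τ_self _)
  zero U := fibZero G F U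
  zeroMap f := ⟨P.zeroMap f, P'.zeroMap f, (P.π_zeroMap f).trans (P'.π_zeroMap f).symm, isoZero_natural f⟩
  π_zeroMap f := P.π_zeroMap f
  zeroMap_id U := FibHom.ext (P.zeroMap_id U) (P'.zeroMap_id U)
  zeroMap_comp f g := FibHom.ext (P.zeroMap_comp f g) (P'.zeroMap_comp f g)
  zeroAdd x := ⟨⟨(P.zeroAdd x.fst).1, (P'.zeroAdd x.snd).1, (FHom.property _).trans (FHom.property _).symm,
    congrArg FHom.val (isoAdd_zero x.iso)⟩,
    (P.zeroAdd x.fst).2⟩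
  zeroAdd_natural φ := FibHom.ext (P.zeroAdd_natural φ.fst)
    ((congrArg (· ≫ _) (P'.addMap_congr _ (congrArg P'.zeroMap φ.eq) rfl)).trans
      (P'.zeroAdd_natural φ.snd))
  triangle x y := FibHom.ext (P.triangle _ _) (P'.triangle _ _)
  exists_neg x := by
    obtain ⟨y, φ, φ', h⟩ := fib_neg x
    exact ⟨y, ⟨⟨⟨φ.1, φ'.1, φ.2.trans φ'.2.symm, h⟩, φ.2⟩⟩⟩

end AddFunctor

namespace AddFunctor

open FibGpd PicardFib

variable {C : Type u} [Category.{v} C] {P P' Q : PicardFib.{w} C}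
  {G : AddFunctor P Q} {F : AddFunctor P' Q} {U : C} {R : Sieve U}

/-- Image of cartesian sections under an additive functor. -/
def mapSec (F : AddFunctor P Q) (R : Sieve U) : P.Sec R ⥤ Q.Sec R where
  obj s :=
    { obj := fun f hf => F.obj (s.obj f hf)
      map := fun hf hk g h => F.map (s.map hf hk g h)
      π_map := fun hf hk g h => by rw [F.π_map, s.π_map]
      map_id := fun hf => by rw [s.map_id, F.map_id]
      map_comp := fun hf hk hl g h g' h' => by rw [← F.map_comp, ← s.map_comp] }
  map a := ⟨fun f hf => F.fmap (Sec.Hom.app a f hf), fun hf hk g h => by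
    have := Sec.Hom.naturality a hf hk g h
    change F.map _ ≫ F.map _ = F.map _ ≫ F.map _
    rw [← F.map_comp, this, F.map_comp]⟩
  map_id s := sec_hom_ext fun f hf => F.map_id _
  map_comp a b := sec_hom_ext fun f hf => F.map_comp _ _

/-- Components of a section of a fibered product. -/
def secFst (s : (fibGpd G F).Sec R) : P.Sec R where
  obj f hf := (s.obj f hf).fst
  map hf hk g h := (s.map hf hk g h).fst
  π_map hf hk g h := s.π_map hf hk g h
  map_id hf := congrArg FibHom.fst (s.map_id hf)
  map_comp hf hk hl g h g' h' := congrArg FibHom.fst (s.map_comp hf hk hl g h g' h')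

def secSnd (s : (fibGpd G F).Sec R) : P'.Sec R where
  obj f hf := (s.obj f hf).snd
  map hf hk g h := (s.map hf hk g h).snd
  π_map hf hk g h := (FibHom.eq (s.map hf hk g h)).symm.trans (s.π_map hf hk g h)
  map_id hf := congrArg FibHom.snd (s.map_id hf)
  map_comp hf hk hl g h g' h' := congrArg FibHom.snd (s.map_comp hf hk hl g h g' h')

def secIso (s : (fibGpd G F).Sec R) : (G.mapSec R).obj (secFst s) ⟶ (F.mapSec R).obj (secSnd s) where
  app f hf := (s.obj f hf).iso
  naturality hf hk g h := FibHom.comm (s.map hf hk g h)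

def secHomFst {s t : (fibGpd G F).Sec R} (a : s ⟶ t) : secFst s ⟶ secFst t where
  app f hf := ⟨FibHom.fst (Sec.Hom.app a f hf).1, (Sec.Hom.app a f hf).2⟩
  naturality hf hk g h := congrArg FibHom.fst (Sec.Hom.naturality a hf hk g h)

def secHomSnd {s t : (fibGpd G F).Sec R} (a : s ⟶ t) : secSnd s ⟶ secSnd t where
  app f hf := ⟨FibHom.snd (Sec.Hom.app a f hf).1,
    (FibHom.eq (Sec.Hom.app a f hf).1).symm.trans (Sec.Hom.app a f hf).2⟩
  naturality hf hk g h := congrArg FibHom.snd (Sec.Hom.naturality a hf hk g h)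

theorem secHom_comm {s t : (fibGpd G F).Sec R} (a : s ⟶ t) :
    (G.mapSec R).map (secHomFst a) ≫ secIso t = secIso s ≫ (F.mapSec R).map (secHomSnd a) :=
  sec_hom_ext fun f hf => FibHom.comm (Sec.Hom.app a f hf).1

def secHomMk {s t : (fibGpd G F).Sec R} (a : secFst s ⟶ secFst t) (b : secSnd s ⟶ secSnd t)
    (hab : (G.mapSec R).map a ≫ secIso t = secIso s ≫ (F.mapSec R).map b) : s ⟶ t where
  app f hf := ⟨⟨(Sec.Hom.app a f hf).1, (Sec.Hom.app b f hf).1,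
    (Sec.Hom.app a f hf).2.trans (Sec.Hom.app b f hf).2.symm,
    congrArg (fun c => (Sec.Hom.app c f hf).1) hab⟩, (Sec.Hom.app a f hf).2⟩
  naturality hf hk g h := FibHom.ext (Sec.Hom.naturality a hf hk g h)
    (Sec.Hom.naturality b hf hk g h)

theorem secHom_ext {s t : (fibGpd G F).Sec R} {a b : s ⟶ t} (h : secHomFst a = secHomFst b)
    (h' : secHomSnd a = secHomSnd b) : a = b :=
  sec_hom_ext fun f hf => FibHom.ext (congrArg (fun c => (Sec.Hom.app c f hf).1) h)
    (congrArg (fun c => (Sec.Hom.app c f hf).1) h')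

def secMk (s : P.Sec R) (t : P'.Sec R) (e : (G.mapSec R).obj s ⟶ (F.mapSec R).obj t) :
    (fibGpd G F).Sec R where
  obj f hf := ⟨s.obj f hf, t.obj f hf, Sec.Hom.app e f hf⟩
  map hf hk g h := ⟨s.map hf hk g h, t.map hf hk g h,
    (s.π_map hf hk g h).trans (t.π_map hf hk g h).symm, Sec.Hom.naturality e hf hk g h⟩
  π_map hf hk g h := s.π_map hf hk g h
  map_id hf := FibHom.ext (s.map_id hf) (t.map_id hf)
  map_comp hf hk hl g h g' h' := FibHom.ext (s.map_comp hf hk hl g h g' h')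
    (t.map_comp hf hk hl g h g' h')

variable (G F) in
theorem isStack_fibGpd {J : GrothendieckTopology C} (hP : P.IsStack J) (hP' : P'.IsStack J)
    (hQ : Q.IsStack J) : (fibGpd G F).IsStack J := by
  intro U R hR
  have h := hP U R hR
  have h' := hP' U R hR
  have hq := hQ U R hR
  refine { faithful := ⟨?_⟩, full := ⟨?_⟩, essSurj := ⟨?_⟩ }
  · intro s t a b hab
    exact secHom_ext ((P.restrict R).map_injective (congrArg secHomFst hab))
      ((P'.restrict R).map_injective (congrArg secHomSnd hab))
  · intro s t a
    obtain ⟨b, hb⟩ := (P.restrict R).map_surjective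
      (X := secFst s) (Y := secFst t) (secHomFst a)
    obtain ⟨b', hb'⟩ := (P'.restrict R).map_surjective
      (X := secSnd s) (Y := secSnd t) (secHomSnd a)
    have hc : (G.mapSec ⊤).map b ≫ secIso t = secIso s ≫ (F.mapSec ⊤).map b' := by
      apply (Q.restrict R).map_injective
      have := secHom_comm a
      rw [← hb, ← hb'] at this
      exact this
    exact ⟨secHomMk b b' hc, secHom_ext hb hb'⟩
  · intro s
    obtain ⟨t, ⟨e⟩⟩ := Functor.EssSurj.mem_essImage (F := P.restrict R) (secFst s)
    obtain ⟨t', ⟨e'⟩⟩ := Functor.EssSurj.mem_essImage (F := P'.restrict R) (secSnd s)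
    obtain ⟨i, hi⟩ := (Q.restrict R).map_surjective (X := (G.mapSec ⊤).obj t)
      (Y := (F.mapSec ⊤).obj t') ((G.mapSec R).map e.hom ≫ secIso s ≫ (F.mapSec R).map e'.inv)
    refine ⟨secMk t t' i, ⟨asIso (secHomMk (s := ((fibGpd G F).restrict R).obj (secMk t t' i))
      (t := s) e.hom e'.hom ?_)⟩⟩
    change _ = (Q.restrict R).map i ≫ _
    rw [hi]
    have hh : (G.mapSec R).map e.hom ≫ secIso s = ((G.mapSec R).map e.hom ≫ secIso s ≫
        (F.mapSec R).map e'.inv) ≫ (F.mapSec R).map e'.hom := by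
      simp [← Functor.map_comp]
    exact hh

end AddFunctor

namespace PicardStack

variable {C : Type u} [Category.{v} C] {J : GrothendieckTopology C}

/-- The product of two strictly commutative Picard stacks. -/
def prod (P P' : PicardStack.{w} J) : PicardStack.{w} J where
  toPicardFib := P.toPicardFib.prod P'.toPicardFib
  isStack := P.isStack.prod P'.isStack

/-- The fibered product of two strictly commutative Picard stacks. -/
noncomputable def fibProd {P P' Q : PicardStack.{w} J}
    (G : AddFunctor P.toPicardFib Q.toPicardFib) (F : AddFunctor P'.toPicardFib Q.toPicardFib) :
    PicardStack.{w} J where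
  toPicardFib := AddFunctor.fibProd G F
  isStack := AddFunctor.isStack_fibGpd G F P.isStack P'.isStack Q.isStack

end PicardStack

namespace FibGpd

variable (C : Type u) [Category.{v} C]

instance oneCategory : Category.{max u v w} (Tot (fun _ : C => PUnit.{(max u v w) + 1})) where
  Hom X Y := ULift.{max u v w} (X.base ⟶ Y.base)
  id X := ⟨𝟙 _⟩
  comp f g := ⟨f.down ≫ g.down⟩

/-- The terminal fibered category `C → C`: one object over each `U`, and one morphism over each
morphism of `C`. -/
def one : FibGpd.{w} C where
  Obj _ := PUnit.{(max u v w) + 1}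
  cat := oneCategory.{w} C
  π φ := ULift.down φ
  π_id _ := rfl
  π_comp _ _ := rfl
  exists_lift f _ := ⟨⟨⟩, ⟨f⟩, rfl⟩
  cartesian _ _ h e := ⟨⟨h⟩, ⟨rfl, ULift.ext _ _ e⟩, fun _ hχ => ULift.ext _ _ hχ.1⟩

theorem isStack_one (J : GrothendieckTopology C) : (one.{w} C).IsStack J := by
  intro U R _
  refine { faithful := ⟨?_⟩, full := ⟨?_⟩, essSurj := ⟨?_⟩ }
  · intro s t a b _
    exact sec_hom_ext fun f hf => ULift.ext _ _
      ((Sec.Hom.app a f hf).2.trans (Sec.Hom.app b f hf).2.symm)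
  · intro s t a
    refine ⟨⟨fun f hf => ⟨⟨𝟙 _⟩, rfl⟩, ?_⟩, ?_⟩
    · intro V W f k hf hk g h
      exact ULift.ext _ _ ((Category.comp_id _).trans (((s.π_map hf hk g h).trans
        (t.π_map hf hk g h).symm).trans (Category.id_comp _).symm))
    · exact sec_hom_ext fun f hf => ULift.ext _ _ (Sec.Hom.app a f hf).2.symm
  · intro s
    let t : (one.{w} C).Sec (⊤ : Sieve U) :=
      { obj := fun _ _ => ⟨⟩
        map := fun _ _ g _ => ⟨g⟩
        π_map := fun _ _ _ _ => rfl
        map_id := fun _ => rfl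
        map_comp := fun _ _ _ _ _ _ _ => rfl }
    let e : ((one.{w} C).restrict R).obj t ⟶ s :=
      ⟨fun f hf => ⟨⟨𝟙 _⟩, rfl⟩, fun hf hk g h => ULift.ext _ _
        ((Category.comp_id _).trans ((s.π_map hf hk g h).symm.trans (Category.id_comp _).symm))⟩
    exact ⟨t, ⟨asIso e⟩⟩

end FibGpd

namespace PicardFib

open FibGpd

variable (C : Type u) [Category.{v} C]

/-- The terminal strictly commutative Picard fibered category. -/
def one : PicardFib.{w} C where
  toFibGpd := FibGpd.one.{w} C
  add _ _ := ⟨⟩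
  addMap φ _ _ := φ
  π_addMap _ _ _ := rfl
  addMap_id _ _ := rfl
  addMap_comp _ _ _ _ _ _ := rfl
  σ _ _ _ := ⟨𝟙 _, rfl⟩
  σ_natural _ _ _ _ _ := (Category.comp_id _).trans (Category.id_comp _).symm
  τ _ _ := ⟨𝟙 _, rfl⟩
  τ_natural φ ψ h := (Category.comp_id φ).trans
    ((ULift.ext φ ψ h).trans (Category.id_comp ψ).symm)
  pentagon _ _ _ _ := (congrArg (_ ≫ ·) (Category.id_comp _))
  hexagon _ _ _ := rfl
  τ_τ _ _ := Category.comp_id _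
  τ_self _ := rfl
  zero _ := ⟨⟩
  zeroMap f := ⟨f⟩
  π_zeroMap _ := rfl
  zeroMap_id _ := rfl
  zeroMap_comp _ _ := rfl
  zeroAdd _ := ⟨𝟙 _, rfl⟩
  zeroAdd_natural _ := ULift.ext _ _ ((Category.comp_id _).trans (Category.id_comp _).symm)
  triangle _ _ := rfl
  exists_neg _ := ⟨⟨⟩, ⟨⟨𝟙 _, rfl⟩⟩⟩

end PicardFib

/-- The terminal strictly commutative Picard stack `1`. -/
def PicardStack.one {C : Type u} [Category.{v} C] (J : GrothendieckTopology C) :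
    PicardStack.{w} J where
  toPicardFib := PicardFib.one.{w} C
  isStack := (FibGpd.isStack_one.{w} C J :)

namespace AddFunctor

open FibGpd PicardFib

variable {C : Type u} [Category.{v} C] {P P' Q Q' O : PicardFib.{w} C}

theorem lift_aux {G : AddFunctor P Q} {F : AddFunctor P' Q} (H : AddFunctor O P)
    (K : AddFunctor O P') (e : Hom (G.comp H) (F.comp K)) {U : C} (x y : O.Obj U) :
    G.map (H.sum x y).1 ≫ (isoAdd (G := G) (F := F) (e.app x) (e.app y)).1 =
      (e.app (O.add x y)).1 ≫ F.map (K.sum x y).1 := by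
  have h1 := e.app_add x y
  have h2 : (isoAdd (G := G) (F := F) (e.app x) (e.app y)).1 ≫ (F.sum (K.obj x) (K.obj y)).1 =
      (G.sum _ _).1 ≫ Q.addMap (e.app x).1 (e.app y).1
        ((FHom.property _).trans (FHom.property _).symm) :=
    congrArg FHom.val (isoAdd_sumF (G := G) (F := F) (e.app x) (e.app y))
  refine (cancel_mono (F.sum (K.obj x) (K.obj y)).1).1 ?_
  refine (Category.assoc _ _ _).trans (Eq.trans ?_ (Category.assoc _ _ _).symm)
  refine (congrArg (G.map (H.sum x y).1 ≫ ·) h2).trans ?_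
  exact ((Category.assoc _ _ _).symm.trans h1.symm)

/-- The additive functor to a fibered product given by additive functors `H`, `K` and an
isomorphism `G ∘ H ≅ F ∘ K`. -/
noncomputable def lift {G : AddFunctor P Q} {F : AddFunctor P' Q} (H : AddFunctor O P)
    (K : AddFunctor O P') (e : Hom (G.comp H) (F.comp K)) : AddFunctor O (fibProd G F) where
  obj x := ⟨H.obj x, K.obj x, e.app x⟩
  map φ := ⟨H.map φ, K.map φ, by simp, e.naturality φ⟩
  π_map φ := H.π_map φ
  map_id x := FibHom.ext (H.map_id x) (K.map_id x)
  map_comp φ ψ := FibHom.ext (H.map_comp φ ψ) (K.map_comp φ ψ)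
  sum x y := ⟨⟨(H.sum x y).1, (K.sum x y).1, (FHom.property _).trans (FHom.property _).symm,
    lift_aux H K e x y⟩, (H.sum x y).2⟩
  sum_natural φ ψ h := FibHom.ext (H.sum_natural φ ψ h) (K.sum_natural φ ψ h)
  map_σ x y z := FibHom.ext (H.map_σ x y z) (K.map_σ x y z)
  map_τ x y := FibHom.ext (H.map_τ x y) (K.map_τ x y)

/-- The projections of a fibered product. -/
noncomputable def pr₁ (G : AddFunctor P Q) (F : AddFunctor P' Q) : AddFunctor (fibProd G F) P where
  obj x := x.fst
  map φ := FibHom.fst φ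
  π_map _ := rfl
  map_id _ := rfl
  map_comp _ _ := rfl
  sum _ _ := ⟨𝟙 _, P.π_id _⟩
  sum_natural _ _ _ := (Category.comp_id _).trans (Category.id_comp _).symm
  map_σ x y z := (by simp : (P.σ x.fst y.fst z.fst).1 ≫ 𝟙 _ ≫ P.addMap (𝟙 _) (𝟙 _) (by simp) =
    𝟙 _ ≫ P.addMap (𝟙 _) (𝟙 _) (by simp) ≫ (P.σ x.fst y.fst z.fst).1)
  map_τ _ _ := (Category.comp_id _).trans (Category.id_comp _).symm

noncomputable def pr₂ (G : AddFunctor P Q) (F : AddFunctor P' Q) : AddFunctor (fibProd G F) P' where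
  obj x := x.snd
  map φ := FibHom.snd φ
  π_map φ := (FibHom.eq φ).symm
  map_id _ := rfl
  map_comp _ _ := rfl
  sum _ _ := ⟨𝟙 _, P'.π_id _⟩
  sum_natural _ _ _ := (Category.comp_id _).trans (Category.id_comp _).symm
  map_σ x y z := (by simp : (P'.σ x.snd y.snd z.snd).1 ≫ 𝟙 _ ≫ P'.addMap (𝟙 _) (𝟙 _) (by simp) =
    𝟙 _ ≫ P'.addMap (𝟙 _) (𝟙 _) (by simp) ≫ (P'.σ x.snd y.snd z.snd).1)
  map_τ _ _ := (Category.comp_id _).trans (Category.id_comp _).symm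

/-- The product of two additive functors. -/
def prodMap (F : AddFunctor P P') (G : AddFunctor Q Q') : AddFunctor (P.prod Q) (P'.prod Q') where
  obj x := (F.obj x.1, G.obj x.2)
  map φ := ⟨F.map (ProdHom.fst φ), G.map (ProdHom.snd φ), by
    rw [F.π_map, G.π_map]; exact ProdHom.eq φ⟩
  π_map φ := F.π_map _
  map_id x := ProdHom.ext (F.map_id _) (G.map_id _)
  map_comp φ ψ := ProdHom.ext (F.map_comp _ _) (G.map_comp _ _)
  sum x y := ⟨⟨(F.sum x.1 y.1).1, (G.sum x.2 y.2).1,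
    (FHom.property _).trans (FHom.property _).symm⟩, (F.sum x.1 y.1).2⟩
  sum_natural φ ψ h := ProdHom.ext (F.sum_natural _ _ _) (G.sum_natural _ _
    ((ProdHom.eq φ).symm.trans (Eq.trans h (ProdHom.eq ψ))))
  map_σ x y z := ProdHom.ext (F.map_σ _ _ _) (G.map_σ _ _ _)
  map_τ x y := ProdHom.ext (F.map_τ _ _) (G.map_τ _ _)

/-- The diagonal additive functor `D : P → P × P`. -/
def diag (P : PicardFib.{w} C) : AddFunctor P (P.prod P) where
  obj x := (x, x)
  map φ := ⟨φ, φ, rfl⟩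
  π_map _ := rfl
  map_id _ := rfl
  map_comp _ _ := rfl
  sum x y := ⟨𝟙 _, FibGpd.π_id _ _⟩
  sum_natural φ ψ h :=
    have h : P.addMap φ ψ h ≫ 𝟙 _ = 𝟙 _ ≫ P.addMap φ ψ h := by simp
    ProdHom.ext h h
  map_σ x y z :=
    have h : (P.σ x y z).1 ≫ 𝟙 _ ≫ P.addMap (𝟙 _) (𝟙 _) (by simp) =
      𝟙 _ ≫ P.addMap (𝟙 _) (𝟙 _) (by simp) ≫ (P.σ x y z).1 := by simp
    ProdHom.ext h h
  map_τ x y :=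
    have h : (P.τ x y).1 ≫ 𝟙 _ = 𝟙 _ ≫ (P.τ x y).1 := by simp
    ProdHom.ext h h

section Addition

open MonoidalCategory

variable (Q)

theorem sq_comp {U V : C} {a b c : Q.Obj U} {a' b' c' : Q.Obj V} {f : Q.Hom a a'} {g : Q.Hom b b'}
    {h : Q.Hom c c'} {s : a ⟶ b} {s' : a' ⟶ b'} {t : b ⟶ c} {t' : b' ⟶ c'}
    (h1 : f ≫ s'.1 = s.1 ≫ g) (h2 : g ≫ t'.1 = t.1 ≫ h) : f ≫ (s' ≫ t').1 = (s ≫ t).1 ≫ h := by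
  change f ≫ s'.1 ≫ t'.1 = (s.1 ≫ t.1) ≫ h
  rw [reassoc_of% h1, h2, Category.assoc]

theorem sq_inv {U V : C} {a b : Q.Obj U} {a' b' : Q.Obj V} {f : Q.Hom a a'} {g : Q.Hom b b'}
    {s : a ≅ b} {s' : a' ≅ b'} (h1 : f ≫ s'.hom.1 = s.hom.1 ≫ g) :
    g ≫ s'.inv.1 = s.inv.1 ≫ f := by
  have e1 : s'.hom.1 ≫ s'.inv.1 = 𝟙 _ := congrArg FHom.val s'.hom_inv_id
  have e2 : s.inv.1 ≫ s.hom.1 = 𝟙 _ := congrArg FHom.val s.inv_hom_id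
  have h3 := congrArg (fun t => s.inv.1 ≫ t ≫ s'.inv.1) h1
  simp only [Category.assoc, e1, Category.comp_id] at h3
  rw [h3, reassoc_of% e2]

theorem sq_left {U V : C} {a b c : Q.Obj U} {a' b' c' : Q.Obj V} {f : Q.Hom a a'} {g : Q.Hom b b'}
    {s : a ⟶ b} {s' : a' ⟶ b'} (h1 : f ≫ s'.1 = s.1 ≫ g) (k : Q.Hom c c') (hk : Q.π k = Q.π f)
    (hk' : Q.π k = Q.π g) :
    Q.addMap k f hk ≫ (c' ◁ s').1 = (c ◁ s).1 ≫ Q.addMap k g hk' := by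
  refine (Q.addMap_comp k (𝟙 _) f s'.1 hk ((Q.π_id _).trans s'.2.symm)).symm.trans ?_
  refine Eq.trans ?_ (Q.addMap_comp (𝟙 _) k s.1 g ((Q.π_id _).trans s.2.symm) hk')
  exact Q.addMap_congr _ ((Category.comp_id _).trans (Category.id_comp _).symm) h1

theorem sq_right {U V : C} {a b c : Q.Obj U} {a' b' c' : Q.Obj V} {f : Q.Hom a a'} {g : Q.Hom b b'}
    {s : a ⟶ b} {s' : a' ⟶ b'} (h1 : f ≫ s'.1 = s.1 ≫ g) (k : Q.Hom c c') (hk : Q.π f = Q.π k)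
    (hk' : Q.π g = Q.π k) :
    Q.addMap f k hk ≫ (s' ▷ c').1 = (s ▷ c).1 ≫ Q.addMap g k hk' := by
  refine (Q.addMap_comp f s'.1 k (𝟙 _) hk (s'.2.trans (Q.π_id _).symm)).symm.trans ?_
  refine Eq.trans ?_ (Q.addMap_comp s.1 g (𝟙 _) k (s.2.trans (Q.π_id _).symm) hk')
  exact Q.addMap_congr _ h1 ((Category.comp_id _).trans (Category.id_comp _).symm)

theorem tensorμ_natural_tot {U V : C} {a b c d : Q.Obj U} {a' b' c' d' : Q.Obj V}
    (f : Q.Hom a a') (g : Q.Hom b b') (h : Q.Hom c c') (k : Q.Hom d d') (h1 : Q.π f = Q.π g)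
    (h2 : Q.π g = Q.π h) (h3 : Q.π h = Q.π k) :
    Q.addMap (Q.addMap f g h1) (Q.addMap h k h3) (by simp [h1, h2]) ≫ (tensorμ a' b' c' d').1 =
      (tensorμ a b c d).1 ≫ Q.addMap (Q.addMap f h (h1.trans h2)) (Q.addMap g k (h2.trans h3))
        (by simp [h1]) := by
  have e1 : π Q.toFibGpd f = π Q.toFibGpd h := h1.trans h2
  refine sq_comp Q (Q.σ_natural f g (Q.addMap h k h3) h1 (by simp [h2])) ?_
  refine sq_comp Q (sq_left Q (g := Q.addMap (Q.addMap g h h2) k (by simp [h2, h3]))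
    (sq_inv Q (s := α_ b c d) (s' := α_ b' c' d') (Q.σ_natural g h k h2 h3)) f _ (by simp [h1])) ?_
  refine sq_comp Q (sq_left Q (g := Q.addMap (Q.addMap h g h2.symm) k (by simp [h3]))
    (sq_right Q (Q.τ_natural g h h2) k _ _) f _ (by simp [e1])) ?_
  refine sq_comp Q (sq_left Q (Q.σ_natural h g k h2.symm (h2.trans h3)) f _ (by simp [e1])) ?_
  exact sq_inv Q (s := α_ a c (b ⊗ d)) (s' := α_ a' c' (b' ⊗ d'))
    (Q.σ_natural f h (Q.addMap g k (h2.trans h3)) e1 (by simp [h2]))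

theorem tensorμ_braid {D : Type*} [Category D] [MonoidalCategory D] [SymmetricCategory D]
    (a b c d : D) : ((β_ a c).hom ⊗ₘ (β_ b d).hom) ≫ tensorμ c a d b =
      tensorμ a c b d ≫ (β_ (a ⊗ b) (c ⊗ d)).hom := by
  have h : (β_ c b).hom = (β_ b c).inv := SymmetricCategory.braiding_swap_eq_inv_braiding b c
  have h' : (β_ d a).hom = (β_ a d).inv := SymmetricCategory.braiding_swap_eq_inv_braiding a d
  simp [tensorμ, h, h', MonoidalCategory.tensorHom_def]

/-- The addition of `Q` as an additive functor `Q × Q → Q`. -/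
noncomputable def addition : AddFunctor (Q.prod Q) Q where
  obj x := Q.add x.1 x.2
  map φ := Q.addMap (ProdHom.fst φ) (ProdHom.snd φ) (ProdHom.eq φ)
  π_map φ := Q.π_addMap _ _ _
  map_id x := Q.addMap_id _ _
  map_comp φ ψ := Q.addMap_comp _ _ _ _ _ _
  sum x y := tensorμ (C := Q.Obj _) x.1 y.1 x.2 y.2
  sum_natural φ ψ h := tensorμ_natural_tot Q _ _ _ _ _
    (Eq.trans h.symm (ProdHom.eq φ)) _
  map_σ x y z := congrArg FHom.val (associator_monoidal (C := Q.Obj _) x.1 y.1 z.1 x.2 y.2 z.2).symm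
  map_τ x y := congrArg FHom.val (tensorμ_braid (D := Q.Obj _) x.1 x.2 y.1 y.2)

end Addition

end AddFunctor

namespace AddFunctor

open FibGpd PicardFib

variable {C : Type u} [Category.{v} C] {P P' Q Q' O : PicardFib.{w} C}

/-- The additive functor to a product given by two additive functors. -/
def pair (F : AddFunctor O P) (G : AddFunctor O P') : AddFunctor O (P.prod P') where
  obj x := (F.obj x, G.obj x)
  map φ := ⟨F.map φ, G.map φ, by rw [F.π_map, G.π_map]⟩
  π_map φ := F.π_map _
  map_id x := ProdHom.ext (F.map_id _) (G.map_id _)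
  map_comp φ ψ := ProdHom.ext (F.map_comp _ _) (G.map_comp _ _)
  sum x y := ⟨⟨(F.sum x y).1, (G.sum x y).1,
    (FHom.property _).trans (FHom.property _).symm⟩, (F.sum x y).2⟩
  sum_natural φ ψ h := ProdHom.ext (F.sum_natural _ _ _) (G.sum_natural _ _ _)
  map_σ x y z := ProdHom.ext (F.map_σ _ _ _) (G.map_σ _ _ _)
  map_τ x y := ProdHom.ext (F.map_τ _ _) (G.map_τ _ _)

variable (P P') in
/-- The first projection of a product. -/
def fst : AddFunctor (P.prod P') P where
  obj x := x.1
  map φ := ProdHom.fst φ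
  π_map _ := rfl
  map_id _ := rfl
  map_comp _ _ := rfl
  sum _ _ := ⟨𝟙 _, P.π_id _⟩
  sum_natural _ _ _ := (Category.comp_id _).trans (Category.id_comp _).symm
  map_σ x y z := (by simp : (P.σ x.1 y.1 z.1).1 ≫ 𝟙 _ ≫ P.addMap (𝟙 _) (𝟙 _) (by simp) =
    𝟙 _ ≫ P.addMap (𝟙 _) (𝟙 _) (by simp) ≫ (P.σ x.1 y.1 z.1).1)
  map_τ _ _ := (Category.comp_id _).trans (Category.id_comp _).symm

theorem finv_eq {U : C} {x y : P.Obj U} {a : P.FHom x y} {b : P.Hom y x} (h : a.1 ≫ b = 𝟙 _) :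
    (finv a).1 = b := by
  rw [← cancel_epi a.1, h, fhom_finv]

/-- Composition of morphisms of additive functors. -/
def Hom.trans {F G H : AddFunctor P Q} (a : Hom F G) (b : Hom G H) : Hom F H where
  app x := ⟨(a.app x).1 ≫ (b.app x).1, by simp⟩
  naturality φ := by rw [← Category.assoc, a.naturality, Category.assoc, b.naturality,
    Category.assoc]
  app_add x y := by
    rw [Category.assoc, b.app_add, ← Category.assoc, a.app_add, Category.assoc, ← Q.addMap_comp]

/-- The isomorphism `0 ≅ G ∘ 0`. -/
noncomputable def zeroComp (O : PicardFib.{w} C) (G : AddFunctor P Q) :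
    Hom (zero O Q) (G.comp (zero O P)) where
  app {U} _ := finv (G.unit U)
  naturality {U V _ _} φ := by
    refine (cancel_mono (G.unit V).1).1 ?_
    refine (cancel_epi (G.unit U).1).1 ?_
    have h := G.unit_natural (O.π φ)
    have e1 : (G.unit U).1 ≫ ((Q.zeroMap (O.π φ)) ≫ (finv (G.unit V)).1) ≫ (G.unit V).1 =
      (G.unit U).1 ≫ Q.zeroMap (O.π φ) := by simp
    have e2 : (G.unit U).1 ≫ ((finv (G.unit U)).1 ≫ G.map (P.zeroMap (O.π φ))) ≫ (G.unit V).1 =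
      (G.unit U).1 ≫ Q.zeroMap (O.π φ) := by simp [h]
    exact e1.trans e2.symm
  app_add {U} _ _ := by
    have h := G.unit_add (U := U)
    have e : (finv (G.unit U)).1 ≫ G.map (finv (P.zeroAdd (P.zero U))).1 ≫
        (G.sum (P.zero U) (P.zero U)).1 = (finv (Q.zeroAdd (Q.zero U))).1 ≫
          Q.addMap (finv (G.unit U)).1 (finv (G.unit U)).1 rfl := by
      have h1 : Q.addMap (finv (G.unit U)).1 (finv (G.unit U)).1 rfl ≫
          Q.addMap (G.unit U).1 (G.unit U).1 rfl = 𝟙 _ := by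
        rw [← Q.addMap_comp, ← Q.addMap_id]
        exact Q.addMap_congr _ (finv_fhom _) (finv_fhom _)
      have : IsIso (Q.addMap (G.unit U).1 (G.unit U).1 rfl) :=
        isIso_val (Q.addF (G.unit U) (G.unit U))
      rw [← cancel_mono (Q.addMap (G.unit U).1 (G.unit U).1 rfl),
        ← cancel_mono (Q.zeroAdd (Q.zero U)).1]
      simp only [Category.assoc]
      rw [h, reassoc_of% h1, finv_fhom, ← Category.assoc (G.map _), ← G.map_comp, finv_fhom]
      simp
    exact e

/-- For `F : P → Q`, an isomorphism of additive functors `F ∘ I ≅ 0` gives an isomorphism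
between `F ∘ I` and the composite `O → 1 → Q`. -/
def nulOne {F : AddFunctor P Q} {I : AddFunctor O P} (n : Hom (F.comp I) (zero O Q)) :
    Hom (F.comp I) ((zero (PicardFib.one.{w} C) Q).comp (zero O (PicardFib.one.{w} C))) where
  app x := n.app x
  naturality φ := n.naturality φ
  app_add x y := by
    refine Eq.trans ?_ (n.app_add x y)
    refine congrArg ((n.app (O.add x y)).1 ≫ ·) ?_
    refine (congrArg (fun f => Q.zeroMap f ≫ ((zero O Q).sum x y).1)
      (FHom.property ((zero O (PicardFib.one.{w} C)).sum x y))).trans ?_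
    exact (congrArg (· ≫ ((zero O Q).sum x y).1) (Q.zeroMap_id _)).trans (Category.id_comp _)

/-- The additive functor `O → ker F` induced by an additive functor `I : O → P` and an isomorphism
`F ∘ I ≅ 0`. Here `ker F` is the fibered product of `F : P → Q` and `1 → Q`. -/
noncomputable def toKer {F : AddFunctor P Q} {I : AddFunctor O P} (n : Hom (F.comp I) (zero O Q)) :
    AddFunctor O (fibProd F (zero (PicardFib.one.{w} C) Q)) :=
  lift I (zero O (PicardFib.one.{w} C)) (nulOne n)

theorem toKer_isEquivalence_iff {F : AddFunctor P Q} {I : AddFunctor O P}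
    (n : Hom (F.comp I) (zero O Q)) : (toKer n).IsEquivalence ↔
      (∀ {U : C} (x y : O.Obj U) (φ : P.FHom (I.obj x) (I.obj y)),
        F.map φ.1 ≫ (n.app y).1 = (n.app x).1 → ∃! ψ : O.FHom x y, I.map ψ.1 = φ.1) ∧
      ∀ {U : C} (e : P.Obj U) (i : Q.FHom (F.obj e) (Q.zero U)),
        ∃ (x : O.Obj U) (φ : P.FHom (I.obj x) e), F.map φ.1 ≫ i.1 = (n.app x).1 := by
  constructor
  · intro h
    refine ⟨fun {U} x y φ hφ => ?_, fun {U} e i => ?_⟩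
    · have := h U
      let φ' : (fibProd F (zero (PicardFib.one.{w} C) Q)).FHom ((toKer n).obj x)
          ((toKer n).obj y) :=
        ⟨⟨φ.1, ⟨𝟙 _⟩, φ.2, hφ.trans (((Category.comp_id _).symm.trans
          (congrArg (_ ≫ ·) (Q.zeroMap_id _).symm)))⟩, φ.2⟩
      obtain ⟨ψ, hψ⟩ := ((toKer n).fiberFunctor U).map_surjective φ'
      refine ⟨ψ, congrArg FibHom.fst (congrArg FHom.val hψ), fun ψ' hψ' => ?_⟩
      refine ((toKer n).fiberFunctor U).map_injective ?_
      rw [hψ]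
      exact fhom_eq (FibHom.ext hψ' (ULift.ext _ _ ψ'.2))
    · have := h U
      obtain ⟨x, ⟨a⟩⟩ := Functor.EssSurj.mem_essImage (F := (toKer n).fiberFunctor U)
        (⟨e, ⟨⟩, i⟩ : FibObj F (zero (PicardFib.one.{w} C) Q) U)
      refine ⟨x, ⟨FibHom.fst a.hom.1, a.hom.2⟩, (FibHom.comm a.hom.1).trans ?_⟩
      have h1 : (FibHom.snd a.hom.1) = ⟨𝟙 U⟩ := ULift.ext _ _
        ((FibHom.eq a.hom.1).symm.trans a.hom.2)
      rw [h1]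
      exact (congrArg (_ ≫ ·) (Q.zeroMap_id _)).trans (Category.comp_id _)
  · rintro ⟨h1, h2⟩ U
    refine { faithful := ⟨?_⟩, full := ⟨?_⟩, essSurj := ⟨?_⟩ }
    · intro x y a b hab
      have ha : F.map (I.map a.1) ≫ (n.app y).1 = (n.app x).1 := by
        refine (n.naturality a.1).trans ?_
        refine (congrArg (fun f => (n.app x).1 ≫ Q.zeroMap f) a.2).trans ?_
        exact (congrArg (_ ≫ ·) (Q.zeroMap_id _)).trans (Category.comp_id _)
      obtain ⟨c, -, hc⟩ := h1 x y (I.fmap a) ha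
      exact (hc a rfl).trans (hc b (congrArg FibHom.fst (congrArg FHom.val hab)).symm).symm
    · intro x y φ
      have h0 : (FibHom.snd φ.1) = ⟨𝟙 U⟩ := ULift.ext _ _ ((FibHom.eq φ.1).symm.trans φ.2)
      have hφ : F.map (FibHom.fst φ.1) ≫ (n.app y).1 = (n.app x).1 := by
        refine (FibHom.comm φ.1).trans ?_
        rw [h0]
        exact (congrArg (_ ≫ ·) (Q.zeroMap_id _)).trans (Category.comp_id _)
      obtain ⟨ψ, hψ, -⟩ := h1 x y ⟨FibHom.fst φ.1, φ.2⟩ hφ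
      exact ⟨ψ, fhom_eq (FibHom.ext hψ (ULift.ext _ _ (ψ.2.trans (congrArg ULift.down h0).symm)))⟩
    · intro e
      obtain ⟨x, φ, hφ⟩ := h2 e.fst e.iso
      let a : ((toKer n).fiberFunctor U).obj x ⟶ e :=
        ⟨⟨φ.1, ⟨𝟙 _⟩, φ.2, hφ.trans (((Category.comp_id _).symm.trans
          (congrArg (_ ≫ ·) (Q.zeroMap_id _).symm)))⟩, φ.2⟩
      exact ⟨x, ⟨asIso a⟩⟩

end AddFunctor

variable {C : Type u} [Category.{v} C] {J : GrothendieckTopology C}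

open FibGpd PicardFib

/-- An extension of `P` by `Q`: a strictly commutative Picard stack `E`, additive functors
`inc : Q → E` and `proj : E → P` and an isomorphism `proj ∘ inc ≅ 0` such that `proj` is surjective
on the sheaves `π₀` (every object of `P` is locally isomorphic to an object in the image of `proj`)
and `inc` induces an equivalence from `Q` to the kernel of `proj`. -/
structure Extension (P Q : PicardStack.{w} J) where
  E : PicardStack.{w} J
  inc : AddFunctor Q.toPicardFib E.toPicardFib
  proj : AddFunctor E.toPicardFib P.toPicardFib
  nul : AddFunctor.Hom (proj.comp inc) (AddFunctor.zero Q.toPicardFib P.toPicardFib)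
  surj : ∀ {U : C} (p : P.Obj U), ∃ R ∈ J U, ∀ {V : C} (f : V ⟶ U), R f →
    ∃ (e : E.Obj V) (φ : P.Hom (proj.obj e) p), P.π φ = f
  ker : (AddFunctor.toKer nul).IsEquivalence

namespace Extension

variable {P P' Q Q' : PicardStack.{w} J}

/-- Morphisms of extensions over given additive functors `G : P → P'` and `H : Q → Q'`: an additive
functor `F : E → E'` with isomorphisms `proj' ∘ F ≅ G ∘ proj` and `F ∘ inc ≅ inc' ∘ H` which are
compatible with `proj ∘ inc ≅ 0` and `proj' ∘ inc' ≅ 0`. -/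
structure Mor (E : Extension P Q) (E' : Extension P' Q')
    (G : AddFunctor P.toPicardFib P'.toPicardFib)
    (H : AddFunctor Q.toPicardFib Q'.toPicardFib) where
  F : AddFunctor E.E.toPicardFib E'.E.toPicardFib
  projIso : AddFunctor.Hom (E'.proj.comp F) (G.comp E.proj)
  incIso : AddFunctor.Hom (F.comp E.inc) (E'.inc.comp H)
  compat : ∀ {U : C} (q : Q.Obj U),
    (projIso.app (E.inc.obj q)).1 ≫ G.map (E.nul.app q).1 ≫ (G.unit U).1 =
      E'.proj.map (incIso.app q).1 ≫ (E'.nul.app (H.obj q)).1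

/-- Two extensions of `P` by `Q` are equivalent if there is a morphism of extensions between them
over the identities of `P` and `Q`. -/
def Equivalent (E E' : Extension P Q) : Prop :=
  Nonempty (Mor E E' (AddFunctor.id P.toPicardFib) (AddFunctor.id Q.toPicardFib))

/-- The product `E × E'`, an extension of `P × P'` by `Q × Q'`. -/
def prod (E : Extension P Q) (E' : Extension P' Q') : Extension (P.prod P') (Q.prod Q') where
  E := E.E.prod E'.E
  inc := AddFunctor.prodMap E.inc E'.inc
  proj := AddFunctor.prodMap E.proj E'.proj
  nul :=
    { app := fun q => ⟨⟨(E.nul.app q.1).1, (E'.nul.app q.2).1,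
        (FHom.property _).trans (FHom.property _).symm⟩, (E.nul.app q.1).2⟩
      naturality := fun φ => ProdHom.ext (E.nul.naturality (ProdHom.fst φ))
        ((E'.nul.naturality (ProdHom.snd φ)).trans
          (congrArg (fun f => (E'.nul.app _).1 ≫ P'.zeroMap f) (ProdHom.eq φ).symm))
      app_add := fun x y => by
        have h1 : ((AddFunctor.zero (Q.prod Q').toPicardFib (P.prod P').toPicardFib).sum x y).1 =
            ⟨((AddFunctor.zero Q.toPicardFib P.toPicardFib).sum x.1 y.1).1,
              ((AddFunctor.zero Q'.toPicardFib P'.toPicardFib).sum x.2 y.2).1,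
              (FHom.property _).trans (FHom.property _).symm⟩ :=
          AddFunctor.finv_eq (ProdHom.ext (fhom_finv _) (fhom_finv _))
        refine (congrArg (_ ≫ ·) h1).trans ?_
        exact ProdHom.ext (E.nul.app_add x.1 y.1) (E'.nul.app_add x.2 y.2) }
  surj := fun {U} p => by
    obtain ⟨R, hR, h⟩ := E.surj p.1
    obtain ⟨R', hR', h'⟩ := E'.surj p.2
    refine ⟨R ⊓ R', J.intersection_covering hR hR', fun f hf => ?_⟩
    obtain ⟨e, φ, hφ⟩ := h f hf.1
    obtain ⟨e', φ', hφ'⟩ := h' f hf.2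
    exact ⟨(e, e'), ⟨φ, φ', hφ.trans hφ'.symm⟩, hφ⟩
  ker := by
    obtain ⟨h1, h2⟩ := (AddFunctor.toKer_isEquivalence_iff E.nul).1 E.ker
    obtain ⟨h1', h2'⟩ := (AddFunctor.toKer_isEquivalence_iff E'.nul).1 E'.ker
    refine (AddFunctor.toKer_isEquivalence_iff _).2 ⟨?_, ?_⟩
    · intro U x y φ hφ
      obtain ⟨ψ, hψ, hu⟩ := h1 x.1 y.1 ⟨ProdHom.fst φ.1, φ.2⟩ (congrArg ProdHom.fst hφ)
      obtain ⟨ψ', hψ', hu'⟩ := h1' x.2 y.2 ⟨ProdHom.snd φ.1, (ProdHom.eq φ.1).symm.trans φ.2⟩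
        (congrArg ProdHom.snd hφ)
      refine ⟨⟨⟨ψ.1, ψ'.1, ψ.2.trans ψ'.2.symm⟩, ψ.2⟩, ProdHom.ext hψ hψ', fun χ hχ => ?_⟩
      have e1 := hu ⟨ProdHom.fst χ.1, χ.2⟩ (congrArg ProdHom.fst hχ)
      have e2 := hu' ⟨ProdHom.snd χ.1, (ProdHom.eq χ.1).symm.trans χ.2⟩ (congrArg ProdHom.snd hχ)
      exact fhom_eq (ProdHom.ext (congrArg FHom.val e1) (congrArg FHom.val e2))
    · intro U e i
      obtain ⟨x, φ, hφ⟩ := h2 e.1 ⟨ProdHom.fst i.1, i.2⟩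
      obtain ⟨x', φ', hφ'⟩ := h2' e.2 ⟨ProdHom.snd i.1, (ProdHom.eq i.1).symm.trans i.2⟩
      exact ⟨(x, x'), ⟨⟨φ.1, φ'.1, φ.2.trans φ'.2.symm⟩, φ.2⟩, ProdHom.ext hφ hφ'⟩

/-- The pull-back of the extension `E` via `F : P' → P`: the fibered product of `E` and `P'` over
`P`, with its second projection. -/
noncomputable def pullback (E : Extension P Q) (F : AddFunctor P'.toPicardFib P.toPicardFib) :
    Extension P' Q where
  E := PicardStack.fibProd E.proj F
  inc := AddFunctor.lift E.inc (AddFunctor.zero Q.toPicardFib P'.toPicardFib)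
    (E.nul.trans (AddFunctor.zeroComp Q.toPicardFib F))
  proj := AddFunctor.pr₂ E.proj F
  nul :=
    { app := fun {U} q => ⟨𝟙 _, P'.π_id _⟩
      naturality := fun {U V x y} φ => (Category.comp_id _).trans (Category.id_comp _).symm
      app_add := fun x y => (Category.id_comp _).trans ((congrArg₂ (· ≫ ·) (Category.comp_id _)
        (P'.addMap_id _ _)).trans (Category.comp_id _)).symm }
  surj := fun {U} p' => by
    obtain ⟨R, hR, h⟩ := E.surj (F.obj p')
    refine ⟨R, hR, fun {V} f hf => ?_⟩
    obtain ⟨e, φ, hφ⟩ := h f hf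
    obtain ⟨r, ψ, hψ⟩ := P'.exists_lift f p'
    obtain ⟨i, ⟨hi, -⟩, -⟩ := P.cartesian φ (F.map ψ) (𝟙 V) (by simp [hφ, hψ])
    exact ⟨⟨e, r, i, hi⟩, ψ, hψ⟩
  ker := by
    obtain ⟨h1, h2⟩ := (AddFunctor.toKer_isEquivalence_iff E.nul).1 E.ker
    refine (AddFunctor.toKer_isEquivalence_iff _).2 ⟨?_, ?_⟩
    · intro U x y φ hφ
      have hs : AddFunctor.FibHom.snd φ.1 = 𝟙 _ := (Category.comp_id _).symm.trans hφ
      have hc : (E.proj.map (AddFunctor.FibHom.fst φ.1) ≫ (E.nul.app y).1) ≫ (finv (F.unit U)).1 =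
          (E.nul.app x).1 ≫ (finv (F.unit U)).1 := by
        refine (Category.assoc _ _ _).trans ((AddFunctor.FibHom.comm φ.1).trans ?_)
        rw [hs]
        exact (congrArg (_ ≫ ·) (F.map_id _)).trans (Category.comp_id _)
      obtain ⟨ψ, hψ, hu⟩ := h1 x y ⟨AddFunctor.FibHom.fst φ.1, φ.2⟩ 
        (haveI := isIso_val (finv (F.unit U)); (cancel_mono (finv (F.unit U)).1).1 hc)
      refine ⟨ψ, AddFunctor.FibHom.ext hψ ?_, fun χ hχ =>
        hu χ (congrArg AddFunctor.FibHom.fst hχ)⟩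
      exact ((congrArg P'.zeroMap ψ.2).trans (P'.zeroMap_id _)).trans hs.symm
    · rintro U ⟨e, p', a⟩ (i : P'.FHom p' (P'.zero U))
      obtain ⟨x, φ, hφ⟩ := h2 e ⟨a.1 ≫ F.map i.1 ≫ (F.unit U).1, by simp⟩
      refine ⟨x, ⟨⟨φ.1, (finv i).1, φ.2.trans (finv i).2.symm, ?_⟩, φ.2⟩, finv_fhom i⟩
      have h3 : (E.nul.app x).1 = E.proj.map φ.1 ≫ a.1 ≫ F.map i.1 ≫ (F.unit U).1 := hφ.symm
      have h4 : E.proj.map φ.1 ≫ a.1 =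
          ((E.proj.map φ.1 ≫ a.1 ≫ F.map i.1 ≫ (F.unit U).1) ≫ (finv (F.unit U)).1) ≫
            F.map (finv i).1 := by
        simp only [Category.assoc, fhom_finv_assoc]
        rw [← F.map_comp, fhom_finv, F.map_id, Category.comp_id]
      exact h4.trans (congrArg (fun t => (t ≫ (finv (F.unit U)).1) ≫ F.map (finv i).1) h3.symm)

/-- The split extension `P × Q` of `P` by `Q`. -/
noncomputable def split (P Q : PicardStack.{w} J) : Extension P Q where
  E := P.prod Q
  inc := AddFunctor.pair (AddFunctor.zero Q.toPicardFib P.toPicardFib)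
    (AddFunctor.id Q.toPicardFib)
  proj := AddFunctor.fst P.toPicardFib Q.toPicardFib
  nul :=
    { app := fun {U} q => ⟨𝟙 _, P.π_id _⟩
      naturality := fun {U V x y} φ => (Category.comp_id _).trans (Category.id_comp _).symm
      app_add := fun x y => (Category.id_comp _).trans ((congrArg₂ (· ≫ ·) (Category.comp_id _)
        (P.addMap_id _ _)).trans (Category.comp_id _)).symm }
  surj := fun {U} p => ⟨⊤, J.top_mem U, fun {V} f _ => by
    obtain ⟨r, ψ, hψ⟩ := P.exists_lift f p
    exact ⟨(r, Q.zero V), ψ, hψ⟩⟩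
  ker := by
    refine (AddFunctor.toKer_isEquivalence_iff _).2 ⟨?_, ?_⟩
    · intro U x y φ hφ
      have hs : ProdHom.fst φ.1 = 𝟙 _ := (Category.comp_id _).symm.trans hφ
      refine ⟨⟨ProdHom.snd φ.1, (ProdHom.eq φ.1).symm.trans φ.2⟩, ProdHom.ext ?_ rfl, fun χ hχ =>
        fhom_eq (congrArg ProdHom.snd hχ)⟩
      exact ((congrArg P.zeroMap ((ProdHom.eq φ.1).symm.trans φ.2)).trans (P.zeroMap_id _)).trans
        hs.symm
    · intro U e i
      exact ⟨e.2, ⟨⟨(finv i).1, 𝟙 _, (FHom.property _).trans (Q.π_id _).symm⟩, (finv i).2⟩,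
        finv_fhom i⟩

end Extension

/-- Composition of morphisms of the fibers. -/
def FibGpd.FHom.comp {P : FibGpd.{w} C} {U : C} {x y z : P.Obj U} (f : P.FHom x y)
    (g : P.FHom y z) : P.FHom x z := ⟨f.1 ≫ g.1, by simp⟩

namespace AddFunctor

/-- The additive functor `(p, p') ↦ K p + K' p'`. -/
noncomputable def sumOf {P P' X : PicardFib.{w} C} (K : AddFunctor P X) (K' : AddFunctor P' X) :
    AddFunctor (P.prod P') X :=
  (addition X).comp (prodMap K K')

end AddFunctor

section FiberedSum

variable {P P' Q X : PicardFib.{w} C}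

/-- The triplets `(q, α, β)` from `x = (p₁, p₁')` to `y = (p₂, p₂')` over `U`, for additive functors
`G : Q → P` and `F : Q → P'`: an object `q` of `Q(U)` and morphisms `α : p₁ + G q → p₂` and
`β : p₁' → p₂' + F q`. -/
structure Triplet (G : AddFunctor Q P) (F : AddFunctor Q P') {U : C}
    (x y : (P.prod P').Obj U) where
  q : Q.Obj U
  α : P.FHom (P.add x.1 (G.obj q)) y.1
  β : P'.FHom x.2 (P'.add y.2 (F.obj q))

namespace Triplet

variable {G : AddFunctor Q P} {F : AddFunctor Q P'}

/-- `t'` is a restriction of the triplet `t` along `a : x' → x` and `b : y' → y` (lying over the same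
morphism `f` of `C`). If `f`, `a` and `b` are identities, this says that `t` and `t'` are
isomorphic. -/
def IsRestriction {U V : C} {x y : (P.prod P').Obj U} {x' y' : (P.prod P').Obj V}
    (a : (P.prod P').Hom x' x) (b : (P.prod P').Hom y' y) (t' : Triplet G F x' y')
    (t : Triplet G F x y) : Prop :=
  ∃ (u : Q.Hom t'.q t.q) (ha : P.π (ProdHom.fst a) = P.π (G.map u))
    (hb : P'.π (ProdHom.snd b) = P'.π (F.map u)),
    P.addMap (ProdHom.fst a) (G.map u) ha ≫ t.α.1 = t'.α.1 ≫ ProdHom.fst b ∧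
      t'.β.1 ≫ P'.addMap (ProdHom.snd b) (F.map u) hb = ProdHom.snd a ≫ t.β.1

/-- The morphism `K p₁ + K' p₁' → K p₂ + K' p₂'` given by a triplet and an isomorphism
`θ : K ∘ G ≅ K' ∘ F`, namely the composite
`K p₁ + K' p₁' → K p₁ + K' (p₂' + F q) ≅ K p₁ + (K' p₂' + K' F q) ≅ K p₁ + (K' p₂' + K G q)
≅ K p₁ + (K G q + K' p₂') ≅ (K p₁ + K G q) + K' p₂' ≅ K (p₁ + G q) + K' p₂' → K p₂ + K' p₂'`. -/
noncomputable def hom {K : AddFunctor P X} {K' : AddFunctor P' X}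
    (θ : AddFunctor.Hom (K.comp G) (K'.comp F)) {U : C} {x y : (P.prod P').Obj U}
    (t : Triplet G F x y) :
    X.FHom ((K.sumOf K').obj x) ((K.sumOf K').obj y) :=
  let one (z : X.Obj U) : X.FHom z z := ⟨𝟙 _, X.π_id z⟩
  let θq : X.FHom (K'.obj (F.obj t.q)) (K.obj (G.obj t.q)) := finv (θ.app t.q)
  let f₁ := X.addF (one (K.obj x.1)) (K'.fmap t.β)
  let f₂ := X.addF (one (K.obj x.1)) (K'.sum y.2 (F.obj t.q))
  let f₃ := X.addF (one (K.obj x.1)) (X.addF (one (K'.obj y.2)) θq)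
  let f₄ := X.addF (one (K.obj x.1)) (X.τ (K'.obj y.2) (K.obj (G.obj t.q)))
  let f₅ := finv (X.σ (K.obj x.1) (K.obj (G.obj t.q)) (K'.obj y.2))
  let f₆ := X.addF (finv (K.sum x.1 (G.obj t.q))) (one (K'.obj y.2))
  let f₇ := X.addF (K.fmap t.α) (one (K'.obj y.2))
  f₁.comp (f₂.comp (f₃.comp (f₄.comp (f₅.comp (f₆.comp f₇)))))

end Triplet

/-- `X`, with `K : P → X`, `K' : P' → X` and `θ : K ∘ G ≅ K' ∘ F`, is the fibered sum of `P` and `P'`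
under `Q` via `G` and `F`, that is, the stack generated by the following fibered category `D`. The
objects of `D(U)` are the pairs `(p, p')`, its morphisms are the isomorphism classes of triplets,
and its addition is the addition of `P × P'`. The functor `D → X` sends `(p, p')` to `K p + K' p'` and
a triplet `t` to `t.hom θ`; it exhibits `X` as the stack generated by `D` if every object of `X` is
locally isomorphic to one in its image, every morphism of `X` between objects of the image comes
locally from a triplet, and two triplets with the same image are locally isomorphic. -/
structure IsFiberedSum {X : PicardStack.{w} J} (G : AddFunctor Q P) (F : AddFunctor Q P')
    (K : AddFunctor P X.toPicardFib) (K' : AddFunctor P' X.toPicardFib)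
    (θ : AddFunctor.Hom (K.comp G) (K'.comp F)) : Prop where
  essSurj : ∀ {U : C} (z : X.Obj U), ∃ R ∈ J U, ∀ {V : C} (f : V ⟶ U), R f →
    ∃ (x : (P.prod P').Obj V) (φ : X.Hom ((K.sumOf K').obj x) z), X.π φ = f
  full : ∀ {U : C} (x y : (P.prod P').Obj U)
    (φ : X.FHom ((K.sumOf K').obj x) ((K.sumOf K').obj y)),
    ∃ R ∈ J U, ∀ {V : C} (f : V ⟶ U), R f →
      ∃ (x' y' : (P.prod P').Obj V) (a : (P.prod P').Hom x' x) (b : (P.prod P').Hom y' y)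
        (t : Triplet G F x' y'), (P.prod P').π a = f ∧ (P.prod P').π b = f ∧
        (t.hom θ).1 ≫ (K.sumOf K').map b = (K.sumOf K').map a ≫ φ.1
  faithful : ∀ {U : C} (x y : (P.prod P').Obj U) (t₁ t₂ : Triplet G F x y),
    t₁.hom θ = t₂.hom θ → ∃ R ∈ J U, ∀ {V : C} (f : V ⟶ U), R f →
      ∃ (x' y' : (P.prod P').Obj V) (a : (P.prod P').Hom x' x) (b : (P.prod P').Hom y' y)
        (t : Triplet G F x' y'), (P.prod P').π a = f ∧ (P.prod P').π b = f ∧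
        t.IsRestriction a b t₁ ∧ t.IsRestriction a b t₂

end FiberedSum

namespace Extension

variable {P Q Q' : PicardStack.{w} J}

/-- The extension `T` of `P` by `Q'` is a push-down `H_* E` of the extension `E` of `P` by `Q` via
`H : Q → Q'`: it is the fibered sum of `E` and `Q'` under `Q`, and the structure functors of `T` are
compatible with those of `E`. -/
def IsPushDown (E : Extension P Q) (H : AddFunctor Q.toPicardFib Q'.toPicardFib)
    (T : Extension P Q') : Prop :=
  ∃ m : Mor E T (AddFunctor.id P.toPicardFib) H, IsFiberedSum E.inc H m.F T.inc m.incIso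

/-- `S` is (up to equivalence) the sum `E + E' = D^* (+)_* (E × E')`, where `D` is the diagonal of
`P` and `+` is the addition of `Q`. -/
def IsSum (E E' S : Extension P Q) : Prop :=
  ∃ T : Extension (P.prod P) Q, IsPushDown (E.prod E') (AddFunctor.addition Q.toPicardFib) T ∧
    Equivalent (T.pullback (AddFunctor.diag P.toPicardFib)) S

variable (P Q) in
/-- The equivalence classes of extensions of `P` by `Q`. -/
def Class := Quot (Equivalent (P := P) (Q := Q))

/-- The equivalence class of an extension. -/
def cls (E : Extension P Q) : Class P Q := Quot.mk _ E

end Extension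

end PicardStacks

namespace PicardStacks

namespace FibGpd

section Lifts

variable {C : Type u} [Category.{v} C] {P : FibGpd.{w} C} {U V W : C}

/-- The factorization of `φ` through the cartesian morphism `ψ`. -/
noncomputable def fac {x : P.Obj U} {y : P.Obj V} {z : P.Obj W} (φ : P.Hom x z) (ψ : P.Hom y z)
    (h : U ⟶ V) (e : h ≫ P.π ψ = P.π φ) : P.Hom x y :=
  (P.cartesian φ ψ h e).exists.choose

@[simp] theorem π_fac {x : P.Obj U} {y : P.Obj V} {z : P.Obj W} (φ : P.Hom x z) (ψ : P.Hom y z)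
    (h : U ⟶ V) (e : h ≫ P.π ψ = P.π φ) : P.π (fac φ ψ h e) = h :=
  (P.cartesian φ ψ h e).exists.choose_spec.1

@[simp] theorem fac_comp {x : P.Obj U} {y : P.Obj V} {z : P.Obj W} (φ : P.Hom x z) (ψ : P.Hom y z)
    (h : U ⟶ V) (e : h ≫ P.π ψ = P.π φ) : fac φ ψ h e ≫ ψ = φ :=
  (P.cartesian φ ψ h e).exists.choose_spec.2

@[simp] theorem fac_comp_assoc {x : P.Obj U} {y : P.Obj V} {z : P.Obj W} (φ : P.Hom x z)
    (ψ : P.Hom y z) (h : U ⟶ V) (e : h ≫ P.π ψ = P.π φ) {Z : Tot P.Obj} (k : Tot.mk z ⟶ Z) :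
    fac φ ψ h e ≫ ψ ≫ k = φ ≫ k := by rw [← Category.assoc, fac_comp]

/-- A factorization over an identity, as a morphism of the fiber. -/
noncomputable def facF {x y : P.Obj U} {z : P.Obj V} (φ : P.Hom x z) (ψ : P.Hom y z)
    (e : P.π φ = P.π ψ) : P.FHom x y :=
  ⟨fac φ ψ (𝟙 U) ((Category.id_comp _).trans e.symm), π_fac _ _ _ _⟩

@[simp] theorem facF_comp {x y : P.Obj U} {z : P.Obj V} (φ : P.Hom x z) (ψ : P.Hom y z)
    (e : P.π φ = P.π ψ) : (facF φ ψ e).1 ≫ ψ = φ := fac_comp φ ψ _ ((Category.id_comp _).trans e.symm)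

@[simp] theorem facF_comp_assoc {x y : P.Obj U} {z : P.Obj V} (φ : P.Hom x z) (ψ : P.Hom y z)
    (e : P.π φ = P.π ψ) {Z : Tot P.Obj} (k : Tot.mk z ⟶ Z) :
    (facF φ ψ e).1 ≫ ψ ≫ k = φ ≫ k := by rw [← Category.assoc, facF_comp]

theorem facF_congr {x y : P.Obj U} {z : P.Obj V} {φ φ' : P.Hom x z} (h : φ = φ') (ψ : P.Hom y z)
    (e : P.π φ = P.π ψ) : (facF φ ψ e).1 = (facF φ' ψ (h ▸ e)).1 := by subst h; rfl

variable (P) in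
/-- A restriction of an object along a morphism of the base. -/
noncomputable def pull (f : U ⟶ V) (y : P.Obj V) : P.Obj U := (P.exists_lift f y).choose

/-- The canonical morphism from a restriction. -/
noncomputable def pullHom (f : U ⟶ V) (y : P.Obj V) : P.Hom (P.pull f y) y :=
  (P.exists_lift f y).choose_spec.choose

@[simp] theorem π_pullHom (f : U ⟶ V) (y : P.Obj V) : P.π (pullHom f y) = f :=
  (P.exists_lift f y).choose_spec.choose_spec

end Lifts

variable {C : Type u} [Category.{v} C]

/-- Morphisms of `P` form sheaves for the topology `J`. Gluing data for a morphism `x → y` over `g`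
are given as a relation between morphisms to `x` and morphisms to `y`. -/
structure IsPrestack (P : FibGpd.{w} C) (J : GrothendieckTopology C) : Prop where
  hom_ext : ∀ {U U' : C} {x : P.Obj U} {y : P.Obj U'} (β β' : P.Hom x y) (_ : P.π β = P.π β')
    (R : Sieve U) (_ : R ∈ J U), (∀ {V : C} (f : V ⟶ U), R f →
      ∃ (z : P.Obj V) (c : P.Hom z x), P.π c = f ∧ c ≫ β = c ≫ β') → β = β'
  glue : ∀ {U U' : C} {x : P.Obj U} {y : P.Obj U'} (g : U ⟶ U')
    (M : ∀ {V : C} {z : P.Obj V}, P.Hom z x → P.Hom z y → Prop),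
    (∀ {V : C} {z : P.Obj V} (c : P.Hom z x) (m : P.Hom z y), M c m → P.π m = P.π c ≫ g) →
    (∀ {V : C} {z : P.Obj V} (c : P.Hom z x) (m m' : P.Hom z y), M c m → M c m' → m = m') →
    (∀ {V W : C} {z : P.Obj V} {z' : P.Obj W} (b : P.Hom z' z) (c : P.Hom z x) (m : P.Hom z y),
      M c m → M (b ≫ c) (b ≫ m)) →
    ∀ (R : Sieve U) (_ : R ∈ J U), (∀ {V : C} (f : V ⟶ U), R f →
      ∃ (z : P.Obj V) (c : P.Hom z x) (m : P.Hom z y), P.π c = f ∧ M c m) →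
    ∃ β : P.Hom x y, P.π β = g ∧
      ∀ {V : C} {z : P.Obj V} (c : P.Hom z x) (m : P.Hom z y), M c m → c ≫ β = m

/-- Cartesian sections of `P` over covering sieves extend. -/
def HasGluing (P : FibGpd.{w} C) (J : GrothendieckTopology C) : Prop :=
  ∀ {U : C} (R : Sieve U) (_ : R ∈ J U) (s : P.Sec R), ∃ (b : P.Obj U)
    (l : ∀ {V : C} (f : V ⟶ U) (hf : R f), P.Hom (s.obj f hf) b),
    (∀ {V : C} (f : V ⟶ U) (hf : R f), P.π (l f hf) = f) ∧
    ∀ {V W : C} {f : V ⟶ U} {k : W ⟶ U} (hf : R f) (hk : R k) (g : W ⟶ V) (h : g ≫ f = k),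
      s.map hf hk g h ≫ l f hf = l k hk

variable {P : FibGpd.{w} C} {J : GrothendieckTopology C}

/-- Gluing of a morphism from an indexed family of compatible pieces. -/
theorem IsPrestack.glue_pieces (hP : P.IsPrestack J) {U U' : C} {x : P.Obj U} {y : P.Obj U'}
    (g : U ⟶ U') {ι : Sort*} {V : ι → C} {z : ∀ i, P.Obj (V i)} (c : ∀ i, P.Hom (z i) x)
    (m : ∀ i, P.Hom (z i) y) (hm : ∀ i, P.π (m i) = P.π (c i) ≫ g)
    (compat : ∀ (i j : ι) {W : C} (k : W ⟶ V i) (k' : W ⟶ V j), k ≫ P.π (c i) = k' ≫ P.π (c j) →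
      ∃ (t : P.Obj W) (b : P.Hom t (z i)) (b' : P.Hom t (z j)), P.π b = k ∧ P.π b' = k' ∧
        b ≫ c i = b' ≫ c j ∧ b ≫ m i = b' ≫ m j)
    (R : Sieve U) (hR : R ∈ J U)
    (hc : ∀ {W : C} (f : W ⟶ U), R f → ∃ (i : ι) (k : W ⟶ V i), k ≫ P.π (c i) = f) :
    ∃ β : P.Hom x y, P.π β = g ∧ ∀ i, c i ≫ β = m i := by
  suffices h : ∃ β : P.Hom x y, P.π β = g ∧ ∀ {W : C} {t : P.Obj W} (a : P.Hom t x)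
      (b : P.Hom t y), (∃ (i : ι) (k : P.Hom t (z i)), a = k ≫ c i ∧ b = k ≫ m i) →
        a ≫ β = b by
    obtain ⟨β, h1, h2⟩ := h
    exact ⟨β, h1, fun i => h2 _ _ ⟨i, 𝟙 _, by simp, by simp⟩⟩
  refine hP.glue g
    (fun {W t} a b => ∃ (i : ι) (k : P.Hom t (z i)), a = k ≫ c i ∧ b = k ≫ m i) ?_ ?_ ?_ R hR ?_
  · rintro W t _ _ ⟨i, k, rfl, rfl⟩
    rw [P.π_comp, P.π_comp, hm, Category.assoc]
  · rintro W t _ _ _ ⟨i, k, rfl, rfl⟩ ⟨j, k', h, rfl⟩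
    obtain ⟨t', b, b', hb, hb', h1, h2⟩ := compat i j (P.π k) (P.π k')
      (by rw [← P.π_comp, ← P.π_comp, h])
    have e1 : (facF k b hb.symm).1 ≫ b' = k' := by
      refine FibGpd.hom_ext (c j) (by simp [hb']) ?_
      rw [Category.assoc, ← h1, facF_comp_assoc, h]
    rw [← e1, Category.assoc, ← h2, facF_comp_assoc]
  · rintro W W' t t' b _ _ ⟨i, k, rfl, rfl⟩
    exact ⟨i, b ≫ k, by simp, by simp⟩
  · intro W f hf
    obtain ⟨i, k, rfl⟩ := hc f hf
    exact ⟨_, pullHom k (z i) ≫ c i, pullHom k (z i) ≫ m i, by simp, i, _, rfl, rfl⟩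

theorem π_pullHom_comp {U V : C} {x y : P.Obj U} (φ : P.FHom x y) (f : V ⟶ U) :
    P.π (pullHom f x ≫ φ.1) = f := by simp

theorem facF_square {U V W : C} {x y : P.Obj U} (φ : P.FHom x y) {f : V ⟶ U} {k : W ⟶ U}
    (g : W ⟶ V) (h : g ≫ f = k) :
    fac (pullHom k x) (pullHom f x) g (by simp [h]) ≫
        (facF (pullHom f x ≫ φ.1) (pullHom f y) (by simp)).1 =
      (facF (pullHom k x ≫ φ.1) (pullHom k y) (by simp)).1 ≫
        fac (pullHom k y) (pullHom f y) g (by simp [h]) :=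
  hom_ext (pullHom f y) (by simp) (by simp)

theorem fac_square {U V W T : C} (x : P.Obj U) {f : V ⟶ U} {k : W ⟶ U} {l : T ⟶ U} (g : W ⟶ V)
    (h : g ≫ f = k) (g' : T ⟶ W) (h' : g' ≫ k = l) :
    (fac (pullHom l x) (pullHom k x) g' (by simp [h']) ≫
      fac (pullHom k x) (pullHom f x) g (by simp [h])) ≫ pullHom f x = pullHom l x := by
  simp

/-- The cartesian section given by an object. -/
noncomputable def secOf {U : C} (x : P.Obj U) (R : Sieve U) : P.Sec R where
  obj f _ := P.pull f x
  map {V W f k} _ _ g h := fac (pullHom k x) (pullHom f x) g (by simp [h])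
  π_map _ _ g h := π_fac _ _ _ _
  map_id {V f} _ := hom_ext (pullHom f x) ((π_fac _ _ _ _).trans (P.π_id _).symm)
    ((fac_comp _ _ _ _).trans (Category.id_comp _).symm)
  map_comp {V W T f k l} _ _ _ g h g' h' := hom_ext (pullHom f x) (by simp)
    ((fac_comp (pullHom l x) (pullHom f x) (g' ≫ g) (by simp [h, h'])).trans
      (fac_square x g h g' h').symm)

/-- The morphism of sections given by a morphism of a fiber. -/
noncomputable def secOfMap {U : C} {x y : P.Obj U} (φ : P.FHom x y) (R : Sieve U) :
    secOf x R ⟶ secOf y R where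
  app f _ := facF (pullHom f x ≫ φ.1) (pullHom f y) ((π_pullHom_comp φ f).trans (π_pullHom f y).symm)
  naturality _ _ g h := facF_square φ g h

theorem IsStack.hom_ext {U U' : C} (hP : P.IsStack J) {x : P.Obj U} {y : P.Obj U'}
    (β β' : P.Hom x y) (e : P.π β = P.π β')
    (R : Sieve U) (hR : R ∈ J U) (h : ∀ {V : C} (f : V ⟶ U), R f →
      ∃ (z : P.Obj V) (c : P.Hom z x), P.π c = f ∧ c ≫ β = c ≫ β') : β = β' := by
  have key : ∀ {x y : P.Obj U} (b b' : P.FHom x y), (∀ {V : C} (f : V ⟶ U), R f →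
      ∃ (z : P.Obj V) (c : P.Hom z x), P.π c = f ∧ c ≫ b.1 = c ≫ b'.1) → b = b' := by
    intro x y b b' hb
    have := hP U R hR
    have h1 : secOfMap b ⊤ = secOfMap b' ⊤ := by
      apply (P.restrict R).map_injective
      refine sec_hom_ext fun f hf => ?_
      obtain ⟨z, c, hc, hc'⟩ := hb f hf
      have e1 : pullHom f x ≫ b.1 = pullHom f x ≫ b'.1 := by
        rw [← facF_comp (pullHom f x) c (by simp [hc]), Category.assoc, hc', Category.assoc]
      exact facF_congr e1 (pullHom f y) (by simp)
    have h2 : pullHom (𝟙 U) x ≫ b.1 = pullHom (𝟙 U) x ≫ b'.1 :=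
      ((facF_comp (pullHom (𝟙 U) x ≫ b.1) (pullHom (𝟙 U) y) (by simp)).symm.trans (congrArg
        (fun t => (Sec.Hom.app t (𝟙 U) trivial).1 ≫ pullHom (𝟙 U) y) h1)).trans
        (facF_comp (pullHom (𝟙 U) x ≫ b'.1) (pullHom (𝟙 U) y) (by simp))
    have h3 := congrArg (fun t => (facF (𝟙 _) (pullHom (𝟙 U) x) (by simp)).1 ≫ t) h2
    exact fhom_eq (by simpa using h3)
  have h1 := key (facF β (pullHom (P.π β) y) (by simp)) (facF β' (pullHom (P.π β) y) (by simp [e]))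
    (fun {V} f hf => by
      obtain ⟨z, c, hc, hc'⟩ := h f hf
      exact ⟨z, c, hc, FibGpd.hom_ext (pullHom (P.π β) y) (by simp) (by simp [hc'])⟩)
  rw [← facF_comp β (pullHom (P.π β) y) (by simp), h1, facF_comp]

theorem IsStack.glue {U U' : C} (hP : P.IsStack J) {x : P.Obj U} {y : P.Obj U'} (g : U ⟶ U')
    (M : ∀ {V : C} {z : P.Obj V}, P.Hom z x → P.Hom z y → Prop)
    (h1 : ∀ {V : C} {z : P.Obj V} (c : P.Hom z x) (m : P.Hom z y), M c m → P.π m = P.π c ≫ g)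
    (h2 : ∀ {V : C} {z : P.Obj V} (c : P.Hom z x) (m m' : P.Hom z y), M c m → M c m' → m = m')
    (h3 : ∀ {V W : C} {z : P.Obj V} {z' : P.Obj W} (b : P.Hom z' z) (c : P.Hom z x)
      (m : P.Hom z y), M c m → M (b ≫ c) (b ≫ m))
    (R : Sieve U) (hR : R ∈ J U) (h4 : ∀ {V : C} (f : V ⟶ U), R f →
      ∃ (z : P.Obj V) (c : P.Hom z x) (m : P.Hom z y), P.π c = f ∧ M c m) :
    ∃ β : P.Hom x y, P.π β = g ∧
      ∀ {V : C} {z : P.Obj V} (c : P.Hom z x) (m : P.Hom z y), M c m → c ≫ β = m := by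
  have h5 : ∀ (V : C) (f : V ⟶ U), R f → ∃ m : P.Hom (P.pull f x) y, M (pullHom f x) m := by
    intro V f hf
    obtain ⟨z, c, m, hc, hm⟩ := h4 f hf
    refine ⟨(facF (pullHom f x) c (by simp [hc])).1 ≫ m, ?_⟩
    have := h3 (facF (pullHom f x) c (by simp [hc])).1 c m hm
    rwa [facF_comp] at this
  choose m hm using h5
  let y' := P.pull g y
  have hy (V : C) (f : V ⟶ U) (hf : R f) : 𝟙 V ≫ P.π (pullHom f y' ≫ pullHom g y) =
      P.π (m V f hf) := by rw [h1 _ _ (hm V f hf)]; simp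
  let a : (P.restrict R).obj (secOf x ⊤) ⟶ (P.restrict R).obj (secOf y' ⊤) :=
    { app := fun {V} f hf => ⟨fac (m V f hf) (pullHom f y' ≫ pullHom g y) (𝟙 V) (hy V f hf), π_fac _ _ _ _⟩
      naturality := fun {V W f k} hf hk b h => by
        change fac (pullHom k x) (pullHom f x) b (by simp [h]) ≫ fac (m V f hf) _ (𝟙 V) (hy V f hf) =
          fac (m W k hk) _ (𝟙 W) (hy W k hk) ≫ fac (pullHom k y') (pullHom f y') b (by simp [h])
        refine FibGpd.hom_ext (pullHom f y' ≫ pullHom g y) (by simp) ?_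
        simp only [Category.assoc, fac_comp, fac_comp_assoc]
        have := h3 (fac (pullHom k x) (pullHom f x) b (by simp [h])) _ _ (hm V f hf)
        rw [fac_comp] at this
        exact h2 _ _ _ this (hm W k hk) }
  have := hP U R hR
  obtain ⟨b, hb⟩ := (P.restrict R).map_surjective a
  have hb' : ∀ {V : C} (f : V ⟶ U) (hf : R f),
      (Sec.Hom.app b f trivial).1 = fac (m V f hf) (pullHom f y' ≫ pullHom g y) (𝟙 V) (hy V f hf) :=
    fun f hf => congrArg (fun t => (Sec.Hom.app t f hf).1) hb
  let b₀ : P.FHom (P.pull (𝟙 U) x) (P.pull (𝟙 U) y') := Sec.Hom.app b (𝟙 U) trivial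
  let β : P.Hom x y := (facF (𝟙 _) (pullHom (𝟙 U) x) (by simp)).1 ≫ b₀.1 ≫
    pullHom (𝟙 U) y' ≫ pullHom g y
  have hβ : P.π β = g := by simp [β]
  have hβ' : ∀ {V : C} (f : V ⟶ U) (hf : R f), pullHom f x ≫ β = m V f hf := by
    intro V f hf
    have n : fac (pullHom f x) (pullHom (𝟙 U) x) f (by simp) ≫ b₀.1 =
        (Sec.Hom.app b f trivial).1 ≫ fac (pullHom f y') (pullHom (𝟙 U) y') f
          ((congrArg (f ≫ ·) (π_pullHom _ _)).trans
            ((Category.comp_id f).trans (π_pullHom _ _).symm)) :=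
      Sec.Hom.naturality b (f := 𝟙 U) (k := f) trivial trivial f (Category.comp_id f)
    have e : pullHom f x ≫ (facF (𝟙 _) (pullHom (𝟙 U) x) (by simp)).1 =
        fac (pullHom f x) (pullHom (𝟙 U) x) f (by simp) :=
      FibGpd.hom_ext (pullHom (𝟙 U) x) (by simp) (by simp)
    simp only [β]
    rw [reassoc_of% e, reassoc_of% n]
    refine (congrArg (fun t : P.Hom (P.pull f x) (P.pull f y') => (t ≫ fac (pullHom f y')
      (pullHom (𝟙 U) y') f (by simp)) ≫ pullHom (𝟙 U) y' ≫ pullHom g y) (hb' f hf)).trans ?_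
    simp
  refine ⟨β, hβ, fun {V z} c n hn => ?_⟩
  refine hP.hom_ext _ _ (by rw [P.π_comp, hβ, h1 _ _ hn]) (R.pullback (P.π c))
    (J.pullback_stable _ hR) fun {W} f hf => ?_
  refine ⟨_, pullHom f z, by simp, ?_⟩
  have e1 : pullHom f z ≫ c = fac (pullHom f z ≫ c) (pullHom _ x) (𝟙 W) (by simp) ≫
    pullHom (f ≫ P.π c) x := by simp
  refine h2 (pullHom f z ≫ c) _ _ ?_ (h3 _ _ _ hn)
  rw [← Category.assoc, e1, Category.assoc, hβ' _ hf]
  exact h3 _ _ _ (hm _ _ hf)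

theorem IsStack.isPrestack (hP : P.IsStack J) : P.IsPrestack J where
  hom_ext := hP.hom_ext
  glue := hP.glue

theorem IsStack.hasGluing (hP : P.IsStack J) : P.HasGluing J := by
  intro U R hR s
  have := hP U R hR
  obtain ⟨t, ⟨e⟩⟩ := Functor.EssSurj.mem_essImage (F := P.restrict R) s
  have hn {V W : C} {f : V ⟶ U} {k : W ⟶ U} (hf : R f) (hk : R k) (g : W ⟶ V) (h : g ≫ f = k) :
      s.map hf hk g h ≫ (Sec.Hom.app e.inv f hf).1 = (Sec.Hom.app e.inv k hk).1 ≫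
        t.map trivial trivial g h := Sec.Hom.naturality e.inv hf hk g h
  refine ⟨t.obj (𝟙 U) trivial, fun {V} f hf => (Sec.Hom.app e.inv f hf).1 ≫
    t.map (f := 𝟙 U) (k := f) trivial trivial f (Category.comp_id f), fun {V} f hf => ?_,
    fun {V W f k} hf hk g h => ?_⟩
  · exact (P.π_comp _ _).trans ((congrArg₂ (· ≫ ·) (FHom.property _) (t.π_map _ _ _ _)).trans
      (Category.id_comp _))
  · change s.map hf hk g h ≫ (Sec.Hom.app e.inv f hf).1 ≫ _ = (Sec.Hom.app e.inv k hk).1 ≫ _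
    refine (Category.assoc _ _ _).symm.trans ((congrArg (· ≫ _) (hn hf hk g h)).trans ?_)
    have := t.map_comp (f := 𝟙 U) (k := f) (l := k) trivial trivial trivial f (Category.comp_id f)
      g h
    refine (Category.assoc _ _ _).trans (congrArg (_ ≫ ·) (this.symm.trans ?_))
    congr 1

theorem isStack_of (hP : P.IsPrestack J) (hP' : P.HasGluing J) : P.IsStack J := by
  intro U R hR
  refine { faithful := ⟨?_⟩, full := ⟨?_⟩, essSurj := ⟨?_⟩ }
  · intro s t a b hab
    refine sec_hom_ext fun {V} f _ => hP.hom_ext _ _ ((FHom.property _).trans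
      (FHom.property _).symm) (R.pullback f) (J.pullback_stable _ hR) fun {W} g hg => ?_
    refine ⟨_, s.map (f := f) (k := g ≫ f) trivial trivial g rfl, s.π_map _ _ _ _, ?_⟩
    rw [Sec.Hom.naturality a, Sec.Hom.naturality b]
    exact congrArg (fun c => (Sec.Hom.app c (g ≫ f) hg).1 ≫ _) hab
  · intro s t a
    let aa : ∀ (V : C) (f : V ⟶ U) (_ : R f), P.FHom (s.obj f trivial) (t.obj f trivial) :=
      fun V f hf => Sec.Hom.app a f hf
    have ha {V W : C} {f : V ⟶ U} {k : W ⟶ U} (hf : R f) (hk : R k) (g : W ⟶ V) (h : g ≫ f = k) :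
      s.map trivial trivial g h ≫ (aa V f hf).1 = (aa W k hk).1 ≫
        t.map trivial trivial g h := Sec.Hom.naturality a hf hk g h
    have key : ∀ (V : C) (f : V ⟶ U), ∃ b : P.FHom (s.obj f trivial) (t.obj f trivial),
        ∀ {W : C} (g : W ⟶ V) (k : W ⟶ U) (h : g ≫ f = k) (hk : R k),
          s.map trivial trivial g h ≫ b.1 = (aa W k hk).1 ≫ t.map trivial trivial g h := by
      intro V f
      suffices h : ∃ β : P.Hom (s.obj f trivial) (t.obj f trivial), P.π β = 𝟙 V ∧
          ∀ i : {x : Σ W : C, W ⟶ V // R (x.2 ≫ f)}, s.map trivial trivial i.1.2 rfl ≫ β =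
            (aa _ (i.1.2 ≫ f) i.2).1 ≫ t.map trivial trivial i.1.2 rfl by
        obtain ⟨β, hβ, hβ'⟩ := h
        refine ⟨⟨β, hβ⟩, fun {W} g k h hk => ?_⟩
        subst h
        exact hβ' ⟨⟨W, g⟩, hk⟩
      refine hP.glue_pieces (x := s.obj f trivial) (y := t.obj f trivial) (𝟙 V)
        (ι := {x : Σ W : C, W ⟶ V // R (x.2 ≫ f)}) (V := fun i => i.1.1)
        (z := fun i => s.obj (i.1.2 ≫ f) trivial)
        (fun i => s.map trivial trivial i.1.2 rfl)
        (fun i => (aa _ (i.1.2 ≫ f) i.2).1 ≫ t.map trivial trivial i.1.2 rfl)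
        (fun i => (P.π_comp _ _).trans ((congrArg₂ (· ≫ ·) (FHom.property _)
          (t.π_map _ _ _ _)).trans (by rw [s.π_map]; simp)))
        ?_ (R.pullback f) (J.pullback_stable f hR) ?_
      · rintro ⟨⟨W, g⟩, hg⟩ ⟨⟨W', g'⟩, hg'⟩ T k k' hk
        rw [s.π_map, s.π_map] at hk
        dsimp only at k k' hk hg hg' ⊢
        have h2 : k ≫ g ≫ f = (k ≫ g) ≫ f := (Category.assoc _ _ _).symm
        have h2' : k' ≫ g' ≫ f = (k ≫ g) ≫ f := by rw [hk, Category.assoc]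
        have hT : R ((k ≫ g) ≫ f) := h2 ▸ R.downward_closed hg k
        refine ⟨s.obj ((k ≫ g) ≫ f) trivial, s.map trivial trivial k h2,
          s.map trivial trivial k' h2', s.π_map _ _ _ _, s.π_map _ _ _ _, ?_, ?_⟩
        · rw [← s.map_comp trivial trivial trivial g rfl k h2,
            ← s.map_comp trivial trivial trivial g' rfl k' h2']
          congr 1
        · rw [reassoc_of% ha hg hT k h2, reassoc_of% ha hg' hT k' h2',
            ← t.map_comp trivial trivial trivial g rfl k h2,
            ← t.map_comp trivial trivial trivial g' rfl k' h2']
          congr 2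
      · intro W g hg
        exact ⟨⟨⟨W, g⟩, hg⟩, 𝟙 _, by simp [s.π_map]⟩
    choose b hb using key
    refine ⟨⟨fun {V} f _ => b V f, fun {V W f k} _ _ g h => ?_⟩, sec_hom_ext fun {V} f hf => ?_⟩
    · refine hP.hom_ext _ _ ?_ (R.pullback k) (J.pullback_stable k hR) fun {T} l hl => ?_
      · rw [P.π_comp, P.π_comp, s.π_map, t.π_map]; simp
      · refine ⟨_, s.map trivial trivial l rfl, s.π_map _ _ _ _, ?_⟩
        have e : (l ≫ g) ≫ f = l ≫ k := by rw [Category.assoc, h]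
        rw [← Category.assoc, ← s.map_comp trivial trivial trivial g h l rfl,
          hb V f (l ≫ g) (l ≫ k) e hl, t.map_comp trivial trivial trivial g h l rfl,
          ← Category.assoc]
        exact (congrArg (· ≫ t.map trivial trivial g h) (hb W k l _ rfl hl).symm).trans
          (Category.assoc _ _ _)
    · have h1 := hb V f (𝟙 V) f (Category.id_comp f) hf
      rw [s.map_id, t.map_id, Category.id_comp, Category.comp_id] at h1
      exact h1
  · intro s
    obtain ⟨b, l, hl, hl'⟩ := hP' R hR s
    have hk' {V : C} (f : V ⟶ U) (hf : R f) : P.π (pullHom f b) = P.π (l f hf) :=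
      (π_pullHom f b).trans (hl f hf).symm
    have key {V W : C} {f : V ⟶ U} {k : W ⟶ U} (hf : R f) (hk : R k) (g : W ⟶ V) (h : g ≫ f = k) :
        fac (pullHom k b) (pullHom f b) g (by simp [h]) ≫
          (facF (pullHom f b) (l f hf) (hk' f hf)).1 =
            (facF (pullHom k b) (l k hk) (hk' k hk)).1 ≫ s.map hf hk g h :=
      FibGpd.hom_ext (l f hf) (by simp [s.π_map]) (by simp [hl'])
    let e : (P.restrict R).obj (secOf b ⊤) ⟶ s :=
      { app := fun {V} f hf => facF (pullHom f b) (l f hf) (hk' f hf)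
        naturality := fun hf hk g h => key hf hk g h }
    exact ⟨secOf b ⊤, ⟨asIso e⟩⟩

end FibGpd
end PicardStacks

namespace PicardStacks

open FibGpd PicardFib

section Basic

variable {C : Type u} [Category.{v} C]

namespace PicardFib

variable (P : PicardFib.{w} C)

theorem addMap_addMap {U V W : C} {x x' : P.Obj U} {y y' : P.Obj V} {z z' : P.Obj W}
    (φ : P.Hom x y) (φ' : P.Hom y z) (ψ : P.Hom x' y') (ψ' : P.Hom y' z')
    (h : P.π φ = P.π ψ) (h' : P.π φ' = P.π ψ') :
    P.addMap φ ψ h ≫ P.addMap φ' ψ' h' =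
      P.addMap (φ ≫ φ') (ψ ≫ ψ') (by rw [P.π_comp, P.π_comp, h, h']) :=
  (P.addMap_comp _ _ _ _ _ _).symm

theorem addMap_addMap_assoc {U V W : C} {x x' : P.Obj U} {y y' : P.Obj V} {z z' : P.Obj W}
    (φ : P.Hom x y) (φ' : P.Hom y z) (ψ : P.Hom x' y') (ψ' : P.Hom y' z')
    (h : P.π φ = P.π ψ) (h' : P.π φ' = P.π ψ') {Z : Tot P.Obj} (k : Tot.mk (P.add z z') ⟶ Z) :
    P.addMap φ ψ h ≫ P.addMap φ' ψ' h' ≫ k =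
      P.addMap (φ ≫ φ') (ψ ≫ ψ') (by rw [P.π_comp, P.π_comp, h, h']) ≫ k := by
  rw [← Category.assoc, addMap_addMap]

end PicardFib

namespace AddFunctor

variable {P Q R : PicardFib.{w} C}

theorem sum_natural_assoc (F : AddFunctor P Q) {U V : C} {x x' : P.Obj U} {y y' : P.Obj V}
    (φ : P.Hom x y) (ψ : P.Hom x' y') (h : P.π φ = P.π ψ) {Z : Tot Q.Obj}
    (k : Tot.mk (Q.add (F.obj y) (F.obj y')) ⟶ Z) :
    F.map (P.addMap φ ψ h) ≫ (F.sum y y').1 ≫ k =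
      (F.sum x x').1 ≫ Q.addMap (F.map φ) (F.map ψ) (by rw [π_map, π_map, h]) ≫ k := by
  rw [← Category.assoc, F.sum_natural, Category.assoc]

/-- The identity of an additive functor. -/
def Hom.refl (F : AddFunctor P Q) : Hom F F where
  app x := ⟨𝟙 _, Q.π_id _⟩
  naturality φ := (Category.comp_id _).trans (Category.id_comp _).symm
  app_add x y := by simp

/-- The inverse of a morphism of additive functors. -/
noncomputable def Hom.symm {F G : AddFunctor P Q} (a : Hom F G) : Hom G F where
  app x := finv (a.app x)
  naturality {U V x y} φ := by
    rw [← cancel_mono (a.app y).1, ← cancel_epi (a.app x).1]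
    simp [a.naturality]
  app_add {U} x y := by
    have e : Q.addMap (finv (a.app x)).1 (finv (a.app y)).1 (by simp) ≫
        Q.addMap (a.app x).1 (a.app y).1 (by simp) = 𝟙 _ := by
      rw [Q.addMap_addMap]
      exact (Q.addMap_congr _ (finv_fhom _) (finv_fhom _)).trans (Q.addMap_id _ _)
    have := isIso_val (Q.addF (a.app x) (a.app y))
    rw [← cancel_mono (Q.addF (a.app x) (a.app y)).1, ← cancel_epi (a.app (P.add x y)).1]
    simp only [addF, Category.assoc]
    rw [e, Category.comp_id, fhom_finv_assoc, ← a.app_add]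

end AddFunctor

end Basic

section Descent

variable {C : Type u} [Category.{v} C] {J : GrothendieckTopology C} {Y T S : PicardFib.{w} C}

/-- Every object of the target is locally isomorphic to an object in the image. -/
def AddFunctor.LocEssSurj (J : GrothendieckTopology C) (L : AddFunctor Y T) : Prop :=
  ∀ {U : C} (t : T.Obj U), ∃ R ∈ J U, ∀ {V : C} (f : V ⟶ U), R f →
    ∃ (y : Y.Obj V) (a : T.Hom (L.obj y) t), T.π a = f

/-- An additive extension of `B` to the morphisms of `T` between objects in the image of `L`. -/
structure ImageExt (L : AddFunctor Y T) (B : AddFunctor Y S) where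
  map : ∀ {U V : C} {y : Y.Obj U} {y' : Y.Obj V}, T.Hom (L.obj y) (L.obj y') →
    S.Hom (B.obj y) (B.obj y')
  π_map : ∀ {U V : C} {y : Y.Obj U} {y' : Y.Obj V} (γ : T.Hom (L.obj y) (L.obj y')),
    S.π (map γ) = T.π γ
  map_map : ∀ {U V : C} {y : Y.Obj U} {y' : Y.Obj V} (φ : Y.Hom y y'), map (L.map φ) = B.map φ
  map_comp : ∀ {U V W : C} {y : Y.Obj U} {y' : Y.Obj V} {y'' : Y.Obj W}
    (γ : T.Hom (L.obj y) (L.obj y')) (γ' : T.Hom (L.obj y') (L.obj y'')),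
    map (γ ≫ γ') = map γ ≫ map γ'
  map_add : ∀ {U V : C} {y₁ y₂ : Y.Obj U} {z₁ z₂ : Y.Obj V} (γ₁ : T.Hom (L.obj y₁) (L.obj z₁))
    (γ₂ : T.Hom (L.obj y₂) (L.obj z₂)) (h : T.π γ₁ = T.π γ₂)
    (γ : T.Hom (L.obj (Y.add y₁ y₂)) (L.obj (Y.add z₁ z₂))),
    γ ≫ (L.sum z₁ z₂).1 = (L.sum y₁ y₂).1 ≫ T.addMap γ₁ γ₂ h →
      map γ ≫ (B.sum z₁ z₂).1 = (B.sum y₁ y₂).1 ≫ S.addMap (map γ₁) (map γ₂) (by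
        rw [π_map, π_map, h])

namespace ImageExt

variable {L : AddFunctor Y T} {B : AddFunctor Y S} (E : ImageExt L B)

theorem exists_cocone (hL : L.LocEssSurj J) (hS : S.HasGluing J) {U : C} (t : T.Obj U) :
    ∃ (b : S.Obj U) (l : ∀ (V : C) (y : Y.Obj V), T.Hom (L.obj y) t → S.Hom (B.obj y) b),
      (∀ (V : C) (y : Y.Obj V) (a : T.Hom (L.obj y) t), S.π (l V y a) = T.π a) ∧
      ∀ (V W : C) (y : Y.Obj V) (z : Y.Obj W) (γ : T.Hom (L.obj y) (L.obj z))
        (a : T.Hom (L.obj z) t), l V y (γ ≫ a) = E.map γ ≫ l W z a := by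
  let R : Sieve U :=
    { arrows := fun V f => ∃ (y : Y.Obj V) (a : T.Hom (L.obj y) t), T.π a = f
      downward_closed := by
        rintro V W _ ⟨y, a, rfl⟩ g
        exact ⟨Y.pull g y, L.map (pullHom g y) ≫ a, by simp⟩ }
  have hR : R ∈ J U := by
    obtain ⟨R', hR', h⟩ := hL t
    exact J.superset_covering (fun V f hf => h f hf) hR'
  have hR' : ∀ (V : C) (f : V ⟶ U), R f → ∃ (y : Y.Obj V) (a : T.Hom (L.obj y) t), T.π a = f :=
    fun V f h => h
  choose y a ha using hR'
  let s : S.Sec R :=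
    { obj := fun {V} f hf => B.obj (y V f hf)
      map := fun {V W f k} hf hk g h => E.map (fac (a W k hk) (a V f hf) g (by rw [ha, ha, h]))
      π_map := fun hf hk g h => by rw [E.π_map, π_fac]
      map_id := fun {V f} hf => by
        rw [← B.map_id, ← E.map_map, L.map_id]
        exact congrArg _ (FibGpd.hom_ext (a V f hf) (by simp) (by simp))
      map_comp := fun {V W Z f k l} hf hk hl g h g' h' => by
        rw [← E.map_comp]
        exact congrArg _ (FibGpd.hom_ext (a V f hf) (by simp) (by simp)) }
  obtain ⟨b, l, hl, hl'⟩ := hS R hR s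
  have hRm {V : C} {y' : Y.Obj V} (c : T.Hom (L.obj y') t) : R (T.π c) := ⟨y', c, rfl⟩
  have hl2 {V W : C} {f : V ⟶ U} {k : W ⟶ U} (hf : R f) (hk : R k) (g : W ⟶ V) (h : g ≫ f = k) :
    E.map (fac (a W k hk) (a V f hf) g (by rw [ha, ha, h])) ≫ l f hf = l k hk := hl' hf hk g h
  refine ⟨b, fun V y' c => E.map (facF c (a V (T.π c) (hRm c)) (ha _ _ _).symm).1 ≫
    l (T.π c) (hRm c), fun V y' c => ?_, fun V W y' z γ c => ?_⟩
  · refine (S.π_comp _ _).trans ?_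
    rw [E.π_map, hl]
    simp
  · dsimp only
    rw [← hl2 (f := T.π c) (k := T.π (γ ≫ c)) (hRm c) (hRm _) (T.π γ) (T.π_comp _ _).symm,
      ← Category.assoc, ← Category.assoc, ← E.map_comp, ← E.map_comp]
    congr 2
    exact FibGpd.hom_ext (a W (T.π c) (hRm c)) (by simp) (by simp)

/-- Universal property of stacks: an additive functor, defined on the objects of `Y` and the
morphisms of `T` between their images, extends to `T`. -/
theorem exists_extension (hL : L.LocEssSurj J) (hS : S.IsPrestack J) (hS' : S.HasGluing J) :
    ∃ (B' : AddFunctor T S) (η : AddFunctor.Hom (B'.comp L) B),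
      ∀ {U V : C} {y : Y.Obj U} {y' : Y.Obj V} (γ : T.Hom (L.obj y) (L.obj y')),
        B'.map γ ≫ (η.app y').1 = (η.app y).1 ≫ E.map γ := by
  have hex := fun (U : C) (t : T.Obj U) => E.exists_cocone hL hS' t
  choose b l hl hl' using hex
  have hcov : ∀ {U : C} (t : T.Obj U), ∃ R ∈ J U, ∀ {V : C} (f : V ⟶ U), R f →
      ∃ (y : Y.Obj V) (a : T.Hom (L.obj y) t), T.π a = f := hL
  have ext : ∀ {U V : C} (t : T.Obj U) (z : S.Obj V) (β β' : S.Hom (b U t) z), S.π β = S.π β' →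
      (∀ {W : C} (y : Y.Obj W) (a : T.Hom (L.obj y) t), l U t W y a ≫ β = l U t W y a ≫ β') →
        β = β' := by
    intro U V t z β β' h h'
    obtain ⟨R, hR, h2⟩ := hL t
    refine hS.hom_ext _ _ h R hR fun {W} f hf => ?_
    obtain ⟨y, a, ha⟩ := h2 f hf
    exact ⟨_, l U t W y a, by simp [ha, hl], h' y a⟩
  have ext₂ : ∀ {U V : C} (t t' : T.Obj U) (z : S.Obj V) (β β' : S.Hom (b U (T.add t t')) z),
      S.π β = S.π β' →
      (∀ {W : C} (y y' : Y.Obj W) (a : T.Hom (L.obj y) t) (a' : T.Hom (L.obj y') t')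
        (h : T.π a = T.π a'), l U (T.add t t') W (Y.add y y') ((L.sum y y').1 ≫ T.addMap a a' h) ≫ β =
          l U (T.add t t') W (Y.add y y') ((L.sum y y').1 ≫ T.addMap a a' h) ≫ β') → β = β' := by
    intro U V t t' z β β' h h'
    obtain ⟨R, hR, h2⟩ := hL t
    obtain ⟨R', hR', h2'⟩ := hL t'
    refine hS.hom_ext _ _ h (R ⊓ R') (J.intersection_covering hR hR') fun {W} f hf => ?_
    obtain ⟨y, a, ha⟩ := h2 f hf.1
    obtain ⟨y', a', ha'⟩ := h2' f hf.2
    exact ⟨_, _, by simp [hl, ha], h' y y' a a' (ha.trans ha'.symm)⟩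
  have map_ex : ∀ (U V : C) (t : T.Obj U) (t' : T.Obj V) (φ : T.Hom t t'),
      ∃ β : S.Hom (b U t) (b V t'), S.π β = T.π φ ∧ ∀ {W : C} (y : Y.Obj W) (a : T.Hom (L.obj y) t),
        l U t W y a ≫ β = l V t' W y (a ≫ φ) := by
    intro U V t t' φ
    suffices h : ∃ β : S.Hom (b U t) (b V t'), S.π β = T.π φ ∧
        ∀ i : Σ (W : C) (y : Y.Obj W), T.Hom (L.obj y) t,
          l U t i.1 i.2.1 i.2.2 ≫ β = l V t' i.1 i.2.1 (i.2.2 ≫ φ) by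
      obtain ⟨β, h1, h2⟩ := h
      exact ⟨β, h1, fun y a => h2 ⟨_, y, a⟩⟩
    obtain ⟨R, hR, h⟩ := hL t
    refine hS.glue_pieces (T.π φ) (V := fun i : Σ (V : C) (y : Y.Obj V), T.Hom (L.obj y) t => i.1)
      (z := fun i => B.obj i.2.1) (fun i => l U t i.1 i.2.1 i.2.2)
      (fun i => l V t' i.1 i.2.1 (i.2.2 ≫ φ)) (fun i => by rw [hl, hl, π_comp]) ?_ R hR ?_
    · rintro ⟨W, y, a⟩ ⟨W', y', a'⟩ Z k k' hk
      simp only [hl] at hk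
      have e : E.map (L.map (pullHom k y)) ≫ l U t W y a =
          E.map (fac (L.map (pullHom k y) ≫ a) a' k' (by simp [hk])) ≫ l U t W' y' a' := by
        rw [← hl', ← hl', fac_comp]
      have e' : E.map (L.map (pullHom k y)) ≫ l V t' W y (a ≫ φ) =
          E.map (fac (L.map (pullHom k y) ≫ a) a' k' (by simp [hk])) ≫
            l V t' W' y' (a' ≫ φ) := by
        rw [← hl', ← hl', fac_comp_assoc, Category.assoc]
      exact ⟨B.obj (Y.pull k y), _, _, by simp [E.π_map], by simp [E.π_map], e, e'⟩
    · intro W f hf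
      obtain ⟨y, a, ha⟩ := h f hf
      exact ⟨⟨W, y, a⟩, 𝟙 _, by simp [ha, hl]⟩
  choose m hm hm' using map_ex
  have sum_ex : ∀ (U : C) (t t' : T.Obj U),
      ∃ β : S.FHom (b U (T.add t t')) (S.add (b U t) (b U t')),
      ∀ {W : C} (y y' : Y.Obj W) (a : T.Hom (L.obj y) t) (a' : T.Hom (L.obj y') t')
        (h : T.π a = T.π a'),
        l U (T.add t t') W (Y.add y y') ((L.sum y y').1 ≫ T.addMap a a' h) ≫ β.1 =
          (B.sum y y').1 ≫ S.addMap (l U t W y a) (l U t' W y' a') (by rw [hl, hl, h]) := by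
    intro U t t'
    let ι := Σ (W : C), {x : (Σ (y : Y.Obj W), T.Hom (L.obj y) t) × Σ (y : Y.Obj W),
      T.Hom (L.obj y) t' // T.π x.1.2 = T.π x.2.2}
    suffices h : ∃ β : S.Hom (b U (T.add t t')) (S.add (b U t) (b U t')), S.π β = 𝟙 U ∧
        ∀ i : ι, l U (T.add t t') i.1 (Y.add i.2.1.1.1 i.2.1.2.1)
          ((L.sum i.2.1.1.1 i.2.1.2.1).1 ≫ T.addMap i.2.1.1.2 i.2.1.2.2 i.2.2) ≫ β =
            (B.sum i.2.1.1.1 i.2.1.2.1).1 ≫ S.addMap (l U t i.1 i.2.1.1.1 i.2.1.1.2)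
              (l U t' i.1 i.2.1.2.1 i.2.1.2.2) (by rw [hl, hl, i.2.2]) by
      obtain ⟨β, h1, h2⟩ := h
      exact ⟨⟨β, h1⟩, fun y y' a a' h => h2 ⟨_, ⟨⟨⟨y, a⟩, ⟨y', a'⟩⟩, h⟩⟩⟩
    obtain ⟨R, hR, h⟩ := hL t
    obtain ⟨R', hR', h'⟩ := hL t'
    refine hS.glue_pieces (𝟙 U) (V := fun i : ι => i.1)
      (z := fun i => B.obj (Y.add i.2.1.1.1 i.2.1.2.1))
      (fun i => l U (T.add t t') i.1 (Y.add i.2.1.1.1 i.2.1.2.1)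
        ((L.sum i.2.1.1.1 i.2.1.2.1).1 ≫ T.addMap i.2.1.1.2 i.2.1.2.2 i.2.2))
      (fun i => (B.sum i.2.1.1.1 i.2.1.2.1).1 ≫ S.addMap (l U t i.1 i.2.1.1.1 i.2.1.1.2)
              (l U t' i.1 i.2.1.2.1 i.2.1.2.2) (by rw [hl, hl, i.2.2]))
      (fun i => by simp [hl]) ?_ (R ⊓ R') (J.intersection_covering hR hR') ?_
    · rintro ⟨W, ⟨⟨⟨y₁, a₁⟩, ⟨y₂, a₂⟩⟩, ha⟩⟩ ⟨W', ⟨⟨⟨z₁, c₁⟩, ⟨z₂, c₂⟩⟩, hc⟩⟩ Z k k' hk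
      simp only [hl, π_comp, π_val, PicardFib.π_addMap, Category.id_comp] at hk
      simp only at k k' ha hc
      have ha' : T.π (L.map (pullHom k y₁)) = T.π (L.map (pullHom k y₂)) := by simp
      let g₁ : T.Hom (L.obj (Y.pull k y₁)) (L.obj z₁) :=
        fac (L.map (pullHom k y₁) ≫ a₁) c₁ k' (by simp [hk])
      let g₂ : T.Hom (L.obj (Y.pull k y₂)) (L.obj z₂) :=
        fac (L.map (pullHom k y₂) ≫ a₂) c₂ k' (by simp [← ha, ← hc, hk])
      have hg : T.π g₁ = T.π g₂ := by simp [g₁, g₂]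
      let γ : T.Hom (L.obj (Y.add (Y.pull k y₁) (Y.pull k y₂))) (L.obj (Y.add z₁ z₂)) :=
        (L.sum _ _).1 ≫ T.addMap g₁ g₂ hg ≫ (finv (L.sum z₁ z₂)).1
      have hγ : γ ≫ (L.sum z₁ z₂).1 = (L.sum _ _).1 ≫ T.addMap g₁ g₂ hg := by simp [γ]
      have hp : Y.π (pullHom k y₁) = Y.π (pullHom k y₂) := by simp
      have e : E.map (L.map (Y.addMap (pullHom k y₁) (pullHom k y₂) hp)) ≫
          l U (T.add t t') W (Y.add y₁ y₂) ((L.sum y₁ y₂).1 ≫ T.addMap a₁ a₂ ha) =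
          E.map γ ≫ l U (T.add t t') W' (Y.add z₁ z₂) ((L.sum z₁ z₂).1 ≫ T.addMap c₁ c₂ hc) := by
        rw [← hl', ← hl', L.sum_natural_assoc, reassoc_of% hγ, T.addMap_addMap, T.addMap_addMap]
        congr 2
        exact T.addMap_congr _ (by simp [g₁]) (by simp [g₂])
      have e₁ : B.map (pullHom k y₁) ≫ l U t W y₁ a₁ = E.map g₁ ≫ l U t W' z₁ c₁ := by
        rw [← E.map_map, ← hl', ← hl']; simp [g₁]
      have e₂ : B.map (pullHom k y₂) ≫ l U t' W y₂ a₂ = E.map g₂ ≫ l U t' W' z₂ c₂ := by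
        rw [← E.map_map, ← hl', ← hl']; simp [g₂]
      have e' : E.map (L.map (Y.addMap (pullHom k y₁) (pullHom k y₂) hp)) ≫
          (B.sum y₁ y₂).1 ≫ S.addMap (l U t W y₁ a₁) (l U t' W y₂ a₂) (by rw [hl, hl, ha]) =
          E.map γ ≫ (B.sum z₁ z₂).1 ≫
            S.addMap (l U t W' z₁ c₁) (l U t' W' z₂ c₂) (by rw [hl, hl, hc]) := by
        rw [E.map_map, B.sum_natural_assoc, reassoc_of% E.map_add g₁ g₂ hg γ hγ, S.addMap_addMap,
          S.addMap_addMap]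
        congr 1
        exact S.addMap_congr _ e₁ e₂
      exact ⟨B.obj (Y.add (Y.pull k y₁) (Y.pull k y₂)), _, _, by simp [E.π_map],
        by simp [E.π_map, γ, g₁], e, e'⟩
    · intro W f hf
      obtain ⟨y, a, ha⟩ := h f hf.1
      obtain ⟨y', a', ha'⟩ := h' f hf.2
      exact ⟨⟨W, ⟨⟨⟨y, a⟩, ⟨y', a'⟩⟩, ha.trans ha'.symm⟩⟩, 𝟙 _, by simp [ha, hl]⟩
  choose s hs using sum_ex
  let B' : AddFunctor T S :=
    { obj := fun {U} t => b U t
      map := fun {U V t t'} φ => m U V t t' φ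
      π_map := fun φ => hm _ _ _ _ φ
      map_id := fun {U} t => ext _ _ _ _ (by simp [hm]) fun y a => by rw [hm']; simp
      map_comp := fun φ ψ => ext _ _ _ _ (by simp [hm]) fun y a => by
        rw [hm', ← Category.assoc (l _ _ _ _ _), hm', hm', Category.assoc]
      sum := fun {U} t t' => s U t t'
      sum_natural := fun {U V x x' y y'} φ ψ h => ext₂ _ _ _ _ _ (by simp [hm])
        fun z z' a a' h' => by
          rw [← Category.assoc, hm', Category.assoc, T.addMap_addMap, hs, ← Category.assoc, hs,
            Category.assoc, S.addMap_addMap]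
          congr 1
          exact S.addMap_congr _ (hm' _ _ _ _ _ _ _).symm (hm' _ _ _ _ _ _ _).symm
      map_σ := fun {U} x y z => by
        obtain ⟨R₁, hR₁, h₁⟩ := hL x
        obtain ⟨R₂, hR₂, h₂⟩ := hL y
        obtain ⟨R₃, hR₃, h₃⟩ := hL z
        refine hS.hom_ext _ _ (by simp [hm]) (R₁ ⊓ R₂ ⊓ R₃) (J.intersection_covering
          (J.intersection_covering hR₁ hR₂) hR₃) fun {W} f hf => ?_
        obtain ⟨y₁, a₁, ha₁⟩ := h₁ f hf.1.1
        obtain ⟨y₂, a₂, ha₂⟩ := h₂ f hf.1.2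
        obtain ⟨y₃, a₃, ha₃⟩ := h₃ f hf.2
        have h12 : T.π a₁ = T.π a₂ := ha₁.trans ha₂.symm
        have h23 : T.π a₂ = T.π a₃ := ha₂.trans ha₃.symm
        refine ⟨_, l U _ W _ ((L.sum (Y.add y₁ y₂) y₃).1 ≫ T.addMap ((L.sum y₁ y₂).1 ≫
          T.addMap a₁ a₂ h12) a₃ (by simp [h12, h23])), by simp [hl, ha₁], ?_⟩
        have e0 : ((L.sum (Y.add y₁ y₂) y₃).1 ≫ T.addMap ((L.sum y₁ y₂).1 ≫
            T.addMap a₁ a₂ h12) a₃ (by simp [h12, h23])) ≫ (T.σ x y z).1 =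
            L.map (Y.σ y₁ y₂ y₃).1 ≫ (L.sum y₁ (Y.add y₂ y₃)).1 ≫ T.addMap a₁
              ((L.sum y₂ y₃).1 ≫ T.addMap a₂ a₃ h23) (by simp [h12]) := by
          have e1 : T.addMap ((L.sum y₁ y₂).1 ≫ T.addMap a₁ a₂ h12) a₃ (by simp [h12, h23]) =
              T.addMap (L.sum y₁ y₂).1 (𝟙 _) (by simp) ≫
                T.addMap (T.addMap a₁ a₂ h12) a₃ (by simp [h12, h23]) := by
            rw [T.addMap_addMap]; exact T.addMap_congr _ rfl (Category.id_comp _).symm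
          have e2 : T.addMap a₁ ((L.sum y₂ y₃).1 ≫ T.addMap a₂ a₃ h23) (by simp [h12]) =
              T.addMap (𝟙 _) (L.sum y₂ y₃).1 (by simp) ≫
                T.addMap a₁ (T.addMap a₂ a₃ h23) (by simp [h12]) := by
            rw [T.addMap_addMap]; exact T.addMap_congr _ (Category.id_comp _).symm rfl
          rw [e1, e2, Category.assoc, Category.assoc, T.σ_natural a₁ a₂ a₃ h12 h23]
          have := L.map_σ y₁ y₂ y₃
          rw [← Category.assoc (L.sum y₁ (Y.add y₂ y₃)).1, ← Category.assoc (L.map _), this]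
          simp only [Category.assoc]
        have e3 : S.addMap (l U x W y₁ a₁) (l U (T.add y z) W (Y.add y₂ y₃)
            ((L.sum y₂ y₃).1 ≫ T.addMap a₂ a₃ h23)) (by simp [hl, h12]) ≫
              S.addMap (𝟙 _) (s U y z).1 (by simp) = S.addMap (𝟙 _) (B.sum y₂ y₃).1 (by simp) ≫
                S.addMap (l U x W y₁ a₁) (S.addMap (l U y W y₂ a₂) (l U z W y₃ a₃)
                  (by simp [hl, h23])) (by simp [hl, h12]) := by
          rw [S.addMap_addMap, S.addMap_addMap]
          exact S.addMap_congr _ ((Category.comp_id _).trans (Category.id_comp _).symm)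
            (hs _ _ _ _ _ _ _ h23)
        have e4 : S.addMap (l U (T.add x y) W (Y.add y₁ y₂) ((L.sum y₁ y₂).1 ≫
            T.addMap a₁ a₂ h12)) (l U z W y₃ a₃) (by simp [hl, h12, h23]) ≫
              S.addMap (s U x y).1 (𝟙 _) (by simp) = S.addMap (B.sum y₁ y₂).1 (𝟙 _) (by simp) ≫
                S.addMap (S.addMap (l U x W y₁ a₁) (l U y W y₂ a₂) (by simp [hl, h12]))
                  (l U z W y₃ a₃) (by simp [hl, h12, h23]) := by
          rw [S.addMap_addMap, S.addMap_addMap]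
          exact S.addMap_congr _ (hs _ _ _ _ _ _ _ h12)
            ((Category.comp_id _).trans (Category.id_comp _).symm)
        rw [← Category.assoc (l _ _ _ _ _), hm', e0, hl', E.map_map, Category.assoc,
          ← Category.assoc (l _ _ _ _ _), hs, Category.assoc, e3, ← Category.assoc (l _ _ _ _ _),
          hs, Category.assoc, ← Category.assoc (S.addMap _ _ _), e4, Category.assoc, S.σ_natural]
        · have := B.map_σ y₁ y₂ y₃
          rw [← Category.assoc (B.sum y₁ (Y.add y₂ y₃)).1, ← Category.assoc (B.map _), this]
          simp only [Category.assoc]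
        all_goals simp [hl, h23]
      map_τ := fun {U} x y => ext₂ _ _ _ _ _ (by simp [hm]) fun z z' a a' h => by
        have e0 : ((L.sum z z').1 ≫ T.addMap a a' h) ≫ (T.τ x y).1 =
            L.map (Y.τ z z').1 ≫ (L.sum z' z).1 ≫ T.addMap a' a h.symm := by
          rw [Category.assoc, T.τ_natural, ← Category.assoc, ← L.map_τ, Category.assoc]
        rw [← Category.assoc (l _ _ _ _ _), hm', e0, hl', E.map_map, Category.assoc, hs,
          ← Category.assoc (l _ _ _ _ _), hs, Category.assoc, S.τ_natural,
          ← Category.assoc (B.map _), B.map_τ, Category.assoc] }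
  let η : AddFunctor.Hom B (B'.comp L) :=
    { app := fun {U} y => ⟨l U (L.obj y) U y (𝟙 _), (hl _ _ _ _ _).trans (T.π_id _)⟩
      naturality := fun {U V x y} φ => by
        change B.map φ ≫ l V (L.obj y) V y (𝟙 _) = l U (L.obj x) U x (𝟙 _) ≫ m _ _ _ _ (L.map φ)
        rw [hm', ← E.map_map, ← hl', Category.id_comp, Category.comp_id]
      app_add := fun {U} x y => by
        change l U (L.obj (Y.add x y)) U (Y.add x y) (𝟙 _) ≫ m _ _ _ _ (L.sum x y).1 ≫
          (s U (L.obj x) (L.obj y)).1 = (B.sum x y).1 ≫ S.addMap (l U (L.obj x) U x (𝟙 _))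
            (l U (L.obj y) U y (𝟙 _)) (by simp [hl])
        rw [← Category.assoc (l _ _ _ _ _), hm', ← hs _ _ _ _ _ _ _ (by simp)]
        congr 2
        simp }
  have hη : ∀ {U V : C} {y : Y.Obj U} {y' : Y.Obj V} (γ : T.Hom (L.obj y) (L.obj y')),
      E.map γ ≫ (η.app y').1 = (η.app y).1 ≫ B'.map γ := by
    intro U V y y' γ
    change E.map γ ≫ l V (L.obj y') V y' (𝟙 _) = l U (L.obj y) U y (𝟙 _) ≫ m _ _ _ _ γ
    rw [hm', ← hl', Category.id_comp, Category.comp_id]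
  refine ⟨B', η.symm, fun {U V y y'} γ => ?_⟩
  have e := hη γ
  let a : S.FHom (B.obj y) (B'.obj (L.obj y)) := η.app y
  let a' : S.FHom (B.obj y') (B'.obj (L.obj y')) := η.app y'
  change B'.map γ ≫ (finv a').1 = (finv a).1 ≫ E.map γ
  have e' : E.map γ ≫ a'.1 = a.1 ≫ B'.map γ := e
  have := isIso_val a
  have := isIso_val a'
  rw [← cancel_epi a.1, ← cancel_mono a'.1]
  simp [e']

end ImageExt

/-- A morphism over the identity with a prescribed restriction exists if it exists locally. -/
theorem AddFunctor.exists_hom_of_locEssSurj {L : AddFunctor Y T} (hL : L.LocEssSurj J)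
    (hS : S.IsPrestack J) {B₁ B₂ : AddFunctor T S}
    (η : ∀ {U : C} (y : Y.Obj U), S.FHom (B₁.obj (L.obj y)) (B₂.obj (L.obj y)))
    (hη : ∀ {U V : C} {y : Y.Obj U} {y' : Y.Obj V} (γ : T.Hom (L.obj y) (L.obj y')),
      B₁.map γ ≫ (η y').1 = (η y).1 ≫ B₂.map γ)
    (hadd : ∀ {U : C} (y y' : Y.Obj U),
      (η (Y.add y y')).1 ≫ B₂.map (L.sum y y').1 ≫ (B₂.sum (L.obj y) (L.obj y')).1 =
        (B₁.map (L.sum y y').1 ≫ (B₁.sum (L.obj y) (L.obj y')).1) ≫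
          S.addMap (η y).1 (η y').1 (by simp)) :
    ∃ η' : Hom B₁ B₂, ∀ {U : C} (y : Y.Obj U), (η'.app (L.obj y)).1 = (η y).1 := by
  have key : ∀ (U : C) (t : T.Obj U), ∃ β : S.FHom (B₁.obj t) (B₂.obj t),
      ∀ {V : C} (y : Y.Obj V) (a : T.Hom (L.obj y) t),
        B₁.map a ≫ β.1 = (η y).1 ≫ B₂.map a := by
    intro U t
    suffices h : ∃ β : S.Hom (B₁.obj t) (B₂.obj t), S.π β = 𝟙 U ∧
        ∀ i : Σ (V : C) (y : Y.Obj V), T.Hom (L.obj y) t,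
          B₁.map i.2.2 ≫ β = (η i.2.1).1 ≫ B₂.map i.2.2 by
      obtain ⟨β, h1, h2⟩ := h
      exact ⟨⟨β, h1⟩, fun y a => h2 ⟨_, y, a⟩⟩
    obtain ⟨R, hR, h⟩ := hL t
    refine hS.glue_pieces (𝟙 U) (V := fun i : Σ (V : C) (y : Y.Obj V), T.Hom (L.obj y) t => i.1)
      (z := fun i => B₁.obj (L.obj i.2.1)) (fun i => B₁.map i.2.2)
      (fun i => (η i.2.1).1 ≫ B₂.map i.2.2) (fun i => ?_) ?_ R hR ?_
    · simp only [π_comp, π_map, π_val, Category.id_comp, Category.comp_id]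
    · rintro ⟨V, y, a⟩ ⟨V', y', a'⟩ W k k' hk
      simp only [π_map] at hk
      refine ⟨B₁.obj (L.obj (Y.pull k y)), B₁.map (L.map (pullHom k y)),
        B₁.map (fac (L.map (pullHom k y) ≫ a) a' k' (by simp [hk])), by simp, by simp, ?_, ?_⟩
      · rw [← B₁.map_comp, ← B₁.map_comp, fac_comp]
      · dsimp only
        rw [← Category.assoc, ← Category.assoc, hη, hη, Category.assoc, Category.assoc,
          ← B₂.map_comp, ← B₂.map_comp, fac_comp]
    · intro W f hf
      obtain ⟨y, a, ha⟩ := h f hf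
      exact ⟨⟨W, y, a⟩, 𝟙 _, by simp [ha]⟩
  choose β hβ using key
  have ext : ∀ {U V : C} (t : T.Obj U) (z : S.Obj V) (b b' : S.Hom (B₁.obj t) z), S.π b = S.π b' →
      (∀ {W : C} (y : Y.Obj W) (a : T.Hom (L.obj y) t), B₁.map a ≫ b = B₁.map a ≫ b') → b = b' := by
    intro U V t z b b' h h'
    obtain ⟨R, hR, h2⟩ := hL t
    refine hS.hom_ext _ _ h R hR fun {W} f hf => ?_
    obtain ⟨y, a, ha⟩ := h2 f hf
    exact ⟨_, B₁.map a, by simp [ha], h' y a⟩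
  refine ⟨⟨fun {U} t => β U t, fun {U V t t'} φ => ext _ _ _ _ (by simp) fun y a => ?_,
    fun {U} t t' => ?_⟩, fun {U} y => ?_⟩
  · rw [← Category.assoc, ← B₁.map_comp, hβ, ← Category.assoc, hβ, B₂.map_comp, Category.assoc]
  · obtain ⟨R, hR, h⟩ := hL t
    obtain ⟨R', hR', h'⟩ := hL t'
    refine hS.hom_ext _ _ (by simp) (R ⊓ R') (J.intersection_covering hR hR')
      fun {W} f hf => ?_
    obtain ⟨y, a, ha⟩ := h f hf.1
    obtain ⟨y', a', ha'⟩ := h' f hf.2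
    have haa : T.π a = T.π a' := ha.trans ha'.symm
    refine ⟨_, B₁.map ((L.sum y y').1 ≫ T.addMap a a' haa), by simp [ha], ?_⟩
    have e1 := hadd y y'
    have e2 := hβ _ (T.add t t') _ ((L.sum y y').1 ≫ T.addMap a a' haa)
    rw [reassoc_of% e2]
    simp only [map_comp, Category.assoc, B₂.sum_natural, B₁.sum_natural_assoc]
    rw [reassoc_of% e1]
    congr 2
    rw [S.addMap_addMap, S.addMap_addMap]
    exact S.addMap_congr _ (hβ _ _ _ _).symm (hβ _ _ _ _).symm
  · have := hβ U (L.obj y) y (𝟙 _)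
    rw [B₁.map_id, B₂.map_id, Category.id_comp] at this
    exact this.trans (Category.comp_id _)

end Descent

end PicardStacks

namespace PicardStacks

open FibGpd PicardFib

section PointwiseSum

/-- The isomorphism `x + 0 ≅ x`. -/
def PicardFib.addZero {C : Type u} [Category.{v} C] (P : PicardFib.{w} C) {U : C} (x : P.Obj U) :
    P.FHom (P.add x (P.zero U)) x :=
  ⟨(P.τ x (P.zero U)).1 ≫ (P.zeroAdd x).1, by simp⟩

theorem PicardFib.addZero_natural {C : Type u} [Category.{v} C] (P : PicardFib.{w} C) {U V : C}
    {x : P.Obj U} {y : P.Obj V} (φ : P.Hom x y) (f : U ⟶ V) (h : P.π φ = f) :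
    P.addMap φ (P.zeroMap f) (by simp [h]) ≫ (P.addZero y).1 = (P.addZero x).1 ≫ φ := by
  subst h
  have h := P.zeroAdd_natural φ
  simp only [addZero]
  rw [← Category.assoc, P.τ_natural, Category.assoc, Category.assoc, ← h]

namespace AddFunctor

open MonoidalCategory

variable {C : Type u} [Category.{v} C] {O P Q R X : PicardFib.{w} C}

theorem sumF_tensor (F : AddFunctor P Q) {U : C} {a b c d : P.Obj U} (f : a ⟶ b) (g : c ⟶ d) :
    (F.fiberFunctor U).map (f ⊗ₘ g) ≫ F.sumF b d =
      F.sumF a c ≫ ((F.fiberFunctor U).map f ⊗ₘ (F.fiberFunctor U).map g) := by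
  rw [MonoidalCategory.tensorHom_def, Functor.map_comp, Category.assoc, sumF_right,
    ← Category.assoc, sumF_left, MonoidalCategory.tensorHom_def, Category.assoc]

theorem sumF_braid (F : AddFunctor P Q) {U : C} (x y : P.Obj U) :
    (F.fiberFunctor U).map (β_ x y).hom ≫ F.sumF y x = F.sumF x y ≫ (β_ _ _).hom :=
  fhom_eq (F.map_τ x y)

theorem unitF_right (F : AddFunctor P Q) {U : C} (x : P.Obj U) :
    F.sumF x (𝟙_ _) ≫ (F.fiberFunctor U).obj x ◁ F.unitF U ≫ (ρ_ _).hom =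
      (F.fiberFunctor U).map (ρ_ x).hom := by
  rw [← braiding_leftUnitor x, Functor.map_comp, ← F.unitF_left x,
    ← Category.assoc ((F.fiberFunctor U).map _), F.sumF_braid, Category.assoc, ← BraidedCategory.braiding_naturality_right_assoc,
    braiding_leftUnitor]

/-- The functors on the fibers are lax symmetric monoidal. -/
@[reducible] noncomputable def fiberBraided (F : AddFunctor P Q) (U : C) : (F.fiberFunctor U).LaxBraided where
  ε := inv (F.unitF U)
  μ x y := inv (F.sumF x y)
  μ_natural_left f x := by
    rw [IsIso.eq_inv_comp, ← Category.assoc, IsIso.comp_inv_eq, sumF_left]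
  μ_natural_right x f := by
    rw [IsIso.eq_inv_comp, ← Category.assoc, IsIso.comp_inv_eq, sumF_right]
  associativity x y z := by
    rw [← cancel_mono (F.sumF x (y ⊗ z)), ← cancel_mono ((F.fiberFunctor U).obj x ◁ F.sumF y z)]
    simp only [Category.assoc, IsIso.inv_hom_id, Category.comp_id]
    rw [sumF_assoc, ← whiskerLeft_comp]
    simp
  left_unitality x := by
    rw [← F.unitF_left x]; simp [← comp_whiskerRight_assoc]
  right_unitality x := by
    rw [← F.unitF_right x]; simp [← whiskerLeft_comp_assoc]
  braided x y := by
    rw [IsIso.inv_comp_eq, ← Category.assoc, IsIso.eq_comp_inv, sumF_braid]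

theorem sumF_tensorμ (F : AddFunctor P Q) {U : C} (a b c d : P.Obj U) :
    (F.fiberFunctor U).map (tensorμ a b c d) ≫ F.sumF (a ⊗ c) (b ⊗ d) ≫
        (F.sumF a c ⊗ₘ F.sumF b d) =
      F.sumF (a ⊗ b) (c ⊗ d) ≫ (F.sumF a b ⊗ₘ F.sumF c d) ≫ tensorμ _ _ _ _ := by
  let _ := F.fiberBraided U
  have h := tensorμ_comp_μ_tensorHom_μ_comp_μ (F.fiberFunctor U) a b c d
  change _ ≫ (inv (F.sumF a c) ⊗ₘ inv (F.sumF b d)) ≫ inv (F.sumF (a ⊗ c) (b ⊗ d)) =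
    (inv (F.sumF a b) ⊗ₘ inv (F.sumF c d)) ≫ inv (F.sumF (a ⊗ b) (c ⊗ d)) ≫ _ at h
  rw [← cancel_epi (inv (F.sumF (a ⊗ b) (c ⊗ d))),
    ← cancel_epi (inv (F.sumF a b) ⊗ₘ inv (F.sumF c d)), ← reassoc_of% h]
  simp

/-- The pointwise sum of two additive functors. -/
noncomputable def padd (F G : AddFunctor O P) : AddFunctor O P := (addition P).comp (pair F G)

theorem compPadd_aux (F : AddFunctor P Q) {U : C} {p p' a b c d : P.Obj U} (s : p ⟶ a ⊗ b)
    (s' : p' ⟶ c ⊗ d) :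
    F.sumF p p' ≫ (((F.fiberFunctor U).map s ≫ F.sumF a b) ⊗ₘ
        ((F.fiberFunctor U).map s' ≫ F.sumF c d)) ≫ tensorμ _ _ _ _ =
      ((F.fiberFunctor U).map ((s ⊗ₘ s') ≫ tensorμ a b c d) ≫ F.sumF (a ⊗ c) (b ⊗ d)) ≫
        (F.sumF a c ⊗ₘ F.sumF b d) := by
  rw [Functor.map_comp, Category.assoc, Category.assoc, F.sumF_tensorμ,
    ← Category.assoc ((F.fiberFunctor U).map _), F.sumF_tensor,
    ← tensorHom_comp_tensorHom, Category.assoc, Category.assoc]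

theorem paddCongr_aux {D : Type*} [Category D] [MonoidalCategory D] [SymmetricCategory D]
    {p p' r r' a b c d a' b' c' d' : D} {s : p ⟶ a ⊗ b} {s' : p' ⟶ a' ⊗ b'} {t : r ⟶ c ⊗ d}
    {t' : r' ⟶ c' ⊗ d'} {f : a ⟶ a'} {g : b ⟶ b'} {h : c ⟶ c'} {k : d ⟶ d'} {m : p ⟶ p'}
    {n : r ⟶ r'} (h1 : m ≫ s' = s ≫ (f ⊗ₘ g)) (h2 : n ≫ t' = t ≫ (h ⊗ₘ k)) :
    (m ⊗ₘ n) ≫ (s' ⊗ₘ t') ≫ tensorμ a' b' c' d' =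
      ((s ⊗ₘ t) ≫ tensorμ a b c d) ≫ ((f ⊗ₘ h) ⊗ₘ (g ⊗ₘ k)) := by
  rw [Category.assoc, ← tensorμ_natural, tensorHom_comp_tensorHom_assoc, h1, h2,
    tensorHom_comp_tensorHom_assoc]

theorem paddZero_aux {D : Type*} [Category D] [MonoidalCategory D] [SymmetricCategory D]
    {p a b : D} (s : p ⟶ a ⊗ b) :
    (ρ_ p).hom ≫ s = ((s ⊗ₘ (λ_ (𝟙_ D)).inv) ≫ tensorμ a b (𝟙_ D) (𝟙_ D)) ≫
      ((ρ_ a).hom ⊗ₘ (ρ_ b).hom) := by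
  have h : tensorμ a b (𝟙_ D) (𝟙_ D) ≫ tensorμ a (𝟙_ D) b (𝟙_ D) = 𝟙 _ := by
    have h1 := tensorμ_tensorδ a b (𝟙_ D) (𝟙_ D)
    have h2 : tensorδ a b (𝟙_ D) (𝟙_ D) = tensorμ a (𝟙_ D) b (𝟙_ D) := by
      simp [tensorδ, tensorμ, SymmetricCategory.braiding_swap_eq_inv_braiding b (𝟙_ D)]
    rwa [h2] at h1
  rw [rightUnitor_monoidal, Category.assoc, reassoc_of% h, MonoidalCategory.tensorHom_def]
  simp [← MonoidalCategory.whiskerLeft_comp_assoc]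

/-- Composition with an additive functor distributes over pointwise sums. -/
noncomputable def compPadd (F : AddFunctor P Q) (G G' : AddFunctor O P) :
    Hom (F.comp (G.padd G')) ((F.comp G).padd (F.comp G')) where
  app x := F.sum (G.obj x) (G'.obj x)
  naturality φ := F.sum_natural _ _ _
  app_add {U} x y := by
    exact congrArg FHom.val (F.compPadd_aux (G.sumF x y) (G'.sumF x y))

/-- Pointwise sums of isomorphisms. -/
def paddCongr {F F' G G' : AddFunctor O P} (a : Hom F F') (b : Hom G G') :
    Hom (F.padd G) (F'.padd G') where
  app x := P.addF (a.app x) (b.app x)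
  naturality φ := by
    refine (P.addMap_addMap _ _ _ _ _ _).trans (Eq.trans ?_ (P.addMap_addMap _ _ _ _ _ _).symm)
    exact P.addMap_congr _ (a.naturality φ) (b.naturality φ)
  app_add {U} x y := by
    exact congrArg FHom.val (paddCongr_aux (D := P.Obj U) (s := F.sumF x y) (s' := F'.sumF x y)
      (t := G.sumF x y) (t' := G'.sumF x y) (f := a.app x) (g := a.app y) (h := b.app x)
      (k := b.app y) (m := a.app (O.add x y)) (n := b.app (O.add x y)) (fhom_eq (a.app_add x y))
      (fhom_eq (b.app_add x y)))

theorem leftUnitor_inv_eq {U : C} (x : P.Obj U) :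
    (λ_ x).inv = (finv (P.zeroAdd x) : x ⟶ 𝟙_ (P.Obj U) ⊗ x) := by
  rw [← cancel_mono (λ_ x).hom, Iso.inv_hom_id]
  exact fhom_eq (finv_fhom (P.zeroAdd x)).symm

/-- The zero functor is neutral for pointwise sums. -/
noncomputable def paddZero (F : AddFunctor O P) : Hom (F.padd (zero O P)) F where
  app {U} x := P.addZero (F.obj x)
  naturality {U V x y} φ := P.addZero_natural (F.map φ) (O.π φ) (by simp)
  app_add {U} x y := by
    have h := paddZero_aux (D := P.Obj U) (F.sumF x y)
    rw [leftUnitor_inv_eq] at h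
    exact congrArg FHom.val h

/-- The second projection of a product. -/
def snd (P Q : PicardFib.{w} C) : AddFunctor (P.prod Q) Q where
  obj x := x.2
  map φ := ProdHom.snd φ
  π_map φ := (ProdHom.eq φ).symm
  map_id _ := rfl
  map_comp _ _ := rfl
  sum _ _ := ⟨𝟙 _, Q.π_id _⟩
  sum_natural _ _ _ := (Category.comp_id _).trans (Category.id_comp _).symm
  map_σ x y z := by
    have h : (Q.σ x.2 y.2 z.2).1 ≫ 𝟙 _ ≫ Q.addMap (𝟙 (Tot.mk x.2))
        (𝟙 (Tot.mk (Q.add y.2 z.2))) (by simp) =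
      𝟙 _ ≫ Q.addMap (𝟙 (Tot.mk (Q.add x.2 y.2))) (𝟙 (Tot.mk z.2)) (by simp) ≫
        (Q.σ x.2 y.2 z.2).1 := by simp
    exact h
  map_τ _ _ := (Category.comp_id _).trans (Category.id_comp _).symm

/-- Composition of an isomorphism with an additive functor. -/
def Hom.whiskerLeft (G : AddFunctor P Q) {F F' : AddFunctor O P} (a : Hom F F') :
    Hom (G.comp F) (G.comp F') where
  app x := G.fmap (a.app x)
  naturality φ := by
    change G.map _ ≫ G.map _ = G.map _ ≫ G.map _
    rw [← G.map_comp, a.naturality, G.map_comp]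
  app_add x y := by
    change G.map _ ≫ G.map _ ≫ (G.sum _ _).1 = (G.map _ ≫ (G.sum _ _).1) ≫
      Q.addMap (G.map _) (G.map _) _
    rw [Category.assoc, ← G.sum_natural _ _ (by simp), ← Category.assoc, ← Category.assoc,
      ← G.map_comp, a.app_add, G.map_comp]

/-- Composition of an isomorphism with an additive functor. -/
def Hom.whiskerRight {G G' : AddFunctor P Q} (a : Hom G G') (F : AddFunctor O P) :
    Hom (G.comp F) (G'.comp F) where
  app x := a.app (F.obj x)
  naturality φ := a.naturality (F.map φ)
  app_add x y := by
    change (a.app _).1 ≫ G'.map _ ≫ (G'.sum _ _).1 = (G.map _ ≫ (G.sum _ _).1) ≫ _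
    rw [← Category.assoc, ← a.naturality, Category.assoc, a.app_add]
    exact (Category.assoc _ _ _).symm

/-- Associativity of the composition of additive functors. -/
def compAssoc (H : AddFunctor Q R) (G : AddFunctor P Q) (F : AddFunctor O P) :
    Hom ((H.comp G).comp F) (H.comp (G.comp F)) where
  app x := ⟨𝟙 _, R.π_id _⟩
  naturality φ := (Category.comp_id _).trans (Category.id_comp _).symm
  app_add x y := by
    change 𝟙 _ ≫ H.map (G.map _ ≫ (G.sum _ _).1) ≫ (H.sum _ _).1 =
      (H.map (G.map _) ≫ H.map (G.sum _ _).1 ≫ (H.sum _ _).1) ≫ R.addMap (𝟙 _) (𝟙 _) _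
    rw [R.addMap_id, Category.comp_id, Category.id_comp, H.map_comp, Category.assoc]

/-- Associativity of the composition of additive functors. -/
def compAssocInv (H : AddFunctor Q R) (G : AddFunctor P Q) (F : AddFunctor O P) :
    Hom (H.comp (G.comp F)) ((H.comp G).comp F) where
  app x := ⟨𝟙 _, R.π_id _⟩
  naturality φ := (Category.comp_id _).trans (Category.id_comp _).symm
  app_add x y := by
    change 𝟙 _ ≫ (H.map (G.map _) ≫ H.map (G.sum _ _).1 ≫ (H.sum _ _).1) =
      (H.map (G.map _ ≫ (G.sum _ _).1) ≫ (H.sum _ _).1) ≫ R.addMap (𝟙 _) (𝟙 _) _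
    rw [R.addMap_id, Category.comp_id, Category.id_comp, H.map_comp, Category.assoc]

/-- The identity is neutral for composition. -/
def compId (F : AddFunctor P Q) : Hom (F.comp (id P)) F where
  app x := ⟨𝟙 _, Q.π_id _⟩
  naturality φ := (Category.comp_id _).trans (Category.id_comp _).symm
  app_add x y := by
    change 𝟙 _ ≫ (F.sum x y).1 = (F.map (𝟙 _) ≫ (F.sum x y).1) ≫ Q.addMap (𝟙 _) (𝟙 _) _
    simp

/-- The identity is neutral for composition. -/
def compIdInv (F : AddFunctor P Q) : Hom F (F.comp (id P)) where
  app x := ⟨𝟙 _, Q.π_id _⟩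
  naturality φ := (Category.comp_id _).trans (Category.id_comp _).symm
  app_add x y := by
    change 𝟙 _ ≫ F.map (𝟙 _) ≫ (F.sum x y).1 = (F.sum x y).1 ≫ Q.addMap (𝟙 _) (𝟙 _) _
    simp

/-- The identity is neutral for composition. -/
def idComp (F : AddFunctor P Q) : Hom ((id Q).comp F) F where
  app x := ⟨𝟙 _, Q.π_id _⟩
  naturality φ := (Category.comp_id _).trans (Category.id_comp _).symm
  app_add x y := by
    change 𝟙 _ ≫ (F.sum x y).1 = ((F.sum x y).1 ≫ 𝟙 _) ≫ Q.addMap (𝟙 _) (𝟙 _) _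
    simp

/-- The identity is neutral for composition. -/
def idCompInv (F : AddFunctor P Q) : Hom F ((id Q).comp F) where
  app x := ⟨𝟙 _, Q.π_id _⟩
  naturality φ := (Category.comp_id _).trans (Category.id_comp _).symm
  app_add x y := by
    change 𝟙 _ ≫ (F.sum x y).1 ≫ 𝟙 _ = (F.sum x y).1 ≫ Q.addMap (𝟙 _) (𝟙 _) _
    simp

/-- Restriction of an isomorphism `L ∘ K ≅ 0` along an additive functor. -/
def nulComp {L : AddFunctor Q R} {K : AddFunctor P Q} (n : Hom (L.comp K) (zero P R))
    (G : AddFunctor O P) : Hom (L.comp (K.comp G)) (zero O R) where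
  app x := n.app (G.obj x)
  naturality {U V x y} φ := by
    refine (n.naturality (G.map φ)).trans ?_
    exact congrArg (fun f => (n.app (G.obj x)).1 ≫ R.zeroMap f) (G.π_map φ)
  app_add {U} x y := by
    have h1 := n.naturality (G.sum x y).1
    have h2 := n.app_add (G.obj x) (G.obj y)
    have h3 : (n.app (G.obj (O.add x y))).1 ≫ R.zeroMap (P.π (G.sum x y).1) =
        (n.app (G.obj (O.add x y))).1 := by
      rw [(G.sum x y).2, R.zeroMap_id]; exact Category.comp_id _
    have h4 : L.map (K.map (G.sum x y).1) ≫ (n.app (P.add (G.obj x) (G.obj y))).1 =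
      (n.app (G.obj (O.add x y))).1 := h1.trans h3
    let A := L.map (K.map (G.sum x y).1)
    let B := L.map (K.sum (G.obj x) (G.obj y)).1 ≫ (L.sum _ _).1
    have h5 : (n.app (P.add (G.obj x) (G.obj y))).1 ≫ ((zero P R).sum (G.obj x) (G.obj y)).1 =
      B ≫ R.addMap (n.app (G.obj x)).1 (n.app (G.obj y)).1
        ((FHom.property _).trans (FHom.property _).symm) := h2
    change (n.app (G.obj (O.add x y))).1 ≫ ((zero P R).sum (G.obj x) (G.obj y)).1 =
      (L.map (K.map (G.sum x y).1 ≫ (K.sum (G.obj x) (G.obj y)).1) ≫ (L.sum _ _).1) ≫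
        R.addMap (n.app (G.obj x)).1 (n.app (G.obj y)).1
        ((FHom.property _).trans (FHom.property _).symm)
    rw [L.map_comp, Category.assoc, Category.assoc]
    refine (congrArg (· ≫ ((zero P R).sum (G.obj x) (G.obj y)).1) h4.symm).trans ?_
    refine (Category.assoc _ _ _).trans ?_
    exact congrArg (A ≫ ·) (h5.trans (Category.assoc _ _ _))

end AddFunctor

end PointwiseSum

end PicardStacks

namespace PicardStacks

open FibGpd PicardFib

section Translation

variable {C : Type u} [Category.{v} C]

namespace PicardFib

variable {P : PicardFib.{w} C} {U : C}

open MonoidalCategory in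
theorem addMap_id_left_inj {x y z : P.Obj U} {f g : P.FHom y z}
    (h : P.addMap (𝟙 (Tot.mk x)) f.1 (by simp) = P.addMap (𝟙 (Tot.mk x)) g.1 (by simp)) :
    f = g := by
  have h' : x ◁ (f : y ⟶ z) = x ◁ (g : y ⟶ z) := fhom_eq h
  apply (tensorRight x).map_injective
  change (f : y ⟶ z) ▷ x = (g : y ⟶ z) ▷ x
  rw [← cancel_mono (β_ _ _).hom, BraidedCategory.braiding_naturality_left,
    BraidedCategory.braiding_naturality_left, h']

open MonoidalCategory in
theorem exists_addMap_id_left {x y z : P.Obj U} (a : P.FHom (P.add x y) (P.add x z)) :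
    ∃ k : P.FHom y z, P.addMap (𝟙 (Tot.mk x)) k.1 (by simp) = a.1 := by
  let a' : x ⊗ y ⟶ x ⊗ z := a
  obtain ⟨b, hb⟩ := (tensorRight x).map_surjective ((β_ x y).inv ≫ a' ≫ (β_ x z).hom)
  have h : x ◁ b = a' := by
    rw [← cancel_mono (β_ _ _).hom, BraidedCategory.braiding_naturality_right,
      ← cancel_epi (β_ _ _).inv, Iso.inv_hom_id_assoc]
    exact hb
  exact ⟨b, congrArg FHom.val h⟩

open MonoidalCategory in
theorem addMap_id_right_inj {x y z : P.Obj U} {f g : P.FHom y z}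
    (h : P.addMap f.1 (𝟙 (Tot.mk x)) (by simp) = P.addMap g.1 (𝟙 (Tot.mk x)) (by simp)) :
    f = g :=
  (tensorRight x).map_injective (X := y) (Y := z) (fhom_eq h)

open MonoidalCategory in
theorem exists_sub (x y : P.Obj U) : ∃ z : P.Obj U, Nonempty (P.FHom (P.add y z) x) := by
  obtain ⟨m, ⟨φ⟩⟩ := P.exists_neg y
  exact ⟨P.add m x, ⟨⟨(finv (P.σ y m x)).1 ≫ P.addMap φ.1 (𝟙 _) (by simp) ≫ (P.zeroAdd x).1,
    by simp⟩⟩⟩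

/-- Strict commutativity: `f + g` is isomorphic to `f ≫ g + 1`. -/
theorem addMap_τ_eq {a b c : P.Obj U} (f : P.FHom a b) (g : P.FHom b c) :
    P.addMap f.1 g.1 (by simp) ≫ (P.τ b c).1 = P.addMap (f.1 ≫ g.1) (𝟙 _) (by simp) := by
  have h1 : P.addMap f.1 g.1 (by simp) =
      P.addMap f.1 (𝟙 (Tot.mk b)) (by simp) ≫ P.addMap (𝟙 (Tot.mk b)) g.1 (by simp) := by
    rw [addMap_addMap]; exact P.addMap_congr _ (by simp) (by simp)
  rw [h1, Category.assoc, P.τ_natural, P.τ_self, Category.id_comp, addMap_addMap]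
  exact P.addMap_congr _ rfl (by simp)

theorem addZero_zero (U : C) : (P.addZero (P.zero U)).1 = (P.zeroAdd (P.zero U)).1 := by
  simp [addZero]

end PicardFib

namespace AddFunctor

variable {P Q R : PicardFib.{w} C}

theorem Hom.app_zero {F G : AddFunctor P Q} (η : Hom F G) (U : C) :
    (η.app (P.zero U)).1 ≫ (G.unit U).1 = (F.unit U).1 := by
  have h1 := η.app_add (P.zero U) (P.zero U)
  have h2 := η.naturality (P.zeroAdd (P.zero U)).1
  have h3 := G.unit_left (P.zero U)
  have h4 := Q.zeroAdd_natural (η.app (P.zero U)).1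
  have key : (⟨(η.app (P.zero U)).1 ≫ (G.unit U).1, by simp⟩ : Q.FHom _ _) = F.unit U := by
    apply F.unit_unique
    rw [← cancel_mono (η.app (P.zero U)).1, h2, ← h3, reassoc_of% h1, addMap_addMap_assoc]
    simp only [Category.assoc]
    congr 1
    rw [← h4, addMap_addMap_assoc]
    congr 1
    exact Q.addMap_congr _ (by simp) (by simp)
  exact congrArg FHom.val key

theorem comp_unit (G : AddFunctor Q R) (F : AddFunctor P Q) (U : C) :
    ((G.comp F).unit U).1 = G.map (F.unit U).1 ≫ (G.unit U).1 := by
  have key : (⟨G.map (F.unit U).1 ≫ (G.unit U).1, by simp⟩ : R.FHom _ _) = (G.comp F).unit U := by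
    apply (G.comp F).unit_unique
    have h1 := F.unit_left (P.zero U)
    have h2 := G.unit_left (F.obj (P.zero U))
    have h3 := G.sum_natural (F.unit U).1 (𝟙 (Tot.mk (F.obj (P.zero U)))) (by simp)
    change (G.map _ ≫ (G.sum _ _).1) ≫ R.addMap _ (𝟙 (Tot.mk (G.obj (F.obj (P.zero U))))) _ ≫
      (R.zeroAdd (G.obj (F.obj (P.zero U)))).1 = G.map (F.map _)
    rw [← h1, G.map_comp, G.map_comp, Category.assoc, ← h2, reassoc_of% h3, addMap_addMap_assoc]
    congr 3
    exact R.addMap_congr _ rfl (by simp)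
  exact congrArg FHom.val key.symm

theorem unit_right (F : AddFunctor P Q) {U : C} (x : P.Obj U) :
    (F.sum x (P.zero U)).1 ≫ Q.addMap (𝟙 (Tot.mk (F.obj x))) (F.unit U).1 (by simp) ≫
      (Q.addZero (F.obj x)).1 = F.map (P.addZero x).1 := by
  have h := F.map_τ x (P.zero U)
  simp only [addZero]
  rw [F.map_comp, ← F.unit_left x, reassoc_of% h, ← Category.assoc (Q.addMap _ _ _), Q.τ_natural,
    Category.assoc]

theorem zero_unit (U : C) : ((zero P Q).unit U).1 = 𝟙 _ := by
  have key : (⟨𝟙 _, Q.π_id _⟩ : Q.FHom (Q.zero U) (Q.zero U)) = (zero P Q).unit U := by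
    apply (zero P Q).unit_unique
    change (finv (Q.zeroAdd (Q.zero U))).1 ≫ Q.addMap (𝟙 _) (𝟙 (Tot.mk (Q.zero U))) _ ≫
      (Q.zeroAdd (Q.zero U)).1 = Q.zeroMap _
    rw [Q.addMap_id, Category.id_comp, finv_fhom]
    exact ((congrArg Q.zeroMap (P.zeroAdd (P.zero U)).2).trans (Q.zeroMap_id _)).symm
  exact congrArg FHom.val key.symm

theorem id_unit (U : C) : ((id P).unit U).1 = 𝟙 _ := by
  have key : (⟨𝟙 _, P.π_id _⟩ : P.FHom (P.zero U) (P.zero U)) = (id P).unit U := by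
    apply (id P).unit_unique
    change 𝟙 _ ≫ P.addMap (𝟙 _) (𝟙 (Tot.mk (P.zero U))) _ ≫ (P.zeroAdd (P.zero U)).1 = _
    rw [P.addMap_id, Category.id_comp, Category.id_comp]
    rfl
  exact congrArg FHom.val key.symm

end AddFunctor

end Translation

section Cokernel

namespace AddFunctor

variable {C : Type u} [Category.{v} C] {Q Y T S : PicardFib.{w} C}

/-- The functor `(y, q) ↦ y + K q`. -/
noncomputable def translate (K : AddFunctor Q Y) : AddFunctor (Y.prod Q) Y :=
  (fst Y Q).padd (K.comp (snd Y Q))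

/-- The isomorphisms `L (y + K q) ≅ L y` given by an isomorphism `L ∘ K ≅ 0`. -/
noncomputable def translateIso {K : AddFunctor Q Y} {L : AddFunctor Y T}
    (n : Hom (L.comp K) (zero Q T)) : Hom (L.comp (translate K)) (L.comp (fst Y Q)) :=
  (L.compPadd (fst Y Q) (K.comp (snd Y Q))).trans
    ((paddCongr (Hom.refl _) (nulComp n (snd Y Q))).trans (paddZero _))

variable {K : AddFunctor Q Y} {L : AddFunctor Y T} (n : Hom (L.comp K) (zero Q T))

/-- The isomorphism `L (y + K q) ≅ L y` given by an isomorphism `L ∘ K ≅ 0`. -/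
noncomputable def rho {U : C} (y : Y.Obj U) (q : Q.Obj U) :
    T.FHom (L.obj (Y.add y (K.obj q))) (L.obj y) := (translateIso n).app (y, q)

/-- The isomorphism `L (K q) ≅ 0`. -/
def nul {U : C} (q : Q.Obj U) : T.FHom (L.obj (K.obj q)) (T.zero U) := n.app q

theorem nul_natural {U V : C} {q : Q.Obj U} {q' : Q.Obj V} (φ : Q.Hom q q') :
    L.map (K.map φ) ≫ (nul n q').1 = (nul n q).1 ≫ T.zeroMap (Q.π φ) := n.naturality φ

theorem rho_eq {U : C} (y : Y.Obj U) (q : Q.Obj U) :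
    (rho n y q).1 = (L.sum y (K.obj q)).1 ≫ T.addMap (𝟙 _) (nul n q).1 (by simp) ≫
      (T.addZero (L.obj y)).1 := rfl

theorem rho_natural {U V : C} {y : Y.Obj U} {y' : Y.Obj V} {q : Q.Obj U} {q' : Q.Obj V}
    (φ : Y.Hom y y') (ψ : Q.Hom q q') (h : Y.π φ = Q.π ψ) :
    L.map (Y.addMap φ (K.map ψ) (by simp [h])) ≫ (rho n y' q').1 = (rho n y q).1 ≫ L.map φ :=
  (translateIso n).naturality (x := (y, q)) (y := (y', q')) ⟨φ, ψ, h⟩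

/-- Composition of the given isomorphism with an additive functor. -/
noncomputable def mapNul (B : AddFunctor T S) : Hom ((B.comp L).comp K) (zero Q S) :=
  (compAssoc B L K).trans ((Hom.whiskerLeft B n).trans (zeroComp Q B).symm)

theorem finv_finv {P : PicardFib.{w} C} {U : C} {x y : P.Obj U} (φ : P.FHom x y) :
    (finv (finv φ)).1 = φ.1 := finv_eq (finv_fhom φ)

theorem nul_mapNul (B : AddFunctor T S) {U : C} (q : Q.Obj U) :
    (nul (mapNul n B) q).1 = B.map (nul n q).1 ≫ (B.unit U).1 :=
  (Category.id_comp _).trans (congrArg (B.map (nul n q).1 ≫ ·) (finv_finv (B.unit U)))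

theorem map_rho (B : AddFunctor T S) {U : C} (y : Y.Obj U) (q : Q.Obj U) :
    B.map (rho n y q).1 = (rho (mapNul n B) y q).1 := by
  have h : (rho (mapNul n B) y q).1 = (B.map (L.sum y (K.obj q)).1 ≫ (B.sum _ _).1) ≫
    S.addMap (𝟙 _) (nul (mapNul n B) q).1 ((S.π_id _).trans (FHom.property _).symm) ≫
      (S.addZero (B.obj (L.obj y))).1 := rfl
  rw [h, rho_eq, B.map_comp, B.map_comp, ← B.unit_right, B.sum_natural_assoc, addMap_addMap_assoc,
    Category.assoc]
  congr 3
  exact S.addMap_congr _ (by simp) (nul_mapNul n B q).symm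

theorem rho_zero_left {U : C} (q : Q.Obj U) : L.map (Y.zeroAdd (K.obj q)).1 ≫ (nul n q).1 =
    (rho n (Y.zero U) q).1 ≫ (L.unit U).1 := by
  rw [rho_eq, ← L.unit_left, Category.assoc, Category.assoc, Category.assoc, Category.assoc,
    ← T.zeroAdd_natural, ← T.addZero_natural _ (𝟙 U) (by simp), addMap_addMap_assoc,
    addMap_addMap_assoc, addZero_zero]
  congr 2
  exact T.addMap_congr _ (by simp) (by simp)

theorem nul_zero (U : C) : (nul n (Q.zero U)).1 = L.map (K.unit U).1 ≫ (L.unit U).1 := by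
  rw [← comp_unit, ← n.app_zero U, zero_unit]
  exact (Category.comp_id _).symm

theorem rho_zero_right {U : C} (y : Y.Obj U) : (rho n y (Q.zero U)).1 =
    L.map (Y.addMap (𝟙 _) (K.unit U).1 (by simp) ≫ (Y.addZero y).1) := by
  rw [rho_eq, L.map_comp, ← L.unit_right, L.sum_natural_assoc, addMap_addMap_assoc]
  congr 2
  exact T.addMap_congr _ (by simp) (nul_zero n U)

theorem rho_hom {L' : AddFunctor Y T} (n' : Hom (L'.comp K) (zero Q T)) (η : Hom L L')
    {U : C} (y : Y.Obj U) (q : Q.Obj U)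
    (h : (η.app (K.obj q)).1 ≫ (nul n' q).1 = (nul n q).1) :
    (rho n y q).1 ≫ (η.app y).1 = (η.app (Y.add y (K.obj q))).1 ≫ (rho n' y q).1 := by
  have h1 := η.app_add y (K.obj q)
  rw [rho_eq, rho_eq, reassoc_of% h1, Category.assoc, Category.assoc,
    ← T.addZero_natural _ (𝟙 U) (by simp), addMap_addMap_assoc, addMap_addMap_assoc]
  congr 2
  exact T.addMap_congr _ (by simp) (by simp [h])

variable {J : GrothendieckTopology C}

variable (J) in
/-- `T` is the cokernel of `K` and `Q` is the kernel of `L`. -/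
structure IsCok : Prop where
  surj : L.LocEssSurj J
  full : ∀ {U : C} (q q' : Q.Obj U) (φ : Y.FHom (K.obj q) (K.obj q')),
    L.map φ.1 ≫ (nul n q').1 = (nul n q).1 → ∃! ψ : Q.FHom q q', K.map ψ.1 = φ.1
  ess : ∀ {U : C} (y : Y.Obj U) (i : T.FHom (L.obj y) (T.zero U)),
    ∃ (q : Q.Obj U) (φ : Y.FHom (K.obj q) y), L.map φ.1 ≫ i.1 = (nul n q).1

namespace IsCok

variable {n}

theorem exists_translate (h : IsCok n J) {U : C} {x y : Y.Obj U} (γ : T.FHom (L.obj x) (L.obj y)) :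
    ∃ (q : Q.Obj U) (α : Y.FHom (Y.add y (K.obj q)) x), L.map α.1 ≫ γ.1 = (rho n y q).1 := by
  obtain ⟨z, ⟨i⟩⟩ := Y.exists_sub x y
  obtain ⟨j, hj⟩ := exists_addMap_id_left (P := T) (x := L.obj y) (y := L.obj z) (z := T.zero U)
    ⟨(finv (L.sum y z)).1 ≫ L.map i.1 ≫ γ.1 ≫ (finv (T.addZero (L.obj y))).1, by simp⟩
  obtain ⟨q, φ, hφ⟩ := h.ess z j
  have hj' : T.addMap (𝟙 _) j.1 (by simp) =
    (finv (L.sum y z)).1 ≫ L.map i.1 ≫ γ.1 ≫ (finv (T.addZero (L.obj y))).1 := hj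
  refine ⟨q, ⟨Y.addMap (𝟙 _) φ.1 (by simp) ≫ i.1, by simp⟩, ?_⟩
  have e : T.addMap (𝟙 _) (nul n q).1 (by simp) =
      T.addMap (L.map (𝟙 (Tot.mk y))) (L.map φ.1) (by simp) ≫ T.addMap (𝟙 _) j.1 (by simp) := by
    rw [addMap_addMap]; exact T.addMap_congr _ (by simp) hφ.symm
  rw [rho_eq, e, hj', Category.assoc, ← L.sum_natural_assoc _ _ (by simp)]
  simp

theorem exists_translate_map (h : IsCok n J) {U V : C} {y : Y.Obj U} {y' : Y.Obj V} {q : Q.Obj U}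
    {q' : Q.Obj V} (a : Y.Hom (Y.add y (K.obj q)) (Y.add y' (K.obj q'))) (b : Y.Hom y y')
    (hab : Y.π a = Y.π b) (e : L.map a ≫ (rho n y' q').1 = (rho n y q).1 ≫ L.map b) :
    ∃ (ψ : Q.Hom q q') (h : Y.π b = Q.π ψ), Y.addMap b (K.map ψ) (by simp [h]) = a := by
  let p := pullHom (Y.π b) q'
  have hp : Y.π b = Q.π p := by simp [p]
  let c := Y.addMap b (K.map p) (by simp [hp])
  let a₀ := facF a c (by simp [c, hab])
  obtain ⟨k, hk⟩ := exists_addMap_id_left a₀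
  have e1 : L.map a₀.1 ≫ (rho n y (Q.pull (Y.π b) q')).1 = (rho n y q).1 := by
    apply hom_ext (L.map b)
    · simp
    · rw [Category.assoc, ← rho_natural n b p hp, ← Category.assoc, ← L.map_comp, ← e]
      congr 2
      exact facF_comp _ _ _
  rw [rho_eq, rho_eq, ← hk, L.sum_natural_assoc, addMap_addMap_assoc, cancel_epi, cancel_mono] at e1
  have e2 : L.map k.1 ≫ (nul n (Q.pull (Y.π b) q')).1 = (nul n q).1 := by
    refine congrArg FHom.val (addMap_id_left_inj (f := ⟨L.map k.1 ≫ (nul n _).1, by simp⟩)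
      (g := nul n q) (Eq.trans ?_ e1))
    exact T.addMap_congr _ (by simp) rfl
  obtain ⟨ψ, hψ, -⟩ := h.full _ _ k e2
  have hb : Y.π b = Q.π (ψ.1 ≫ p) := by simp [hp]
  refine ⟨ψ.1 ≫ p, hb, ?_⟩
  have e3 : Y.addMap b (K.map (ψ.1 ≫ p)) (by simp [hb]) =
      Y.addMap (𝟙 _) k.1 (by simp) ≫ Y.addMap b (K.map p) (by simp [hp]) := by
    rw [addMap_addMap]; exact Y.addMap_congr _ (by simp) (by rw [K.map_comp, hψ])
  rw [e3, hk]
  exact facF_comp _ _ _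

end IsCok

end AddFunctor

namespace ImageExt

open AddFunctor

variable {C : Type u} [Category.{v} C] {Y T S : PicardFib.{w} C} {L : AddFunctor Y T}
  {B : AddFunctor Y S}

/-- The value of a morphism between the two projections of `Y ×_T Y`. -/
def ev (η : Hom (B.comp (pr₁ L L)) (B.comp (pr₂ L L))) {U : C} {x y : Y.Obj U}
    (γ : T.FHom (L.obj x) (L.obj y)) : S.FHom (B.obj x) (B.obj y) :=
  η.app (⟨x, y, γ⟩ : FibObj L L U)

variable (η : Hom (B.comp (pr₁ L L)) (B.comp (pr₂ L L)))

theorem ev_natural {U V : C} {x y : Y.Obj U} {x' y' : Y.Obj V} (γ : T.FHom (L.obj x) (L.obj y))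
    (γ' : T.FHom (L.obj x') (L.obj y')) (φ : Y.Hom x x') (ψ : Y.Hom y y') (h : Y.π φ = Y.π ψ)
    (h' : L.map φ ≫ γ'.1 = γ.1 ≫ L.map ψ) : B.map φ ≫ (ev η γ').1 = (ev η γ).1 ≫ B.map ψ :=
  η.naturality (x := (⟨x, y, γ⟩ : FibObj L L U)) (y := (⟨x', y', γ'⟩ : FibObj L L V)) ⟨φ, ψ, h, h'⟩

theorem ev_add {U : C} {x y x' y' : Y.Obj U} (γ : T.FHom (L.obj x) (L.obj y))
    (γ' : T.FHom (L.obj x') (L.obj y')) (γ'' : T.FHom (L.obj (Y.add x x')) (L.obj (Y.add y y')))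
    (h : γ''.1 ≫ (L.sum y y').1 = (L.sum x x').1 ≫ T.addMap γ.1 γ'.1 (by simp)) :
    (ev η γ'').1 ≫ (B.sum y y').1 =
      (B.sum x x').1 ≫ S.addMap (ev η γ).1 (ev η γ').1 (by simp) := by
  have e : γ'' = isoAdd (G := L) (F := L) γ γ' := by
    apply fhom_eq
    rw [← cancel_mono (L.sum y y').1, h]
    exact (congrArg FHom.val (isoAdd_sumF (G := L) (F := L) γ γ')).symm
  subst e
  have h1 := η.app_add (⟨x, y, γ⟩ : FibObj L L U) (⟨x', y', γ'⟩ : FibObj L L U)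
  have h2 : (ev η (isoAdd (G := L) (F := L) γ γ')).1 ≫ B.map (𝟙 _) ≫ (B.sum y y').1 =
    (B.map (𝟙 _) ≫ (B.sum x x').1) ≫ S.addMap (ev η γ).1 (ev η γ').1 (by simp) := h1
  rw [B.map_id, B.map_id, Category.id_comp, Category.id_comp] at h2
  exact h2

theorem ev_comp (h1 : ∀ {U : C} (x : Y.Obj U), (ev η (⟨𝟙 _, T.π_id (L.obj x)⟩ :
    T.FHom (L.obj x) (L.obj x))).1 = 𝟙 _) {U : C} {x y z : Y.Obj U}
    (γ : T.FHom (L.obj x) (L.obj y)) (γ' : T.FHom (L.obj y) (L.obj z))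
    (γ'' : T.FHom (L.obj x) (L.obj z)) (h : γ''.1 = γ.1 ≫ γ'.1) :
    (ev η γ'').1 = (ev η γ).1 ≫ (ev η γ').1 := by
  let a : T.FHom (L.obj (Y.add x y)) (L.obj (Y.add y z)) :=
    ⟨(L.sum x y).1 ≫ T.addMap γ.1 γ'.1 (by simp) ≫ (finv (L.sum y z)).1, by simp⟩
  let b : T.FHom (L.obj (Y.add x y)) (L.obj (Y.add z y)) :=
    ⟨(L.sum x y).1 ≫ T.addMap γ''.1 (𝟙 _) (by simp) ≫ (finv (L.sum z y)).1, by simp⟩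
  have ha : a.1 ≫ (L.sum y z).1 = (L.sum x y).1 ≫ T.addMap γ.1 γ'.1 (by simp) := by simp [a]
  have hb : b.1 ≫ (L.sum z y).1 = (L.sum x y).1 ≫ T.addMap γ''.1 (𝟙 _) (by simp) := by simp [b]
  have ha' := ev_add η γ γ' a ha
  have hb' := ev_add η γ'' (⟨𝟙 _, T.π_id (L.obj y)⟩ : T.FHom (L.obj y) (L.obj y)) b hb
  have hab : a.1 ≫ L.map (Y.τ y z).1 = b.1 := by
    rw [← cancel_mono (L.sum z y).1, Category.assoc, L.map_τ, reassoc_of% ha, hb, addMap_τ_eq]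
    congr 1
    exact T.addMap_congr _ h.symm rfl
  have key := ev_natural η b a (𝟙 (Tot.mk (Y.add x y))) (finv (Y.τ y z)).1 (by simp) (by
    rw [← hab, L.map_id, Category.id_comp, Category.assoc, ← L.map_comp, fhom_finv, L.map_id,
      Category.comp_id])
  rw [B.map_id, Category.id_comp] at key
  have key' : (ev η a).1 ≫ B.map (Y.τ y z).1 = (ev η b).1 := by
    rw [key, Category.assoc, ← B.map_comp, finv_fhom, B.map_id, Category.comp_id]
  have e : (B.sum x y).1 ≫ S.addMap (ev η γ).1 (ev η γ').1 (by simp) ≫ (S.τ _ _).1 =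
      (B.sum x y).1 ≫ S.addMap (ev η γ'').1 (𝟙 _) (by simp) := by
    rw [← reassoc_of% ha', ← B.map_τ, ← Category.assoc, key', hb']
    congr 1
    exact S.addMap_congr _ rfl (h1 y)
  rw [cancel_epi, addMap_τ_eq] at e
  exact congrArg FHom.val (addMap_id_right_inj (f := ev η γ'')
    (g := ⟨(ev η γ).1 ≫ (ev η γ').1, by simp⟩) e.symm)

/-- The extension of `B` to morphisms of `T` given by a morphism between the projections of
`Y ×_T Y`. -/
noncomputable def ofHom (h1 : ∀ {U : C} (x : Y.Obj U), (ev η (⟨𝟙 _, T.π_id (L.obj x)⟩ :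
    T.FHom (L.obj x) (L.obj x))).1 = 𝟙 _) : ImageExt L B :=
  have hev : ∀ {U V : C} {y : Y.Obj U} {y' : Y.Obj V} (γ : T.Hom (L.obj y) (L.obj y'))
      (z : Y.Obj U) (γ₀ : T.FHom (L.obj y) (L.obj z)) (p : Y.Hom z y') (_ : γ₀.1 ≫ L.map p = γ),
      (ev η (facF γ (L.map (pullHom (T.π γ) y')) (by simp))).1 ≫ B.map (pullHom (T.π γ) y') =
        (ev η γ₀).1 ≫ B.map p := by
    intro U V y y' γ z γ₀ p hp
    have hp' : Y.π p = T.π γ := by rw [← hp]; simp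
    let u : Y.FHom z (Y.pull (T.π γ) y') := facF p (pullHom (T.π γ) y') (by simp [hp'])
    have hu : u.1 ≫ pullHom (T.π γ) y' = p := facF_comp _ _ _
    have e := ev_natural η γ₀ (facF γ (L.map (pullHom (T.π γ) y')) (by simp))
      (𝟙 (Tot.mk y)) u.1 (by simp) (by
        apply hom_ext (L.map (pullHom (T.π γ) y'))
        · simp
        · rw [L.map_id, Category.id_comp, facF_comp, Category.assoc, ← L.map_comp, hu, hp])
    rw [B.map_id, Category.id_comp] at e
    rw [e, Category.assoc, ← B.map_comp, hu]
  { map := fun {U V y y'} γ => (ev η (facF γ (L.map (pullHom (T.π γ) y')) (by simp))).1 ≫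
      B.map (pullHom (T.π γ) y')
    π_map := fun γ => by simp
    map_map := fun {U V y y'} φ => by
      rw [hev (L.map φ) (Y.pull (Y.π φ) y') (L.fmap (facF φ (pullHom (Y.π φ) y') (by simp)))
        (pullHom (Y.π φ) y') (by
          change L.map _ ≫ L.map _ = L.map φ
          rw [← L.map_comp, facF_comp])]
      have e := ev_natural η (L.fmap (facF φ (pullHom (Y.π φ) y') (by simp)))
        (⟨𝟙 _, T.π_id _⟩ : T.FHom (L.obj (Y.pull (Y.π φ) y')) _)
        (facF φ (pullHom (Y.π φ) y') (by simp)).1 (𝟙 _) (by simp) (by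
          rw [L.map_id]; rfl)
      rw [B.map_id, Category.comp_id, h1, Category.comp_id] at e
      rw [← e, ← B.map_comp, facF_comp]
    map_comp := fun {U V W y y' y''} γ γ' => by
      let p := pullHom (T.π γ) y'
      let p' := pullHom (T.π γ') y''
      let z := Y.pull (T.π γ') y''
      let p'' := pullHom (T.π γ) z
      have hp'' : Y.π p'' = T.π γ := π_pullHom _ _
      let γ₀ := facF γ (L.map p) (by simp [p])
      let γ₀' := facF γ' (L.map p') (by simp [p'])
      let γ₁ := facF (L.map p ≫ γ₀'.1) (L.map p'') (by simp [p, hp''])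
      have hγ₀ : γ₀.1 ≫ L.map p = γ := facF_comp _ _ _
      have hγ₀' : γ₀'.1 ≫ L.map p' = γ' := facF_comp _ _ _
      have hγ₁ : γ₁.1 ≫ L.map p'' = L.map p ≫ γ₀'.1 := facF_comp _ _ _
      rw [hev (γ ≫ γ') (Y.pull (T.π γ) z) ⟨γ₀.1 ≫ γ₁.1, by simp⟩ (p'' ≫ p') (by
        rw [L.map_comp, Category.assoc, reassoc_of% hγ₁, hγ₀', reassoc_of% hγ₀])]
      have e := ev_natural η γ₁ γ₀' p p'' (by simp [p, hp'']) hγ₁.symm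
      rw [ev_comp η h1 γ₀ γ₁ _ rfl, B.map_comp, Category.assoc, Category.assoc,
        ← reassoc_of% e]
    map_add := fun {U V y₁ y₂ z₁ z₂} γ₁ γ₂ h γ hγ => by
      let p₁ := pullHom (T.π γ₁) z₁
      let p₂ := pullHom (T.π γ₂) z₂
      have hp : Y.π p₁ = Y.π p₂ := by simp [p₁, p₂, h]
      have hπ : T.π γ = T.π γ₁ := by
        have := congrArg T.π hγ
        simpa using this
      let γ₁' := facF γ₁ (L.map p₁) (by simp [p₁])
      let γ₂' := facF γ₂ (L.map p₂) (by simp [p₂])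
      let γ' := facF γ (L.map (Y.addMap p₁ p₂ hp)) (by simp [p₁, hπ])
      have hγ' : γ'.1 ≫ L.map (Y.addMap p₁ p₂ hp) = γ := facF_comp _ _ _
      have e : γ'.1 ≫ (L.sum _ _).1 = (L.sum y₁ y₂).1 ≫ T.addMap γ₁'.1 γ₂'.1 (by simp) := by
        apply hom_ext (T.addMap (L.map p₁) (L.map p₂) (by simp [hp]))
        · simp
        · rw [Category.assoc, Category.assoc, ← L.sum_natural, reassoc_of% hγ', hγ,
            T.addMap_addMap]
          congr 1
          · exact T.addMap_congr _ (facF_comp _ _ _).symm (facF_comp _ _ _).symm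
          · exact hp
      have e' := ev_add η γ₁' γ₂' γ' e
      rw [hev γ _ γ' _ hγ', Category.assoc, B.sum_natural, ← Category.assoc, e', Category.assoc,
        S.addMap_addMap] }

theorem ofHom_map (h1 : ∀ {U : C} (x : Y.Obj U), (ev η (⟨𝟙 _, T.π_id (L.obj x)⟩ :
    T.FHom (L.obj x) (L.obj x))).1 = 𝟙 _) {U : C} {y y' : Y.Obj U}
    (γ : T.FHom (L.obj y) (L.obj y')) : (ofHom η h1).map γ.1 = (ev η γ).1 := by
  have e := ev_natural η (facF γ.1 (L.map (pullHom (T.π γ.1) y')) (by simp)) γ (𝟙 _)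
    (pullHom (T.π γ.1) y') (by simp) (by rw [L.map_id, Category.id_comp, facF_comp])
  rw [B.map_id, Category.id_comp] at e
  exact e.symm

end ImageExt

namespace AddFunctor

variable {C : Type u} [Category.{v} C] {J : GrothendieckTopology C} {Q Y T S : PicardFib.{w} C}
  {K : AddFunctor Q Y} {L : AddFunctor Y T} {n : Hom (L.comp K) (zero Q T)} {B : AddFunctor Y S}

/-- An additive functor on `Y` which kills `Q` is compatible with all morphisms of the cokernel
between objects in the image of `Y`. -/
theorem IsCok.exists_imageExt (h : IsCok n J) (hS : S.IsPrestack J)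
    (n' : Hom (B.comp K) (zero Q S)) : ∃ E : ImageExt L B, ∀ {U : C} (y : Y.Obj U) (q : Q.Obj U),
      E.map (rho n y q).1 = (rho n' y q).1 := by
  let W : AddFunctor (Y.prod Q) (fibProd L L) := lift (translate K) (fst Y Q) (translateIso n)
  have hW : W.LocEssSurj J := by
    intro U t
    refine ⟨⊤, J.top_mem U, fun {V} f _ => ?_⟩
    obtain ⟨t', φ, hφ⟩ := (fibProd L L).exists_lift f t
    obtain ⟨q, α, hα⟩ := h.exists_translate t'.iso
    let a : (fibProd L L).Hom (W.obj (t'.snd, q)) t' :=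
      ⟨α.1, 𝟙 _, α.2.trans (Y.π_id _).symm, hα.trans
        ((Category.comp_id _).symm.trans (congrArg ((rho n _ q).1 ≫ ·) (L.map_id _).symm))⟩
    refine ⟨(t'.snd, q), a ≫ φ, ?_⟩
    rw [π_comp, hφ, show (fibProd L L).π a = 𝟙 V from α.2]
    exact Category.id_comp _
  obtain ⟨η, hη⟩ := AddFunctor.exists_hom_of_locEssSurj hW hS (B₁ := B.comp (pr₁ L L))
    (B₂ := B.comp (pr₂ L L)) (fun {U} y => rho n' y.1 y.2) (by
      rintro U V ⟨y, q⟩ ⟨y', q'⟩ γ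
      obtain ⟨ψ, e, hψ⟩ := h.exists_translate_map (FibHom.fst γ) (FibHom.snd γ) (FibHom.eq γ)
        (FibHom.comm γ)
      have e' := rho_natural n' (FibHom.snd γ) ψ e
      exact (congrArg (fun t => B.map t ≫ (rho n' y' q').1) hψ.symm).trans e') (by
      rintro U ⟨y, q⟩ ⟨y', q'⟩
      have e : (rho n' (Y.add y y') (Q.add q q')).1 ≫ B.map (𝟙 _) ≫ (B.sum y y').1 =
        (B.map ((translate K).sum (y, q) (y', q')).1 ≫
          (B.sum (Y.add y (K.obj q)) (Y.add y' (K.obj q'))).1) ≫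
            S.addMap (rho n' y q).1 (rho n' y' q').1 (by simp) :=
        (translateIso n').app_add (y, q) (y', q')
      have e' : (rho n' (Y.add y y') (Q.add q q')).1 ≫ B.map (𝟙 _) ≫ B.map (𝟙 _) ≫
            (B.sum y y').1 =
          (B.map ((translate K).sum (y, q) (y', q')).1 ≫ B.map (𝟙 _) ≫
            (B.sum (Y.add y (K.obj q)) (Y.add y' (K.obj q'))).1) ≫
              S.addMap (rho n' y q).1 (rho n' y' q').1 (by simp) := by
        rw [B.map_id, Category.id_comp, B.map_id, Category.id_comp]
        rw [B.map_id, Category.id_comp] at e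
        exact e.trans (congrArg (fun t => (B.map _ ≫ t) ≫ _) (Category.id_comp _).symm)
      exact e')
  have hη' : ∀ {U : C} (y : Y.Obj U) (q : Q.Obj U),
      (ImageExt.ev η (rho n y q)).1 = (rho n' y q).1 := fun y q => hη (y, q)
  have h1 : ∀ {U : C} (x : Y.Obj U), (ImageExt.ev η (⟨𝟙 _, T.π_id (L.obj x)⟩ :
      T.FHom (L.obj x) (L.obj x))).1 = 𝟙 _ := by
    intro U x
    let α : Y.FHom (Y.add x (K.obj (Q.zero U))) x :=
      ⟨Y.addMap (𝟙 _) (K.unit U).1 (by simp) ≫ (Y.addZero x).1, by simp⟩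
    have e := ImageExt.ev_natural η (rho n x (Q.zero U)) (⟨𝟙 _, T.π_id (L.obj x)⟩ :
      T.FHom (L.obj x) (L.obj x)) α.1 (𝟙 _) (by simp) (by
        rw [L.map_id, Category.comp_id, Category.comp_id, rho_zero_right])
    rw [hη', rho_zero_right, B.map_id] at e
    have := isIso_val (B.fmap α)
    exact (cancel_epi (B.fmap α).1).1 e
  refine ⟨ImageExt.ofHom η h1, fun {U} y q => ?_⟩
  rw [ImageExt.ofHom_map, hη']

/-- Universal property of the cokernel. -/
theorem IsCok.exists_desc (h : IsCok n J) (hS : S.IsPrestack J) (hS' : S.HasGluing J)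
    (n' : Hom (B.comp K) (zero Q S)) : ∃ (B' : AddFunctor T S) (η : Hom (B'.comp L) B),
      ∀ {U : C} (q : Q.Obj U), B'.map (nul n q).1 ≫ (B'.unit U).1 =
        (η.app (K.obj q)).1 ≫ (nul n' q).1 := by
  obtain ⟨E, hE⟩ := h.exists_imageExt hS n'
  obtain ⟨B', η, hη⟩ := E.exists_extension h.surj hS hS'
  refine ⟨B', η, fun {U} q => ?_⟩
  let γ : T.FHom (L.obj (K.obj q)) (L.obj (Y.zero U)) :=
    ⟨(nul n q).1 ≫ (finv (L.unit U)).1, by simp⟩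
  have e1 : L.map (Y.zeroAdd (K.obj q)).1 ≫ γ.1 = (rho n (Y.zero U) q).1 := by
    rw [← cancel_mono (L.unit U).1, ← rho_zero_left]; simp [γ]
  have e2 := congrArg E.map e1
  rw [E.map_comp, E.map_map, hE] at e2
  have e3 := hη γ.1
  have e4 : (η.app (Y.zero U)).1 ≫ (B.unit U).1 = B'.map (L.unit U).1 ≫ (B'.unit U).1 := by
    rw [← comp_unit]; exact η.app_zero U
  have e5 := rho_zero_left n' q
  have := isIso_val (B.fmap (Y.zeroAdd (K.obj q)))
  rw [← e2, Category.assoc] at e5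
  replace e5 := (cancel_epi (B.fmap (Y.zeroAdd (K.obj q))).1).1 e5
  have e6 : B'.map (nul n q).1 = B'.map γ.1 ≫ B'.map (L.unit U).1 := by
    rw [← B'.map_comp]; simp [γ]
  rw [e6, Category.assoc, ← e4]
  refine (Category.assoc _ _ _).symm.trans ((congrArg (· ≫ (B.unit U).1) e3).trans ?_)
  exact (Category.assoc _ _ _).trans (congrArg ((η.app (K.obj q)).1 ≫ ·) e5.symm)

/-- Isomorphisms of functors on the cokernel. -/
theorem IsCok.exists_hom (h : IsCok n J) (hS : S.IsPrestack J) {B₁ B₂ : AddFunctor T S}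
    (η : Hom (B₁.comp L) (B₂.comp L))
    (hη : ∀ {U : C} (q : Q.Obj U), B₁.map (nul n q).1 ≫ (B₁.unit U).1 =
      (η.app (K.obj q)).1 ≫ B₂.map (nul n q).1 ≫ (B₂.unit U).1) :
    ∃ η' : Hom B₁ B₂, ∀ {U : C} (y : Y.Obj U), (η'.app (L.obj y)).1 = (η.app y).1 := by
  have hρ : ∀ {U : C} (y : Y.Obj U) (q : Q.Obj U), B₁.map (rho n y q).1 ≫ (η.app y).1 =
      (η.app (Y.add y (K.obj q))).1 ≫ B₂.map (rho n y q).1 := by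
    intro U y q
    rw [map_rho, map_rho]
    exact rho_hom (mapNul n B₁) (mapNul n B₂) η y q (by
      rw [nul_mapNul, nul_mapNul]; exact (hη q).symm)
  refine exists_hom_of_locEssSurj h.surj hS (fun y => η.app y) ?_ ?_
  · intro U V y y' γ
    let p := pullHom (T.π γ) y'
    let γ₀ := facF γ (L.map p) (by simp [p])
    obtain ⟨q, α, hα⟩ := h.exists_translate γ₀
    let a {U : C} (y : Y.Obj U) : S.FHom (B₁.obj (L.obj y)) (B₂.obj (L.obj y)) := η.app y
    have ha {U V : C} {y : Y.Obj U} {y' : Y.Obj V} (φ : Y.Hom y y') :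
      B₁.map (L.map φ) ≫ (a y').1 = (a y).1 ≫ B₂.map (L.map φ) := η.naturality φ
    have hρ' : B₁.map (rho n (Y.pull (T.π γ) y') q).1 ≫ (a _).1 = (a _).1 ≫ B₂.map _ := hρ _ q
    have e : B₁.map γ₀.1 ≫ (a _).1 = (a y).1 ≫ B₂.map γ₀.1 := by
      have := isIso_val (B₁.fmap (L.fmap α))
      refine (cancel_epi (B₁.fmap (L.fmap α)).1).1 ?_
      change B₁.map (L.map α.1) ≫ _ = B₁.map (L.map α.1) ≫ _
      rw [reassoc_of% ha α.1, ← Category.assoc, ← B₁.map_comp, hα, ← B₂.map_comp, hα, hρ']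
    have hγ : γ₀.1 ≫ L.map p = γ := facF_comp _ _ _
    change B₁.map γ ≫ (a y').1 = (a y).1 ≫ B₂.map γ
    rw [← hγ, B₁.map_comp, B₂.map_comp, Category.assoc, ha, reassoc_of% e]
  · intro U y y'
    exact η.app_add y y'

end AddFunctor

end Cokernel

end PicardStacks

namespace PicardStacks

open FibGpd PicardFib

section Associativity

namespace AddFunctor

open MonoidalCategory

variable {C : Type u} [Category.{v} C] {O P Q Y : PicardFib.{w} C}

theorem paddAssoc_aux {D : Type*} [Category D] [MonoidalCategory D] [SymmetricCategory D]
    {p q r a a' b b' c c' : D} (s : p ⟶ a ⊗ a') (t : q ⟶ b ⊗ b') (m : r ⟶ c ⊗ c') :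
    (α_ p q r).hom ≫ (s ⊗ₘ ((t ⊗ₘ m) ≫ tensorμ b b' c c')) ≫ tensorμ a a' (b ⊗ c) (b' ⊗ c') =
      ((((s ⊗ₘ t) ≫ tensorμ a a' b b') ⊗ₘ m) ≫ tensorμ (a ⊗ b) (a' ⊗ b') c c') ≫
        ((α_ a b c).hom ⊗ₘ (α_ a' b' c').hom) := by
  have h := tensor_associativity a a' b b' c c'
  have e1 : (s ⊗ₘ ((t ⊗ₘ m) ≫ tensorμ b b' c c')) =
      (s ⊗ₘ (t ⊗ₘ m)) ≫ ((a ⊗ a') ◁ tensorμ b b' c c') := by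
    rw [← id_tensorHom, tensorHom_comp_tensorHom, Category.comp_id]
  have e2 : (((s ⊗ₘ t) ≫ tensorμ a a' b b') ⊗ₘ m) =
      ((s ⊗ₘ t) ⊗ₘ m) ≫ (tensorμ a a' b b' ▷ (c ⊗ c')) := by
    rw [← tensorHom_id, tensorHom_comp_tensorHom, Category.comp_id]
  rw [e1, e2, Category.assoc, Category.assoc, Category.assoc, h,
    associator_naturality_assoc]

/-- Pointwise sums are associative. -/
def paddAssoc (F G H : AddFunctor O P) : Hom ((F.padd G).padd H) (F.padd (G.padd H)) where
  app x := P.σ (F.obj x) (G.obj x) (H.obj x)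
  naturality φ := P.σ_natural (F.map φ) (G.map φ) (H.map φ) (by simp) (by simp)
  app_add {U} x y := congrArg FHom.val
    (paddAssoc_aux (D := P.Obj U) (F.sumF x y) (G.sumF x y) (H.sumF x y))

theorem addition_unit (U : C) : ((addition Q).unit U).1 = (Q.zeroAdd (Q.zero U)).1 := by
  have key : Q.zeroAdd (Q.zero U) = (addition Q).unit U := by
    apply (addition Q).unit_unique
    have h := leftUnitor_monoidal (C := Q.Obj U) (𝟙_ _) (𝟙_ _)
    exact congrArg FHom.val h.symm
  exact congrArg FHom.val key.symm

theorem pair_unit (F : AddFunctor O P) (G : AddFunctor O Q) (U : C) :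
    ((F.pair G).unit U).1 = ⟨(F.unit U).1, (G.unit U).1,
      (FHom.property _).trans (FHom.property _).symm⟩ := by
  let v : (P.prod Q).FHom ((F.pair G).obj (O.zero U)) ((P.prod Q).zero U) :=
    ⟨⟨(F.unit U).1, (G.unit U).1, (FHom.property _).trans (FHom.property _).symm⟩, (F.unit U).2⟩
  have key : v = (F.pair G).unit U := by
    apply (F.pair G).unit_unique
    exact ProdHom.ext (F.unit_left _) (G.unit_left _)
  exact congrArg FHom.val key.symm

theorem padd_unit (F G : AddFunctor O P) (U : C) : ((F.padd G).unit U).1 =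
    P.addMap (F.unit U).1 (G.unit U).1 (by simp) ≫ (P.zeroAdd (P.zero U)).1 := by
  refine (comp_unit (addition P) (F.pair G) U).trans ?_
  rw [pair_unit, addition_unit]
  rfl

theorem fst_unit (U : C) : ((fst P Q).unit U).1 = 𝟙 _ := by
  have key : (⟨𝟙 _, P.π_id _⟩ : P.FHom (P.zero U) (P.zero U)) = (fst P Q).unit U := by
    apply (fst P Q).unit_unique
    change 𝟙 _ ≫ P.addMap (𝟙 _) (𝟙 (Tot.mk (P.zero U))) _ ≫ (P.zeroAdd (P.zero U)).1 = _
    rw [P.addMap_id, Category.id_comp, Category.id_comp]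
    rfl
  exact congrArg FHom.val key.symm

theorem snd_unit (U : C) : ((snd P Q).unit U).1 = 𝟙 _ := by
  have key : (⟨𝟙 _, Q.π_id _⟩ : Q.FHom (Q.zero U) (Q.zero U)) = (snd P Q).unit U := by
    apply (snd P Q).unit_unique
    change 𝟙 _ ≫ Q.addMap (𝟙 _) (𝟙 (Tot.mk (Q.zero U))) _ ≫ (Q.zeroAdd (Q.zero U)).1 = _
    rw [Q.addMap_id, Category.id_comp, Category.id_comp]
    rfl
  exact congrArg FHom.val key.symm

variable (K : AddFunctor Q Y)

/-- `(y, q, r) ↦ y + K (q + r)`. -/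
noncomputable def translateAdd : AddFunctor ((Y.prod Q).prod Q) Y :=
  ((fst Y Q).comp (fst (Y.prod Q) Q)).padd
    (K.comp (((snd Y Q).comp (fst (Y.prod Q) Q)).padd (snd (Y.prod Q) Q)))

/-- `(y, q, r) ↦ (y + K q) + K r`. -/
noncomputable def translateTwice : AddFunctor ((Y.prod Q).prod Q) Y :=
  (((fst Y Q).comp (fst (Y.prod Q) Q)).padd (K.comp ((snd Y Q).comp (fst (Y.prod Q) Q)))).padd
    (K.comp (snd (Y.prod Q) Q))

/-- The isomorphisms `y + K (q + r) ≅ (y + K q) + K r`. -/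
noncomputable def kappaHom : Hom (translateAdd K) (translateTwice K) :=
  (paddCongr (Hom.refl _) (K.compPadd _ _)).trans (paddAssoc _ _ _).symm

/-- The isomorphism `y + K (q + r) ≅ (y + K q) + K r`. -/
noncomputable def kappa {U : C} (y : Y.Obj U) (q r : Q.Obj U) :
    Y.FHom (Y.add y (K.obj (Q.add q r))) (Y.add (Y.add y (K.obj q)) (K.obj r)) :=
  (kappaHom K).app ((y, q), r)

theorem kappa_eq {U : C} (y : Y.Obj U) (q r : Q.Obj U) : (kappa K y q r).1 =
    Y.addMap (𝟙 _) (K.sum q r).1 (by simp) ≫ (finv (Y.σ y (K.obj q) (K.obj r))).1 := rfl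

theorem kappa_natural {U V : C} {y : Y.Obj U} {q r : Q.Obj U} {y' : Y.Obj V} {q' r' : Q.Obj V}
    (φ : Y.Hom y y') (ψ : Q.Hom q q') (χ : Q.Hom r r') (h : Y.π φ = Q.π ψ) (h' : Q.π ψ = Q.π χ) :
    Y.addMap φ (K.map (Q.addMap ψ χ h')) (by simp [h]) ≫ (kappa K y' q' r').1 =
      (kappa K y q r).1 ≫ Y.addMap (Y.addMap φ (K.map ψ) (by simp [h])) (K.map χ)
        (by simp [h, h']) :=
  (kappaHom K).naturality (x := ((y, q), r)) (y := ((y', q'), r')) ⟨⟨φ, ψ, h⟩, χ, h.trans h'⟩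

/-- The isomorphism `(y + y') + K (q + q') ≅ (y + K q) + (y' + K q')`. -/
noncomputable def shuffle {U : C} (y y' : Y.Obj U) (q q' : Q.Obj U) :
    Y.FHom (Y.add (Y.add y y') (K.obj (Q.add q q'))) (Y.add (Y.add y (K.obj q))
      (Y.add y' (K.obj q'))) :=
  (translate K).sum (y, q) (y', q')

theorem shuffle_natural {U V : C} {y z : Y.Obj U} {q r : Q.Obj U} {y' z' : Y.Obj V}
    {q' r' : Q.Obj V} (φ : Y.Hom y y') (φ' : Y.Hom z z') (ψ : Q.Hom q q') (ψ' : Q.Hom r r')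
    (h : Y.π φ = Y.π φ') (h' : Y.π φ = Q.π ψ) (h'' : Y.π φ' = Q.π ψ') :
    Y.addMap (Y.addMap φ φ' h) (K.map (Q.addMap ψ ψ' (by rw [← h', ← h'', h]))) (by simp [h']) ≫
        (shuffle K y' z' q' r').1 = (shuffle K y z q r).1 ≫
      Y.addMap (Y.addMap φ (K.map ψ) (by simp [h'])) (Y.addMap φ' (K.map ψ') (by simp [h'']))
        (by simp [h]) :=
  (translate K).sum_natural (x := (y, q)) (x' := (z, r)) (y := (y', q')) (y' := (z', r'))
    ⟨φ, ψ, h'⟩ ⟨φ', ψ', h''⟩ h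

theorem shuffle_eq {U : C} (y y' : Y.Obj U) (q q' : Q.Obj U) : (shuffle K y y' q q').1 =
    Y.addMap (𝟙 _) (K.sum q q').1 (by simp) ≫
      (tensorμ (C := Y.Obj U) y y' (K.obj q) (K.obj q')).1 := by
  have h : (shuffle K y y' q q').1 = Y.addMap (𝟙 (Tot.mk (Y.add y y')))
    (K.map (𝟙 (Tot.mk (Q.add q q'))) ≫ (K.sum q q').1) (by simp) ≫
      (tensorμ (C := Y.Obj U) y y' (K.obj q) (K.obj q')).1 := rfl
  rw [h]
  exact congrArg (· ≫ (tensorμ (C := Y.Obj U) y y' (K.obj q) (K.obj q')).1)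
    (Y.addMap_congr _ rfl (by simp))

theorem shuffle_kappa_aux {D : Type*} [Category D] [MonoidalCategory D] [SymmetricCategory D]
    (y y' : D) {a a' b b' c d e f p p' : D} (m : p ⟶ c ⊗ d) (s : c ⟶ a ⊗ a') (t : d ⟶ b ⊗ b')
    (w : p ⟶ p') (m' : p' ⟶ e ⊗ f) (s' : e ⟶ a ⊗ b) (t' : f ⟶ a' ⊗ b')
    (h : w ≫ m' ≫ (s' ⊗ₘ t') = m ≫ (s ⊗ₘ t) ≫ tensorμ a a' b b') :
    ((y ⊗ y') ◁ m ≫ (α_ _ _ _).inv) ≫ (((y ⊗ y') ◁ s ≫ tensorμ y y' a a') ▷ d) ≫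
        (((y ⊗ a) ⊗ (y' ⊗ a')) ◁ t ≫ tensorμ (y ⊗ a) (y' ⊗ a') b b') =
      (y ⊗ y') ◁ w ≫ ((y ⊗ y') ◁ m' ≫ tensorμ y y' e f) ≫
        ((y ◁ s' ≫ (α_ y a b).inv) ⊗ₘ (y' ◁ t' ≫ (α_ y' a' b').inv)) := by
  have h1 := tensor_associativity y y' a a' b b'
  have h2 : tensorμ y y' e f ≫ ((y ◁ s') ⊗ₘ (y' ◁ t')) =
      (y ⊗ y') ◁ (s' ⊗ₘ t') ≫ tensorμ y y' (a ⊗ b) (a' ⊗ b') := by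
    have := tensorμ_natural (𝟙 y) (𝟙 y') s' t'
    simpa using this.symm
  have h3 : (y ⊗ y') ◁ w ≫ (y ⊗ y') ◁ m' ≫ (y ⊗ y') ◁ (s' ⊗ₘ t') =
      (y ⊗ y') ◁ m ≫ (y ⊗ y') ◁ (s ⊗ₘ t) ≫ (y ⊗ y') ◁ tensorμ a a' b b' := by
    simp only [← MonoidalCategory.whiskerLeft_comp, h]
  have h4 : (y ⊗ y') ◁ tensorμ a a' b b' ≫ tensorμ y y' (a ⊗ b) (a' ⊗ b') ≫
      ((α_ y a b).inv ⊗ₘ (α_ y' a' b').inv) =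
        (α_ _ _ _).inv ≫ tensorμ y y' a a' ▷ (b ⊗ b') ≫ tensorμ (y ⊗ a) (y' ⊗ a') b b' := by
    rw [← cancel_epi (α_ (y ⊗ y') (a ⊗ a') (b ⊗ b')).hom, ← reassoc_of% h1]
    simp
  have e1 : ((y ◁ s' ≫ (α_ y a b).inv) ⊗ₘ (y' ◁ t' ≫ (α_ y' a' b').inv)) =
      ((y ◁ s') ⊗ₘ (y' ◁ t')) ≫ ((α_ y a b).inv ⊗ₘ (α_ y' a' b').inv) := by simp
  have e2 : (((y ⊗ y') ◁ s ≫ tensorμ y y' a a') ▷ d) ≫ ((y ⊗ a) ⊗ (y' ⊗ a')) ◁ t =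
      (((y ⊗ y') ◁ s) ⊗ₘ t) ≫ tensorμ y y' a a' ▷ (b ⊗ b') := by
    rw [MonoidalCategory.tensorHom_def, comp_whiskerRight, Category.assoc, Category.assoc,
      whisker_exchange]
  rw [e1]
  simp only [Category.assoc] at e2 ⊢
  rw [reassoc_of% h2, reassoc_of% h3, h4, reassoc_of% e2]
  congr 1
  simp only [← Category.assoc]
  congr 2
  simp [MonoidalCategory.tensorHom_def]

theorem shuffle_kappa {U : C} (y y' : Y.Obj U) (q q' r r' : Q.Obj U) :
    (kappa K (Y.add y y') (Q.add q q') (Q.add r r')).1 ≫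
        Y.addMap (shuffle K y y' q q').1 (𝟙 _) (by simp) ≫
          (shuffle K (Y.add y (K.obj q)) (Y.add y' (K.obj q')) r r').1 =
      Y.addMap (𝟙 _) (K.map (tensorμ (C := Q.Obj U) q q' r r').1)
          (by rw [K.π_map]; exact (Y.π_id _).trans (FHom.property _).symm) ≫
        (shuffle K y y' (Q.add q r) (Q.add q' r')).1 ≫
          Y.addMap (kappa K y q r).1 (kappa K y' q' r').1 (by simp) := by
  have h := shuffle_kappa_aux (D := Y.Obj U) y y' (K.sumF (Q.add q q') (Q.add r r')) (K.sumF q q')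
    (K.sumF r r') _ (K.sumF (Q.add q r) (Q.add q' r')) (K.sumF q r) (K.sumF q' r')
    (K.sumF_tensorμ q q' r r')
  have e1 (a b c d : Y.Obj U) (m : Y.FHom d (Y.add b c)) : ((a ◁ (m : d ⟶ b ⊗ c)) ≫
    (α_ a b c).inv).1 = Y.addMap (𝟙 _) m.1 (by simp) ≫ (finv (Y.σ a b c)).1 := by
    have h0 : (finv (Y.σ a b c)).1 = ((α_ a b c).inv).1 :=
      finv_eq (congrArg FHom.val (α_ a b c).hom_inv_id)
    exact congrArg (Y.addMap (𝟙 (Tot.mk a)) m.1 (by simp) ≫ ·) h0.symm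
  have e2 (y : Y.Obj U) (q r : Q.Obj U) : kappa K y q r =
      ((y ◁ K.sumF q r) ≫ (α_ y (K.obj q) (K.obj r)).inv) :=
    fhom_eq ((kappa_eq K y q r).trans (e1 _ _ _ _ (K.sumF q r)).symm)
  have e3 (y y' : Y.Obj U) (q q' : Q.Obj U) : shuffle K y y' q q' =
      (((y ⊗ y') ◁ K.sumF q q') ≫ tensorμ (C := Y.Obj U) y y' (K.obj q) (K.obj q')) :=
    fhom_eq (shuffle_eq K y y' q q')
  simp only [e2, e3]
  exact congrArg FHom.val h

theorem shuffle_σ {U : C} (x y z : Y.Obj U) (q r s : Q.Obj U) :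
    Y.addMap (Y.σ x y z).1 (K.map (Q.σ q r s).1) (by simp) ≫
        (shuffle K x (Y.add y z) q (Q.add r s)).1 ≫
          Y.addMap (𝟙 _) (shuffle K y z r s).1 (by simp) =
      (shuffle K (Y.add x y) z (Q.add q r) s).1 ≫ Y.addMap (shuffle K x y q r).1 (𝟙 _) (by simp) ≫
        (Y.σ _ _ _).1 :=
  (translate K).map_σ (x, q) (y, r) (z, s)

theorem shuffle_τ {U : C} (x y : Y.Obj U) (q r : Q.Obj U) :
    Y.addMap (Y.τ x y).1 (K.map (Q.τ q r).1) (by simp) ≫ (shuffle K y x r q).1 =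
      (shuffle K x y q r).1 ≫ (Y.τ _ _).1 :=
  (translate K).map_τ (x, q) (y, r)

/-- The isomorphism `y + K 0 ≅ y`. -/
noncomputable def translateZero {U : C} (y : Y.Obj U) : Y.FHom (Y.add y (K.obj (Q.zero U))) y :=
  ⟨Y.addMap (𝟙 _) (K.unit U).1 (by simp) ≫ (Y.addZero y).1, by simp⟩

theorem translateZero_natural {U V : C} {y : Y.Obj U} {y' : Y.Obj V} (φ : Y.Hom y y') :
    Y.addMap φ (K.map (Q.zeroMap (Y.π φ))) (by simp) ≫ (translateZero K y').1 =
      (translateZero K y).1 ≫ φ := by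
  simp only [translateZero]
  rw [addMap_addMap_assoc, Category.assoc, ← Y.addZero_natural φ _ rfl, addMap_addMap_assoc]
  congr 1
  exact Y.addMap_congr _ (by simp) (K.unit_natural _)

theorem translateZero_zero (U : C) :
    (translateZero K (Y.zero U)).1 = ((translate K).unit U).1 := by
  have h1 := padd_unit (fst Y Q) (K.comp (snd Y Q)) U
  have h2 := comp_unit K (snd Y Q) U
  have h3 : K.map ((snd Y Q).unit U).1 = 𝟙 _ := (congrArg K.map (snd_unit U)).trans (K.map_id _)
  have h4 : ((K.comp (snd Y Q)).unit U).1 = (K.unit U).1 :=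
    h2.trans ((congrArg (· ≫ (K.unit U).1) h3).trans (Category.id_comp _))
  refine Eq.trans ?_ h1.symm
  simp only [translateZero, addZero_zero]
  exact congrArg (· ≫ (Y.zeroAdd (Y.zero U)).1) (Y.addMap_congr _ (fst_unit U).symm h4.symm)

theorem shuffle_zero {U : C} (y : Y.Obj U) (q : Q.Obj U) :
    (shuffle K (Y.zero U) y (Q.zero U) q).1 ≫
        Y.addMap (translateZero K (Y.zero U)).1 (𝟙 _) (by simp) ≫ (Y.zeroAdd _).1 =
      Y.addMap (Y.zeroAdd y).1 (K.map (Q.zeroAdd q).1) (by simp) := by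
  have h := (translate K).unit_left (y, q)
  refine Eq.trans ?_ h
  congr 2
  exact Y.addMap_congr _ (translateZero_zero K U) rfl

end AddFunctor

end Associativity

end PicardStacks

namespace PicardStacks

open FibGpd PicardFib

section QuotientFib

open MonoidalCategory

variable {C : Type u} [Category.{v} C] {Q Y : PicardFib.{w} C}

theorem PicardFib.addMap_left_inj {P : PicardFib.{w} C} {U V : C} {x y : P.Obj U} {x' y' : P.Obj V}
    {φ : P.Hom x x'} {f g : P.Hom y y'} (h : P.π φ = P.π f) (h' : P.π φ = P.π g)
    (e : P.addMap φ f h = P.addMap φ g h') : f = g := by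
  have h1 : P.addMap (𝟙 (Tot.mk x)) (facF f g (h.symm.trans h')).1 (by simp) ≫ P.addMap φ g h' =
      P.addMap (𝟙 (Tot.mk x)) (𝟙 (Tot.mk y)) (by simp) ≫ P.addMap φ g h' := by
    rw [P.addMap_id, Category.id_comp, P.addMap_addMap, ← e]
    exact P.addMap_congr _ (Category.id_comp _) (facF_comp _ _ _)
  have h2 := FibGpd.hom_ext _ (by simp) h1
  have h3 := congrArg FHom.val (addMap_id_left_inj (f := facF f g (h.symm.trans h'))
    (g := ⟨𝟙 _, P.π_id _⟩) h2)
  rw [← facF_comp f g (h.symm.trans h'), h3]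
  exact Category.id_comp _

namespace AddFunctor

theorem kappa_assoc_aux {D : Type*} [Category D] [MonoidalCategory D] (x : D)
    {p p' a b c d e : D} (k : p ⟶ p') (m : p' ⟶ a ⊗ d) (t : d ⟶ b ⊗ c) (n : p ⟶ e ⊗ c)
    (s : e ⟶ a ⊗ b) (h : k ≫ m ≫ a ◁ t = n ≫ s ▷ c ≫ (α_ a b c).hom) :
    x ◁ k ≫ (x ◁ m ≫ (α_ x a d).inv) ≫ ((x ⊗ a) ◁ t ≫ (α_ (x ⊗ a) b c).inv) =
      (x ◁ n ≫ (α_ x e c).inv) ≫ ((x ◁ s ≫ (α_ x a b).inv) ▷ c) := by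
  have h' := congrArg (x ◁ ·) h
  simp only [MonoidalCategory.whiskerLeft_comp] at h'
  have e1 : (α_ x a d).inv ≫ (x ⊗ a) ◁ t = x ◁ a ◁ t ≫ (α_ x a (b ⊗ c)).inv := by simp
  simp only [Category.assoc]
  rw [reassoc_of% e1, reassoc_of% h']
  simp

variable (K : AddFunctor Q Y)

theorem kappa_eq_tensor {U : C} (y : Y.Obj U) (q r : Q.Obj U) : kappa K y q r =
      ((y ◁ K.sumF q r) ≫ (α_ y (K.obj q) (K.obj r)).inv) := by
  have e1 (a b c d : Y.Obj U) (m : Y.FHom d (Y.add b c)) : ((a ◁ (m : d ⟶ b ⊗ c)) ≫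
    (α_ a b c).inv).1 = Y.addMap (𝟙 _) m.1 (by simp) ≫ (finv (Y.σ a b c)).1 := by
    have h0 : (finv (Y.σ a b c)).1 = ((α_ a b c).inv).1 :=
      finv_eq (congrArg FHom.val (α_ a b c).hom_inv_id)
    exact congrArg (Y.addMap (𝟙 (Tot.mk a)) m.1 (by simp) ≫ ·) h0.symm
  exact fhom_eq ((kappa_eq K y q r).trans (e1 _ _ _ _ (K.sumF q r)).symm)

theorem kappa_assoc {U : C} (x : Y.Obj U) (q r s : Q.Obj U) :
    Y.addMap (𝟙 _) (K.map (Q.σ q r s).1) (by simp) ≫ (kappa K x q (Q.add r s)).1 ≫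
        (kappa K (Y.add x (K.obj q)) r s).1 =
      (kappa K x (Q.add q r) s).1 ≫ Y.addMap (kappa K x q r).1 (𝟙 _) (by simp) := by
  have h := kappa_assoc_aux (D := Y.Obj U) x _ (K.sumF q (Q.add r s)) (K.sumF r s)
    (K.sumF (Q.add q r) s) (K.sumF q r) (K.sumF_assoc q r s)
  simp only [kappa_eq_tensor]
  exact congrArg FHom.val h

theorem kappa_zero_left_aux {D : Type*} [Category D] [MonoidalCategory D] (x : D) {p z a : D}
    (m : p ⟶ z ⊗ a) (v : z ⟶ 𝟙_ D) :
    (x ◁ m ≫ (α_ x z a).inv) ≫ ((x ◁ v ≫ (ρ_ x).hom) ▷ a) =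
      x ◁ (m ≫ v ▷ a ≫ (λ_ a).hom) := by
  simp

theorem kappa_zero_right_aux {D : Type*} [Category D] [MonoidalCategory D] (x : D) {p z a : D}
    (m : p ⟶ a ⊗ z) (v : z ⟶ 𝟙_ D) :
    (x ◁ m ≫ (α_ x a z).inv) ≫ ((x ⊗ a) ◁ v ≫ (ρ_ (x ⊗ a)).hom) =
      x ◁ (m ≫ a ◁ v ≫ (ρ_ a).hom) := by
  simp

theorem kappa_zero_left {U : C} (x : Y.Obj U) (q : Q.Obj U) :
    (kappa K x (Q.zero U) q).1 ≫ Y.addMap (translateZero K x).1 (𝟙 _) (by simp) =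
      Y.addMap (𝟙 _) (K.map (Q.zeroAdd q).1) (by simp) := by
  have h := kappa_zero_left_aux (D := Y.Obj U) x (K.sumF (Q.zero U) q) (K.unitF U)
  rw [kappa_eq_tensor]
  refine (congrArg FHom.val h).trans ?_
  exact Y.addMap_congr _ rfl (K.unit_left q)

theorem kappa_zero_right {U : C} (x : Y.Obj U) (q : Q.Obj U) :
    (kappa K x q (Q.zero U)).1 ≫ (translateZero K (Y.add x (K.obj q))).1 =
      Y.addMap (𝟙 _) (K.map (Q.addZero q).1) (by simp) := by
  have h := kappa_zero_right_aux (D := Y.Obj U) x (K.sumF q (Q.zero U)) (K.unitF U)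
  rw [kappa_eq_tensor]
  refine (congrArg FHom.val h).trans ?_
  exact Y.addMap_congr _ rfl (K.unit_right q)

theorem tensorμ_tensorμ {D : Type*} [Category D] [MonoidalCategory D] [SymmetricCategory D]
    (a b c d : D) : tensorμ a b c d ≫ tensorμ a c b d = 𝟙 _ := by
  have e : a ◁ (β_ b c).hom ▷ d ≫ a ◁ (β_ c b).hom ▷ d = 𝟙 _ := by
    rw [← MonoidalCategory.whiskerLeft_comp, ← comp_whiskerRight, SymmetricCategory.symmetry]
    simp
  simp only [tensorμ, Category.assoc, Iso.inv_hom_id_assoc, whiskerLeft_hom_inv_assoc,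
    reassoc_of% e]
  simp

theorem shuffle_zero_zero_aux {D : Type*} [Category D] [MonoidalCategory D] [SymmetricCategory D]
    (x y : D) {p z : D} (m : p ⟶ z ⊗ z) (v : z ⟶ 𝟙_ D) :
    ((x ⊗ y) ◁ m ≫ tensorμ x y z z) ≫ ((x ◁ v ≫ (ρ_ x).hom) ⊗ₘ (y ◁ v ≫ (ρ_ y).hom)) =
      (x ⊗ y) ◁ (m ≫ v ▷ z ≫ (λ_ z).hom) ≫ (x ⊗ y) ◁ v ≫ (ρ_ (x ⊗ y)).hom := by
  have h := rightUnitor_monoidal (C := D) x y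
  have h2 := tensorμ_natural (𝟙 x) (𝟙 y) v v
  rw [id_tensorHom_id, id_tensorHom, id_tensorHom, id_tensorHom] at h2
  have e : ((x ◁ v ≫ (ρ_ x).hom) ⊗ₘ (y ◁ v ≫ (ρ_ y).hom)) =
      ((x ◁ v) ⊗ₘ (y ◁ v)) ≫ ((ρ_ x).hom ⊗ₘ (ρ_ y).hom) := by simp
  have e' : (v ⊗ₘ v) ≫ (λ_ (𝟙_ D)).hom = v ▷ z ≫ (λ_ z).hom ≫ v := by
    rw [MonoidalCategory.tensorHom_def, Category.assoc, leftUnitor_naturality]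
  have h3 : tensorμ x y (𝟙_ D) (𝟙_ D) ≫ ((ρ_ x).hom ⊗ₘ (ρ_ y).hom) =
      (x ⊗ y) ◁ (λ_ (𝟙_ D)).hom ≫ (ρ_ (x ⊗ y)).hom := by
    rw [h, reassoc_of% tensorμ_tensorμ]
  rw [e, Category.assoc, ← reassoc_of% h2, h3]
  simp only [← MonoidalCategory.whiskerLeft_comp_assoc, Category.assoc, e']

theorem shuffle_zero_zero {U : C} (x y : Y.Obj U) :
    (shuffle K x y (Q.zero U) (Q.zero U)).1 ≫
        Y.addMap (translateZero K x).1 (translateZero K y).1 (by simp) =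
      Y.addMap (𝟙 _) (K.map (Q.zeroAdd (Q.zero U)).1) (by simp) ≫
        (translateZero K (Y.add x y)).1 := by
  have h := shuffle_zero_zero_aux (D := Y.Obj U) x y (K.sumF (Q.zero U) (Q.zero U)) (K.unitF U)
  rw [shuffle_eq]
  refine (congrArg FHom.val h).trans ?_
  exact congrArg (· ≫ (translateZero K (Y.add x y)).1) (Y.addMap_congr _ rfl (K.unit_left _))

theorem shuffle_zero_left_aux {D : Type*} [Category D] [MonoidalCategory D] [SymmetricCategory D]
    {x y p : D} (m : p ⟶ x ⊗ y) :
    ((𝟙_ D ⊗ 𝟙_ D) ◁ m ≫ tensorμ (𝟙_ D) (𝟙_ D) x y) ≫ ((λ_ x).hom ⊗ₘ (λ_ y).hom) =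
      (λ_ (𝟙_ D)).hom ▷ p ≫ (λ_ p).hom ≫ m := by
  rw [leftUnitor_monoidal, Category.assoc, reassoc_of% tensorμ_tensorμ, ← leftUnitor_naturality,
    whisker_exchange_assoc]

theorem shuffle_zero_left {U : C} (q r : Q.Obj U) :
    (shuffle K (Y.zero U) (Y.zero U) q r).1 ≫
        Y.addMap (Y.zeroAdd (K.obj q)).1 (Y.zeroAdd (K.obj r)).1 (by simp) =
      Y.addMap (Y.zeroAdd (Y.zero U)).1 (𝟙 _) (by simp) ≫ (Y.zeroAdd _).1 ≫ (K.sum q r).1 := by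
  rw [shuffle_eq]
  exact congrArg FHom.val (shuffle_zero_left_aux (D := Y.Obj U) (K.sumF q r))

/-- Objects of the quotient of `Y` by the image of `K`. -/
structure QuotObj (K : AddFunctor Q Y) (U : C) : Type (max u v w) where
  pt : Y.Obj U

/-- Representatives `x + K q → y` of the morphisms `x → y` of the quotient. -/
structure QuotRep {U V : C} (x : QuotObj K U) (y : QuotObj K V) : Type (max u v w) where
  q : Q.Obj U
  hom : Y.Hom (Y.add x.pt (K.obj q)) y.pt

/-- Equivalence of representatives. -/
def quotSetoid {U V : C} (x : QuotObj K U) (y : QuotObj K V) : Setoid (QuotRep K x y) where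
  r a b := ∃ u : Q.FHom a.q b.q, Y.addMap (𝟙 _) (K.map u.1) (by simp) ≫ b.hom = a.hom
  iseqv := by
    refine ⟨fun a => ⟨⟨𝟙 _, Q.π_id _⟩, ?_⟩, ?_, ?_⟩
    · rw [Y.addMap_congr _ rfl (K.map_id _), Y.addMap_id, Category.id_comp]
    · rintro a b ⟨u, hu⟩
      refine ⟨finv u, ?_⟩
      rw [← hu, Y.addMap_addMap_assoc]
      refine Eq.trans (congrArg (· ≫ b.hom) (Y.addMap_congr _ (Category.id_comp _)
        (ψ₂ := 𝟙 _) ?_)) ?_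
      · rw [← K.map_comp, finv_fhom, K.map_id]
      · rw [Y.addMap_id, Category.id_comp]
    · rintro a b c ⟨u, hu⟩ ⟨t, ht⟩
      refine ⟨⟨u.1 ≫ t.1, by simp⟩, ?_⟩
      rw [← hu, ← ht, Y.addMap_addMap_assoc]
      exact congrArg (· ≫ c.hom) (Y.addMap_congr _ (Category.id_comp _).symm (K.map_comp _ _))

/-- Morphisms of the quotient. -/
def QuotHom {U V : C} (x : QuotObj K U) (y : QuotObj K V) : Type (max u v w) :=
  Quotient (quotSetoid K x y)

variable {K} {U V W : C} {x : QuotObj K U} {y : QuotObj K V} {z : QuotObj K W}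

/-- The morphism of the quotient with a given representative. -/
def QuotHom.mk (x : QuotObj K U) (y : QuotObj K V) (q : Q.Obj U)
    (α : Y.Hom (Y.add x.pt (K.obj q)) y.pt) : QuotHom K x y := Quotient.mk _ ⟨q, α⟩

theorem QuotHom.ind {p : QuotHom K x y → Prop} (h : ∀ q α, p (QuotHom.mk x y q α))
    (f : QuotHom K x y) : p f := Quotient.ind (fun a => h a.q a.hom) f

theorem QuotHom.mk_eq_iff {q q' : Q.Obj U} {α : Y.Hom (Y.add x.pt (K.obj q)) y.pt}
    {β : Y.Hom (Y.add x.pt (K.obj q')) y.pt} : QuotHom.mk x y q α = QuotHom.mk x y q' β ↔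
      ∃ u : Q.FHom q q', Y.addMap (𝟙 _) (K.map u.1) (by simp) ≫ β = α :=
  ⟨fun h => Quotient.exact h, fun h => Quotient.sound h⟩

theorem QuotHom.sound {q q' : Q.Obj U} {α : Y.Hom (Y.add x.pt (K.obj q)) y.pt}
    {β : Y.Hom (Y.add x.pt (K.obj q')) y.pt} (u : Q.FHom q q')
    (h : Y.addMap (𝟙 _) (K.map u.1) (by simp) ≫ β = α) :
    QuotHom.mk x y q α = QuotHom.mk x y q' β := QuotHom.mk_eq_iff.2 ⟨u, h⟩

/-- The morphism of the base under a morphism of the quotient. -/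
def QuotHom.base (f : QuotHom K x y) : U ⟶ V :=
  Quotient.lift (fun a => Y.π a.hom) (by
    rintro a b ⟨u, hu⟩
    rw [← hu]; simp) f

@[simp] theorem QuotHom.base_mk (q : Q.Obj U) (α : Y.Hom (Y.add x.pt (K.obj q)) y.pt) :
    (QuotHom.mk x y q α).base = Y.π α := rfl

/-- A representative of the composite. -/
noncomputable def compRep {q r' : Q.Obj U} {r : Q.Obj V}
    (α : Y.Hom (Y.add x.pt (K.obj q)) y.pt) (β : Y.Hom (Y.add y.pt (K.obj r)) z.pt)
    (p : Q.Hom r' r) (h : Y.π α = Q.π p) : Y.Hom (Y.add x.pt (K.obj (Q.add q r'))) z.pt :=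
  (kappa K x.pt q r').1 ≫ Y.addMap α (K.map p) (by simp [h]) ≫ β

theorem compRep_rel {q r' q₁ r₁' : Q.Obj U} {r r₁ : Q.Obj V}
    {α : Y.Hom (Y.add x.pt (K.obj q)) y.pt} {β : Y.Hom (Y.add y.pt (K.obj r)) z.pt}
    {α₁ : Y.Hom (Y.add x.pt (K.obj q₁)) y.pt} {β₁ : Y.Hom (Y.add y.pt (K.obj r₁)) z.pt}
    (p : Q.Hom r' r) (h : Y.π α = Q.π p) (p₁ : Q.Hom r₁' r₁) (h₁ : Y.π α₁ = Q.π p₁)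
    (e : QuotHom.mk x y q α = QuotHom.mk x y q₁ α₁)
    (e' : QuotHom.mk y z r β = QuotHom.mk y z r₁ β₁) :
    QuotHom.mk x z _ (compRep α β p h) = QuotHom.mk x z _ (compRep α₁ β₁ p₁ h₁) := by
  obtain ⟨u, rfl⟩ := QuotHom.mk_eq_iff.1 e
  obtain ⟨t, rfl⟩ := QuotHom.mk_eq_iff.1 e'
  have h2 : Q.π (p ≫ t.1) = Q.π p₁ := by simp [← h, ← h₁]
  refine QuotHom.sound (Q.addF u (facF (p ≫ t.1) p₁ h2)) ?_
  simp only [compRep, addF]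
  have := kappa_natural K (𝟙 (Tot.mk x.pt)) u.1 (facF (p ≫ t.1) p₁ h2).1 (by simp) (by simp)
  rw [reassoc_of% this, Y.addMap_addMap_assoc, Y.addMap_addMap_assoc]
  refine congrArg (fun f => (kappa K x.pt q r').1 ≫ f ≫ β₁) (Y.addMap_congr _ ?_ ?_)
  · rw [Category.comp_id]
  · rw [← K.map_comp, facF_comp, K.map_comp]

/-- Composition of the quotient. -/
noncomputable def QuotHom.comp (f : QuotHom K x y) (g : QuotHom K y z) : QuotHom K x z :=
  Quotient.lift₂ (fun a b => QuotHom.mk x z _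
    (compRep a.hom b.hom (pullHom (Y.π a.hom) b.q) (by simp)))
    (fun _ _ _ _ h h' => compRep_rel _ _ _ _ (Quotient.sound h) (Quotient.sound h')) f g

theorem QuotHom.mk_comp {q r' : Q.Obj U} {r : Q.Obj V}
    (α : Y.Hom (Y.add x.pt (K.obj q)) y.pt) (β : Y.Hom (Y.add y.pt (K.obj r)) z.pt)
    (p : Q.Hom r' r) (h : Y.π α = Q.π p) : (QuotHom.mk x y q α).comp (QuotHom.mk y z r β) =
      QuotHom.mk x z _ (compRep α β p h) :=
  compRep_rel _ _ _ _ rfl rfl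

theorem QuotHom.base_comp (f : QuotHom K x y) (g : QuotHom K y z) :
    (f.comp g).base = f.base ≫ g.base := by
  induction f using QuotHom.ind with | _ q α
  induction g using QuotHom.ind with | _ r β
  rw [QuotHom.mk_comp α β (pullHom (Y.π α) r) (by simp)]
  simp [compRep]

theorem QuotHom.assoc {Z : C} {t : QuotObj K Z} (f : QuotHom K x y) (g : QuotHom K y z)
    (k : QuotHom K z t) : (f.comp g).comp k = f.comp (g.comp k) := by
  induction f using QuotHom.ind with | _ q α
  induction g using QuotHom.ind with | _ r β
  induction k using QuotHom.ind with | _ s γ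
  let p := pullHom (Y.π α) r
  let m := pullHom (Y.π β) s
  let m' := pullHom (Y.π α) (Q.pull (Y.π β) s)
  have hm : Q.π p = Q.π m' := by simp [p, m']
  rw [QuotHom.mk_comp α β p (by simp [p]), QuotHom.mk_comp β γ m (by simp [m]),
    QuotHom.mk_comp (compRep α β p _) γ (m' ≫ m) (by simp [compRep, m, m']),
    QuotHom.mk_comp α (compRep β γ m _) (Q.addMap p m' hm) (by simp [p])]
  refine QuotHom.sound (Q.σ _ _ _) ?_
  simp only [compRep]
  have h1 := kappa_natural K α p m' (by simp [p]) hm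
  have h2 := kappa_assoc K x.pt q (Q.pull (Y.π α) r) (Q.pull (Y.π α) (Q.pull (Y.π β) s))
  rw [reassoc_of% h1, reassoc_of% h2, Y.addMap_addMap_assoc, Y.addMap_addMap_assoc]
  refine congrArg (fun f => (kappa K x.pt _ _).1 ≫ f ≫ γ) (Y.addMap_congr _ ?_ ?_)
  · rw [Category.assoc]
  · rw [Category.id_comp, K.map_comp]

/-- The image of a morphism of `Y` in the quotient. -/
noncomputable def QuotHom.of (x : QuotObj K U) (y : QuotObj K V) (φ : Y.Hom x.pt y.pt) :
    QuotHom K x y :=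
  QuotHom.mk x y (Q.zero U) ((translateZero K x.pt).1 ≫ φ)

theorem QuotHom.base_of (φ : Y.Hom x.pt y.pt) : (QuotHom.of x y φ).base = Y.π φ := by
  simp [QuotHom.of]

theorem QuotHom.of_comp_mk (φ : Y.Hom x.pt y.pt) {r' : Q.Obj U} {r : Q.Obj V}
    (β : Y.Hom (Y.add y.pt (K.obj r)) z.pt) (p : Q.Hom r' r) (h : Y.π φ = Q.π p) :
    (QuotHom.of x y φ).comp (QuotHom.mk y z r β) =
      QuotHom.mk x z r' (Y.addMap φ (K.map p) (by simp [h]) ≫ β) := by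
  rw [QuotHom.of, QuotHom.mk_comp _ β p (by simp [h])]
  refine QuotHom.sound (Q.zeroAdd _) ?_
  simp only [compRep]
  rw [← kappa_zero_left, Category.assoc, Y.addMap_addMap_assoc]
  exact congrArg (fun f => (kappa K x.pt _ _).1 ≫ f ≫ β) (Y.addMap_congr _ rfl
    (Category.id_comp _))

theorem QuotHom.mk_comp_of {q : Q.Obj U} (α : Y.Hom (Y.add x.pt (K.obj q)) y.pt)
    (φ : Y.Hom y.pt z.pt) : (QuotHom.mk x y q α).comp (QuotHom.of y z φ) =
      QuotHom.mk x z q (α ≫ φ) := by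
  rw [QuotHom.of, QuotHom.mk_comp α _ (Q.zeroMap (Y.π α)) (by simp)]
  refine QuotHom.sound (Q.addZero _) ?_
  simp only [compRep]
  have h := translateZero_natural K α
  rw [reassoc_of% h, ← Category.assoc (kappa K _ _ _).1, kappa_zero_right]

theorem QuotHom.of_comp_of (φ : Y.Hom x.pt y.pt) (ψ : Y.Hom y.pt z.pt) :
    (QuotHom.of x y φ).comp (QuotHom.of y z ψ) = QuotHom.of x z (φ ≫ ψ) := by
  rw [QuotHom.of, QuotHom.mk_comp_of, QuotHom.of, Category.assoc]

theorem QuotHom.id_comp (f : QuotHom K x y) : (QuotHom.of x x (𝟙 _)).comp f = f := by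
  induction f using QuotHom.ind with | _ q α
  rw [QuotHom.of_comp_mk (𝟙 _) α (𝟙 _) (by simp)]
  refine congrArg (QuotHom.mk x y q) ?_
  rw [Y.addMap_congr _ rfl (K.map_id _), Y.addMap_id, Category.id_comp]

theorem QuotHom.comp_id (f : QuotHom K x y) : f.comp (QuotHom.of y y (𝟙 _)) = f := by
  induction f using QuotHom.ind with | _ q α
  rw [QuotHom.mk_comp_of, Category.comp_id]

theorem QuotHom.of_cancel (φ : Y.Hom y.pt z.pt) {f g : QuotHom K x y} (hb : f.base = g.base)
    (h : f.comp (QuotHom.of y z φ) = g.comp (QuotHom.of y z φ)) : f = g := by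
  induction f using QuotHom.ind with | _ q α
  induction g using QuotHom.ind with | _ r β
  rw [QuotHom.mk_comp_of, QuotHom.mk_comp_of] at h
  obtain ⟨u, hu⟩ := QuotHom.mk_eq_iff.1 h
  refine QuotHom.sound u (FibGpd.hom_ext φ ?_ (by rw [Category.assoc, hu]))
  rw [QuotHom.base_mk, QuotHom.base_mk] at hb
  simp [hb]

theorem QuotHom.exists_fac_of (f : QuotHom K x z) (φ : Y.Hom y.pt z.pt) (h : U ⟶ V)
    (e : h ≫ Y.π φ = f.base) : ∃ k : QuotHom K x y, k.base = h ∧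
      k.comp (QuotHom.of y z φ) = f := by
  induction f using QuotHom.ind with | _ q α
  replace e : h ≫ Y.π φ = Y.π α := e
  refine ⟨QuotHom.mk x y q (fac α φ h e), by simp, ?_⟩
  rw [QuotHom.mk_comp_of, fac_comp]

theorem QuotHom.exists_right_inv {x y : QuotObj K U} (f : QuotHom K x y) (hf : f.base = 𝟙 U) :
    ∃ g : QuotHom K y x, g.base = 𝟙 U ∧ f.comp g = QuotHom.of x x (𝟙 _) := by
  induction f using QuotHom.ind with | _ q α
  replace hf : Y.π α = 𝟙 U := hf
  obtain ⟨m, ⟨ν⟩⟩ := Q.exists_neg q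
  let α' : Y.FHom (Y.add x.pt (K.obj q)) y.pt := ⟨α, hf⟩
  refine ⟨QuotHom.mk y x m (Y.addMap (finv α').1 (𝟙 _) (by simp) ≫ (finv (kappa K x.pt q m)).1 ≫
    Y.addMap (𝟙 _) (K.map ν.1) (by simp) ≫ (translateZero K x.pt).1), by simp, ?_⟩
  rw [QuotHom.mk_comp α _ (𝟙 _) (by simp [hf])]
  refine QuotHom.sound ν ?_
  simp only [compRep]
  rw [Y.addMap_addMap_assoc, Category.comp_id, Y.addMap_congr _ (fhom_finv α')
    ((Category.comp_id _).trans (K.map_id _)), Y.addMap_id, Category.id_comp, fhom_finv_assoc]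

@[simp] theorem π_compRep {q r' : Q.Obj U} {r : Q.Obj V}
    (α : Y.Hom (Y.add x.pt (K.obj q)) y.pt) (β : Y.Hom (Y.add y.pt (K.obj r)) z.pt)
    (p : Q.Hom r' r) (h : Y.π α = Q.π p) : Y.π (compRep α β p h) = Y.π α ≫ Y.π β := by
  simp [compRep]

/-- A chosen representative. -/
noncomputable def QuotHom.rep (f : QuotHom K x y) : QuotRep K x y := Quotient.out f

theorem QuotHom.mk_rep (f : QuotHom K x y) : QuotHom.mk x y f.rep.q f.rep.hom = f :=
  Quotient.out_eq f

theorem QuotHom.π_rep (f : QuotHom K x y) : Y.π f.rep.hom = f.base :=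
  congrArg QuotHom.base f.mk_rep

/-- The sum of objects of the quotient. -/
abbrev QuotObj.add (x x' : QuotObj K U) : QuotObj K U := ⟨Y.add x.pt x'.pt⟩

/-- A representative of the sum. -/
noncomputable def addRep {x' : QuotObj K U} {y' : QuotObj K V} {q q' : Q.Obj U}
    (α : Y.Hom (Y.add x.pt (K.obj q)) y.pt) (α' : Y.Hom (Y.add x'.pt (K.obj q')) y'.pt)
    (h : Y.π α = Y.π α') :
    Y.Hom (Y.add (x.add x').pt (K.obj (Q.add q q'))) (y.add y').pt :=
  (shuffle K x.pt x'.pt q q').1 ≫ Y.addMap α α' h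

theorem π_addRep {x' : QuotObj K U} {y' : QuotObj K V} {q q' : Q.Obj U}
    (α : Y.Hom (Y.add x.pt (K.obj q)) y.pt) (α' : Y.Hom (Y.add x'.pt (K.obj q')) y'.pt)
    (h : Y.π α = Y.π α') : Y.π (addRep α α' h) = Y.π α := by
  exact ((Y.π_comp _ _).trans (congrArg₂ (· ≫ ·) (FHom.property _) (Y.π_addMap _ _ _))).trans
    (Category.id_comp _)

theorem addRep_rel {x' : QuotObj K U} {y' : QuotObj K V} {q q' r r' : Q.Obj U}
    {α : Y.Hom (Y.add x.pt (K.obj q)) y.pt} {α' : Y.Hom (Y.add x'.pt (K.obj q')) y'.pt}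
    {β : Y.Hom (Y.add x.pt (K.obj r)) y.pt} {β' : Y.Hom (Y.add x'.pt (K.obj r')) y'.pt}
    (h : Y.π α = Y.π α') (h' : Y.π β = Y.π β') (e : QuotHom.mk x y q α = QuotHom.mk x y r β)
    (e' : QuotHom.mk x' y' q' α' = QuotHom.mk x' y' r' β') :
    QuotHom.mk (x.add x') (y.add y') (Q.add q q') (addRep α α' h) =
      QuotHom.mk (x.add x') (y.add y') (Q.add r r') (addRep β β' h') := by
  obtain ⟨u, rfl⟩ := QuotHom.mk_eq_iff.1 e
  obtain ⟨t, rfl⟩ := QuotHom.mk_eq_iff.1 e'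
  refine QuotHom.sound (Q.addF u t) ?_
  have := shuffle_natural K (𝟙 (Tot.mk x.pt)) (𝟙 (Tot.mk x'.pt)) u.1 t.1 (by simp) (by simp)
    (by simp)
  have e2 : Y.addMap (Y.addMap (𝟙 (Tot.mk x.pt)) (K.map u.1) (by simp) ≫ β)
      (Y.addMap (𝟙 (Tot.mk x'.pt)) (K.map t.1) (by simp) ≫ β') h = _ :=
    Y.addMap_comp _ _ _ _ (by simp) h'
  unfold addRep
  rw [e2, ← reassoc_of% this]
  exact congrArg (· ≫ (shuffle K x.pt x'.pt r r').1 ≫ Y.addMap β β' h')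
    (Y.addMap_congr _ (Y.addMap_id _ _).symm rfl)

/-- The sum of morphisms of the quotient. -/
noncomputable def QuotHom.add {x' : QuotObj K U} {y' : QuotObj K V} (f : QuotHom K x y)
    (g : QuotHom K x' y') (h : f.base = g.base) : QuotHom K (x.add x') (y.add y') :=
  QuotHom.mk _ _ _ (addRep f.rep.hom g.rep.hom (by rw [f.π_rep, g.π_rep, h]))

theorem QuotHom.mk_add {x' : QuotObj K U} {y' : QuotObj K V} {q q' : Q.Obj U}
    (α : Y.Hom (Y.add x.pt (K.obj q)) y.pt) (α' : Y.Hom (Y.add x'.pt (K.obj q')) y'.pt)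
    (h : Y.π α = Y.π α') : (QuotHom.mk x y q α).add (QuotHom.mk x' y' q' α') h =
      QuotHom.mk (x.add x') (y.add y') (Q.add q q') (addRep α α' h) :=
  addRep_rel _ _ (QuotHom.mk_rep _) (QuotHom.mk_rep _)

theorem QuotHom.base_add {x' : QuotObj K U} {y' : QuotObj K V} (f : QuotHom K x y)
    (g : QuotHom K x' y') (h : f.base = g.base) : (f.add g h).base = f.base := by
  induction f using QuotHom.ind with | _ q α
  induction g using QuotHom.ind with | _ q' α'
  rw [QuotHom.mk_add α α' h]
  exact π_addRep α α' h

theorem QuotHom.of_add_of {x' : QuotObj K U} {y' : QuotObj K V} (φ : Y.Hom x.pt y.pt)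
    (ψ : Y.Hom x'.pt y'.pt) (h : Y.π φ = Y.π ψ) :
    (QuotHom.of x y φ).add (QuotHom.of x' y' ψ) (by rw [base_of, base_of, h]) =
      QuotHom.of (x.add x') (y.add y') (Y.addMap φ ψ h) := by
  refine (QuotHom.mk_add _ _ (by simp [h])).trans (QuotHom.sound (Q.zeroAdd _) ?_)
  simp only [addRep, QuotObj.add]
  rw [Y.addMap_comp _ _ _ _ (by simp) h, ← Category.assoc, ← Category.assoc, shuffle_zero_zero]

theorem QuotHom.add_comp {x' : QuotObj K U} {y' : QuotObj K V} {z' : QuotObj K W}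
    (f : QuotHom K x y) (g : QuotHom K y z) (f' : QuotHom K x' y') (g' : QuotHom K y' z')
    (h : f.base = f'.base) (h' : g.base = g'.base) :
    (f.comp g).add (f'.comp g') (by rw [base_comp, base_comp, h, h']) =
      (f.add f' h).comp (g.add g' h') := by
  induction f using QuotHom.ind with | _ q α
  induction g using QuotHom.ind with | _ r β
  induction f' using QuotHom.ind with | _ q' α'
  induction g' using QuotHom.ind with | _ r' β'
  replace h : Y.π α = Y.π α' := h
  replace h' : Y.π β = Y.π β' := h'
  let p := pullHom (Y.π α) r
  let p' := pullHom (Y.π α) r'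
  have hp : Q.π p = Q.π p' := by simp [p, p']
  have e1 := QuotHom.mk_comp α β p (by simp [p])
  have e2 := QuotHom.mk_comp α' β' p' (by simp [p', h])
  have h3 : Y.π (compRep α β p (by simp [p])) = Y.π (compRep α' β' p' (by simp [p', h])) := by
    simp [h, h']
  have e3 : ((QuotHom.mk x y q α).comp (QuotHom.mk y z r β)).add
      ((QuotHom.mk x' y' q' α').comp (QuotHom.mk y' z' r' β'))
        (by rw [base_comp, base_comp]; exact congrArg₂ (· ≫ ·) h h') =
      QuotHom.mk (x.add x') (z.add z') _ (addRep _ _ h3) := by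
    simp only [e1, e2]
    exact QuotHom.mk_add _ _ h3
  rw [e3, QuotHom.mk_add α α' h, QuotHom.mk_add β β' h', QuotHom.mk_comp _ _ (Q.addMap p p' hp)
    ((π_addRep α α' h).trans ((π_pullHom _ _).symm.trans (Q.π_addMap _ _ _).symm))]
  let w := tensorμ (C := Q.Obj U) q (Q.pull (Y.π α) r) q' (Q.pull (Y.π α) r')
  let w' := tensorμ (C := Q.Obj U) q q' (Q.pull (Y.π α) r) (Q.pull (Y.π α) r')
  refine (QuotHom.sound w' ?_).symm
  have k1 := shuffle_kappa K x.pt x'.pt q q' (Q.pull (Y.π α) r) (Q.pull (Y.π α) r')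
  have k2 := shuffle_natural K α α' p p' h (by simp [p]) (by simp [p', h])
  have k3 : addRep (compRep α β p (by simp [p])) (compRep α' β' p' (by simp [p', h])) h3 =
      (shuffle K x.pt x'.pt _ _).1 ≫ Y.addMap (kappa K x.pt q _).1 (kappa K x'.pt q' _).1
        (by simp) ≫ Y.addMap (Y.addMap α (K.map p) (by simp [p])) (Y.addMap α' (K.map p')
          (by simp [p', h])) (by simp [h]) ≫ Y.addMap β β' h' := by
    rw [Y.addMap_addMap, Y.addMap_addMap]
    rfl
  have k4 : compRep (addRep α α' h) (addRep β β' h') (Q.addMap p p' hp)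
      ((π_addRep α α' h).trans ((π_pullHom _ _).symm.trans (Q.π_addMap _ _ _).symm)) =
      (kappa K (Y.add x.pt x'.pt) (Q.add q q') _).1 ≫ Y.addMap (shuffle K x.pt x'.pt q q').1 (𝟙 _)
        (by simp) ≫ Y.addMap (Y.addMap α α' h) (K.map (Q.addMap p p' hp)) (by simp [p]) ≫
          (shuffle K y.pt y'.pt r r').1 ≫ Y.addMap β β' h' := by
    rw [Y.addMap_addMap_assoc]
    refine congrArg (fun f => (kappa K (Y.add x.pt x'.pt) (Q.add q q') _).1 ≫ f ≫
      (shuffle K y.pt y'.pt r r').1 ≫ Y.addMap β β' h') (Y.addMap_congr _ rfl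
        (Category.id_comp _).symm)
  rw [k3]
  refine Eq.trans ?_ k4.symm
  rw [reassoc_of% k2, reassoc_of% k1]

theorem QuotHom.exists_inv {x y : QuotObj K U} (f : QuotHom K x y) (hf : f.base = 𝟙 U) :
    ∃ g : QuotHom K y x, g.base = 𝟙 U ∧ f.comp g = QuotHom.of x x (𝟙 _) ∧
      g.comp f = QuotHom.of y y (𝟙 _) := by
  obtain ⟨g, hg, h⟩ := f.exists_right_inv hf
  obtain ⟨k, hk, h'⟩ := g.exists_right_inv hg
  have : f = k := by
    rw [← QuotHom.comp_id f, ← h', ← QuotHom.assoc, h, QuotHom.id_comp]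
  exact ⟨g, hg, h, this ▸ h'⟩

theorem QuotHom.exists_fac (f : QuotHom K x z) (g : QuotHom K y z) (h : U ⟶ V)
    (e : h ≫ g.base = f.base) : ∃! k : QuotHom K x y, k.base = h ∧ k.comp g = f := by
  let y' : QuotObj K V := ⟨Y.pull g.base z.pt⟩
  let a : QuotHom K y' z := QuotHom.of y' z (pullHom g.base z.pt)
  obtain ⟨g₀, hg₀, hg⟩ := g.exists_fac_of (y := y') (pullHom g.base z.pt) (𝟙 V) (by simp)
  obtain ⟨j, hj, h1, h2⟩ := g₀.exists_inv hg₀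
  obtain ⟨k, hk, hk'⟩ := f.exists_fac_of (y := y') (pullHom g.base z.pt) h
    (by rw [← e]; simp)
  refine ⟨k.comp j, ⟨by rw [base_comp, hk, hj, Category.comp_id], ?_⟩, ?_⟩
  · rw [← hg, QuotHom.assoc, ← QuotHom.assoc j, h2, QuotHom.id_comp]
    exact hk'
  · rintro k' ⟨hb, hk''⟩
    have : k'.comp g₀ = k := by
      refine QuotHom.of_cancel (pullHom g.base z.pt) ?_ ?_
      · rw [base_comp, hb, hg₀, hk, Category.comp_id]
      · rw [hk', QuotHom.assoc, hg, hk'']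
    rw [← this, QuotHom.assoc, h1, QuotHom.comp_id]

theorem QuotHom.σ_natural {x₁ x₂ x₃ : QuotObj K U} {y₁ y₂ y₃ : QuotObj K V}
    (f₁ : QuotHom K x₁ y₁) (f₂ : QuotHom K x₂ y₂) (f₃ : QuotHom K x₃ y₃)
    (h : f₁.base = f₂.base) (h' : f₂.base = f₃.base) :
    ((f₁.add f₂ h).add f₃ (by rw [base_add, h, h'])).comp
        (QuotHom.of _ (y₁.add (y₂.add y₃)) (Y.σ y₁.pt y₂.pt y₃.pt).1) =
      (QuotHom.of _ (x₁.add (x₂.add x₃)) (Y.σ x₁.pt x₂.pt x₃.pt).1).comp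
        (f₁.add (f₂.add f₃ h') (by rw [base_add, h])) := by
  induction f₁ using QuotHom.ind with | _ q₁ α₁
  induction f₂ using QuotHom.ind with | _ q₂ α₂
  induction f₃ using QuotHom.ind with | _ q₃ α₃
  replace h : Y.π α₁ = Y.π α₂ := h
  replace h' : Y.π α₂ = Y.π α₃ := h'
  have e1 := QuotHom.mk_add α₁ α₂ h
  have e2 := QuotHom.mk_add α₂ α₃ h'
  have h1 : Y.π (addRep α₁ α₂ h) = Y.π α₃ := (π_addRep _ _ _).trans (h.trans h')
  have h2 : Y.π α₁ = Y.π (addRep α₂ α₃ h') := h.trans (π_addRep _ _ _).symm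
  have e3 : ((QuotHom.mk x₁ y₁ q₁ α₁).add (QuotHom.mk x₂ y₂ q₂ α₂) h).add
      (QuotHom.mk x₃ y₃ q₃ α₃) ((QuotHom.base_add _ _ _).trans (h.trans h')) =
      QuotHom.mk _ _ _ (addRep (addRep α₁ α₂ h) α₃ h1) := by
    simp only [e1]
    exact QuotHom.mk_add _ _ h1
  have e4 : (QuotHom.mk x₁ y₁ q₁ α₁).add ((QuotHom.mk x₂ y₂ q₂ α₂).add
      (QuotHom.mk x₃ y₃ q₃ α₃) h') ((show (QuotHom.mk x₁ y₁ q₁ α₁).base =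
        (QuotHom.mk x₂ y₂ q₂ α₂).base from h).trans (QuotHom.base_add _ _ _).symm) =
      QuotHom.mk _ _ _ (addRep α₁ (addRep α₂ α₃ h') h2) := by
    simp only [e2]
    exact QuotHom.mk_add _ _ h2
  rw [e3, e4, QuotHom.mk_comp_of, QuotHom.of_comp_mk _ _ (𝟙 _) (by simp)]
  refine QuotHom.sound (Q.σ q₁ q₂ q₃) ?_
  have k1 := shuffle_σ K x₁.pt x₂.pt x₃.pt q₁ q₂ q₃
  have k2 := Y.σ_natural α₁ α₂ α₃ h h'
  have k3 : addRep (addRep α₁ α₂ h) α₃ h1 = (shuffle K (Y.add x₁.pt x₂.pt) x₃.pt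
      (Q.add q₁ q₂) q₃).1 ≫ Y.addMap (shuffle K x₁.pt x₂.pt q₁ q₂).1 (𝟙 _) (by simp) ≫
        Y.addMap (Y.addMap α₁ α₂ h) α₃ (by simp [h, h']) := by
    rw [Y.addMap_addMap]
    exact congrArg _ (Y.addMap_congr _ rfl (Category.id_comp _).symm)
  have k4 : addRep α₁ (addRep α₂ α₃ h') h2 = (shuffle K x₁.pt (Y.add x₂.pt x₃.pt)
      q₁ (Q.add q₂ q₃)).1 ≫ Y.addMap (𝟙 _) (shuffle K x₂.pt x₃.pt q₂ q₃).1 (by simp) ≫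
        Y.addMap α₁ (Y.addMap α₂ α₃ h') (by simp [h]) := by
    rw [Y.addMap_addMap]
    exact congrArg _ (Y.addMap_congr _ (Category.id_comp _).symm rfl)
  rw [k3, k4]
  simp only [Category.assoc]
  rw [k2, Y.addMap_addMap_assoc, ← reassoc_of% k1]
  refine congrArg (· ≫ (shuffle K x₁.pt (Y.add x₂.pt x₃.pt) q₁ (Q.add q₂ q₃)).1 ≫
    Y.addMap (𝟙 _) (shuffle K x₂.pt x₃.pt q₂ q₃).1 (by simp) ≫
        Y.addMap α₁ (Y.addMap α₂ α₃ h') (by simp [h])) (Y.addMap_congr _ (Category.id_comp _) ?_)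
  rw [K.map_id, Category.comp_id]

theorem QuotHom.τ_natural {x₁ x₂ : QuotObj K U} {y₁ y₂ : QuotObj K V}
    (f₁ : QuotHom K x₁ y₁) (f₂ : QuotHom K x₂ y₂) (h : f₁.base = f₂.base) :
    (f₁.add f₂ h).comp (QuotHom.of _ (y₂.add y₁) (Y.τ y₁.pt y₂.pt).1) =
      (QuotHom.of _ (x₂.add x₁) (Y.τ x₁.pt x₂.pt).1).comp (f₂.add f₁ h.symm) := by
  induction f₁ using QuotHom.ind with | _ q₁ α₁
  induction f₂ using QuotHom.ind with | _ q₂ α₂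
  replace h : Y.π α₁ = Y.π α₂ := h
  rw [QuotHom.mk_add α₁ α₂ h, QuotHom.mk_add α₂ α₁ h.symm, QuotHom.mk_comp_of,
    QuotHom.of_comp_mk _ _ (𝟙 _) (by simp)]
  refine QuotHom.sound (Q.τ q₁ q₂) ?_
  have k1 := shuffle_τ K x₁.pt x₂.pt q₁ q₂
  have k2 := Y.τ_natural α₁ α₂ h
  unfold addRep
  rw [Category.assoc, k2, Y.addMap_addMap_assoc, ← reassoc_of% k1]
  refine congrArg (· ≫ (shuffle K x₂.pt x₁.pt q₂ q₁).1 ≫ Y.addMap α₂ α₁ h.symm)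
    (Y.addMap_congr _ (Category.id_comp _) ?_)
  rw [K.map_id, Category.comp_id]

theorem QuotHom.zeroAdd_natural (f : QuotHom K x y) :
    ((QuotHom.of (⟨Y.zero U⟩ : QuotObj K U) ⟨Y.zero V⟩ (Y.zeroMap f.base)).add f
        ((QuotHom.base_of _).trans (Y.π_zeroMap _))).comp
      (QuotHom.of _ y (Y.zeroAdd y.pt).1) =
      (QuotHom.of (QuotObj.add ⟨Y.zero U⟩ x) x (Y.zeroAdd x.pt).1).comp f := by
  induction f using QuotHom.ind with | _ q α
  have h : Y.π ((translateZero K (Y.zero U)).1 ≫ Y.zeroMap (Y.π α)) = Y.π α := by simp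
  have e : (QuotHom.of (⟨Y.zero U⟩ : QuotObj K U) ⟨Y.zero V⟩ (Y.zeroMap (Y.π α))).add
      (QuotHom.mk x y q α) ((QuotHom.base_of _).trans (Y.π_zeroMap _)) = _ :=
    QuotHom.mk_add (x := ⟨Y.zero U⟩) (y := ⟨Y.zero V⟩) _ _ h
  refine (congrArg (fun f => QuotHom.comp f (QuotHom.of _ y (Y.zeroAdd y.pt).1)) e).trans ?_
  rw [QuotHom.mk_comp_of, QuotHom.of_comp_mk _ _ (𝟙 _) (by simp)]
  refine QuotHom.sound (Q.zeroAdd q) ?_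
  have k1 := shuffle_zero K x.pt q
  have k2 := Y.zeroAdd_natural α
  have k3 : addRep (x := (⟨Y.zero U⟩ : QuotObj K U)) (y := ⟨Y.zero V⟩) _ _ h =
      (shuffle K (Y.zero U) x.pt (Q.zero U) q).1 ≫ Y.addMap (translateZero K (Y.zero U)).1 (𝟙 _)
        (by simp) ≫ Y.addMap (Y.zeroMap (Y.π α)) α (by simp) := by
    rw [Y.addMap_addMap]
    exact congrArg _ (Y.addMap_congr _ rfl (Category.id_comp _).symm)
  rw [k3]
  simp only [Category.assoc]
  rw [k2, Y.addMap_addMap_assoc, reassoc_of% k1]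
  refine congrArg (· ≫ α) (Y.addMap_congr _ (Category.id_comp _) ?_)
  rw [K.map_id, Category.comp_id]

/-- The quotient of `Y` by the image of `K`, whose morphisms `x → y` are the classes of the
morphisms `x + K q → y`. -/
noncomputable def quot (K : AddFunctor Q Y) : PicardFib.{w} C where
  Obj U := QuotObj K U
  cat :=
    { Hom := fun x y => QuotHom K x.pt y.pt
      id := fun x => QuotHom.of x.pt x.pt (𝟙 _)
      comp := fun f g => QuotHom.comp f g
      id_comp := fun f => QuotHom.id_comp f
      comp_id := fun f => QuotHom.comp_id f
      assoc := fun f g h => QuotHom.assoc f g h }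
  π f := QuotHom.base f
  π_id x := (QuotHom.base_of _).trans (Y.π_id _)
  π_comp f g := QuotHom.base_comp f g
  exists_lift f y := ⟨⟨Y.pull f y.pt⟩, QuotHom.of _ _ (pullHom f y.pt),
    (QuotHom.base_of _).trans (π_pullHom _ _)⟩
  cartesian f g h e := QuotHom.exists_fac f g h e
  add x y := x.add y
  addMap f g h := f.add g h
  π_addMap f g h := QuotHom.base_add f g h
  addMap_id x y := (QuotHom.of_add_of (𝟙 _) (𝟙 _) (by simp)).trans
    (congrArg (QuotHom.of (x.add y) (x.add y)) (Y.addMap_id _ _))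
  addMap_comp f g f' g' h h' := QuotHom.add_comp f g f' g' h h'
  σ x y z := ⟨QuotHom.of ((x.add y).add z) (x.add (y.add z)) (Y.σ x.pt y.pt z.pt).1,
    (QuotHom.base_of _).trans (FHom.property _)⟩
  σ_natural f g k h h' := QuotHom.σ_natural f g k h h'
  τ x y := ⟨QuotHom.of (x.add y) (y.add x) (Y.τ x.pt y.pt).1,
    (QuotHom.base_of _).trans (FHom.property _)⟩
  τ_natural f g h := QuotHom.τ_natural f g h
  pentagon x y z t := by
    refine (congrArg₂ QuotHom.comp (QuotHom.of_add_of _ _ (by simp)) (congrArg₂ QuotHom.comp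
      rfl (QuotHom.of_add_of _ _ (by simp)))).trans ?_
    refine (congrArg (QuotHom.comp _) (QuotHom.of_comp_of _ _)).trans ?_
    refine (QuotHom.of_comp_of _ _).trans (Eq.trans ?_ (QuotHom.of_comp_of _ _).symm)
    exact congrArg (QuotHom.of _ _) (Y.pentagon x.pt y.pt z.pt t.pt)
  hexagon x y z := by
    refine Eq.trans ?_ (congrArg₂ QuotHom.comp (QuotHom.of_add_of _ _ (by simp))
      (congrArg₂ QuotHom.comp rfl (QuotHom.of_add_of _ _ (by simp)))).symm
    refine Eq.trans ?_ (congrArg (QuotHom.comp _) (QuotHom.of_comp_of _ _)).symm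
    refine (congrArg (QuotHom.comp _) (QuotHom.of_comp_of _ _)).trans ?_
    refine (QuotHom.of_comp_of _ _).trans (Eq.trans ?_ (QuotHom.of_comp_of _ _).symm)
    exact congrArg (QuotHom.of _ _) (Y.hexagon x.pt y.pt z.pt)
  τ_τ x y := (QuotHom.of_comp_of _ _).trans (congrArg (QuotHom.of _ _) (Y.τ_τ _ _))
  τ_self x := congrArg (QuotHom.of _ _) (Y.τ_self _)
  zero U := ⟨Y.zero U⟩
  zeroMap f := QuotHom.of ⟨_⟩ ⟨_⟩ (Y.zeroMap f)
  π_zeroMap f := (QuotHom.base_of _).trans (Y.π_zeroMap f)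
  zeroMap_id U := congrArg (QuotHom.of _ _) (Y.zeroMap_id U)
  zeroMap_comp f g := (congrArg (QuotHom.of _ _) (Y.zeroMap_comp f g)).trans
    (QuotHom.of_comp_of (y := ⟨Y.zero _⟩) _ _).symm
  zeroAdd x := ⟨QuotHom.of (QuotObj.add ⟨_⟩ x) x (Y.zeroAdd x.pt).1,
    (QuotHom.base_of _).trans (FHom.property _)⟩
  zeroAdd_natural f := QuotHom.zeroAdd_natural f
  triangle x y := by
    refine Eq.trans ?_ (congrArg₂ QuotHom.comp (QuotHom.of_add_of _ _ (by simp))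
      (QuotHom.of_add_of _ _ (by simp))).symm
    refine (congrArg (QuotHom.comp _) (QuotHom.of_add_of _ _ (by simp))).trans ?_
    refine (QuotHom.of_comp_of _ _).trans (Eq.trans ?_ (QuotHom.of_comp_of _ _).symm)
    exact congrArg (QuotHom.of _ _) (Y.triangle x.pt y.pt)
  exists_neg x := by
    obtain ⟨y, ⟨φ⟩⟩ := Y.exists_neg x.pt
    exact ⟨⟨y⟩, ⟨⟨QuotHom.of _ _ φ.1, (QuotHom.base_of _).trans φ.2⟩⟩⟩

/-- The functor from `Y` to its quotient. -/
noncomputable def toQuot (K : AddFunctor Q Y) : AddFunctor Y (quot K) where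
  obj x := ⟨x⟩
  map {U V x y} φ := QuotHom.of (⟨x⟩ : QuotObj K U) ⟨y⟩ φ
  π_map φ := QuotHom.base_of _
  map_id x := rfl
  map_comp φ ψ := (QuotHom.of_comp_of _ _).symm
  sum x y := ⟨𝟙 _, FibGpd.π_id _ _⟩
  sum_natural φ ψ h := (Category.comp_id _).trans ((QuotHom.of_add_of φ ψ h).symm.trans
    (QuotHom.id_comp _).symm)
  map_σ x y z := by
    refine (congrArg (_ ≫ ·) ((Category.id_comp _).trans ((quot K).addMap_id _ _))).trans ?_
    refine Eq.trans ?_ ((Category.id_comp _).trans (congrArg (· ≫ _)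
      ((quot K).addMap_id _ _))).symm
    exact (QuotHom.comp_id _).trans (QuotHom.id_comp _).symm
  map_τ x y := (QuotHom.comp_id _).trans (QuotHom.id_comp _).symm

/-- The morphism `x → y` of the quotient given by a morphism `x + K q → y`. -/
def quotMk {U V : C} {x : Y.Obj U} {y : Y.Obj V} (q : Q.Obj U) (α : Y.Hom (Y.add x (K.obj q)) y) :
    (quot K).Hom ((toQuot K).obj x) ((toQuot K).obj y) := QuotHom.mk ⟨x⟩ ⟨y⟩ q α

section QuotMk

variable {x : Y.Obj U} {y : Y.Obj V} {z : Y.Obj W}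

theorem exists_quotMk (f : (quot K).Hom ((toQuot K).obj x) ((toQuot K).obj y)) :
    ∃ (q : Q.Obj U) (α : Y.Hom (Y.add x (K.obj q)) y), f = quotMk q α := by
  induction f using QuotHom.ind with | _ q α
  exact ⟨q, α, rfl⟩

theorem quotMk_eq_iff {q q' : Q.Obj U} {α : Y.Hom (Y.add x (K.obj q)) y}
    {β : Y.Hom (Y.add x (K.obj q')) y} : quotMk q α = quotMk q' β ↔
      ∃ u : Q.FHom q q', Y.addMap (𝟙 _) (K.map u.1) (by simp) ≫ β = α :=
  QuotHom.mk_eq_iff (x := ⟨x⟩) (y := ⟨y⟩)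

theorem map_quotMk (φ : Y.Hom x y) {r' : Q.Obj U} {r : Q.Obj V}
    (β : Y.Hom (Y.add y (K.obj r)) z) (p : Q.Hom r' r) (h : Y.π φ = Q.π p) :
    (toQuot K).map φ ≫ quotMk r β = quotMk r' (Y.addMap φ (K.map p) (by simp [h]) ≫ β) :=
  QuotHom.of_comp_mk (x := ⟨x⟩) (y := ⟨y⟩) (z := ⟨z⟩) φ β p h

theorem quotMk_map {q : Q.Obj U} (α : Y.Hom (Y.add x (K.obj q)) y) (φ : Y.Hom y z) :
    quotMk q α ≫ (toQuot K).map φ = quotMk q (α ≫ φ) :=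
  QuotHom.mk_comp_of (x := ⟨x⟩) (y := ⟨y⟩) (z := ⟨z⟩) α φ

theorem quotMk_addMap {x' : Y.Obj U} {y' : Y.Obj V} {q q' : Q.Obj U}
    (α : Y.Hom (Y.add x (K.obj q)) y) (α' : Y.Hom (Y.add x' (K.obj q')) y')
    (h : Y.π α = Y.π α') : (quot K).addMap (quotMk q α) (quotMk q' α') h =
      quotMk (x := Y.add x x') (y := Y.add y y') (Q.add q q')
        ((shuffle K x x' q q').1 ≫ Y.addMap α α' h) :=
  QuotHom.mk_add (x := ⟨x⟩) (y := ⟨y⟩) (x' := ⟨x'⟩) (y' := ⟨y'⟩) α α' h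

end QuotMk

/-- The image of `K` is isomorphic to zero in the quotient. -/
noncomputable def quotNul (K : AddFunctor Q Y) : Hom ((toQuot K).comp K) (zero Q (quot K)) :=
  Hom.symm
    { app := fun {U} q => ⟨quotMk (x := Y.zero U) q (Y.zeroAdd (K.obj q)).1, (Y.zeroAdd _).2⟩
      naturality := fun {U V q r} φ => by
        refine (map_quotMk (Y.zeroMap (Q.π φ)) (Y.zeroAdd (K.obj r)).1 φ (by simp)).trans
          (Eq.trans ?_ (quotMk_map (Y.zeroAdd (K.obj q)).1 (K.map φ)).symm)
        have h := Y.zeroAdd_natural (K.map φ)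
        refine congrArg (quotMk q) (Eq.trans ?_ h)
        exact congrArg (· ≫ (Y.zeroAdd _).1) (Y.addMap_congr _ (by simp) rfl)
      app_add := fun {U} q r => by
        refine (cancel_epi ((quot K).zeroAdd ((quot K).zero U)).1).1 ?_
        refine Eq.trans ?_ (fhom_finv_assoc _ _).symm
        refine Eq.trans ?_ (quotMk_addMap (x := Y.zero U) (x' := Y.zero U)
          (Y.zeroAdd (K.obj q)).1 (Y.zeroAdd (K.obj r)).1 (by simp)).symm
        have e : (((toQuot K).comp K).sum q r).1 = (toQuot K).map (K.sum q r).1 :=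
          QuotHom.comp_id ((toQuot K).map (K.sum q r).1)
        refine (congrArg (fun t => ((quot K).zeroAdd ((quot K).zero U)).1 ≫
          quotMk (x := Y.zero U) _ (Y.zeroAdd (K.obj (Q.add q r))).1 ≫ t) e).trans ?_
        refine (congrArg (((quot K).zeroAdd ((quot K).zero U)).1 ≫ ·)
          (quotMk_map (Y.zeroAdd (K.obj (Q.add q r))).1 (K.sum q r).1)).trans ?_
        refine (map_quotMk (Y.zeroAdd (Y.zero U)).1 ((Y.zeroAdd (K.obj (Q.add q r))).1 ≫
          (K.sum q r).1) (𝟙 _) (by simp)).trans ?_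
        refine congrArg (quotMk _) (Eq.trans ?_ (shuffle_zero_left K q r).symm)
        exact congrArg (· ≫ _) (Y.addMap_congr _ rfl (K.map_id _)) }

end AddFunctor

end QuotientFib

end PicardStacks

namespace PicardStacks

open FibGpd PicardFib

section QuotientPrestack

variable {C : Type u} [Category.{v} C] {J : GrothendieckTopology C} {Q Y : PicardFib.{w} C}

namespace AddFunctor

/-- Faithfulness on the fibers. -/
def Faithful (K : AddFunctor Q Y) : Prop :=
  ∀ {U : C} {q q' : Q.Obj U} (u u' : Q.FHom q q'), K.map u.1 = K.map u'.1 → u = u'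

variable {K : AddFunctor Q Y}

theorem Faithful.map_inj (hK : K.Faithful) {U V : C} {q : Q.Obj U} {q' : Q.Obj V}
    {m m' : Q.Hom q q'} (h : Q.π m = Q.π m') (e : K.map m = K.map m') : m = m' := by
  have h1 : K.map (facF m m' h).1 = K.map (𝟙 _) := by
    refine FibGpd.hom_ext (K.map m') (by simp) ?_
    rw [← K.map_comp, facF_comp, e, K.map_id, Category.id_comp]
  have h2 := congrArg FHom.val (hK (facF m m' h) ⟨𝟙 _, Q.π_id _⟩ h1)
  rw [← facF_comp m m' h, h2]
  exact Category.id_comp _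

theorem Faithful.exists_of_local (hK : K.Faithful) (hQ : Q.IsPrestack J) (hY : Y.IsPrestack J)
    {U : C} {q q' : Q.Obj U} (k : Y.FHom (K.obj q) (K.obj q')) (R : Sieve U) (hR : R ∈ J U)
    (h : ∀ {V : C} (f : V ⟶ U), R f → ∃ (z : Q.Obj V) (c : Q.Hom z q) (m : Q.Hom z q'),
      Q.π c = f ∧ K.map m = K.map c ≫ k.1) : ∃ u : Q.FHom q q', K.map u.1 = k.1 := by
  have hm {V : C} {z : Q.Obj V} {c : Q.Hom z q} {m : Q.Hom z q'}
      (h : K.map m = K.map c ≫ k.1) : Q.π m = Q.π c := by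
    have := congrArg Y.π h
    simpa using this
  obtain ⟨u, hu, hu'⟩ := hQ.glue (x := q) (y := q') (𝟙 U)
    (fun c m => K.map m = K.map c ≫ k.1)
    (fun c m e => (hm e).trans (Category.comp_id _).symm)
    (fun c m m' e e' => hK.map_inj ((hm e).trans (hm e').symm) (e.trans e'.symm))
    (fun b c m e => by rw [K.map_comp, K.map_comp, e, Category.assoc]) R hR h
  refine ⟨⟨u, hu⟩, hY.hom_ext _ _ (by simp [hu]) R hR fun f hf => ?_⟩
  obtain ⟨z, c, m, hc, e⟩ := h f hf
  refine ⟨_, K.map c, by simp [hc], ?_⟩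
  rw [← e, ← hu' c m e, K.map_comp]

theorem map_pullHom_comp {U V W : C} {x : Y.Obj U} {y : Y.Obj W} {f : V ⟶ U}
    {z : (quot K).Obj V} (c : (quot K).Hom z ((toQuot K).obj x)) (hc : (quot K).π c = f)
    (β : (quot K).Hom ((toQuot K).obj x) ((toQuot K).obj y)) :
    (facF ((toQuot K).map (pullHom f x)) c (by simp [hc])).1 ≫ c ≫ β =
      (toQuot K).map (pullHom f x) ≫ β := by
  rw [facF_comp_assoc]

theorem quot_hom_ext (hK : K.Faithful) (hQ : Q.IsPrestack J) (hY : Y.IsPrestack J)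
    {U V : C} {x : Y.Obj U} {y : Y.Obj V} (β β' : (quot K).Hom ((toQuot K).obj x)
      ((toQuot K).obj y)) (hβ : (quot K).π β = (quot K).π β') (R : Sieve U) (hR : R ∈ J U)
    (h : ∀ {W : C} (f : W ⟶ U), R f → (toQuot K).map (pullHom f x) ≫ β =
      (toQuot K).map (pullHom f x) ≫ β') : β = β' := by
  obtain ⟨q, b, rfl⟩ := exists_quotMk β
  obtain ⟨q', b', rfl⟩ := exists_quotMk β'
  replace hβ : Y.π b = Y.π b' := hβ
  obtain ⟨k, hk⟩ := exists_addMap_id_left (facF b b' hβ)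
  have key : ∃ u : Q.FHom q q', K.map u.1 = k.1 := by
    refine hK.exists_of_local hQ hY k R hR fun {W} f hf => ?_
    have e := h f hf
    rw [map_quotMk _ _ (pullHom f q) (by simp), map_quotMk _ _ (pullHom f q') (by simp)] at e
    obtain ⟨u, hu⟩ := quotMk_eq_iff.1 e
    refine ⟨_, pullHom f q, u.1 ≫ pullHom f q', by simp, ?_⟩
    rw [Y.addMap_addMap_assoc] at hu
    refine Y.addMap_left_inj (φ := pullHom f x) (by simp) (by simp) ?_
    refine FibGpd.hom_ext b' (by simp) ?_
    have e2 : Y.addMap (pullHom f x) (K.map (pullHom f q)) (by simp) ≫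
        Y.addMap (𝟙 _) k.1 (by simp) =
        Y.addMap (pullHom f x) (K.map (pullHom f q) ≫ k.1) (by simp) := by
      rw [Y.addMap_addMap]; exact Y.addMap_congr _ (Category.comp_id _) rfl
    rw [← e2, hk, Category.assoc, facF_comp, ← hu]
    exact congrArg (· ≫ b') (Y.addMap_congr _ (Category.id_comp _).symm (K.map_comp _ _))
  obtain ⟨u, hu⟩ := key
  refine quotMk_eq_iff.2 ⟨u, ?_⟩
  have e : Y.addMap (𝟙 (Tot.mk x)) (K.map u.1) (by simp) = (facF b b' hβ).1 :=
    (Y.addMap_congr _ rfl hu).trans hk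
  rw [e, facF_comp]

theorem quot_glue (hK : K.Faithful) (hQ' : Q.HasGluing J)
    (hY : Y.IsPrestack J) {U U' : C} {x : Y.Obj U} {y : Y.Obj U'} (g : U ⟶ U') (R : Sieve U)
    (hR : R ∈ J U) (m : ∀ {V : C} (f : V ⟶ U), R f → (quot K).Hom ((toQuot K).obj (Y.pull f x))
      ((toQuot K).obj y)) (hm : ∀ {V : C} (f : V ⟶ U) (hf : R f), (quot K).π (m f hf) = f ≫ g)
    (hm' : ∀ {V W : C} {f : V ⟶ U} {k : W ⟶ U} (hf : R f) (hk : R k) (t : W ⟶ V) (h : t ≫ f = k),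
      (toQuot K).map (fac (pullHom k x) (pullHom f x) t (by simp [h])) ≫ m f hf = m k hk) :
    ∃ β : (quot K).Hom ((toQuot K).obj x) ((toQuot K).obj y), (quot K).π β = g ∧
      ∀ {V : C} (f : V ⟶ U) (hf : R f), (toQuot K).map (pullHom f x) ≫ β = m f hf := by
  have h1 : ∀ (V : C) (f : V ⟶ U) (hf : R f), ∃ (q : Q.Obj V)
      (α : Y.Hom (Y.add (Y.pull f x) (K.obj q)) y), m f hf = quotMk q α :=
    fun V f hf => exists_quotMk (m f hf)
  choose q α hα using h1
  have hπ : ∀ {V : C} (f : V ⟶ U) (hf : R f), Y.π (α V f hf) = f ≫ g := fun f hf => by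
    have := hm f hf
    rw [hα] at this
    exact this
  have h2 : ∀ (V W : C) (f : V ⟶ U) (k : W ⟶ U) (hf : R f) (hk : R k) (t : W ⟶ V)
      (h : t ≫ f = k), ∃ (s : Q.Hom (q W k hk) (q V f hf)) (hs : Q.π s = t),
        Y.addMap (fac (pullHom k x) (pullHom f x) t (by simp [h])) (K.map s) (by simp [hs]) ≫
          α V f hf = α W k hk := by
    intro V W f k hf hk t h
    have e := hm' hf hk t h
    rw [hα, hα, map_quotMk _ _ (pullHom t (q V f hf)) (by simp)] at e
    obtain ⟨u, hu⟩ := quotMk_eq_iff.1 e.symm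
    refine ⟨u.1 ≫ pullHom t _, by simp, ?_⟩
    rw [← hu, Y.addMap_addMap_assoc]
    exact congrArg (· ≫ α V f hf) (Y.addMap_congr _ (Category.id_comp _).symm (K.map_comp _ _))
  have hu : ∀ {V W : C} {f : V ⟶ U} {k : W ⟶ U} (hf : R f) (hk : R k) (t : W ⟶ V)
      (h : t ≫ f = k) (s s' : Q.Hom (q W k hk) (q V f hf)) (hs : Q.π s = t) (hs' : Q.π s' = t),
        Y.addMap (fac (pullHom k x) (pullHom f x) t (by simp [h])) (K.map s) (by simp [hs]) ≫
          α V f hf = α W k hk →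
        Y.addMap (fac (pullHom k x) (pullHom f x) t (by simp [h])) (K.map s') (by simp [hs']) ≫
          α V f hf = α W k hk → s = s' := by
    intro V W f k hf hk t h s s' hs hs' e e'
    refine hK.map_inj (hs.trans hs'.symm) ?_
    refine Y.addMap_left_inj (φ := fac (pullHom k x) (pullHom f x) t (by simp [h]))
      (by simp [hs]) (by simp [hs']) ?_
    exact FibGpd.hom_ext (α V f hf) (by simp) (e.trans e'.symm)
  choose s hs hs' using h2
  let sec : Q.Sec R :=
    { obj := fun {V} f hf => q V f hf
      map := fun {V W f k} hf hk t h => s V W f k hf hk t h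
      π_map := fun hf hk t h => hs _ _ _ _ hf hk t h
      map_id := fun {V f} hf => by
        refine hu hf hf (𝟙 V) (Category.id_comp f) _ _ (hs _ _ _ _ _ _ _ _) (by simp)
          (hs' _ _ _ _ _ _ _ _) ?_
        have e : fac (pullHom f x) (pullHom f x) (𝟙 V) (by simp) = 𝟙 _ :=
          FibGpd.hom_ext (pullHom f x) (by simp) (by simp)
        rw [Y.addMap_congr _ e (K.map_id _), Y.addMap_id, Category.id_comp]
      map_comp := fun {V W T f k l} hf hk hl t h t' h' => by
        refine hu hf hl (t' ≫ t) (by simp [h, h']) _ _ (hs _ _ _ _ _ _ _ _)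
          (by simp [hs]) (hs' _ _ _ _ _ _ _ _) ?_
        have e : fac (pullHom l x) (pullHom f x) (t' ≫ t) (by simp [h, h']) =
          fac (pullHom l x) (pullHom k x) t' (by simp [h']) ≫
            fac (pullHom k x) (pullHom f x) t (by simp [h]) :=
          FibGpd.hom_ext (pullHom f x) (by simp) (by simp)
        rw [Y.addMap_congr _ e (K.map_comp _ _), Y.addMap_comp _ _ _ _ (by simp [hs])
          (by simp [hs]), Category.assoc, hs' _ _ _ _ hf hk t h, hs' _ _ _ _ hk hl t' h'] }
  obtain ⟨b, l, hl, hl'⟩ := hQ' R hR sec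
  have hl'' {V W : C} {f : V ⟶ U} {k : W ⟶ U} (hf : R f) (hk : R k) (t : W ⟶ V)
    (h : t ≫ f = k) : s V W f k hf hk t h ≫ l f hf = l k hk := hl' hf hk t h
  obtain ⟨β, hβ, hβ'⟩ := hY.glue_pieces (x := Y.add x (K.obj b)) (y := y) g
    (ι := Σ V : C, {f : V ⟶ U // R f}) (V := fun i => i.1)
    (z := fun i => Y.add (Y.pull i.2.1 x) (K.obj (q i.1 i.2.1 i.2.2)))
    (fun i => Y.addMap (pullHom i.2.1 x) (K.map (l i.2.1 i.2.2)) (by rw [K.π_map, hl]; simp))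
    (fun i => α i.1 i.2.1 i.2.2) (fun i => by rw [hπ]; simp) (by
      rintro ⟨V, f, hf⟩ ⟨V', f', hf'⟩ W k k' hk
      simp only [Y.π_addMap, π_pullHom] at hk
      have hR' : R (k ≫ f) := R.downward_closed hf k
      refine ⟨Y.add (Y.pull (k ≫ f) x) (K.obj (q W (k ≫ f) hR')),
        Y.addMap (fac (pullHom _ x) (pullHom f x) k (by simp)) (K.map (s _ _ _ _ hf hR' k rfl))
          (by simp [hs]),
        Y.addMap (fac (pullHom _ x) (pullHom f' x) k' (by simp [hk]))
          (K.map (s _ _ _ _ hf' hR' k' hk.symm)) (by simp [hs]), by simp, by simp, ?_, ?_⟩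
      · rw [Y.addMap_addMap, Y.addMap_addMap]
        refine Y.addMap_congr _ (by simp) ?_
        rw [← K.map_comp, ← K.map_comp, hl'', hl'']
      · rw [hs', hs']) R hR (fun {W} f hf => ⟨⟨W, f, hf⟩, 𝟙 _, by simp⟩)
  refine ⟨quotMk b β, hβ, fun {V} f hf => ?_⟩
  rw [map_quotMk _ _ (l f hf) (by rw [hl]; simp), hα]
  exact congrArg (quotMk _) (hβ' ⟨V, f, hf⟩)

theorem quot_glue_rel (hK : K.Faithful) (hQ : Q.IsPrestack J) (hQ' : Q.HasGluing J)
    (hY : Y.IsPrestack J) {U U' : C} {x : Y.Obj U} {y : Y.Obj U'} (g : U ⟶ U')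
    (M : ∀ {V : C} {z : (quot K).Obj V}, (quot K).Hom z ((toQuot K).obj x) →
      (quot K).Hom z ((toQuot K).obj y) → Prop)
    (h1 : ∀ {V : C} {z : (quot K).Obj V} (c : (quot K).Hom z ((toQuot K).obj x))
      (m : (quot K).Hom z ((toQuot K).obj y)), M c m → (quot K).π m = (quot K).π c ≫ g)
    (h2 : ∀ {V : C} {z : (quot K).Obj V} (c : (quot K).Hom z ((toQuot K).obj x))
      (m m' : (quot K).Hom z ((toQuot K).obj y)), M c m → M c m' → m = m')
    (h3 : ∀ {V W : C} {z : (quot K).Obj V} {z' : (quot K).Obj W} (b : (quot K).Hom z' z)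
      (c : (quot K).Hom z ((toQuot K).obj x)) (m : (quot K).Hom z ((toQuot K).obj y)),
        M c m → M (b ≫ c) (b ≫ m))
    (R : Sieve U) (hR : R ∈ J U) (h4 : ∀ {V : C} (f : V ⟶ U), R f →
      ∃ (z : (quot K).Obj V) (c : (quot K).Hom z ((toQuot K).obj x))
        (m : (quot K).Hom z ((toQuot K).obj y)), (quot K).π c = f ∧ M c m) :
    ∃ β : (quot K).Hom ((toQuot K).obj x) ((toQuot K).obj y), (quot K).π β = g ∧
      ∀ {V : C} {z : (quot K).Obj V} (c : (quot K).Hom z ((toQuot K).obj x))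
        (m : (quot K).Hom z ((toQuot K).obj y)), M c m → c ≫ β = m := by
  have h5 : ∀ (V : C) (f : V ⟶ U), R f → ∃ m : (quot K).Hom ((toQuot K).obj (Y.pull f x))
      ((toQuot K).obj y), M ((toQuot K).map (pullHom f x)) m := by
    intro V f hf
    obtain ⟨z, c, m, hc, hm⟩ := h4 f hf
    have := h3 (facF ((toQuot K).map (pullHom f x)) c (by simp [hc])).1 c m hm
    rw [facF_comp] at this
    exact ⟨_, this⟩
  choose m hm using h5
  obtain ⟨β, hβ, hβ'⟩ := quot_glue hK hQ' hY g R hR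
    (fun {V} f hf => m V f hf) (fun {V} f hf => by rw [h1 _ _ (hm V f hf)]; simp)
    (fun {V W f k} hf hk t h => by
      have := h3 ((toQuot K).map (fac (pullHom k x) (pullHom f x) t (by simp [h])))
        _ _ (hm V f hf)
      rw [← (toQuot K).map_comp, fac_comp] at this
      exact h2 _ _ _ this (hm W k hk))
  refine ⟨β, hβ, fun {V z} c n hn => ?_⟩
  have hπ : (quot K).π (c ≫ β) = (quot K).π n := by rw [FibGpd.π_comp, hβ, h1 c n hn]
  refine quot_hom_ext (x := z.pt) hK hQ hY (c ≫ β) n hπ (R.pullback ((quot K).π c))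
    (J.pullback_stable _ hR) fun {W} f hf => ?_
  let p : (quot K).Hom ((toQuot K).obj (Y.pull f z.pt)) z := (toQuot K).map (pullHom f z.pt)
  have hp : (quot K).π p = f := ((toQuot K).π_map _).trans (π_pullHom _ _)
  have e : (quot K).π (p ≫ c) = (quot K).π ((toQuot K).map (pullHom (f ≫ (quot K).π c) x)) := by
    rw [FibGpd.π_comp, hp]; simp
  have e1 := facF_comp (p ≫ c) ((toQuot K).map (pullHom (f ≫ (quot K).π c) x)) e
  have e2 := h3 (facF (p ≫ c) ((toQuot K).map (pullHom (f ≫ (quot K).π c) x)) e).1 _ _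
    (hm W (f ≫ (quot K).π c) hf)
  rw [e1] at e2
  have e3 := h2 _ _ _ e2 (h3 p c n hn)
  refine Eq.trans ?_ e3
  refine (Category.assoc p c β).symm.trans ?_
  rw [← hβ' _ hf]
  refine Eq.trans ?_ (Category.assoc _ _ _)
  rw [e1]

/-- The quotient by a stack under a faithful functor is a prestack. -/
theorem quot_isPrestack (hK : K.Faithful) (hQ : Q.IsPrestack J) (hQ' : Q.HasGluing J)
    (hY : Y.IsPrestack J) : (quot K).IsPrestack J where
  hom_ext {U U' x y} β β' e R hR h := by
    refine quot_hom_ext (x := x.pt) (y := y.pt) hK hQ hY β β' e R hR fun {W} f hf => ?_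
    obtain ⟨z, c, hc, e⟩ := h f hf
    rw [← map_pullHom_comp (x := x.pt) (y := y.pt) c hc β,
      ← map_pullHom_comp (x := x.pt) (y := y.pt) c hc β']
    exact congrArg (_ ≫ ·) e
  glue {U U' x y} g M h1 h2 h3 R hR h4 :=
    quot_glue_rel (x := x.pt) (y := y.pt) hK hQ hQ' hY g M h1 h2 h3 R hR h4

theorem quotNul_spec {U : C} (q : Q.Obj U) :
    quotMk (x := Y.zero U) q (Y.zeroAdd (K.obj q)).1 ≫ (nul (quotNul K) q).1 = 𝟙 _ :=
  fhom_finv (P := (quot K).toFibGpd) (U := U)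
    ⟨quotMk (x := Y.zero U) q (Y.zeroAdd (K.obj q)).1, (Y.zeroAdd _).2⟩

theorem quotNul_spec' {U : C} (q : Q.Obj U) :
    (nul (quotNul K) q).1 ≫ quotMk (x := Y.zero U) q (Y.zeroAdd (K.obj q)).1 = 𝟙 _ :=
  finv_fhom (P := (quot K).toFibGpd) (U := U)
    ⟨quotMk (x := Y.zero U) q (Y.zeroAdd (K.obj q)).1, (Y.zeroAdd _).2⟩

theorem quot_isCok (hK : K.Faithful) : IsCok (quotNul K) J where
  surj {U} t := ⟨⊤, J.top_mem U, fun {V} f _ =>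
    ⟨Y.pull f t.pt, (toQuot K).map (pullHom f t.pt), ((toQuot K).π_map _).trans (π_pullHom _ _)⟩⟩
  full {U} q q' φ h := by
    have h1 := congrArg (quotMk (x := Y.zero U) q (Y.zeroAdd (K.obj q)).1 ≫ · ≫
      quotMk (x := Y.zero U) q' (Y.zeroAdd (K.obj q')).1) h
    have h2 : quotMk (x := Y.zero U) q (Y.zeroAdd (K.obj q)).1 ≫ (toQuot K).map φ.1 =
        quotMk (x := Y.zero U) q' (Y.zeroAdd (K.obj q')).1 := by
      refine Eq.trans ?_ (h1.trans ?_)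
      · refine congrArg (_ ≫ ·) ?_
        exact ((Category.assoc _ _ _).trans ((congrArg (_ ≫ ·) (quotNul_spec' q')).trans
          (Category.comp_id _))).symm
      · exact (Category.assoc _ _ _).symm.trans ((congrArg (· ≫ _) (quotNul_spec q)).trans
          (Category.id_comp _))
    rw [quotMk_map] at h2
    obtain ⟨u, hu⟩ := quotMk_eq_iff.1 h2
    have h3 := Y.zeroAdd_natural (K.map u.1)
    have h4 : K.map u.1 = φ.1 := by
      rw [← cancel_epi (Y.zeroAdd (K.obj q)).1, ← hu, ← h3]
      exact congrArg (· ≫ (Y.zeroAdd (K.obj q')).1) (Y.addMap_congr _ (by simp) rfl)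
    exact ⟨u, h4, fun u' hu' => hK _ _ (hu'.trans h4.symm)⟩
  ess {U} y i := by
    obtain ⟨q, α, hα⟩ := exists_quotMk (x := Y.zero U) (finv i).1
    have hα' : Y.π α = 𝟙 U := (congrArg (quot K).π hα).symm.trans (finv i).2
    refine ⟨q, ⟨(finv (Y.zeroAdd (K.obj q))).1 ≫ α, by simp [hα']⟩, ?_⟩
    have e : quotMk (x := Y.zero U) q (Y.zeroAdd (K.obj q)).1 ≫
        (toQuot K).map ((finv (Y.zeroAdd (K.obj q))).1 ≫ α) = (finv i).1 := by
      rw [quotMk_map, fhom_finv_assoc]; exact hα.symm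
    have e2 : (quotMk (x := Y.zero U) q (Y.zeroAdd (K.obj q)).1 ≫
        (toQuot K).map ((finv (Y.zeroAdd (K.obj q))).1 ≫ α)) ≫ i.1 = 𝟙 _ :=
      (congrArg (· ≫ i.1) e).trans (finv_fhom i)
    have e3 := congrArg ((nul (quotNul K) q).1 ≫ ·) e2
    refine Eq.trans ?_ (e3.trans (Category.comp_id _))
    refine Eq.trans ?_ (congrArg ((nul (quotNul K) q).1 ≫ ·) (Category.assoc _ _ _).symm)
    exact ((Category.assoc _ _ _).symm.trans ((congrArg (· ≫ _) (quotNul_spec' q)).trans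
      (Category.id_comp _))).symm

/-- Cokernels up to a fully faithful and locally essentially surjective functor. -/
theorem IsCok.comp {T S : PicardFib.{w} C} {L : AddFunctor Y T} {n : Hom (L.comp K) (zero Q T)}
    (h : IsCok n J) (A : AddFunctor T S) (hA : A.Faithful)
    (hA' : ∀ {U : C} {x y : T.Obj U} (φ : S.FHom (A.obj x) (A.obj y)),
      ∃ ψ : T.FHom x y, A.map ψ.1 = φ.1)
    (hA'' : A.LocEssSurj J) : IsCok (mapNul n A) J where
  surj {U} t := by
    obtain ⟨R, hR, h1⟩ := hA'' t
    let R' : Sieve U :=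
      { arrows := fun V f => ∃ (y : Y.Obj V) (a : S.Hom ((A.comp L).obj y) t), S.π a = f
        downward_closed := by
          rintro V W _ ⟨y, a, rfl⟩ g
          exact ⟨Y.pull g y, (A.comp L).map (pullHom g y) ≫ a, by simp⟩ }
    refine ⟨R', J.transitive hR R' fun V f hf => ?_, fun f hf => hf⟩
    obtain ⟨y, a, rfl⟩ := h1 f hf
    obtain ⟨R₁, hR₁, h2⟩ := h.surj y
    refine J.superset_covering (fun W g hg => ?_) hR₁
    obtain ⟨z, b, rfl⟩ := h2 g hg
    exact ⟨z, A.map b ≫ a, (S.π_comp _ _).trans (congrArg (· ≫ S.π a) (A.π_map b))⟩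
  full {U} q q' φ e := by
    refine h.full q q' φ ?_
    rw [nul_mapNul, nul_mapNul] at e
    have e1 : A.map (L.map φ.1 ≫ (nul n q').1) = A.map (nul n q).1 := by
      rw [A.map_comp, ← cancel_mono (A.unit U).1, Category.assoc]
      exact e
    exact congrArg FHom.val (hA ⟨L.map φ.1 ≫ (nul n q').1, by simp⟩ (nul n q) e1)
  ess {U} y i := by
    let i' : S.FHom (A.obj (L.obj y)) (S.zero U) := i
    obtain ⟨j, hj⟩ := hA' (x := L.obj y) (y := T.zero U) ⟨i'.1 ≫ (finv (A.unit U)).1, by simp⟩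
    obtain ⟨q, φ, hφ⟩ := h.ess y j
    refine ⟨q, φ, ?_⟩
    rw [nul_mapNul, ← hφ, A.map_comp, hj]
    exact ((Category.assoc _ _ _).trans (congrArg (_ ≫ ·) ((Category.assoc _ _ _).trans
      ((congrArg (i'.1 ≫ ·) (finv_fhom _)).trans (Category.comp_id _))))).symm

end AddFunctor

end QuotientPrestack

end PicardStacks

namespace PicardStacks

open FibGpd PicardFib

section Stackification

namespace FibGpd

variable {C : Type u} [Category.{v} C] {J : GrothendieckTopology C} {D : FibGpd.{w} C}

/-- The map of a cartesian section between equal arguments. -/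
def Sec.tr {U : C} {R : Sieve U} (s : D.Sec R) {V : C} {f k : V ⟶ U} (hf : R f) (hk : R k)
    (e : f = k) : D.FHom (s.obj f hf) (s.obj k hk) :=
  ⟨s.map hk hf (𝟙 V) (by rw [e, Category.id_comp]), s.π_map _ _ _ _⟩

@[simp] theorem Sec.tr_self {U : C} {R : Sieve U} (s : D.Sec R) {V : C} {f : V ⟶ U} (hf : R f)
    (hk : R f) (e : f = f) : (s.tr hf hk e).1 = 𝟙 _ := s.map_id hf

variable (J D) in
/-- Objects of the associated stack: sections over covering sieves. -/
structure StkObj (U : C) : Type (max u v w) where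
  R : Sieve U
  mem : R ∈ J U
  s : D.Sec R

/-- Morphisms of the associated stack. -/
structure StkHom {U V : C} (x : StkObj J D U) (y : StkObj J D V) : Type (max u v w) where
  base : U ⟶ V
  app : ∀ {W : C} (h : W ⟶ U) (k : W ⟶ V), h ≫ base = k → ∀ (hx : x.R h) (hy : y.R k),
    D.FHom (x.s.obj h hx) (y.s.obj k hy)
  nat : ∀ {W W' : C} (a : W' ⟶ W) {h : W ⟶ U} {k : W ⟶ V} (e : h ≫ base = k) (hx : x.R h)
    (hy : y.R k) {h' : W' ⟶ U} {k' : W' ⟶ V} (e' : h' ≫ base = k') (hx' : x.R h') (hy' : y.R k')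
    (ah : a ≫ h = h') (ak : a ≫ k = k'), x.s.map hx hx' a ah ≫ (app h k e hx hy).1 =
      (app h' k' e' hx' hy').1 ≫ y.s.map hy hy' a ak

namespace StkHom

variable {U V W : C} {x : StkObj J D U} {y : StkObj J D V} {z : StkObj J D W}

theorem ext {φ ψ : StkHom x y} (hb : φ.base = ψ.base)
    (h : ∀ {T : C} (h : T ⟶ U) (k : T ⟶ V) (e : h ≫ φ.base = k) (e' : h ≫ ψ.base = k)
      (hx : x.R h) (hy : y.R k), (φ.app h k e hx hy).1 = (ψ.app h k e' hx hy).1) : φ = ψ := by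
  cases φ with | mk b a n
  cases ψ with | mk b' a' n'
  obtain rfl : b = b' := hb
  have : @a = @a' := by
    funext T h' k e hx hy
    exact FHom.ext (h h' k e e hx hy)
  subst this
  rfl

theorem congr_app {φ ψ : StkHom x y} (h : φ = ψ) {T : C} (t : T ⟶ U) (k : T ⟶ V)
    (e : t ≫ φ.base = k) (e' : t ≫ ψ.base = k) (hx : x.R t) (hy : y.R k) :
    (φ.app t k e hx hy).1 = (ψ.app t k e' hx hy).1 := by subst h; rfl

theorem ext_local (hD : D.IsPrestack J) {φ ψ : StkHom x y} (hb : φ.base = ψ.base) (R : Sieve U)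
    (hR : R ∈ J U) (h : ∀ {T : C} (h : T ⟶ U) (k : T ⟶ V) (e : h ≫ φ.base = k)
      (e' : h ≫ ψ.base = k) (hx : x.R h) (hy : y.R k), R h →
        (φ.app h k e hx hy).1 = (ψ.app h k e' hx hy).1) : φ = ψ := by
  refine ext hb fun {T} t k e e' hx hy => ?_
  refine hD.hom_ext _ _ ((π_val _).trans (π_val _).symm) (R.pullback t)
    (J.pullback_stable t hR) fun {T'} a ha => ?_
  have e1 : (a ≫ t) ≫ φ.base = a ≫ k := by rw [Category.assoc, e]
  have e2 : (a ≫ t) ≫ ψ.base = a ≫ k := by rw [Category.assoc, e']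
  have h1 := x.R.downward_closed hx a
  have h2 := y.R.downward_closed hy a
  refine ⟨_, x.s.map hx h1 a rfl, x.s.π_map _ _ _ _, ?_⟩
  rw [φ.nat a e hx hy e1 h1 h2 rfl rfl, ψ.nat a e' hx hy e2 h1 h2 rfl rfl,
    h (a ≫ t) (a ≫ k) e1 e2 h1 h2 ha]

theorem ext_id {x y : StkObj J D U} {φ ψ : StkHom x y} (hb : φ.base = 𝟙 U) (hb' : ψ.base = 𝟙 U)
    (h : ∀ {T : C} (h : T ⟶ U) (e : h ≫ φ.base = h) (e' : h ≫ ψ.base = h)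
      (hx : x.R h) (hy : y.R h), (φ.app h h e hx hy).1 = (ψ.app h h e' hx hy).1) : φ = ψ := by
  refine ext (hb.trans hb'.symm) fun {T} t k e e' hx hy => ?_
  obtain rfl : t = k := by rw [← e, hb, Category.comp_id]
  exact h t e e' hx hy

theorem exists_glue (hD : D.IsPrestack J) (g : U ⟶ V) (R : Sieve U) (hR : R ∈ J U)
    (a : ∀ {T : C} (h : T ⟶ U) (k : T ⟶ V), h ≫ g = k → ∀ (hx : x.R h) (hy : y.R k), R h →
      D.FHom (x.s.obj h hx) (y.s.obj k hy))
    (ha : ∀ {T T' : C} (b : T' ⟶ T) {h : T ⟶ U} {k : T ⟶ V} (e : h ≫ g = k) (hx : x.R h)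
      (hy : y.R k) (hr : R h) {h' : T' ⟶ U} {k' : T' ⟶ V} (e' : h' ≫ g = k') (hx' : x.R h')
      (hy' : y.R k') (hr' : R h') (ah : b ≫ h = h') (ak : b ≫ k = k'),
      x.s.map hx hx' b ah ≫ (a h k e hx hy hr).1 =
        (a h' k' e' hx' hy' hr').1 ≫ y.s.map hy hy' b ak)
    {T : C} (h : T ⟶ U) (k : T ⟶ V) (e : h ≫ g = k) (hx : x.R h) (hy : y.R k) :
    ∃ c : D.FHom (x.s.obj h hx) (y.s.obj k hy), ∀ {T' : C} (b : T' ⟶ T) {h' : T' ⟶ U}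
      {k' : T' ⟶ V} (e' : h' ≫ g = k') (hx' : x.R h') (hy' : y.R k') (hr' : R h')
      (ah : b ≫ h = h') (ak : b ≫ k = k'),
      x.s.map hx hx' b ah ≫ c.1 = (a h' k' e' hx' hy' hr').1 ≫ y.s.map hy hy' b ak := by
  let ι := {i : Σ T' : C, T' ⟶ T // R (i.2 ≫ h)}
  have hx1 (i : ι) : x.R (i.1.2 ≫ h) := x.R.downward_closed hx _
  have hy1 (i : ι) : y.R (i.1.2 ≫ k) := y.R.downward_closed hy _
  have he (i : ι) : (i.1.2 ≫ h) ≫ g = i.1.2 ≫ k := by rw [Category.assoc, e]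
  obtain ⟨β, hβ, hβ'⟩ := hD.glue_pieces (x := x.s.obj h hx) (y := y.s.obj k hy) (𝟙 T) (ι := ι)
    (V := fun i => i.1.1) (z := fun i => x.s.obj (i.1.2 ≫ h) (hx1 i))
    (fun i => x.s.map hx (hx1 i) i.1.2 rfl)
    (fun i => (a (i.1.2 ≫ h) (i.1.2 ≫ k) (he i) (hx1 i) (hy1 i) i.2).1 ≫
      y.s.map hy (hy1 i) i.1.2 rfl)
    (fun i => by rw [D.π_comp, π_val, x.s.π_map, y.s.π_map]; simp) (by
      rintro ⟨⟨T₁, b₁⟩, hb₁⟩ ⟨⟨T₂, b₂⟩, hb₂⟩ T' c₁ c₂ hc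
      rw [x.s.π_map, x.s.π_map] at hc
      dsimp only at c₁ c₂ hc hb₁ hb₂ ⊢
      have h1 : c₁ ≫ b₁ ≫ h = (c₁ ≫ b₁) ≫ h := (Category.assoc _ _ _).symm
      have h2 : c₂ ≫ b₂ ≫ h = (c₁ ≫ b₁) ≫ h := by rw [hc, Category.assoc]
      have k1 : c₁ ≫ b₁ ≫ k = (c₁ ≫ b₁) ≫ k := (Category.assoc _ _ _).symm
      have k2 : c₂ ≫ b₂ ≫ k = (c₁ ≫ b₁) ≫ k := by rw [hc, Category.assoc]
      have hT : R ((c₁ ≫ b₁) ≫ h) := h1 ▸ R.downward_closed hb₁ c₁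
      have hx' := x.R.downward_closed hx (c₁ ≫ b₁)
      have hy' := y.R.downward_closed hy (c₁ ≫ b₁)
      have e' : ((c₁ ≫ b₁) ≫ h) ≫ g = (c₁ ≫ b₁) ≫ k := by rw [Category.assoc, e]
      refine ⟨x.s.obj ((c₁ ≫ b₁) ≫ h) hx', x.s.map _ hx' c₁ h1, x.s.map _ hx' c₂ h2,
        x.s.π_map _ _ _ _, x.s.π_map _ _ _ _, ?_, ?_⟩
      · rw [← x.s.map_comp _ _ hx' b₁ rfl c₁ h1, ← x.s.map_comp _ _ hx' b₂ rfl c₂ h2]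
        congr 1
      · have n1 := ha c₁ (he ⟨⟨T₁, b₁⟩, hb₁⟩) (hx1 ⟨⟨T₁, b₁⟩, hb₁⟩) (hy1 ⟨⟨T₁, b₁⟩, hb₁⟩) hb₁
          e' hx' hy' hT h1 k1
        have n2 := ha c₂ (he ⟨⟨T₂, b₂⟩, hb₂⟩) (hx1 ⟨⟨T₂, b₂⟩, hb₂⟩) (hy1 ⟨⟨T₂, b₂⟩, hb₂⟩) hb₂
          e' hx' hy' hT h2 k2
        rw [reassoc_of% n1, reassoc_of% n2, ← y.s.map_comp _ _ hy' b₁ rfl c₁ k1,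
          ← y.s.map_comp _ _ hy' b₂ rfl c₂ k2]
        congr 2)
    (R.pullback h) (J.pullback_stable h hR)
    (fun {T'} f hf => ⟨⟨⟨T', f⟩, hf⟩, 𝟙 _, by rw [x.s.π_map]; simp⟩)
  refine ⟨⟨β, hβ⟩, fun {T'} b h' k' e' hx' hy' hr' ah ak => ?_⟩
  subst ah ak
  exact hβ' ⟨⟨T', b⟩, hr'⟩

/-- A morphism defined on a covering sieve. -/
noncomputable def glue (hD : D.IsPrestack J) (g : U ⟶ V) (R : Sieve U) (hR : R ∈ J U)
    (a : ∀ {T : C} (h : T ⟶ U) (k : T ⟶ V), h ≫ g = k → ∀ (hx : x.R h) (hy : y.R k), R h →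
      D.FHom (x.s.obj h hx) (y.s.obj k hy))
    (ha : ∀ {T T' : C} (b : T' ⟶ T) {h : T ⟶ U} {k : T ⟶ V} (e : h ≫ g = k) (hx : x.R h)
      (hy : y.R k) (hr : R h) {h' : T' ⟶ U} {k' : T' ⟶ V} (e' : h' ≫ g = k') (hx' : x.R h')
      (hy' : y.R k') (hr' : R h') (ah : b ≫ h = h') (ak : b ≫ k = k'),
      x.s.map hx hx' b ah ≫ (a h k e hx hy hr).1 =
        (a h' k' e' hx' hy' hr').1 ≫ y.s.map hy hy' b ak) : StkHom x y where
  base := g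
  app h k e hx hy := (exists_glue hD g R hR a ha h k e hx hy).choose
  nat {T T'} b h k e hx hy h' k' e' hx' hy' ah ak := by
    refine hD.hom_ext _ _ (by simp [x.s.π_map, y.s.π_map]) (R.pullback h')
      (J.pullback_stable h' hR) fun {S} c hc => ?_
    have h1 := x.R.downward_closed hx' c
    have h2 := y.R.downward_closed hy' c
    have e1 : (c ≫ h') ≫ g = c ≫ k' := by rw [Category.assoc, e']
    refine ⟨_, x.s.map hx' h1 c rfl, x.s.π_map _ _ _ _, ?_⟩
    have s1 := (exists_glue hD g R hR a ha h k e hx hy).choose_spec (c ≫ b) e1 h1 h2 hc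
      (by rw [Category.assoc, ah]) (by rw [Category.assoc, ak])
    have s2 := (exists_glue hD g R hR a ha h' k' e' hx' hy').choose_spec c e1 h1 h2 hc rfl rfl
    rw [← Category.assoc, ← x.s.map_comp _ _ _ b ah c rfl, s1, reassoc_of% s2,
      y.s.map_comp _ _ _ b ak c rfl]

theorem glue_app (hD : D.IsPrestack J) (g : U ⟶ V) (R : Sieve U) (hR : R ∈ J U)
    (a : ∀ {T : C} (h : T ⟶ U) (k : T ⟶ V), h ≫ g = k → ∀ (hx : x.R h) (hy : y.R k), R h →
      D.FHom (x.s.obj h hx) (y.s.obj k hy))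
    (ha : ∀ {T T' : C} (b : T' ⟶ T) {h : T ⟶ U} {k : T ⟶ V} (e : h ≫ g = k) (hx : x.R h)
      (hy : y.R k) (hr : R h) {h' : T' ⟶ U} {k' : T' ⟶ V} (e' : h' ≫ g = k') (hx' : x.R h')
      (hy' : y.R k') (hr' : R h') (ah : b ≫ h = h') (ak : b ≫ k = k'),
      x.s.map hx hx' b ah ≫ (a h k e hx hy hr).1 =
        (a h' k' e' hx' hy' hr').1 ≫ y.s.map hy hy' b ak)
    {T : C} (h : T ⟶ U) (k : T ⟶ V) (e : h ≫ g = k) (hx : x.R h) (hy : y.R k) (hr : R h) :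
    ((glue hD g R hR a ha).app h k e hx hy).1 = (a h k e hx hy hr).1 := by
  have s := (exists_glue hD g R hR a ha h k e hx hy).choose_spec (𝟙 T) e hx hy hr
    (Category.id_comp _) (Category.id_comp _)
  rw [x.s.map_id, y.s.map_id, Category.id_comp, Category.comp_id] at s
  exact s

/-- Identity morphisms of the associated stack. -/
def id (x : StkObj J D U) : StkHom x x where
  base := 𝟙 U
  app h k e hx hy := x.s.tr hx hy ((Category.comp_id h).symm.trans e)
  nat {T T'} a h k e hx hy h' k' e' hx' hy' ah ak := by
    obtain rfl : h = k := (Category.comp_id h).symm.trans e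
    obtain rfl : h' = k' := (Category.comp_id h').symm.trans e'
    rw [x.s.tr_self, x.s.tr_self, Category.comp_id, Category.id_comp]

/-- Composition where the intermediate point exists. -/
def compApp (φ : StkHom x y) (ψ : StkHom y z) {T : C} (h : T ⟶ U) (k : T ⟶ W)
    (e : h ≫ φ.base ≫ ψ.base = k) (hx : x.R h) (hz : z.R k) (hr : y.R.pullback φ.base h) :
    D.FHom (x.s.obj h hx) (z.s.obj k hz) :=
  ⟨(φ.app h (h ≫ φ.base) rfl hx hr).1 ≫
      (ψ.app (h ≫ φ.base) k (by rw [Category.assoc, e]) hr hz).1, by simp⟩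

theorem compApp_nat (φ : StkHom x y) (ψ : StkHom y z) {T T' : C} (b : T' ⟶ T) {h : T ⟶ U}
    {k : T ⟶ W} (e : h ≫ φ.base ≫ ψ.base = k) (hx : x.R h) (hz : z.R k)
    (hr : y.R.pullback φ.base h) {h' : T' ⟶ U} {k' : T' ⟶ W} (e' : h' ≫ φ.base ≫ ψ.base = k')
    (hx' : x.R h') (hz' : z.R k') (hr' : y.R.pullback φ.base h') (ah : b ≫ h = h')
    (ak : b ≫ k = k') : x.s.map hx hx' b ah ≫ (compApp φ ψ h k e hx hz hr).1 =
      (compApp φ ψ h' k' e' hx' hz' hr').1 ≫ z.s.map hz hz' b ak := by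
  have e1 : b ≫ h ≫ φ.base = h' ≫ φ.base := by rw [← Category.assoc, ah]
  dsimp only [compApp]
  rw [← Category.assoc, φ.nat b rfl hx hr rfl hx' hr' ah e1, Category.assoc,
    ψ.nat b _ hr hz (by rw [Category.assoc, e']) hr' hz' e1 ak]
  exact (Category.assoc _ _ _).symm

/-- Composition of the associated stack. -/
noncomputable def comp (hD : D.IsPrestack J) (φ : StkHom x y) (ψ : StkHom y z) : StkHom x z :=
  glue hD (φ.base ≫ ψ.base) (y.R.pullback φ.base) (J.pullback_stable _ y.mem)
    (compApp φ ψ) (compApp_nat φ ψ)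

theorem comp_app (hD : D.IsPrestack J) (φ : StkHom x y) (ψ : StkHom y z) {T : C} (h : T ⟶ U)
    (m : T ⟶ V) (k : T ⟶ W) (e₁ : h ≫ φ.base = m) (e₂ : m ≫ ψ.base = k)
    (e : h ≫ φ.base ≫ ψ.base = k) (hx : x.R h) (hy : y.R m) (hz : z.R k) :
    ((comp hD φ ψ).app h k e hx hz).1 = (φ.app h m e₁ hx hy).1 ≫ (ψ.app m k e₂ hy hz).1 := by
  subst e₁
  exact glue_app hD _ _ _ (compApp φ ψ) (compApp_nat φ ψ) h k e hx hz hy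

/-- Factorization where the image of the target exists. -/
noncomputable def facApp (φ : StkHom x z) (ψ : StkHom y z) (g : U ⟶ V)
    (e : g ≫ ψ.base = φ.base) {T : C} (h : T ⟶ U) (k : T ⟶ V) (e' : h ≫ g = k) (hx : x.R h)
    (hy : y.R k) (hr : z.R.pullback φ.base h) : D.FHom (x.s.obj h hx) (y.s.obj k hy) :=
  ⟨(φ.app h (h ≫ φ.base) rfl hx hr).1 ≫
    (finv (ψ.app k (h ≫ φ.base) (by rw [← e, ← e', Category.assoc]) hy hr)).1, by simp⟩

theorem facApp_nat (φ : StkHom x z) (ψ : StkHom y z) (g : U ⟶ V)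
    (e : g ≫ ψ.base = φ.base) {T T' : C} (b : T' ⟶ T) {h : T ⟶ U}
    {k : T ⟶ V} (e₁ : h ≫ g = k) (hx : x.R h) (hy : y.R k)
    (hr : z.R.pullback φ.base h) {h' : T' ⟶ U} {k' : T' ⟶ V} (e₁' : h' ≫ g = k')
    (hx' : x.R h') (hy' : y.R k') (hr' : z.R.pullback φ.base h') (ah : b ≫ h = h')
    (ak : b ≫ k = k') : x.s.map hx hx' b ah ≫ (facApp φ ψ g e h k e₁ hx hy hr).1 =
      (facApp φ ψ g e h' k' e₁' hx' hy' hr').1 ≫ y.s.map hy hy' b ak := by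
  have e2 : b ≫ h ≫ φ.base = h' ≫ φ.base := by rw [← Category.assoc, ah]
  have e3 : k ≫ ψ.base = h ≫ φ.base := by rw [← e, ← e₁, Category.assoc]
  have e3' : k' ≫ ψ.base = h' ≫ φ.base := by rw [← e, ← e₁', Category.assoc]
  have n := ψ.nat b e3 hy hr e3' hy' hr' ak e2
  have m : z.s.map hr hr' b e2 ≫ (finv (ψ.app k (h ≫ φ.base) e3 hy hr)).1 =
      (finv (ψ.app k' (h' ≫ φ.base) e3' hy' hr')).1 ≫ y.s.map hy hy' b ak :=
    calc _ = ((finv (ψ.app k' (h' ≫ φ.base) e3' hy' hr')).1 ≫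
          ((ψ.app k' (h' ≫ φ.base) e3' hy' hr').1 ≫ z.s.map hr hr' b e2)) ≫
          (finv (ψ.app k (h ≫ φ.base) e3 hy hr)).1 :=
          congrArg (· ≫ _) (finv_fhom_assoc _ _).symm
      _ = _ := by
        rw [← n, Category.assoc, Category.assoc]
        exact congrArg (_ ≫ ·) ((congrArg (_ ≫ ·) (fhom_finv _)).trans (Category.comp_id _))
  dsimp only [facApp]
  rw [← Category.assoc, φ.nat b rfl hx hr rfl hx' hr' ah e2]
  exact (Category.assoc _ _ _).trans ((congrArg (_ ≫ ·) m).trans (Category.assoc _ _ _).symm)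

theorem exists_fac (hD : D.IsPrestack J) (φ : StkHom x z) (ψ : StkHom y z) (g : U ⟶ V)
    (e : g ≫ ψ.base = φ.base) : ∃! χ : StkHom x y, χ.base = g ∧ comp hD χ ψ = φ := by
  have e0 {T : C} {t : T ⟶ U} {k : T ⟶ V} (e' : t ≫ g = k) : k ≫ ψ.base = t ≫ φ.base := by
    rw [← e, ← e', Category.assoc]
  let χ : StkHom x y := glue hD g (z.R.pullback φ.base) (J.pullback_stable _ z.mem)
    (facApp φ ψ g e) (facApp_nat φ ψ g e)
  have hχ {T : C} (t : T ⟶ U) (k : T ⟶ V) (e₁ : t ≫ g = k) (hx : x.R t) (hy : y.R k)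
      (hr : z.R.pullback φ.base t) :
      (χ.app t k e₁ hx hy).1 ≫ (ψ.app k (t ≫ φ.base) (e0 e₁) hy hr).1 =
        (φ.app t (t ≫ φ.base) rfl hx hr).1 := by
    have a2 := glue_app hD g (z.R.pullback φ.base) (J.pullback_stable _ z.mem) (facApp φ ψ g e)
      (facApp_nat φ ψ g e) t k e₁ hx hy hr
    refine (congrArg (· ≫ _) a2).trans ((Category.assoc _ _ _).trans ?_)
    exact (congrArg (_ ≫ ·) (finv_fhom _)).trans (Category.comp_id _)
  refine ⟨χ, ⟨rfl, ?_⟩, ?_⟩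
  · refine ext_local hD e (y.R.pullback g) (J.pullback_stable _ y.mem)
      fun {T} t k e₁ e₂ hx hz hr => ?_
    subst e₂
    exact (comp_app hD χ ψ t (t ≫ g) (t ≫ φ.base) rfl (e0 rfl) e₁ hx hr hz).trans
      (hχ t (t ≫ g) rfl hx hr hz)
  · rintro χ' ⟨hb, hc⟩
    refine ext_local hD hb (z.R.pullback φ.base) (J.pullback_stable _ z.mem)
      fun {T} t k e₁ e₂ hx hy hr => ?_
    have a1 := comp_app hD χ' ψ t k (t ≫ φ.base) e₁ (e0 e₂)
      (by rw [← Category.assoc, e₁, e0 e₂]) hx hy hr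
    have a3 := congr_app hc t (t ≫ φ.base)
      (((Category.assoc _ _ _).symm.trans (congrArg (· ≫ ψ.base) e₁)).trans (e0 e₂)) rfl hx hr
    have : IsIso (ψ.app k (t ≫ φ.base) (e0 e₂) hy hr).1 := inferInstance
    rw [← cancel_mono (ψ.app k (t ≫ φ.base) (e0 e₂) hy hr).1]
    exact (a1.symm.trans a3).trans (hχ t k e₂ hx hy hr).symm

/-- Restriction of an object of the associated stack. -/
def pullObj (f : U ⟶ V) (y : StkObj J D V) : StkObj J D U :=
  ⟨y.R.pullback f, J.pullback_stable f y.mem,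
    { obj := fun h hh => y.s.obj (h ≫ f) hh
      map := fun hh hk g e => y.s.map hh hk g (by rw [← e, Category.assoc])
      π_map := fun _ _ _ _ => y.s.π_map _ _ _ _
      map_id := fun _ => y.s.map_id _
      map_comp := fun _ _ _ _ _ _ _ => y.s.map_comp _ _ _ _ _ _ _ }⟩

/-- The canonical morphism from a restriction. -/
def ofPull (f : U ⟶ V) (y : StkObj J D V) : StkHom (pullObj f y) y where
  base := f
  app h k e hx hy := y.s.tr hx hy e
  nat {T T'} a h k e hx hy h' k' e' hx' hy' ah ak := by
    subst e e'
    exact (congrArg (_ ≫ ·) (y.s.tr_self hx hy rfl)).trans ((Category.comp_id _).trans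
      ((Category.id_comp _).symm.trans (congrArg (· ≫ _) (y.s.tr_self hx' hy' rfl).symm)))

end StkHom

variable (J D) in
/-- The associated stack of a prestack. -/
noncomputable def stk (hD : D.IsPrestack J) : FibGpd.{w} C where
  Obj U := StkObj J D U
  cat :=
    { Hom := fun x y => StkHom x.pt y.pt
      id := fun x => StkHom.id x.pt
      comp := fun f g => StkHom.comp hD f g
      id_comp := fun {x y} f => by
        refine StkHom.ext (Category.id_comp _) fun {T} h k e e' hx hy => ?_
        refine (StkHom.comp_app hD (StkHom.id x.pt) f h h k (Category.comp_id _) e' _ hx hx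
          hy).trans ?_
        exact (congrArg (· ≫ _) (x.pt.s.tr_self hx hx rfl)).trans (Category.id_comp _)
      comp_id := fun {x y} f => by
        refine StkHom.ext (Category.comp_id _) fun {T} h k e e' hx hy => ?_
        refine (StkHom.comp_app hD f (StkHom.id y.pt) h k k e' (Category.comp_id _) _ hx hy
          hy).trans ?_
        exact (congrArg (_ ≫ ·) (y.pt.s.tr_self hy hy rfl)).trans (Category.comp_id _)
      assoc := fun {x y z t} f g l => by
        refine StkHom.ext_local hD (Category.assoc _ _ _)
          ((y.pt.R ⊓ z.pt.R.pullback g.base).pullback f.base) (J.pullback_stable _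
            (J.intersection_covering y.pt.mem (J.pullback_stable _ z.pt.mem)))
              fun {T} h k e e' hx ht hr => ?_
        have hy : y.pt.R (h ≫ f.base) := hr.1
        have hz : z.pt.R ((h ≫ f.base) ≫ g.base) := hr.2
        have e1 : ((h ≫ f.base) ≫ g.base) ≫ l.base = k :=
          (by simp : _ = h ≫ (f.base ≫ g.base) ≫ l.base).trans e
        have e2 : h ≫ f.base ≫ g.base = (h ≫ f.base) ≫ g.base := (Category.assoc _ _ _).symm
        have e3 : (h ≫ f.base) ≫ g.base ≫ l.base = k := (Category.assoc _ _ _).symm.trans e1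
        have a1 := StkHom.comp_app hD (StkHom.comp hD f g) l h _ k e2 e1 e hx hz ht
        have a2 := StkHom.comp_app hD f g h _ _ rfl rfl e2 hx hy hz
        have a3 := StkHom.comp_app hD f (StkHom.comp hD g l) h _ k rfl e3 e' hx hy ht
        have a4 := StkHom.comp_app hD g l _ _ k rfl e1 e3 hy hz ht
        rw [a1, a2, a3, a4, Category.assoc] }
  π f := StkHom.base f
  π_id x := rfl
  π_comp f g := rfl
  exists_lift f y := ⟨StkHom.pullObj f y, StkHom.ofPull f y, rfl⟩
  cartesian φ ψ h e := StkHom.exists_fac hD φ ψ h e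

end FibGpd

end Stackification

end PicardStacks

namespace PicardStacks

open FibGpd PicardFib

section StackificationPicard

variable {C : Type u} [Category.{v} C] {J : GrothendieckTopology C} {D : PicardFib.{w} C}

namespace FibGpd

/-- The componentwise sum of cartesian sections. -/
def Sec.add {U : C} {R S : Sieve U} (s : D.Sec R) (t : D.Sec S) : D.Sec (R ⊓ S) where
  obj f hf := D.add (s.obj f hf.1) (t.obj f hf.2)
  map hf hk g e := D.addMap (s.map hf.1 hk.1 g e) (t.map hf.2 hk.2 g e)
    (by rw [s.π_map, t.π_map])
  π_map _ _ _ _ := by rw [D.π_addMap, s.π_map]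
  map_id _ := (D.addMap_congr _ (s.map_id _) (t.map_id _)).trans (D.addMap_id _ _)
  map_comp hf hk hl g h g' h' := (D.addMap_congr _ (s.map_comp hf.1 hk.1 hl.1 g h g' h')
    (t.map_comp hf.2 hk.2 hl.2 g h g' h')).trans (D.addMap_comp _ _ _ _ _ _)

/-- The sum of objects of the associated stack. -/
def StkObj.add {U : C} (x y : StkObj J D.toFibGpd U) : StkObj J D.toFibGpd U :=
  ⟨x.R ⊓ y.R, J.intersection_covering x.mem y.mem, x.s.add y.s⟩

variable (J D) in
/-- The neutral object of the associated stack. -/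
def StkObj.zero (U : C) : StkObj J D.toFibGpd U :=
  ⟨⊤, J.top_mem U,
    { obj := fun {V} _ _ => D.zero V
      map := fun _ _ g _ => D.zeroMap g
      π_map := fun _ _ _ _ => D.π_zeroMap _
      map_id := fun _ => D.zeroMap_id _
      map_comp := fun _ _ _ _ _ _ _ => D.zeroMap_comp _ _ }⟩

namespace StkHom

/-- The sum of morphisms of the associated stack. -/
def add {U V : C} {x x' : StkObj J D.toFibGpd U} {y y' : StkObj J D.toFibGpd V}
    (φ : StkHom x y) (ψ : StkHom x' y') (h : φ.base = ψ.base) :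
    StkHom (x.add x') (y.add y') where
  base := φ.base
  app t k e hx hy := D.addF (φ.app t k e hx.1 hy.1) (ψ.app t k (h ▸ e) hx.2 hy.2)
  nat {T T'} a t k e hx hy t' k' e' hx' hy' at' ak := by
    refine (D.addMap_comp _ _ _ _ _ _).symm.trans (Eq.trans ?_ (D.addMap_comp _ _ _ _ _ _))
    exact D.addMap_congr _ (φ.nat a e hx.1 hy.1 e' hx'.1 hy'.1 at' ak)
      (ψ.nat a (h ▸ e) hx.2 hy.2 (h ▸ e') hx'.2 hy'.2 at' ak)

/-- The morphisms between the neutral objects. -/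
def zeroMap {U V : C} (f : U ⟶ V) : StkHom (StkObj.zero J D U) (StkObj.zero J D V) where
  base := f
  app t k e _ _ := ⟨𝟙 _, D.π_id _⟩
  nat {T T'} a t k e hx hy t' k' e' hx' hy' at' ak :=
    (Category.comp_id _).trans (Category.id_comp _).symm

/-- Morphisms of a fiber given by compatible components. -/
def ofComponents {U : C} {x y : StkObj J D.toFibGpd U}
    (a : ∀ {T : C} (t : T ⟶ U) (hx : x.R t) (hy : y.R t), D.FHom (x.s.obj t hx) (y.s.obj t hy))
    (ha : ∀ {T T' : C} (b : T' ⟶ T) {t : T ⟶ U} (hx : x.R t) (hy : y.R t) {t' : T' ⟶ U}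
      (hx' : x.R t') (hy' : y.R t') (e : b ≫ t = t'), x.s.map hx hx' b e ≫ (a t hx hy).1 =
        (a t' hx' hy').1 ≫ y.s.map hy hy' b e) : StkHom x y where
  base := 𝟙 U
  app t k e hx hy := (x.s.tr hx (((Category.comp_id t).symm.trans e) ▸ hx)
    ((Category.comp_id t).symm.trans e)).comp (a k _ hy)
  nat {T T'} b t k e hx hy t' k' e' hx' hy' at' ak := by
    obtain rfl : t = k := (Category.comp_id t).symm.trans e
    obtain rfl : t' = k' := (Category.comp_id t').symm.trans e'
    refine (congrArg (_ ≫ ·) (congrArg (· ≫ (a t hx hy).1) (x.s.tr_self hx hx rfl))).trans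
      (Eq.trans ?_ (congrArg (· ≫ _) (congrArg (· ≫ (a t' hx' hy').1)
        (x.s.tr_self hx' hx' rfl))).symm)
    rw [Category.id_comp, Category.id_comp, ha b hx hy hx' hy' at']

variable {U V W : C}

/-- The associativity constraint. -/
def σ (x y z : StkObj J D.toFibGpd U) : StkHom ((x.add y).add z) (x.add (y.add z)) :=
  ofComponents (fun t hx _ => D.σ (x.s.obj t hx.1.1) (y.s.obj t hx.1.2) (z.s.obj t hx.2))
    (fun {T T'} b {t} hx hy {t'} hx' hy' e => D.σ_natural _ _ _ _ _)

/-- The commutativity constraint. -/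
def τ (x y : StkObj J D.toFibGpd U) : StkHom (x.add y) (y.add x) :=
  ofComponents (fun t hx _ => D.τ (x.s.obj t hx.1) (y.s.obj t hx.2))
    (fun {T T'} b {t} hx hy {t'} hx' hy' e => D.τ_natural _ _ _)

/-- The unit constraint. -/
def zeroAdd (x : StkObj J D.toFibGpd U) : StkHom ((StkObj.zero J D U).add x) x :=
  ofComponents (fun t hx _ => D.zeroAdd (x.s.obj t hx.2))
    (fun {T T'} b {t} hx hy {t'} hx' hy' e =>
      (congrArg (· ≫ _) (D.addMap_congr _ (congrArg D.zeroMap (x.s.π_map _ _ _ _).symm) rfl)).trans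
        (D.zeroAdd_natural _))

theorem σ_app (x y z : StkObj J D.toFibGpd U) {T : C} (t : T ⟶ U) (e : t ≫ 𝟙 U = t)
    (hx : ((x.add y).add z).R t) (hy : (x.add (y.add z)).R t) :
    ((σ x y z).app t t e hx hy).1 =
      (D.σ (x.s.obj t hx.1.1) (y.s.obj t hx.1.2) (z.s.obj t hx.2)).1 :=
  (congrArg (· ≫ _) (((x.add y).add z).s.tr_self hx hx rfl)).trans (Category.id_comp _)

theorem τ_app (x y : StkObj J D.toFibGpd U) {T : C} (t : T ⟶ U) (e : t ≫ 𝟙 U = t)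
    (hx : (x.add y).R t) (hy : (y.add x).R t) :
    ((τ x y).app t t e hx hy).1 = (D.τ (x.s.obj t hx.1) (y.s.obj t hx.2)).1 :=
  (congrArg (· ≫ _) ((x.add y).s.tr_self hx hx rfl)).trans (Category.id_comp _)

theorem zeroAdd_app (x : StkObj J D.toFibGpd U) {T : C} (t : T ⟶ U) (e : t ≫ 𝟙 U = t)
    (hx : ((StkObj.zero J D U).add x).R t) (hy : x.R t) :
    ((zeroAdd x).app t t e hx hy).1 = (D.zeroAdd (x.s.obj t hy)).1 :=
  (congrArg (· ≫ _) (((StkObj.zero J D U).add x).s.tr_self hx hx rfl)).trans (Category.id_comp _)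

theorem id_app (x : StkObj J D.toFibGpd U) {T : C} (t : T ⟶ U) (e : t ≫ 𝟙 U = t)
    (hx hy : x.R t) : ((id x).app t t e hx hy).1 = 𝟙 _ := x.s.tr_self hx hy rfl

variable (hD : D.toFibGpd.IsPrestack J)

theorem add_id (x y : StkObj J D.toFibGpd U) :
    add (id x) (id y) rfl = id (x.add y) :=
  ext_id rfl rfl fun {T} t e e' hx hy =>
    (D.addMap_congr _ (id_app x t e hx.1 hy.1) (id_app y t e hx.2 hy.2)).trans
      ((D.addMap_id _ _).trans (id_app (x.add y) t e' hx hy).symm)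

theorem add_comp {x x' : StkObj J D.toFibGpd U} {y y' : StkObj J D.toFibGpd V}
    {z z' : StkObj J D.toFibGpd W} (φ : StkHom x y) (φ' : StkHom y z) (ψ : StkHom x' y')
    (ψ' : StkHom y' z') (h : φ.base = ψ.base) (h' : φ'.base = ψ'.base) :
    add (comp hD φ φ') (comp hD ψ ψ') (congrArg₂ (· ≫ ·) h h') =
      comp hD (add φ ψ h) (add φ' ψ' h') := by
  refine ext_local hD rfl ((y.R ⊓ y'.R).pullback φ.base) (J.pullback_stable _
    (J.intersection_covering y.mem y'.mem)) fun {T} t k e e' hx hz hy => ?_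
  have e1 : (t ≫ φ.base) ≫ φ'.base = k := (Category.assoc _ _ _).trans e
  have e2 : t ≫ ψ.base = t ≫ φ.base := by rw [h]
  have e3 : (t ≫ φ.base) ≫ ψ'.base = k := h' ▸ e1
  have e4 : t ≫ ψ.base ≫ ψ'.base = k := by rw [← Category.assoc, e2, e3]
  refine (D.addMap_congr _ (comp_app hD φ φ' t _ k rfl e1 e hx.1 hy.1 hz.1)
    (comp_app hD ψ ψ' t _ k e2 e3 e4 hx.2 hy.2 hz.2)).trans ?_
  exact (D.addMap_comp _ _ _ _ _ _).trans
    (comp_app hD (add φ ψ h) (add φ' ψ' h') t _ k rfl e1 e hx hy hz).symm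

theorem σ_natural {x y z : StkObj J D.toFibGpd U} {x' y' z' : StkObj J D.toFibGpd V}
    (φ : StkHom x x') (ψ : StkHom y y') (χ : StkHom z z') (h : φ.base = ψ.base)
    (h' : ψ.base = χ.base) :
    comp hD (add (add φ ψ h) χ (h.trans h')) (σ x' y' z') =
      comp hD (σ x y z) (add φ (add ψ χ h') h) := by
  refine ext ((Category.comp_id _).trans (Category.id_comp _).symm) fun {T} t k e e' hx hz => ?_
  have ek : t ≫ φ.base = k := (congrArg (t ≫ ·) (Category.comp_id φ.base)).symm.trans e
  refine (comp_app hD (add (add φ ψ h) χ (h.trans h')) (σ x' y' z') t k k ek (Category.comp_id k) e hx ⟨⟨hz.1, hz.2.1⟩, hz.2.2⟩ hz).trans ?_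
  refine Eq.trans ?_ (comp_app hD (σ x y z) (add φ (add ψ χ h') h) t t k (Category.comp_id t) ek e' hx
    ⟨hx.1.1, hx.1.2, hx.2⟩ hz).symm
  refine (congrArg (_ ≫ ·) (σ_app x' y' z' k _ _ _)).trans ?_
  exact (D.σ_natural _ _ _ _ _).trans (congrArg (· ≫ _) (σ_app x y z t _ _ _).symm)

theorem τ_natural {x y : StkObj J D.toFibGpd U} {x' y' : StkObj J D.toFibGpd V}
    (φ : StkHom x x') (ψ : StkHom y y') (h : φ.base = ψ.base) :
    comp hD (add φ ψ h) (τ x' y') = comp hD (τ x y) (add ψ φ h.symm) := by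
  refine ext ((Category.comp_id _).trans (h.trans (Category.id_comp _).symm))
    fun {T} t k e e' hx hz => ?_
  have ek : t ≫ φ.base = k := (congrArg (t ≫ ·) (Category.comp_id φ.base)).symm.trans e
  refine (comp_app hD (add φ ψ h) (τ x' y') t k k ek (Category.comp_id k) e hx ⟨hz.2, hz.1⟩ hz).trans ?_
  refine Eq.trans ?_ (comp_app hD (τ x y) (add ψ φ h.symm) t t k (Category.comp_id t) (h ▸ ek) e' hx
    ⟨hx.2, hx.1⟩ hz).symm
  refine (congrArg (_ ≫ ·) (τ_app x' y' k _ _ _)).trans ?_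
  exact (D.τ_natural _ _ _).trans (congrArg (· ≫ _) (τ_app x y t _ _ _).symm)

theorem zeroAdd_natural {x : StkObj J D.toFibGpd U} {y : StkObj J D.toFibGpd V}
    (φ : StkHom x y) :
    comp hD (add (zeroMap φ.base) φ rfl) (zeroAdd y) = comp hD (zeroAdd x) φ := by
  refine ext ((Category.comp_id _).trans (Category.id_comp _).symm) fun {T} t k e e' hx hz => ?_
  have ek : t ≫ φ.base = k := (congrArg (t ≫ ·) (Category.comp_id φ.base)).symm.trans e
  refine (comp_app hD (add (zeroMap φ.base) φ rfl) (zeroAdd y) t k k ek (Category.comp_id k) e hx ⟨trivial, hz⟩ hz).trans ?_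
  refine Eq.trans ?_ (comp_app hD (zeroAdd x) φ t t k (Category.comp_id t) ek e' hx hx.2 hz).symm
  refine (congrArg (_ ≫ ·) (zeroAdd_app y k _ _ _)).trans ?_
  refine Eq.trans ?_ (congrArg (· ≫ _) (zeroAdd_app x t _ _ _).symm)
  refine Eq.trans ?_ (D.zeroAdd_natural (φ.app t k ek hx.2 hz).1)
  exact congrArg (· ≫ _) (D.addMap_congr _ ((D.zeroMap_id _).symm.trans
    (congrArg D.zeroMap (φ.app t k ek hx.2 hz).2.symm)) rfl)

theorem pentagon (x y z w : StkObj J D.toFibGpd U) :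
    comp hD (add (σ x y z) (id w) rfl) (comp hD (σ x (y.add z) w) (add (id x) (σ y z w) rfl)) =
      comp hD (σ (x.add y) z w) (σ x y (z.add w)) := by
  refine ext_id ((Category.id_comp _).trans (Category.id_comp _)) (Category.id_comp _)
    fun {T} t e e' hx hz => ?_
  have i : t ≫ 𝟙 U = t := Category.comp_id t
  have ii : t ≫ 𝟙 U ≫ 𝟙 U = t := (congrArg (t ≫ ·) (Category.id_comp _)).trans i
  have h1 := hx.1.1.1
  have h2 := hx.1.1.2
  have h3 := hx.1.2
  have h4 := hx.2
  refine (comp_app hD _ _ t t t i ii e hx ⟨⟨h1, h2, h3⟩, h4⟩ hz).trans ?_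
  refine (congrArg (_ ≫ ·) (comp_app hD (σ x (y.add z) w) (add (id x) (σ y z w) rfl) t t t i i ii ⟨⟨h1, h2, h3⟩, h4⟩ ⟨h1, ⟨h2, h3⟩, h4⟩
    hz)).trans ?_
  refine Eq.trans ?_ (comp_app hD _ _ t t t i i e' hx ⟨⟨h1, h2⟩, h3, h4⟩ hz).symm
  refine Eq.trans ?_ ((D.pentagon _ _ _ _).trans (congrArg₂ (· ≫ ·)
    (σ_app (x.add y) z w t i hx _).symm (σ_app x y (z.add w) t i _ hz).symm))
  exact congrArg₂ (· ≫ ·) (D.addMap_congr _ (σ_app x y z t i _ _) (id_app w t i _ _))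
    (congrArg₂ (· ≫ ·) (σ_app x (y.add z) w t i _ _)
      (D.addMap_congr _ (id_app x t i _ _) (σ_app y z w t i _ _)))

theorem hexagon (x y z : StkObj J D.toFibGpd U) :
    comp hD (σ x y z) (comp hD (τ x (y.add z)) (σ y z x)) =
      comp hD (add (τ x y) (id z) rfl) (comp hD (σ y x z) (add (id y) (τ x z) rfl)) := by
  refine ext_id ((Category.id_comp _).trans (Category.id_comp _))
    ((Category.id_comp _).trans (Category.id_comp _)) fun {T} t e e' hx hz => ?_
  have i : t ≫ 𝟙 U = t := Category.comp_id t
  have ii : t ≫ 𝟙 U ≫ 𝟙 U = t := (congrArg (t ≫ ·) (Category.id_comp _)).trans i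
  have h1 := hx.1.1
  have h2 := hx.1.2
  have h3 := hx.2
  refine (comp_app hD _ _ t t t i ii e hx ⟨h1, h2, h3⟩ hz).trans ?_
  refine (congrArg (_ ≫ ·) (comp_app hD (τ x (y.add z)) (σ y z x) t t t i i ii ⟨h1, h2, h3⟩ ⟨⟨h2, h3⟩, h1⟩
    hz)).trans ?_
  refine Eq.trans ?_ (comp_app hD _ _ t t t i ii e' hx ⟨⟨h2, h1⟩, h3⟩ hz).symm
  refine Eq.trans ?_ (congrArg (_ ≫ ·) (comp_app hD (σ y x z) (add (id y) (τ x z) rfl) t t t i i ii ⟨⟨h2, h1⟩, h3⟩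
    ⟨h2, h1, h3⟩ hz)).symm
  refine Eq.trans (congrArg₂ (· ≫ ·) (σ_app x y z t i _ _)
    (congrArg₂ (· ≫ ·) (τ_app x (y.add z) t i _ _) (σ_app y z x t i _ _))) ?_
  refine (D.hexagon _ _ _).trans ?_
  exact congrArg₂ (· ≫ ·) (D.addMap_congr _ (τ_app x y t i _ _).symm (id_app z t i _ _).symm)
    (congrArg₂ (· ≫ ·) (σ_app y x z t i _ _).symm
      (D.addMap_congr _ (id_app y t i _ _).symm (τ_app x z t i _ _).symm))

theorem triangle (x y : StkObj J D.toFibGpd U) :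
    comp hD (σ x (StkObj.zero J D U) y) (add (id x) (zeroAdd y) rfl) =
      comp hD (add (τ x (StkObj.zero J D U)) (id y) rfl) (add (zeroAdd x) (id y) rfl) := by
  refine ext_id (Category.id_comp _) (Category.id_comp _) fun {T} t e e' hx hz => ?_
  have i : t ≫ 𝟙 U = t := Category.comp_id t
  refine (comp_app hD _ _ t t t i i e hx ⟨hz.1, trivial, hz.2⟩ hz).trans ?_
  refine Eq.trans ?_ (comp_app hD _ _ t t t i i e' hx ⟨⟨trivial, hz.1⟩, hz.2⟩ hz).symm
  refine (congrArg₂ (· ≫ ·) (σ_app x (StkObj.zero J D U) y t i _ _)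
    (D.addMap_congr _ (id_app x t i _ _) (zeroAdd_app y t i _ _))).trans ?_
  refine (D.triangle _ _).trans ?_
  exact congrArg₂ (· ≫ ·) (D.addMap_congr _ (τ_app x (StkObj.zero J D U) t i _ _).symm (id_app y t i _ _).symm)
    (D.addMap_congr _ (zeroAdd_app x t i _ _).symm (id_app y t i _ _).symm)

theorem τ_τ (x y : StkObj J D.toFibGpd U) : comp hD (τ x y) (τ y x) = id (x.add y) := by
  refine ext_id (Category.id_comp _) rfl fun {T} t e e' hx hz => ?_
  have i : t ≫ 𝟙 U = t := Category.comp_id t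
  refine (comp_app hD _ _ t t t i i e hx ⟨hz.2, hz.1⟩ hz).trans ?_
  refine (congrArg₂ (· ≫ ·) (τ_app x y t i _ _) (τ_app y x t i _ _)).trans ?_
  exact (D.τ_τ _ _).trans (id_app (x.add y) t i _ _).symm

end StkHom

end FibGpd

theorem PicardFib.existsUnique_neg_map {U V : C} {x n : D.Obj U} {x' n' : D.Obj V}
    (ν : D.FHom (D.add x n) (D.zero U)) (ν' : D.FHom (D.add x' n') (D.zero V)) (a : D.Hom x' x) :
    ∃! t : D.Hom n' n, ∃ h : D.π a = D.π t, D.addMap a t h ≫ ν.1 = ν'.1 ≫ D.zeroMap (D.π a) := by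
  have h0 : D.π a = D.π (pullHom (D.π a) n) := by simp
  obtain ⟨u, hu⟩ := PicardFib.exists_addMap_id_left (facF (ν'.1 ≫ D.zeroMap (D.π a))
    (D.addMap a (pullHom (D.π a) n) h0 ≫ ν.1) (by simp))
  refine ⟨u.1 ≫ pullHom (D.π a) n, ⟨by simp, ?_⟩, ?_⟩
  · have e1 : D.addMap a (u.1 ≫ pullHom (D.π a) n) (by simp) =
        D.addMap (𝟙 _) u.1 (by simp) ≫ D.addMap a (pullHom (D.π a) n) h0 := by
      rw [addMap_addMap]
      exact D.addMap_congr _ (Category.id_comp _).symm rfl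
    rw [e1, Category.assoc, hu]
    exact facF_comp _ _ _
  · rintro t ⟨h, ht⟩
    have h1 : D.π a = D.π (u.1 ≫ pullHom (D.π a) n) := by simp
    have e1 : D.addMap a (u.1 ≫ pullHom (D.π a) n) h1 =
        D.addMap (𝟙 _) u.1 (by simp) ≫ D.addMap a (pullHom (D.π a) n) h0 := by
      rw [addMap_addMap]
      exact D.addMap_congr _ (Category.id_comp _).symm rfl
    refine PicardFib.addMap_left_inj h h1 ((cancel_mono ν.1).1 ?_)
    rw [ht, e1, Category.assoc, hu]
    exact (facF_comp _ _ _).symm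

namespace FibGpd

theorem StkObj.exists_neg {U : C} (x : StkObj J D.toFibGpd U) :
    ∃ (y : StkObj J D.toFibGpd U) (φ : StkHom (x.add y) (StkObj.zero J D U)), φ.base = 𝟙 U := by
  choose n ν using fun {V : C} (f : V ⟶ U) (hf : x.R f) => D.exists_neg (x.s.obj f hf)
  let ν' {V : C} (f : V ⟶ U) (hf : x.R f) := (ν f hf).some
  choose t ht ht' using fun {V W : C} {f : V ⟶ U} {k : W ⟶ U} (hf : x.R f) (hk : x.R k)
    (g : W ⟶ V) (h : g ≫ f = k) => D.existsUnique_neg_map (ν' f hf) (ν' k hk) (x.s.map hf hk g h)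
  choose h1 h2 using @ht
  have hπ {V W : C} {f : V ⟶ U} {k : W ⟶ U} (hf : x.R f) (hk : x.R k)
      (g : W ⟶ V) (h : g ≫ f = k) : D.π (t hf hk g h) = g :=
    (h1 hf hk g h).symm.trans (x.s.π_map _ _ _ _)
  refine ⟨⟨x.R, x.mem, ⟨n, t, hπ, ?_, ?_⟩⟩, StkHom.ofComponents (fun f hf _ => ν' f hf.1) ?_, rfl⟩
  · intro V f hf
    refine (ht' hf hf (𝟙 V) (Category.id_comp f) (𝟙 _) ⟨by rw [x.s.π_map, D.π_id], ?_⟩).symm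
    rw [D.addMap_congr _ (x.s.map_id hf) rfl, D.addMap_id, x.s.map_id, D.π_id, D.zeroMap_id,
      Category.id_comp, Category.comp_id]
  · intro V W T f k l hf hk hl g h g' h'
    refine (ht' hf hl (g' ≫ g) _ _ ⟨by rw [x.s.π_map, D.π_comp, hπ, hπ], ?_⟩).symm
    rw [D.addMap_congr _ (x.s.map_comp hf hk hl g h g' h') rfl,
      D.addMap_comp _ _ _ _ (h1 hk hl g' h') (h1 hf hk g h), Category.assoc, h2, reassoc_of% h2 hk,
      ← D.zeroMap_comp, x.s.map_comp hf hk hl g h g' h', D.π_comp]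
  · intro T T' b f hx hy f' hx' hy' e
    refine (h2 hx.1 hx'.1 b e).trans ?_
    rw [x.s.π_map]
    rfl

variable (J D) in
/-- The associated Picard stack of a Picard prestack. -/
noncomputable def stkPicard (hD : D.toFibGpd.IsPrestack J) : PicardFib.{w} C where
  toFibGpd := stk J D.toFibGpd hD
  add x y := StkObj.add x y
  addMap φ ψ h := StkHom.add φ ψ h
  π_addMap _ _ _ := rfl
  addMap_id x y := StkHom.add_id x y
  addMap_comp φ φ' ψ ψ' h h' := StkHom.add_comp hD φ φ' ψ ψ' h h'
  σ x y z := ⟨StkHom.σ x y z, rfl⟩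
  σ_natural φ ψ χ h h' := StkHom.σ_natural hD φ ψ χ h h'
  τ x y := ⟨StkHom.τ x y, rfl⟩
  τ_natural φ ψ h := StkHom.τ_natural hD φ ψ h
  pentagon x y z w := StkHom.pentagon hD x y z w
  hexagon x y z := StkHom.hexagon hD x y z
  τ_τ x y := StkHom.τ_τ hD x y
  τ_self x := StkHom.ext_id rfl rfl fun {T} t e e' hx hy =>
    (StkHom.τ_app x x t e hx hy).trans
      ((D.τ_self _).trans (StkHom.id_app (StkObj.add x x) t e' hx hy).symm)
  zero U := StkObj.zero J D U
  zeroMap f := StkHom.zeroMap f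
  π_zeroMap _ := rfl
  zeroMap_id U := StkHom.ext_id rfl rfl fun {T} t e e' hx hy =>
    (StkHom.id_app (StkObj.zero J D U) t e' hx hy).symm
  zeroMap_comp {U V W} f g := StkHom.ext rfl fun {T} t k e e' hx hy =>
    ((StkHom.comp_app hD (StkHom.zeroMap f) (StkHom.zeroMap g) t (t ≫ f) k rfl
      ((Category.assoc _ _ _).trans e) e' trivial trivial trivial).trans (Category.comp_id _)).symm
  zeroAdd x := ⟨StkHom.zeroAdd x, rfl⟩
  zeroAdd_natural φ := StkHom.zeroAdd_natural hD φ
  triangle x y := StkHom.triangle hD x y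
  exists_neg x := by
    obtain ⟨y, φ, h⟩ := StkObj.exists_neg x
    exact ⟨y, ⟨⟨φ, h⟩⟩⟩

end FibGpd

end StackificationPicard

end PicardStacks

namespace PicardStacks

open FibGpd PicardFib

section StackificationIsStack

namespace FibGpd

variable {C : Type u} [Category.{v} C] {J : GrothendieckTopology C} {D : FibGpd.{w} C}

theorem hom_ext' {U V W : C} {x : D.Obj U} {y : D.Obj V} {z : D.Obj W} {φ φ' : D.Hom x y}
    (ψ : D.Hom y z) {f : U ⟶ V} (h : D.π φ = f) (h' : D.π φ' = f)
    (e : φ ≫ ψ = φ' ≫ ψ) : φ = φ' := hom_ext ψ (h.trans h'.symm) e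

/-- The object of the associated stack given by an object of the prestack. -/
noncomputable def StkObj.of {U : C} (d : D.Obj U) : StkObj J D U := ⟨⊤, J.top_mem U, secOf d ⊤⟩

theorem secOf_map_comp {U V W : C} (x : D.Obj U) {R : Sieve U} {f : V ⟶ U} {k : W ⟶ U}
    (hf : R f) (hk : R k) (g : W ⟶ V) (h : g ≫ f = k) :
    (secOf x R).map hf hk g h ≫ pullHom f x = pullHom k x :=
  fac_comp (pullHom k x) (pullHom f x) g (by simp [h])

theorem π_pullHom_comp_eq {U V W : C} {x : D.Obj U} {y : D.Obj V} (t : W ⟶ U) (φ : D.Hom x y)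
    {k : W ⟶ V} (e : t ≫ D.π φ = k) : D.π (pullHom t x ≫ φ) = D.π (pullHom k y) := by
  rw [D.π_comp, π_pullHom, π_pullHom, e]

theorem π_comp_val {U V : C} {x : D.Obj U} {y z : D.Obj V} {φ : D.Hom x y} (ψ : D.FHom y z)
    {f : U ⟶ V} (h : D.π φ = f) : D.π (φ ≫ ψ.1) = f := by
  rw [D.π_comp, h, π_val, Category.comp_id]

theorem π_val_comp {U V : C} {x y : D.Obj U} {z : D.Obj V} (ψ : D.FHom x y) {φ : D.Hom y z}
    {f : U ⟶ V} (h : D.π φ = f) : D.π (ψ.1 ≫ φ) = f := by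
  rw [D.π_comp, h, π_val, Category.id_comp]

namespace StkHom

variable {U V W : C}

/-- The morphism of the associated stack given by a morphism of the prestack. -/
noncomputable def of {d : D.Obj U} {d' : D.Obj V} (φ : D.Hom d d') :
    StkHom (J := J) (StkObj.of d) (StkObj.of d') where
  base := D.π φ
  app t k e _ _ := facF (pullHom t d ≫ φ) (pullHom k d') (π_pullHom_comp_eq t φ e)
  nat {T T'} b t k e hx hy t' k' e' hx' hy' bt bk := by
    refine hom_ext' (f := b) (pullHom k d') ?_ ?_ ?_
    · exact π_comp_val _ ((secOf d ⊤).π_map _ _ _ _)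
    · exact π_val_comp _ ((secOf d' ⊤).π_map _ _ _ _)
    · refine (Category.assoc _ _ _).trans ((congrArg (_ ≫ ·) (facF_comp _ _ _)).trans ?_)
      refine ((Category.assoc _ _ _).symm.trans (congrArg (· ≫ φ)
        (secOf_map_comp d hx hx' b bt))).trans ?_
      refine Eq.trans ?_ (Category.assoc _ _ _).symm
      refine Eq.trans ?_ (congrArg (_ ≫ ·) (secOf_map_comp d' hy hy' b bk)).symm
      exact (facF_comp (pullHom t' d ≫ φ) (pullHom k' d') (π_pullHom_comp_eq t' φ e')).symm

theorem of_app {d : D.Obj U} {d' : D.Obj V} (φ : D.Hom d d') {T : C} (t : T ⟶ U) (k : T ⟶ V)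
    (e : t ≫ D.π φ = k) (hx : (StkObj.of (J := J) d).R t) (hy : (StkObj.of (J := J) d').R k) :
    ((of φ).app t k e hx hy).1 ≫ pullHom k d' = pullHom t d ≫ φ :=
  facF_comp _ _ (π_pullHom_comp_eq t φ e)

theorem exists_of {d : D.Obj U} {d' : D.Obj V}
    (Φ : StkHom (J := J) (StkObj.of d) (StkObj.of d')) :
    ∃ φ : D.Hom d d', D.π φ = Φ.base ∧ of φ = Φ := by
  let i : D.FHom (D.pull (𝟙 U) d) d := ⟨pullHom (𝟙 U) d, π_pullHom _ _⟩
  have hb : D.π ((finv i).1 ≫ (Φ.app (𝟙 U) Φ.base (Category.id_comp _) trivial trivial).1 ≫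
      pullHom Φ.base d') = Φ.base :=
    (D.π_comp _ _).trans ((congrArg₂ (· ≫ ·) (finv i).2 ((D.π_comp _ _).trans
      (congrArg₂ (· ≫ ·) (FHom.property _) (π_pullHom _ _)))).trans (by simp))
  refine ⟨_, hb, ext hb fun {T} t k e e' hx hy => ?_⟩
  refine hom_ext' (f := 𝟙 T) (pullHom k d') (FHom.property _) (FHom.property _) ?_
  refine (of_app _ t k e hx hy).trans ?_
  have n := Φ.nat t (Category.id_comp _) trivial trivial e' hx hy (Category.comp_id t) e'
  have m : pullHom t d ≫ (finv i).1 = (secOf d ⊤).map trivial hx t (Category.comp_id t) := by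
    rw [← secOf_map_comp d trivial hx t (Category.comp_id t)]
    exact (Category.assoc _ _ _).trans ((congrArg (_ ≫ ·) (fhom_finv i)).trans
      (Category.comp_id _))
  refine ((Category.assoc _ _ _).symm.trans (congrArg (· ≫ _) m)).trans ?_
  refine ((Category.assoc _ _ _).symm.trans (congrArg (· ≫ _) n)).trans ?_
  exact (Category.assoc _ _ _).trans (congrArg (_ ≫ ·) (secOf_map_comp d' _ _ _ _))

theorem of_inj {d : D.Obj U} {d' : D.Obj V} {φ ψ : D.Hom d d'}
    (h : of (J := J) φ = of ψ) : φ = ψ := by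
  have e : D.π φ = D.π ψ := congrArg StkHom.base h
  have h1 := congr_app h (𝟙 U) (D.π φ) (Category.id_comp _)
    ((Category.id_comp (D.π ψ)).trans e.symm) trivial trivial
  have h2 := (of_app (J := J) φ (𝟙 U) (D.π φ) (Category.id_comp _) trivial trivial).symm.trans
    ((congrArg (· ≫ _) h1).trans (of_app ψ (𝟙 U) (D.π φ)
      ((Category.id_comp (D.π ψ)).trans e.symm) trivial trivial))
  let i : D.FHom (D.pull (𝟙 U) d) d := ⟨pullHom (𝟙 U) d, π_pullHom _ _⟩
  have := isIso_val i
  exact (cancel_epi i.1).1 h2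

theorem of_id (d : D.Obj U) : of (J := J) (𝟙 (Tot.mk d)) = id (StkObj.of d) := by
  refine ext_id (D.π_id d) rfl fun {T} t e e' hx hy => ?_
  refine hom_ext' (f := 𝟙 T) (pullHom t d) (FHom.property _) (FHom.property _) ?_
  refine (of_app _ t t e hx hy).trans ((Category.comp_id _).trans ?_)
  exact ((congrArg (· ≫ pullHom t d) ((StkObj.of (J := J) d).s.tr_self hx hy rfl)).trans
    (Category.id_comp _)).symm

/-- The morphism to an object of the associated stack from one of its components. -/
noncomputable def can (x : StkObj J D U) (f : V ⟶ U) (hf : x.R f) :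
    StkHom (StkObj.of (x.s.obj f hf)) x where
  base := f
  app t k e _ hy := facF (pullHom t _) (x.s.map hf hy t e) ((π_pullHom t _).trans (x.s.π_map _ _ _ _).symm)
  nat {T T'} b t k e hx hy t' k' e' hx' hy' bt bk := by
    refine hom_ext' (f := b) (x.s.map hf hy t e) ?_ ?_ ?_
    · exact π_comp_val _ (Sec.π_map _ _ _ _ _)
    · exact π_val_comp _ (Sec.π_map _ _ _ _ _)
    · refine (Category.assoc _ _ _).trans ((congrArg (_ ≫ ·) (facF_comp _ _ _)).trans ?_)
      refine (secOf_map_comp _ hx hx' b bt).trans ?_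
      refine Eq.trans ?_ (Category.assoc _ _ _).symm
      subst bt
      exact ((congrArg (_ ≫ ·) (x.s.map_comp hf hy hy' t e b bk).symm).trans
        (facF_comp _ _ _)).symm

theorem can_app (x : StkObj J D U) (f : V ⟶ U) (hf : x.R f) {T : C} (t : T ⟶ V) (k : T ⟶ U)
    (e : t ≫ f = k) (hx : (StkObj.of (J := J) (x.s.obj f hf)).R t) (hy : x.R k) :
    ((can x f hf).app t k e hx hy).1 ≫ x.s.map hf hy t e = pullHom t _ :=
  facF_comp _ _ ((π_pullHom t _).trans (x.s.π_map _ _ _ _).symm)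

variable (hD : D.IsPrestack J)

theorem of_comp {d : D.Obj U} {d' : D.Obj V} {d'' : D.Obj W} (φ : D.Hom d d') (ψ : D.Hom d' d'') :
    of (J := J) (φ ≫ ψ) = comp hD (of φ) (of ψ) := by
  refine ext (D.π_comp φ ψ) fun {T} t k e e' hx hy => ?_
  refine hom_ext' (f := 𝟙 T) (pullHom k d'') (FHom.property _) (FHom.property _) ?_
  have e1 : (t ≫ D.π φ) ≫ D.π ψ = k := (Category.assoc _ _ _).trans e'
  refine (of_app _ t k e hx hy).trans ?_
  refine Eq.trans ?_ (congrArg (· ≫ _)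
    (comp_app hD (of φ) (of ψ) t _ k rfl e1 e' hx trivial hy).symm)
  refine Eq.trans ?_ ((Category.assoc _ _ _).trans (congrArg (_ ≫ ·)
    (of_app ψ _ k e1 trivial hy))).symm
  exact (((Category.assoc _ _ _).symm.trans (congrArg (· ≫ ψ)
    (of_app φ t _ rfl hx trivial))).trans (Category.assoc _ _ _)).symm

theorem of_can (x : StkObj J D U) {f : V ⟶ U} {k : W ⟶ U} (hf : x.R f) (hk : x.R k) (g : W ⟶ V)
    (e : g ≫ f = k) : comp hD (of (x.s.map hf hk g e)) (can x f hf) = can x k hk := by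
  have hb : D.π (x.s.map hf hk g e) = g := x.s.π_map _ _ _ _
  refine ext ((congrArg (· ≫ f) hb).trans e) fun {T} t l e₁ e₂ hx hy => ?_
  have h1 : (t ≫ g) ≫ f = l := (Category.assoc _ _ _).trans ((congrArg (t ≫ ·) e).trans e₂)
  refine hom_ext' (f := 𝟙 T) (x.s.map hf hy (t ≫ g) h1) (FHom.property _) (FHom.property _) ?_
  refine (congrArg (· ≫ _) (comp_app hD _ (can x f hf) t (t ≫ g) l (congrArg (t ≫ ·) hb) h1 e₁ hx
    trivial hy)).trans ?_
  refine (Category.assoc _ _ _).trans ((congrArg (_ ≫ ·) (can_app x f hf _ l h1 trivial hy)).trans ?_)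
  refine (of_app _ t _ (congrArg (t ≫ ·) hb) hx trivial).trans ?_
  refine Eq.trans ?_ (congrArg (_ ≫ ·) (x.s.map_comp hf hk hy g e t e₂)).symm
  exact ((Category.assoc _ _ _).symm.trans
    (congrArg (· ≫ _) (can_app x k hk t l e₂ hx hy))).symm

theorem can_comp {x : StkObj J D U} {y : StkObj J D V} (β : StkHom x y) {T : C} (f : T ⟶ U)
    (k : T ⟶ V) (e : f ≫ β.base = k) (hx : x.R f) (hy : y.R k) :
    comp hD (can x f hx) β = comp hD (of (β.app f k e hx hy).1) (can y k hy) := by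
  have hb : D.π (β.app f k e hx hy).1 = 𝟙 T := FHom.property _
  refine ext (e.trans ((congrArg (· ≫ k) hb).trans (Category.id_comp k)).symm)
    fun {S} t l e₁ e₂ ht hl => ?_
  have h1 : t ≫ k = l := by rw [← e, ← Category.assoc]; exact (Category.assoc _ _ _).trans e₁
  have h2 : (t ≫ f) ≫ β.base = l := by rw [Category.assoc, e, h1]
  have h3 : t ≫ D.π (β.app f k e hx hy).1 = t := (congrArg (t ≫ ·) hb).trans (Category.comp_id t)
  have h4 := x.R.downward_closed hx t
  refine hom_ext' (f := 𝟙 S) (y.s.map hy hl t h1) (FHom.property _) (FHom.property _) ?_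
  refine (congrArg (· ≫ _) (comp_app hD (can x f hx) β t (t ≫ f) l rfl h2 e₁ ht h4 hl)).trans ?_
  refine Eq.trans ?_ (congrArg (· ≫ _) (comp_app hD (of (β.app f k e hx hy).1) (can y k hy) t t l
    h3 h1 e₂ ht trivial hl)).symm
  refine (Category.assoc _ _ _).trans ?_
  refine (congrArg (_ ≫ ·) (β.nat t e hx hy h2 h4 hl rfl h1).symm).trans ?_
  refine ((Category.assoc _ _ _).symm.trans (congrArg (· ≫ _)
    (can_app x f hx t _ rfl ht h4))).trans ?_
  refine Eq.trans ?_ ((Category.assoc _ _ _).trans (congrArg (_ ≫ ·)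
    (can_app y k hy t l h1 trivial hl))).symm
  exact (of_app (β.app f k e hx hy).1 t t h3 ht trivial).symm

theorem hom_ext {x : StkObj J D U} {y : StkObj J D V} {β β' : StkHom x y} (hb : β.base = β'.base)
    (R : Sieve U) (hR : R ∈ J U) (h : ∀ {T : C} (f : T ⟶ U), R f →
      ∃ (z : StkObj J D T) (c : StkHom z x), c.base = f ∧ comp hD c β = comp hD c β') :
    β = β' := by
  refine ext_local hD hb R hR fun {T} t k e e' hx hy ht => ?_
  obtain ⟨z, c, rfl, hc⟩ := h t ht
  refine hD.hom_ext _ _ ((π_val _).trans (π_val _).symm) z.R z.mem fun {S} a ha => ?_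
  have h1 := x.R.downward_closed hx a
  have h2 := y.R.downward_closed hy a
  have e1 : (a ≫ c.base) ≫ β.base = a ≫ k := by rw [Category.assoc, e]
  have e2 : (a ≫ c.base) ≫ β'.base = a ≫ k := by rw [Category.assoc, e']
  refine ⟨_, x.s.map hx h1 a rfl, x.s.π_map _ _ _ _, ?_⟩
  refine (β.nat a e hx hy e1 h1 h2 rfl rfl).trans (Eq.trans ?_
    (β'.nat a e' hx hy e2 h1 h2 rfl rfl).symm)
  refine congrArg (· ≫ _) ((cancel_epi (c.app a (a ≫ c.base) rfl ha h1).1).1 ?_)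
  have e3 : a ≫ c.base ≫ β.base = a ≫ k := by rw [e]
  have e4 : a ≫ c.base ≫ β'.base = a ≫ k := by rw [e']
  exact (comp_app hD c β a _ _ rfl e1 e3 ha h1 h2).symm.trans
    ((congr_app hc a _ e3 e4 ha h2).trans (comp_app hD c β' a _ _ rfl e2 e4 ha h1 h2))

theorem comp_assoc {T : C} {x : StkObj J D U} {y : StkObj J D V} {z : StkObj J D W}
    {w : StkObj J D T} (φ : StkHom x y) (ψ : StkHom y z) (χ : StkHom z w) :
    comp hD (comp hD φ ψ) χ = comp hD φ (comp hD ψ χ) :=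
  (stk J D hD).cat.assoc (W := ⟨x⟩) (X := ⟨y⟩) (Y := ⟨z⟩) (Z := ⟨w⟩) φ ψ χ

theorem id_comp {x : StkObj J D U} {y : StkObj J D V} (φ : StkHom x y) :
    comp hD (id x) φ = φ :=
  (stk J D hD).cat.id_comp (X := ⟨x⟩) (Y := ⟨y⟩) φ

theorem comp_cancel {x : StkObj J D U} {y : StkObj J D V} {z : StkObj J D W} {φ φ' : StkHom x y}
    (ψ : StkHom y z) (h : φ.base = φ'.base) (h' : comp hD φ ψ = comp hD φ' ψ) : φ = φ' :=
  FibGpd.hom_ext (P := stk J D hD) (x := x) (y := y) (z := z) (φ := φ) (φ' := φ') ψ h h'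

theorem exists_of_can {d : D.Obj W} {x : StkObj J D U} (Φ : StkHom (StkObj.of d) x) (f : W ⟶ V)
    {t : V ⟶ U} (hx : x.R t) (h : f ≫ t = Φ.base) :
    ∃ c : D.Hom d (x.s.obj t hx), D.π c = f ∧ comp hD (of c) (can x t hx) = Φ := by
  obtain ⟨χ, ⟨hχ, hχ'⟩, -⟩ := exists_fac hD Φ (can x t hx) f h
  obtain ⟨c, hc, rfl⟩ := exists_of χ
  exact ⟨c, hc.trans hχ, hχ'⟩

section Glue

variable {x : StkObj J D U} {y : StkObj J D V} (g : U ⟶ V)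
  (M : ∀ {T : C} {z : StkObj J D T}, StkHom z x → StkHom z y → Prop)
  (h1 : ∀ {T : C} {z : StkObj J D T} (c : StkHom z x) (m : StkHom z y), M c m →
    m.base = c.base ≫ g)
  (h2 : ∀ {T : C} {z : StkObj J D T} (c : StkHom z x) (m m' : StkHom z y), M c m → M c m' →
    m = m')
  (h3 : ∀ {T S : C} {z : StkObj J D T} {z' : StkObj J D S} (b : StkHom z' z) (c : StkHom z x)
    (m : StkHom z y), M c m → M (comp hD b c) (comp hD b m))
  (R : Sieve U) (hR : R ∈ J U) (h4 : ∀ {T : C} (f : T ⟶ U), R f →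
    ∃ (z : StkObj J D T) (c : StkHom z x) (m : StkHom z y), c.base = f ∧ M c m)

/-- The pairs of morphisms of the prestack whose images in the associated stack are related. -/
def GlueRel {T S : C} {t : T ⟶ U} {k : T ⟶ V} (hx : x.R t) (hy : y.R k) {d : D.Obj S}
    (c : D.Hom d (x.s.obj t hx)) (m : D.Hom d (y.s.obj k hy)) : Prop :=
  D.π m = D.π c ∧ M (comp hD (of c) (can x t hx)) (comp hD (of m) (can y k hy))

include h3 in
theorem GlueRel.comp_left {T S : C} {t : T ⟶ U} {k : T ⟶ V} {hx : x.R t} {hy : y.R k} {d : D.Obj S}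
    {c : D.Hom d (x.s.obj t hx)} {m : D.Hom d (y.s.obj k hy)} (h : GlueRel hD M hx hy c m)
    {S' : C} {d' : D.Obj S'} (b : D.Hom d' d) : GlueRel hD M hx hy (b ≫ c) (b ≫ m) := by
  refine ⟨by rw [D.π_comp, D.π_comp, h.1], ?_⟩
  rw [of_comp hD, of_comp hD, comp_assoc, comp_assoc]
  exact h3 _ _ _ h.2

include h1 h3 h4 hR in
theorem GlueRel.exists_local {T : C} {t : T ⟶ U} {k : T ⟶ V} (e : t ≫ g = k) (hx : x.R t)
    (hy : y.R k) : ∃ R' ∈ J T, ∀ {S : C} (f : S ⟶ T), R' f →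
      ∃ (d : D.Obj S) (c : D.Hom d (x.s.obj t hx)) (m : D.Hom d (y.s.obj k hy)), D.π c = f ∧
        GlueRel hD M hx hy c m := by
  let R' : Sieve T :=
    { arrows := fun S f => ∃ (d : D.Obj S) (c : D.Hom d (x.s.obj t hx))
        (m : D.Hom d (y.s.obj k hy)), D.π c = f ∧ GlueRel hD M hx hy c m
      downward_closed := by
        rintro S S' _ ⟨d, c, m, rfl, h⟩ b
        exact ⟨D.pull b d, pullHom b d ≫ c, pullHom b d ≫ m, by simp, h.comp_left hD M h3 _⟩ }
  refine ⟨R', J.transitive (J.pullback_stable t hR) R' fun S f hf => ?_, fun f hf => hf⟩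
  obtain ⟨z, c, m, hc, hm⟩ := h4 (f ≫ t) hf
  refine J.superset_covering (fun S' a ha => ?_) z.mem
  have hm' := h3 (can z a ha) c m hm
  obtain ⟨c', hc', ec⟩ := exists_of_can hD (comp hD (can z a ha) c) (a ≫ f) hx
    ((Category.assoc _ _ _).trans (congrArg (a ≫ ·) hc.symm))
  obtain ⟨m', hm'', em⟩ := exists_of_can hD (comp hD (can z a ha) m) (a ≫ f) hy (by
    refine Eq.trans ?_ (h1 _ _ hm').symm
    refine (congrArg ((a ≫ f) ≫ ·) e.symm).trans ?_
    refine Eq.trans ?_ (congrArg (fun l => (a ≫ l) ≫ g) hc.symm)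
    simp)
  exact ⟨_, c', m', hc', hm''.trans hc'.symm, by rw [ec, em]; exact hm'⟩

include h1 h2 h3 h4 hR in
theorem exists_glue_app {T : C} (t : T ⟶ U) (k : T ⟶ V) (e : t ≫ g = k) (hx : x.R t)
    (hy : y.R k) : ∃ a : D.FHom (x.s.obj t hx) (y.s.obj k hy), ∀ {S : C} {d : D.Obj S}
      (c : D.Hom d (x.s.obj t hx)) (m : D.Hom d (y.s.obj k hy)), GlueRel hD M hx hy c m →
        c ≫ a.1 = m := by
  obtain ⟨R', hR', h5⟩ := GlueRel.exists_local hD g M h1 h3 R hR h4 e hx hy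
  obtain ⟨β, hβ, h⟩ := hD.glue (𝟙 T) (fun c m => GlueRel hD M hx hy c m)
    (fun c m h => h.1.trans (Category.comp_id _).symm)
    (fun c m m' h h' => of_inj (comp_cancel hD (can y k hy) (h.1.trans h'.1.symm)
      (h2 _ _ _ h.2 h'.2)))
    (fun b c m h => h.comp_left hD M h3 b) R' hR' h5
  exact ⟨⟨β, hβ⟩, h⟩

include h1 h2 h3 h4 hR in
theorem exists_glueRel : ∃ β : StkHom x y, β.base = g ∧
    ∀ {T : C} {z : StkObj J D T} (c : StkHom z x) (m : StkHom z y), M c m → comp hD c β = m := by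
  choose a ha using fun {T : C} (t : T ⟶ U) (k : T ⟶ V) (e : t ≫ g = k) (hx : x.R t)
    (hy : y.R k) => exists_glue_app hD g M h1 h2 h3 R hR h4 t k e hx hy
  refine ⟨⟨g, a, ?_⟩, rfl, ?_⟩
  · intro T T' b t k e hx hy t' k' e' hx' hy' bt bk
    obtain ⟨R', hR', h5⟩ := GlueRel.exists_local hD g M h1 h3 R hR h4 e' hx' hy'
    refine hD.hom_ext _ _ (by simp [x.s.π_map, y.s.π_map]) R' hR' fun {S} f hf => ?_
    obtain ⟨d, c, m, hc, h⟩ := h5 f hf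
    refine ⟨d, c, hc, ?_⟩
    have h6 : GlueRel hD M hx hy (c ≫ x.s.map hx hx' b bt) (m ≫ y.s.map hy hy' b bk) := by
      refine ⟨by rw [D.π_comp, D.π_comp, h.1, x.s.π_map, y.s.π_map], ?_⟩
      rw [of_comp hD, of_comp hD, comp_assoc, comp_assoc, of_can, of_can]
      exact h.2
    rw [← Category.assoc, ha t k e hx hy _ _ h6, ← Category.assoc, ha t' k' e' hx' hy' _ _ h]
  · intro T z c m h
    have hb := h1 c m h
    refine hom_ext hD hb.symm (z.R ⊓ (x.R ⊓ y.R.pullback g).pullback c.base)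
      (J.intersection_covering z.mem (J.pullback_stable _ (J.intersection_covering x.mem
        (J.pullback_stable _ y.mem)))) fun {S} f hf => ⟨_, can z f hf.1, rfl, ?_⟩
    have hm := h3 (can z f hf.1) c m h
    have hx : x.R (f ≫ c.base) := hf.2.1
    have hy : y.R ((f ≫ c.base) ≫ g) := hf.2.2
    obtain ⟨c', hc', ec⟩ := exists_of_can hD (comp hD (can z f hf.1) c) (𝟙 S) hx
      (Category.id_comp _)
    obtain ⟨m', hm', em⟩ := exists_of_can hD (comp hD (can z f hf.1) m) (𝟙 S) hy
      ((Category.id_comp _).trans ((h1 _ _ hm).symm))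
    rw [← comp_assoc, ← ec, ← em, comp_assoc, can_comp hD _ _ ((f ≫ c.base) ≫ g) rfl hx hy,
      ← comp_assoc, ← of_comp hD]
    refine congrArg (fun l => comp hD (of l) _) (ha _ _ rfl hx hy c' m' ⟨hm'.trans hc'.symm, ?_⟩)
    rw [ec, em]
    exact hm

end Glue

end StkHom

theorem stk_isPrestack (hD : D.IsPrestack J) : (stk J D hD).IsPrestack J where
  hom_ext β β' e R hR h := StkHom.hom_ext hD e R hR h
  glue g M h1 h2 h3 R hR h4 := StkHom.exists_glueRel hD g M h1 h2 h3 R hR h4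

end FibGpd

end StackificationIsStack

end PicardStacks

namespace PicardStacks

open FibGpd PicardFib

section StackificationGluing

namespace FibGpd

variable {C : Type u} [Category.{v} C] {J : GrothendieckTopology C} {D : FibGpd.{w} C}

open StkHom

theorem exists_square_of (hD : D.IsPrestack J) {V W : C} {d : D.Obj V} {d' : D.Obj W}
    {x : StkObj J D V} {x' : StkObj J D W} (ε : StkHom (StkObj.of d) x) (hε : ε.base = 𝟙 V)
    (ε' : StkHom (StkObj.of d') x') (hε' : ε'.base = 𝟙 W) (μ : StkHom x' x) :
    ∃! c : D.Hom d' d, comp hD (of c) ε = comp hD ε' μ := by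
  have e : μ.base ≫ ε.base = (comp hD ε' μ).base :=
    (congrArg (_ ≫ ·) hε).trans ((Category.comp_id _).trans
      ((congrArg (· ≫ _) hε').trans (Category.id_comp _)).symm)
  obtain ⟨χ, ⟨hχ, hχ'⟩, -⟩ := exists_fac hD (comp hD ε' μ) ε μ.base e
  obtain ⟨c, hc, rfl⟩ := exists_of χ
  refine ⟨c, hχ', fun c' h => of_inj (comp_cancel hD ε ?_ (h.trans hχ'.symm))⟩
  have := congrArg StkHom.base (h.trans hχ'.symm)
  have h2 : D.π c' ≫ ε.base = D.π c ≫ ε.base := this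
  rw [hε, Category.comp_id, Category.comp_id] at h2
  exact h2

theorem exists_square_base (hD : D.IsPrestack J) {V W : C} {d : D.Obj V} {d' : D.Obj W}
    {x : StkObj J D V} {x' : StkObj J D W} {ε : StkHom (StkObj.of d) x} (hε : ε.base = 𝟙 V)
    {ε' : StkHom (StkObj.of d') x'} (hε' : ε'.base = 𝟙 W) {μ : StkHom x' x} {c : D.Hom d' d}
    (h : comp hD (of c) ε = comp hD ε' μ) : D.π c = μ.base := by
  have h2 : D.π c ≫ ε.base = ε'.base ≫ μ.base := congrArg StkHom.base h
  rw [hε, hε', Category.comp_id, Category.id_comp] at h2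
  exact h2

theorem stk_hasGluing (hD : D.IsPrestack J) : (stk J D hD).HasGluing J := by
  intro U R hR s
  let so {V : C} (f : V ⟶ U) (hf : R f) : StkObj J D V := s.obj f hf
  let sm {V W : C} {f : V ⟶ U} {k : W ⟶ U} (hf : R f) (hk : R k) (g : W ⟶ V) (e : g ≫ f = k) :
      StkHom (so k hk) (so f hf) := s.map hf hk g e
  have smb {V W : C} {f : V ⟶ U} {k : W ⟶ U} (hf : R f) (hk : R k) (g : W ⟶ V) (e : g ≫ f = k) :
    (sm hf hk g e).base = g := s.π_map hf hk g e
  have smc {V W T : C} {f : V ⟶ U} {k : W ⟶ U} {l : T ⟶ U} (hf : R f) (hk : R k) (hl : R l)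
    (g : W ⟶ V) (h : g ≫ f = k) (g' : T ⟶ W) (h' : g' ≫ k = l) (h'' : (g' ≫ g) ≫ f = l) :
    sm hf hl (g' ≫ g) h'' = comp hD (sm hk hl g' h') (sm hf hk g h) :=
    s.map_comp hf hk hl g h g' h'
  have smi {V : C} {f : V ⟶ U} (hf : R f) : sm hf hf (𝟙 V) (Category.id_comp f) = StkHom.id (so f hf) :=
    s.map_id hf
  let R₁ : Sieve U :=
    { arrows := fun W k => ∃ hk : R k, ∃ (d : D.Obj W) (ε : StkHom (StkObj.of d) (so k hk)),
        ε.base = 𝟙 W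
      downward_closed := by
        rintro V W k ⟨hk, d, ε, hε⟩ b
        have hk' : R (b ≫ k) := R.downward_closed hk b
        obtain ⟨χ, ⟨hχ, -⟩, -⟩ := exists_fac hD (comp hD (of (pullHom b d)) ε) (sm hk hk' b rfl)
          (𝟙 W) ((Category.id_comp _).trans ((smb hk hk' b rfl).trans
            ((congrArg₂ (· ≫ ·) (π_pullHom b d) hε).trans (Category.comp_id _)).symm))
        exact ⟨hk', _, χ, hχ⟩ }
  have hR₁ : R₁ ∈ J U := by
    refine J.transitive hR R₁ fun V f hf => ?_
    refine J.superset_covering (fun W t ht => ?_) (so f hf).mem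
    have hk : R (t ≫ f) := R.downward_closed hf t
    obtain ⟨χ, ⟨hχ, -⟩, -⟩ := exists_fac hD (can (so f hf) t ht) (sm hf hk t rfl)
      (𝟙 W) ((Category.id_comp _).trans (smb hf hk t rfl))
    exact ⟨hk, _, χ, hχ⟩
  have hle {W : C} {k : W ⟶ U} (hk : R₁ k) : R k := hk.1
  choose d ε hε using fun {W : C} (k : W ⟶ U) (hk : R₁ k) => hk.2
  choose t ht ht' using fun {V W : C} {f : V ⟶ U} {k : W ⟶ U} (hf : R₁ f) (hk : R₁ k)
    (g : W ⟶ V) (e : g ≫ f = k) =>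
      exists_square_of hD (ε f hf) (hε f hf) (ε k hk) (hε k hk) (sm hf.1 hk.1 g e)
  have htb {V W : C} {f : V ⟶ U} {k : W ⟶ U} (hf : R₁ f) (hk : R₁ k) (g : W ⟶ V)
      (e : g ≫ f = k) : D.π (t hf hk g e) = g :=
    (exists_square_base hD (hε f hf) (hε k hk) (ht hf hk g e)).trans (smb _ _ _ _)
  let b : StkObj J D U := ⟨R₁, hR₁, d, t, htb, fun {V f} hf => by
      refine (ht' hf hf (𝟙 V) (Category.id_comp f) (𝟙 _) ?_).symm
      dsimp only
      rw [of_id, StkHom.id_comp, smi]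
      exact ((stk J D hD).cat.comp_id (X := ⟨StkObj.of (d f hf)⟩) (Y := ⟨so f hf.1⟩) (ε f hf)).symm,
    fun {V W T f k l} hf hk hl g h g' h' => by
      refine (ht' hf hl (g' ≫ g) (by rw [Category.assoc, h, h']) _ ?_).symm
      dsimp only
      rw [smc hf.1 hk.1 hl.1 g h g' h', of_comp hD, comp_assoc, ht, ← comp_assoc, ht, comp_assoc]⟩
  have key {V : C} (f : V ⟶ U) (hf : R f) : ∃ l : StkHom (so f hf) b, l.base = f ∧
      ∀ {W : C} (a : W ⟶ V) (k : W ⟶ U) (e : a ≫ f = k) (hk : R₁ k),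
        comp hD (comp hD (ε k hk) (sm hf hk.1 a e)) l = can b k hk := by
    let ι := {i : Σ W : C, (W ⟶ V) × (W ⟶ U) // i.2.1 ≫ f = i.2.2 ∧ R₁ i.2.2}
    have hbc (i : ι) : (comp hD (ε i.1.2.2 i.2.2) (sm hf i.2.2.1 i.1.2.1 i.2.1)).base = i.1.2.1 :=
      (congrArg₂ (· ≫ ·) (hε _ _) (smb _ _ _ _)).trans (Category.id_comp _)
    obtain ⟨l, hl, hl'⟩ := (stk_isPrestack hD).glue_pieces (x := so f hf) (y := b) f (ι := ι)
      (V := fun i => i.1.1) (z := fun i => StkObj.of (d i.1.2.2 i.2.2))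
      (fun i => comp hD (ε i.1.2.2 i.2.2) (sm hf i.2.2.1 i.1.2.1 i.2.1))
      (fun i => can b i.1.2.2 i.2.2)
      (fun i => i.2.1.symm.trans (congrArg (· ≫ f) (hbc i).symm)) (by
        intro i j W c c' hc
        have hc' : c ≫ i.1.2.1 = c' ≫ j.1.2.1 := ((congrArg (c ≫ ·) (hbc i)).symm.trans hc).trans
          (congrArg (c' ≫ ·) (hbc j))
        have e1 : c ≫ i.1.2.2 = (c ≫ i.1.2.1) ≫ f := by rw [← i.2.1, Category.assoc]
        have e2 : c' ≫ j.1.2.2 = (c ≫ i.1.2.1) ≫ f := by rw [hc', ← j.2.1, Category.assoc]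
        have hk : R₁ ((c ≫ i.1.2.1) ≫ f) := e1 ▸ R₁.downward_closed i.2.2 c
        refine ⟨StkObj.of (d _ hk), of (t i.2.2 hk c e1), of (t j.2.2 hk c' e2), htb _ _ _ _,
          htb _ _ _ _, ?_, ?_⟩
        · refine (comp_assoc hD _ _ _).symm.trans (Eq.trans ?_ (comp_assoc hD _ _ _))
          rw [ht i.2.2 hk c e1, ht j.2.2 hk c' e2, comp_assoc, comp_assoc]
          refine congrArg (comp hD _) ?_
          refine (smc hf i.2.2.1 hk.1 _ i.2.1 c e1 rfl).symm.trans (Eq.trans ?_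
            (smc hf j.2.2.1 hk.1 _ j.2.1 c' e2 (congrArg (· ≫ f) hc'.symm)))
          congr 1
        · exact (of_can hD b i.2.2 hk c e1).trans (of_can hD b j.2.2 hk c' e2).symm)
      (R₁.pullback f) (J.pullback_stable f hR₁)
      (fun {W} a ha => ⟨⟨⟨W, a, a ≫ f⟩, rfl, ha⟩, 𝟙 W,
        (Category.id_comp _).trans (hbc ⟨⟨W, a, a ≫ f⟩, rfl, ha⟩)⟩)
    exact ⟨l, hl, fun {W} a k e hk => hl' ⟨⟨W, a, k⟩, e, hk⟩⟩
  choose l hl hl' using @key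
  refine ⟨b, l, hl, fun {V W f k} hf hk g e => ?_⟩
  refine StkHom.hom_ext hD (x := so k hk) (y := b) ?_ (R₁.pullback k) (J.pullback_stable k hR₁)
    fun {T} a ha => ⟨_, comp hD (ε (a ≫ k) ha) (sm hk (hle ha) a rfl), ?_, ?_⟩
  · exact (congrArg₂ (· ≫ ·) (smb hf hk g e) (hl f hf)).trans (e.trans (hl k hk).symm)
  · exact (congrArg₂ (· ≫ ·) (hε _ _) (smb _ _ _ _)).trans (Category.id_comp _)
  · refine Eq.trans ?_ (hl' k hk a (a ≫ k) rfl ha).symm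
    refine Eq.trans ?_ (hl' f hf (a ≫ g) (a ≫ k) (by rw [Category.assoc, e]) ha)
    change comp hD (comp hD (ε _ ha) (sm hk (hle ha) a rfl)) (comp hD (sm hf hk g e) (l f hf)) = _
    rw [smc hf hk (hle ha) g e a rfl, comp_assoc, comp_assoc, comp_assoc]

theorem stk_isStack (hD : D.IsPrestack J) : (stk J D hD).IsStack J :=
  isStack_of (stk_isPrestack hD) (stk_hasGluing hD)

end FibGpd

end StackificationGluing

end PicardStacks

namespace PicardStacks

open FibGpd PicardFib

section ToStackification

variable {C : Type u} [Category.{v} C] {J : GrothendieckTopology C} {D : PicardFib.{w} C}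

theorem PicardFib.addF_comp_eq {U V : C} {x y x' y' : D.Obj U} {z z' : D.Obj V} {a : D.FHom x y}
    {a' : D.FHom x' y'} {b : D.Hom y z} {b' : D.Hom y' z'} {c : D.Hom x z} {c' : D.Hom x' z'}
    (h : D.π b = D.π b') (e : a.1 ≫ b = c) (e' : a'.1 ≫ b' = c') (hc : D.π c = D.π c') :
    (D.addF a a').1 ≫ D.addMap b b' h = D.addMap c c' hc :=
  (D.addMap_addMap _ _ _ _ _ _).trans (D.addMap_congr _ e e')

namespace FibGpd.StkHom

variable {U V : C}

/-- The comparison of the sums of the prestack and of the associated stack. -/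
noncomputable def ofSum (x y : D.Obj U) :
    StkHom (J := J) (StkObj.of (D.add x y)) ((StkObj.of x).add (StkObj.of y)) :=
  ofComponents (fun t _ _ => facF (pullHom t (D.add x y)) (D.addMap (pullHom t x) (pullHom t y)
    ((π_pullHom t x).trans (π_pullHom t y).symm))
      ((π_pullHom t _).trans ((D.π_addMap _ _ _).trans (π_pullHom t x)).symm))
    (fun {T T'} b {t} hx hy {t'} hx' hy' e => by
      have hp : D.π (pullHom t x) = D.π (pullHom t y) := (π_pullHom t x).trans (π_pullHom t y).symm
      refine hom_ext' (f := b) (D.addMap (pullHom t x) (pullHom t y) hp)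
        (π_comp_val _ (Sec.π_map _ _ _ _ _)) (π_val_comp _ (Sec.π_map _ _ _ _ _)) ?_
      refine (Category.assoc _ _ _).trans ((congrArg (_ ≫ ·) (facF_comp _ _ _)).trans ?_)
      refine (secOf_map_comp _ hx hx' b e).trans ?_
      have h1 := (D.addMap_comp ((secOf x ⊤).map hy.1 hy'.1 b e) (pullHom t x)
        ((secOf y ⊤).map hy.2 hy'.2 b e) (pullHom t y) ((Sec.π_map _ _ _ _ _).trans
          (Sec.π_map _ _ _ _ _).symm) hp).symm.trans (D.addMap_congr _
            (secOf_map_comp x hy.1 hy'.1 b e) (secOf_map_comp y hy.2 hy'.2 b e))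
      refine Eq.trans ?_ ((Category.assoc _ _ _).trans (congrArg (_ ≫ ·) h1)).symm
      exact (facF_comp (pullHom t' (D.add x y)) _ ((π_pullHom t' _).trans
        ((D.π_addMap _ _ _).trans (π_pullHom t' x)).symm)).symm)

theorem ofSum_app (x y : D.Obj U) {T : C} (t : T ⟶ U) (e : t ≫ 𝟙 U = t)
    (hx : (StkObj.of (J := J) (D.add x y)).R t)
    (hy : ((StkObj.of (J := J) x).add (StkObj.of y)).R t)
    (hp : D.π (pullHom t x) = D.π (pullHom t y)) :
    ((ofSum x y).app t t e hx hy).1 ≫ D.addMap (pullHom t x) (pullHom t y) hp =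
      pullHom t (D.add x y) := by
  refine (Category.assoc _ _ _).trans ?_
  refine (congrArg₂ (· ≫ ·) ((StkObj.of (J := J) (D.add x y)).s.tr_self hx hx rfl)
    (facF_comp (pullHom t (D.add x y)) _ _)).trans (Category.id_comp _)

variable (hD : D.toFibGpd.IsPrestack J)

theorem π_pullHom_eq {W : C} (t : W ⟶ U) (x : D.Obj U) (y : D.Obj U) :
    D.π (pullHom t x) = D.π (pullHom t y) := (π_pullHom t x).trans (π_pullHom t y).symm

theorem ofSum_natural {x x' : D.Obj U} {y y' : D.Obj V} (φ : D.Hom x y) (ψ : D.Hom x' y')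
    (h : D.π φ = D.π ψ) : comp hD (of (D.addMap φ ψ h)) (ofSum y y') =
      comp hD (ofSum (J := J) x x') (add (of φ) (of ψ) h) := by
  have hb : D.π (D.addMap φ ψ h) = D.π φ := D.π_addMap _ _ _
  refine ext ((Category.comp_id _).trans (hb.trans (Category.id_comp _).symm))
    fun {T} t k e e' hx hy => ?_
  have ek : t ≫ D.π (D.addMap φ ψ h) = k :=
    (congrArg (t ≫ ·) (Category.comp_id (D.π (D.addMap φ ψ h)))).symm.trans e
  have ek' : t ≫ D.π φ = k := hb ▸ ek
  have ek'' : t ≫ D.π ψ = k := h ▸ ek'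
  refine hom_ext' (f := 𝟙 T) (D.addMap (pullHom k y) (pullHom k y') (π_pullHom_eq k y y'))
    (FHom.property _) (FHom.property _) ?_
  refine (congrArg (· ≫ _) (comp_app hD (of (D.addMap φ ψ h)) (ofSum y y') t k k ek
    (Category.comp_id k) e hx trivial hy)).trans ?_
  refine Eq.trans ?_ (congrArg (· ≫ _) (comp_app hD (ofSum (J := J) x x') (add (of φ) (of ψ) h)
    t t k (Category.comp_id t) ek' e' hx ⟨trivial, trivial⟩ hy).symm)
  refine (Category.assoc _ _ _).trans ((congrArg (_ ≫ ·)
    (ofSum_app y y' k _ trivial hy _)).trans ?_)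
  refine (of_app (J := J) _ t k ek hx trivial).trans ?_
  refine Eq.trans ?_ (Category.assoc _ _ _).symm
  have h1 := (D.addMap_addMap _ _ _ _ (π_pullHom_eq t x x') h).trans
    (D.addF_comp_eq (a := (of (J := J) φ).app t k ek' trivial trivial)
      (a' := (of (J := J) ψ).app t k ek'' trivial trivial) (π_pullHom_eq k y y')
      (of_app (J := J) φ t k ek' trivial trivial) (of_app (J := J) ψ t k ek'' trivial trivial)
      ((π_pullHom_comp_eq t φ ek').trans ((π_pullHom_eq k y y').trans
        (π_pullHom_comp_eq t ψ ek'').symm))).symm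
  refine Eq.trans ?_ (congrArg (_ ≫ ·) h1)
  exact ((Category.assoc _ _ _).symm.trans (congrArg (· ≫ _)
    (ofSum_app x x' t _ hx ⟨trivial, trivial⟩ _))).symm

theorem ofSum_σ (x y z : D.Obj U) :
    comp hD (of (D.σ x y z).1) (comp hD (ofSum x (D.add y z)) (add (id _) (ofSum y z) rfl)) =
      comp hD (ofSum (J := J) (D.add x y) z) (comp hD (add (ofSum x y) (id _) rfl) (σ _ _ _)) := by
  have hb : D.π (D.σ x y z).1 = 𝟙 U := FHom.property _
  refine ext_id ((congrArg₂ (· ≫ ·) hb (Category.id_comp _)).trans (Category.id_comp _))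
    ((Category.id_comp _).trans (Category.id_comp _)) fun {T} t e e' hx hz => ?_
  have i : t ≫ 𝟙 U = t := Category.comp_id t
  have ib : t ≫ D.π (D.σ x y z).1 = t := (congrArg (t ≫ ·) hb).trans i
  have ii : t ≫ 𝟙 U ≫ 𝟙 U = t := (congrArg (t ≫ ·) (Category.id_comp _)).trans i
  refine hom_ext' (f := 𝟙 T) (D.addMap (pullHom t x) (D.addMap (pullHom t y) (pullHom t z)
    (π_pullHom_eq t y z)) ((π_pullHom_eq t x y).trans (D.π_addMap _ _ _).symm))
    (FHom.property _) (FHom.property _) ?_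
  refine (congrArg (· ≫ _) (comp_app hD _ _ t t t ib ii e hx trivial hz)).trans ?_
  refine (congrArg (fun l => (_ ≫ l) ≫ _) (comp_app hD (ofSum x (D.add y z))
    (add (id _) (ofSum y z) rfl) t t t i i ii trivial ⟨trivial, trivial⟩ hz)).trans ?_
  refine Eq.trans ?_ (congrArg (· ≫ _) (comp_app hD _ _ t t t i ii e' hx
    ⟨trivial, trivial⟩ hz).symm)
  refine Eq.trans ?_ (congrArg (fun l => (_ ≫ l) ≫ _) (comp_app hD (add (ofSum x y) (id _) rfl)
    (σ _ _ _) t t t i i ii ⟨trivial, trivial⟩ ⟨⟨trivial, trivial⟩, trivial⟩ hz).symm)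
  refine (Category.assoc _ _ _).trans ?_
  have h1 := (congrArg (_ ≫ ·) (D.addF_comp_eq (a := (id (StkObj.of (J := J) x)).app t t i trivial
      trivial) (a' := (ofSum (J := J) y z).app t t i trivial ⟨trivial, trivial⟩)
        ((π_pullHom_eq t x y).trans (D.π_addMap _ _ _).symm)
        ((congrArg (· ≫ _) (id_app (StkObj.of (J := J) x) t i trivial trivial)).trans
          (Category.id_comp _)) (ofSum_app (J := J) y z t i trivial ⟨trivial, trivial⟩
            (π_pullHom_eq t y z)) (π_pullHom_eq t _ _))).trans
    (ofSum_app (J := J) x (D.add y z) t i trivial ⟨trivial, trivial⟩ (π_pullHom_eq t _ _))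
  have h2 := (congrArg (_ ≫ ·) (D.addF_comp_eq (a := (ofSum (J := J) x y).app t t i trivial
      ⟨trivial, trivial⟩) (a' := (id (StkObj.of (J := J) z)).app t t i trivial trivial)
        ((D.π_addMap _ _ _).trans (π_pullHom_eq t x z))
        (ofSum_app (J := J) x y t i trivial ⟨trivial, trivial⟩ (π_pullHom_eq t x y))
        ((congrArg (· ≫ _) (id_app (StkObj.of (J := J) z) t i trivial trivial)).trans
          (Category.id_comp _)) (π_pullHom_eq t _ _))).trans
    (ofSum_app (J := J) (D.add x y) z t i trivial ⟨trivial, trivial⟩ (π_pullHom_eq t _ _))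
  refine (congrArg (_ ≫ ·) ((Category.assoc _ _ _).trans h1)).trans ?_
  refine (of_app (J := J) _ t t ib trivial trivial).trans ?_
  refine (congrArg (· ≫ _) h2.symm).trans ?_
  refine (Category.assoc _ _ _).trans (Eq.trans ?_ (Category.assoc _ _ _).symm)
  refine congrArg (_ ≫ ·) ?_
  refine (Category.assoc _ _ _).trans (Eq.trans ?_ (Category.assoc _ _ _).symm)
  refine congrArg (_ ≫ ·) ?_
  exact (D.σ_natural _ _ _ _ _).trans (congrArg (· ≫ _) (σ_app _ _ _ t i _ _).symm)

theorem ofSum_τ (x y : D.Obj U) :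
    comp hD (of (D.τ x y).1) (ofSum y x) = comp hD (ofSum (J := J) x y) (τ _ _) := by
  have hb : D.π (D.τ x y).1 = 𝟙 U := FHom.property _
  refine ext_id ((congrArg (· ≫ _) hb).trans (Category.id_comp _)) (Category.id_comp _)
    fun {T} t e e' hx hz => ?_
  have i : t ≫ 𝟙 U = t := Category.comp_id t
  have ib : t ≫ D.π (D.τ x y).1 = t := (congrArg (t ≫ ·) hb).trans i
  refine hom_ext' (f := 𝟙 T) (D.addMap (pullHom t y) (pullHom t x) (π_pullHom_eq t y x))
    (FHom.property _) (FHom.property _) ?_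
  refine (congrArg (· ≫ _) (comp_app hD _ _ t t t ib i e hx trivial hz)).trans ?_
  refine Eq.trans ?_ (congrArg (· ≫ _) (comp_app hD _ _ t t t i i e' hx
    ⟨trivial, trivial⟩ hz).symm)
  refine (Category.assoc _ _ _).trans ((congrArg (_ ≫ ·)
    (ofSum_app y x t i trivial hz (π_pullHom_eq t y x))).trans ?_)
  refine (of_app (J := J) _ t t ib trivial trivial).trans ?_
  refine (congrArg (· ≫ _) (ofSum_app (J := J) x y t i trivial ⟨trivial, trivial⟩
    (π_pullHom_eq t x y)).symm).trans ?_
  refine (Category.assoc _ _ _).trans (Eq.trans ?_ (Category.assoc _ _ _).symm)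
  refine congrArg (_ ≫ ·) ?_
  exact (D.τ_natural _ _ _).trans (congrArg (· ≫ _) (τ_app _ _ t i _ _).symm)

end FibGpd.StkHom

open StkHom in
/-- The canonical additive functor from a Picard prestack to the associated Picard stack. -/
noncomputable def toStk (hD : D.toFibGpd.IsPrestack J) : AddFunctor D (stkPicard J D hD) where
  obj d := StkObj.of d
  map φ := StkHom.of φ
  π_map _ := rfl
  map_id d := of_id d
  map_comp φ ψ := of_comp hD φ ψ
  sum x y := ⟨ofSum x y, rfl⟩
  sum_natural φ ψ h := ofSum_natural hD φ ψ h
  map_σ x y z := ofSum_σ hD x y z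
  map_τ x y := ofSum_τ hD x y

theorem toStk_faithful (hD : D.toFibGpd.IsPrestack J) : (toStk hD).Faithful :=
  fun _ _ h => fhom_eq (StkHom.of_inj h)

theorem toStk_full (hD : D.toFibGpd.IsPrestack J) {U : C} {x y : D.Obj U}
    (φ : (stkPicard J D hD).FHom ((toStk hD).obj x) ((toStk hD).obj y)) :
    ∃ ψ : D.FHom x y, (toStk hD).map ψ.1 = φ.1 := by
  obtain ⟨c, hc, hc'⟩ := StkHom.exists_of (J := J) φ.1
  exact ⟨⟨c, hc.trans φ.2⟩, hc'⟩

theorem toStk_locEssSurj (hD : D.toFibGpd.IsPrestack J) : (toStk hD).LocEssSurj J :=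
  fun x => ⟨StkObj.R x, StkObj.mem x, fun f hf => ⟨_, StkHom.can x f hf, rfl⟩⟩

/-- The Picard stack associated to a Picard prestack. -/
noncomputable def stkPicardStack (hD : D.toFibGpd.IsPrestack J) : PicardStack.{w} J where
  toPicardFib := stkPicard J D hD
  isStack := stk_isStack hD

/-- A faithful additive functor of Picard stacks has a cokernel. -/
theorem AddFunctor.Faithful.exists_isCok {Q Y : PicardStack.{w} J}
    {K : AddFunctor Q.toPicardFib Y.toPicardFib} (hK : K.Faithful) :
    ∃ (T : PicardStack.{w} J) (L : AddFunctor Y.toPicardFib T.toPicardFib)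
      (n : AddFunctor.Hom (L.comp K) (AddFunctor.zero _ _)), AddFunctor.IsCok n J := by
  have hD := quot_isPrestack hK Q.isStack.isPrestack Q.isStack.hasGluing Y.isStack.isPrestack
  exact ⟨stkPicardStack hD, _, _, (quot_isCok hK).comp (toStk hD) (toStk_faithful hD)
    (toStk_full hD) (toStk_locEssSurj hD)⟩

end ToStackification

end PicardStacks

namespace PicardStacks

open FibGpd PicardFib

section CokernelUniqueness

namespace AddFunctor

variable {C : Type u} [Category.{v} C] {J : GrothendieckTopology C}

section Kernel

variable {Q Q' : PicardFib.{w} C} (H : AddFunctor Q Q')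

/-- The kernel of an additive functor. -/
noncomputable abbrev kernel : PicardFib.{w} C := fibProd H (zero (PicardFib.one.{w} C) Q')

/-- The inclusion of the kernel of an additive functor. -/
noncomputable abbrev kernelInc : AddFunctor (kernel H) Q := pr₁ H (zero (PicardFib.one.{w} C) Q')

/-- The vanishing of an additive functor on its kernel. -/
noncomputable def kernelNul : Hom (H.comp (kernelInc H)) (zero (kernel H) Q') where
  app x := x.iso
  naturality {U V x y} φ := (FibHom.comm φ).trans
    (congrArg (fun f => x.iso.1 ≫ Q'.zeroMap f) (FibHom.eq φ).symm)
  app_add x y := by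
    refine (congrArg FHom.val (isoAdd_sumF (G := H) (F := zero (PicardFib.one.{w} C) Q')
      x.iso y.iso)).trans ?_
    refine congrArg (· ≫ _) ?_
    exact ((congrArg (· ≫ _) (H.map_id _)).trans (Category.id_comp _)).symm

theorem isCok_kernelNul (hH : H.LocEssSurj J) : IsCok (kernelNul H) J where
  surj := hH
  full {U} q q' φ h := by
    refine ⟨⟨⟨φ.1, ⟨𝟙 U⟩, φ.2, ?_⟩, φ.2⟩, rfl, fun ψ hψ => ?_⟩
    · exact h.trans ((Category.comp_id _).symm.trans (congrArg (_ ≫ ·) (Q'.zeroMap_id U).symm))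
    · exact fhom_eq (FibHom.ext hψ (ULift.ext _ _ ((FibHom.eq ψ.1).symm.trans ψ.2)))
  ess {U} y i := ⟨⟨y, ⟨⟩, i⟩, ⟨𝟙 _, Q.π_id _⟩,
    (congrArg (· ≫ i.1) (H.map_id y)).trans (Category.id_comp _)⟩

/-- Every object of the target is isomorphic to one in the image. -/
def EssSurj : Prop := ∀ {U : C} (q' : Q'.Obj U), ∃ q : Q.Obj U, Nonempty (Q'.FHom (H.obj q) q')

variable {H}

theorem EssSurj.locEssSurj (hH : H.EssSurj) : H.LocEssSurj J := fun {U} t => by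
  refine ⟨⊤, J.top_mem U, fun {V} f _ => ?_⟩
  obtain ⟨q, ⟨φ⟩⟩ := hH (Q'.pull f t)
  exact ⟨q, φ.1 ≫ pullHom f t, by simp⟩

end Kernel

section Uniqueness

variable {Q Y T T' : PicardFib.{w} C} {K : AddFunctor Q Y} {L : AddFunctor Y T}
  {n : Hom (L.comp K) (zero Q T)} {L' : AddFunctor Y T'} {n' : Hom (L'.comp K) (zero Q T')}

/-- Endofunctors under `L` of a cokernel `L` are isomorphic to the identity. -/
theorem IsCok.exists_hom_id (h : IsCok n J) (hT : T.toFibGpd.IsPrestack J) {B : AddFunctor T T}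
    (η : Hom (B.comp L) L)
    (hη : ∀ {U : C} (q : Q.Obj U), B.map (nul n q).1 ≫ (B.unit U).1 =
      (η.app (K.obj q)).1 ≫ (nul n q).1) : ∃ η' : Hom B (id T), ∀ {U : C} (y : Y.Obj U),
        (η'.app (L.obj y)).1 = (η.app y).1 := by
  have h1 {U : C} (q : Q.Obj U) : B.map (nul n q).1 ≫ (B.unit U).1 =
      ((η.trans (idCompInv L)).app (K.obj q)).1 ≫ (id T).map (nul n q).1 ≫ ((id T).unit U).1 :=
    (hη q).trans (congrArg₂ (· ≫ ·) (Category.comp_id _).symm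
      ((congrArg (_ ≫ ·) (id_unit U)).trans (Category.comp_id _)).symm)
  obtain ⟨η', h'⟩ := h.exists_hom hT (η.trans (idCompInv L)) h1
  exact ⟨η', fun y => (h' y).trans (Category.comp_id _)⟩

/-- The comparison of two cokernels composed with the comparison in the other direction. -/
theorem IsCok.exists_comp_hom_id (h : IsCok n J) (hT : T.toFibGpd.IsPrestack J)
    {B : AddFunctor T T'} {B' : AddFunctor T' T} (η : Hom (B.comp L) L') (η' : Hom (B'.comp L') L)
    (hη : ∀ {U : C} (q : Q.Obj U), B.map (nul n q).1 ≫ (B.unit U).1 =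
      (η.app (K.obj q)).1 ≫ (nul n' q).1)
    (hη' : ∀ {U : C} (q : Q.Obj U), B'.map (nul n' q).1 ≫ (B'.unit U).1 =
      (η'.app (K.obj q)).1 ≫ (nul n q).1) : Nonempty (Hom (B'.comp B) (id T)) := by
  obtain ⟨θ, -⟩ := h.exists_hom_id hT (((compAssoc B' B L).trans (η.whiskerLeft B')).trans η')
    fun {U} q => by
      have e1 : (B'.comp B).map (nul n q).1 ≫ ((B'.comp B).unit U).1 =
          B'.map (B.map (nul n q).1 ≫ (B.unit U).1) ≫ (B'.unit U).1 := by
        rw [comp_unit, B'.map_comp, Category.assoc]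
        rfl
      rw [e1, hη]
      refine (congrArg (· ≫ (B'.unit U).1) (B'.map_comp (η.app (K.obj q)).1 (nul n' q).1)).trans ?_
      refine (Category.assoc _ _ _).trans ((congrArg (_ ≫ ·) (hη' q)).trans ?_)
      refine (Category.assoc _ _ _).symm.trans (congrArg (· ≫ (nul n q).1) ?_)
      exact congrArg (· ≫ _) (Category.id_comp (B'.map (η.app (K.obj q)).1)).symm
  exact ⟨θ⟩

theorem IsCok.exists_comparison (h : IsCok n J) (h' : IsCok n' J) (hT : T.toFibGpd.IsStack J)
    (hT' : T'.toFibGpd.IsStack J) : ∃ (B : AddFunctor T T') (B' : AddFunctor T' T)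
      (η : Hom (B.comp L) L'), (∀ {U : C} (q : Q.Obj U), B.map (nul n q).1 ≫ (B.unit U).1 =
        (η.app (K.obj q)).1 ≫ (nul n' q).1) ∧ Nonempty (Hom (B'.comp B) (id T)) ∧
      Nonempty (Hom (B.comp B') (id T')) := by
  obtain ⟨B, η, hη⟩ := h.exists_desc hT'.isPrestack hT'.hasGluing n'
  obtain ⟨B', η', hη'⟩ := h'.exists_desc hT.isPrestack hT.hasGluing n
  exact ⟨B, B', η, hη, h.exists_comp_hom_id hT.isPrestack η η' hη hη',
    h'.exists_comp_hom_id hT'.isPrestack η' η hη' hη⟩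

end Uniqueness

section QuasiInverse

variable {A B : PicardFib.{w} C} {F : AddFunctor A B} {G : AddFunctor B A}

theorem Hom.map_inj (α : Hom (G.comp F) (id A)) {U : C} {x y : A.Obj U} {φ ψ : A.FHom x y}
    (h : F.map φ.1 = F.map ψ.1) : φ = ψ := by
  refine fhom_eq ((cancel_epi (α.app x).1).1 ?_)
  exact (α.naturality φ.1).symm.trans ((congrArg (fun t => G.map t ≫ (α.app y).1) h).trans
    (α.naturality ψ.1))

theorem Hom.existsUnique_map_eq (α : Hom (G.comp F) (id A)) (β : Hom (F.comp G) (id B)) {U : C}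
    {x y : A.Obj U} (φ : B.FHom (F.obj x) (F.obj y)) : ∃! ψ : A.FHom x y, F.map ψ.1 = φ.1 := by
  let ψ : A.FHom x y := ⟨(finv (α.app x)).1 ≫ G.map φ.1 ≫ (α.app y).1,
    π_val_comp _ (π_comp_val _ ((G.π_map _).trans φ.2))⟩
  have h1 : (α.app x).1 ≫ ψ.1 = G.map φ.1 ≫ (α.app y).1 := fhom_finv_assoc _ _
  have h2 : G.map (F.map ψ.1) = G.map φ.1 :=
    (cancel_mono (α.app y).1).1 ((α.naturality ψ.1).trans h1)
  have h3 : (F.fmap ψ : B.FHom (F.obj x) (F.obj y)) = φ := β.map_inj h2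
  exact ⟨ψ, congrArg FHom.val h3, fun ψ' h' => α.map_inj (h'.trans (congrArg FHom.val h3).symm)⟩

theorem Hom.essSurj (β : Hom (F.comp G) (id B)) : F.EssSurj := fun y => ⟨G.obj y, ⟨β.app y⟩⟩

end QuasiInverse

end AddFunctor

end CokernelUniqueness

end PicardStacks

namespace PicardStacks

open FibGpd PicardFib AddFunctor

section OverMorphisms

namespace Extension

variable {C : Type u} [Category.{v} C] {J : GrothendieckTopology C}
  {P Q Q' Q'' : PicardStack.{w} J}

theorem _root_.PicardStacks.AddFunctor.nul_map_fiber {Q Y T : PicardFib.{w} C}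
    {K : AddFunctor Q Y} {L : AddFunctor Y T} (n : AddFunctor.Hom (L.comp K) (zero Q T)) {U : C}
    {q q' : Q.Obj U} (φ : Q.FHom q q') :
    L.map (K.map φ.1) ≫ (AddFunctor.nul n q').1 = (AddFunctor.nul n q).1 := by
  rw [AddFunctor.nul_natural, φ.2, T.zeroMap_id]
  exact Category.comp_id _

theorem isCok (E : Extension P Q) : IsCok E.nul J where
  surj := E.surj
  full := ((toKer_isEquivalence_iff E.nul).1 E.ker).1
  ess := ((toKer_isEquivalence_iff E.nul).1 E.ker).2

/-- The extension given by a cokernel. -/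
def ofIsCok {E : PicardStack.{w} J} {inc : AddFunctor Q.toPicardFib E.toPicardFib}
    {proj : AddFunctor E.toPicardFib P.toPicardFib}
    {nul : Hom (proj.comp inc) (zero Q.toPicardFib P.toPicardFib)} (h : IsCok nul J) :
    Extension P Q where
  E := E
  inc := inc
  proj := proj
  nul := nul
  surj := h.surj
  ker := (toKer_isEquivalence_iff nul).2 ⟨h.full, h.ess⟩

/-- Morphisms of extensions of `P` over an additive functor `H : Q → Q'`. -/
structure OverMor (E : Extension P Q) (E' : Extension P Q')
    (H : AddFunctor Q.toPicardFib Q'.toPicardFib) where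
  F : AddFunctor E.E.toPicardFib E'.E.toPicardFib
  projIso : AddFunctor.Hom (E'.proj.comp F) E.proj
  incIso : AddFunctor.Hom (F.comp E.inc) (E'.inc.comp H)
  compat : ∀ {U : C} (q : Q.Obj U),
    (projIso.app (E.inc.obj q)).1 ≫ (AddFunctor.nul E.nul q).1 =
      E'.proj.map (incIso.app q).1 ≫ (AddFunctor.nul E'.nul (H.obj q)).1

variable {H : AddFunctor Q.toPicardFib Q'.toPicardFib}

/-- A morphism of extensions over the identity of `P`. -/
def Mor.toOver {E : Extension P Q} {E' : Extension P Q'}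
    (m : Mor E E' (AddFunctor.id P.toPicardFib) H) : OverMor E E' H where
  F := m.F
  projIso := m.projIso.trans (idComp E.proj)
  incIso := m.incIso
  compat {U} q := by
    refine Eq.trans ?_ (m.compat q)
    refine congrArg₂ (· ≫ ·) (Category.comp_id _) ?_
    exact ((congrArg (_ ≫ ·) (id_unit U)).trans (Category.comp_id _)).symm

namespace OverMor

variable {E : Extension P Q} {E' : Extension P Q'} {E'' : Extension P Q''}

/-- A morphism over the identity of `P` is a morphism of extensions. -/
def toMor (m : OverMor E E' H) : Mor E E' (AddFunctor.id P.toPicardFib) H where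
  F := m.F
  projIso := m.projIso.trans (idCompInv E.proj)
  incIso := m.incIso
  compat {U} q := by
    refine Eq.trans ?_ (m.compat q)
    refine congrArg₂ (· ≫ ·) (Category.comp_id _) ?_
    exact (congrArg (_ ≫ ·) (id_unit U)).trans (Category.comp_id _)

theorem equivalent {E E' : Extension P Q} (m : OverMor E E' (AddFunctor.id _)) :
    Equivalent E E' := ⟨m.toMor⟩

/-- The identity. -/
def refl (E : Extension P Q) : OverMor E E (AddFunctor.id _) where
  F := AddFunctor.id _
  projIso := compId E.proj
  incIso := (idComp E.inc).trans (compIdInv E.inc)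
  compat q := by
    refine congrArg (· ≫ (AddFunctor.nul E.nul q).1) ?_
    exact ((congrArg E.proj.map (Category.comp_id _)).trans (E.proj.map_id _)).symm

/-- Change of the functor `H` along an isomorphism. -/
def congr (m : OverMor E E' H) {H' : AddFunctor Q.toPicardFib Q'.toPicardFib}
    (a : AddFunctor.Hom H H') : OverMor E E' H' where
  F := m.F
  projIso := m.projIso
  incIso := m.incIso.trans (a.whiskerLeft E'.inc)
  compat {U} q := by
    have h := AddFunctor.nul_natural E'.nul (a.app q).1
    have h' : E'.proj.map (E'.inc.map (a.app q).1) ≫ (AddFunctor.nul E'.nul (H'.obj q)).1 =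
        (AddFunctor.nul E'.nul (H.obj q)).1 :=
      h.trans ((congrArg (fun f => _ ≫ P.zeroMap f) (a.app q).2).trans
        ((congrArg (_ ≫ ·) (P.zeroMap_id U)).trans (Category.comp_id _)))
    refine (m.compat q).trans ?_
    refine (congrArg (_ ≫ ·) h'.symm).trans ((Category.assoc _ _ _).symm.trans ?_)
    exact congrArg (· ≫ _) (E'.proj.map_comp _ _).symm

/-- Composition. -/
def comp {H' : AddFunctor Q'.toPicardFib Q''.toPicardFib} (m' : OverMor E' E'' H')
    (m : OverMor E E' H) : OverMor E E'' (H'.comp H) where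
  F := m'.F.comp m.F
  projIso := ((compAssocInv E''.proj m'.F m.F).trans (m'.projIso.whiskerRight m.F)).trans m.projIso
  incIso := ((((compAssoc m'.F m.F E.inc).trans (m.incIso.whiskerLeft m'.F)).trans
    (compAssocInv m'.F E'.inc H)).trans (m'.incIso.whiskerRight H)).trans (compAssoc E''.inc H' H)
  compat {U} q := by
    let p₁ := (m.projIso.app (E.inc.obj q)).1
    let i₁ := (m.incIso.app q).1
    let i₂ := (m'.incIso.app (H.obj q)).1
    have e1 : ((((compAssocInv E''.proj m'.F m.F).trans (m'.projIso.whiskerRight m.F)).trans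
        m.projIso).app (E.inc.obj q)).1 =
        (m'.projIso.app (m.F.obj (E.inc.obj q))).1 ≫ p₁ :=
      congrArg (· ≫ p₁) (Category.id_comp _)
    have e2 : (((((compAssoc m'.F m.F E.inc).trans (m.incIso.whiskerLeft m'.F)).trans
        (compAssocInv m'.F E'.inc H)).trans (m'.incIso.whiskerRight H)).trans
        (compAssoc E''.inc H' H) |>.app q).1 = m'.F.map i₁ ≫ i₂ :=
      (Category.comp_id _).trans (congrArg (· ≫ i₂) ((Category.comp_id _).trans
        (Category.id_comp _)))
    refine (congrArg (· ≫ _) e1).trans (Eq.trans ?_ (congrArg (fun t => E''.proj.map t ≫ _) e2).symm)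
    refine (Category.assoc _ _ _).trans ((congrArg (_ ≫ ·) (m.compat q)).trans ?_)
    refine (Category.assoc _ _ _).symm.trans ((congrArg (· ≫ _)
      (m'.projIso.naturality i₁).symm).trans ((Category.assoc _ _ _).trans
        ((congrArg (_ ≫ ·) (m'.compat (H.obj q))).trans ?_)))
    exact (Category.assoc _ _ _).symm.trans (congrArg (· ≫ _) (E''.proj.map_comp _ _).symm)

end OverMor

theorem equivalent_refl (E : Extension P Q) : Equivalent E E := (OverMor.refl E).equivalent

theorem Equivalent.exists_overMor {E E' : Extension P Q} (h : Equivalent E E') :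
    Nonempty (OverMor E E' (AddFunctor.id _)) := h.map Mor.toOver

theorem Equivalent.trans {E E' E'' : Extension P Q} (h : Equivalent E E')
    (h' : Equivalent E' E'') : Equivalent E E'' := by
  obtain ⟨m⟩ := h.exists_overMor
  obtain ⟨m'⟩ := h'.exists_overMor
  exact ((m'.comp m).congr (compId _)).equivalent

namespace OverMor

variable {X : Extension P Q} {S : Extension P Q'}

/-- The isomorphism `S.proj (m.F x) ≅ X.proj x`. -/
def p (m : OverMor X S H) {U : C} (x : X.E.Obj U) :
    P.FHom (S.proj.obj (m.F.obj x)) (X.proj.obj x) := m.projIso.app x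

/-- The isomorphism `m.F (X.inc q) ≅ S.inc (H q)`. -/
def i (m : OverMor X S H) {U : C} (q : Q.Obj U) :
    S.E.FHom (m.F.obj (X.inc.obj q)) (S.inc.obj (H.obj q)) := m.incIso.app q

theorem p_natural (m : OverMor X S H) {U V : C} {x : X.E.Obj U} {y : X.E.Obj V}
    (φ : X.E.Hom x y) :
    S.proj.map (m.F.map φ) ≫ (m.p y).1 = (m.p x).1 ≫ X.proj.map φ := m.projIso.naturality φ

theorem i_natural (m : OverMor X S H) {U V : C} {q : Q.Obj U} {q' : Q.Obj V} (φ : Q.Hom q q') :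
    m.F.map (X.inc.map φ) ≫ (m.i q').1 = (m.i q).1 ≫ S.inc.map (H.map φ) :=
  m.incIso.naturality φ

theorem p_nul (m : OverMor X S H) {U : C} (q : Q.Obj U) :
    (m.p (X.inc.obj q)).1 ≫ (AddFunctor.nul X.nul q).1 =
      S.proj.map (m.i q).1 ≫ (AddFunctor.nul S.nul (H.obj q)).1 := m.compat q

/-- A morphism over `H` vanishes on the kernel of `H`. -/
noncomputable def kerNul (m : OverMor X S H) :
    AddFunctor.Hom (m.F.comp (X.inc.comp (kernelInc H))) (zero (kernel H) S.E.toPicardFib) :=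
  ((((compAssocInv m.F X.inc (kernelInc H)).trans (m.incIso.whiskerRight (kernelInc H))).trans
    (compAssoc S.inc H (kernelInc H))).trans ((kernelNul H).whiskerLeft S.inc)).trans
      (zeroComp (kernel H) S.inc).symm

theorem kerNul_app (m : OverMor X S H) {U : C} (q : (kernel H).Obj U) :
    (AddFunctor.nul m.kerNul q).1 =
      (m.incIso.app q.fst).1 ≫ S.inc.map q.iso.1 ≫ (S.inc.unit U).1 := by
  refine Eq.trans ?_ (Category.assoc _ _ _)
  refine congrArg₂ (· ≫ ·) (congrArg (· ≫ _) ((Category.comp_id _).trans (Category.id_comp _))) ?_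
  exact finv_finv (S.inc.unit U)

theorem proj_i (m : OverMor X S H) {U : C} (q : Q.Obj U) (j : Q'.FHom (H.obj q) (Q'.zero U)) :
    S.proj.map ((m.i q).1 ≫ S.inc.map j.1 ≫ (S.inc.unit U).1) ≫ (S.proj.unit U).1 =
      (m.p (X.inc.obj q)).1 ≫ (AddFunctor.nul X.nul q).1 := by
  rw [m.p_nul, ← AddFunctor.nul_map_fiber S.nul j, AddFunctor.nul_zero]
  simp only [S.proj.map_comp, Category.assoc]

theorem locEssSurj (m : OverMor X S H) (hH : H.EssSurj) : m.F.LocEssSurj J := fun {U} t => by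
  obtain ⟨R, hR, h⟩ := X.surj (S.proj.obj t)
  refine ⟨R, hR, fun {V} f hf => ?_⟩
  obtain ⟨x, φ, hφ⟩ := h f hf
  let γ : P.FHom (S.proj.obj (S.E.pull f t)) (S.proj.obj (m.F.obj x)) :=
    finv ⟨(m.p x).1 ≫ (facF φ (S.proj.map (pullHom f t)) (by simp [hφ])).1, by simp⟩
  obtain ⟨q', α, -⟩ := S.isCok.exists_translate γ
  obtain ⟨q, ⟨β⟩⟩ := hH q'
  exact ⟨X.E.add x (X.inc.obj q), (m.F.sum x (X.inc.obj q)).1 ≫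
    S.E.addMap (𝟙 _) ((m.i q).1 ≫ S.inc.map β.1) (by simp) ≫ α.1 ≫ pullHom f t, by simp⟩

theorem full_aux (m : OverMor X S H) {U : C} {q q' : Q.Obj U} (j : Q'.FHom (H.obj q) (Q'.zero U))
    (j' : Q'.FHom (H.obj q') (Q'.zero U)) (φ : X.E.FHom (X.inc.obj q) (X.inc.obj q'))
    (h : m.F.map φ.1 ≫ (m.i q').1 ≫ S.inc.map j'.1 ≫ (S.inc.unit U).1 =
      (m.i q).1 ≫ S.inc.map j.1 ≫ (S.inc.unit U).1) :
    ∃ ψ : Q.FHom q q', X.inc.map ψ.1 = φ.1 ∧ (∀ ψ' : Q.FHom q q', X.inc.map ψ'.1 = φ.1 → ψ' = ψ) ∧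
      H.map ψ.1 ≫ j'.1 = j.1 := by
  have h1 : X.proj.map φ.1 ≫ (AddFunctor.nul X.nul q').1 = (AddFunctor.nul X.nul q).1 := by
    rw [← cancel_epi (m.p (X.inc.obj q)).1, ← m.proj_i q j, ← h, ← Category.assoc, ← m.p_natural,
      Category.assoc, ← m.proj_i q' j']
    simp only [S.proj.map_comp, Category.assoc]
  obtain ⟨ψ, hψ, hu⟩ := X.isCok.full q q' φ h1
  refine ⟨ψ, hψ, hu, ?_⟩
  have e1 : S.inc.map (H.map ψ.1 ≫ j'.1) = S.inc.map j.1 := by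
    rw [← cancel_mono (S.inc.unit U).1, ← cancel_epi (m.i q).1, ← h, ← hψ, S.inc.map_comp,
      ← Category.assoc, ← Category.assoc, ← m.i_natural]
    simp only [Category.assoc]
  obtain ⟨_, _, hu'⟩ := S.isCok.full (H.obj q) (Q'.zero U) (S.inc.fmap j)
    (AddFunctor.nul_map_fiber S.nul j)
  exact congrArg FHom.val ((hu' ⟨H.map ψ.1 ≫ j'.1, by simp⟩ e1).trans (hu' j rfl).symm)

theorem ess_aux (m : OverMor X S H) {U : C} (x : X.E.Obj U)
    (j : S.E.FHom (m.F.obj x) (S.E.zero U)) :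
    ∃ (q : Q.Obj U) (k : Q'.FHom (H.obj q) (Q'.zero U)) (φ : X.E.FHom (X.inc.obj q) x),
      m.F.map φ.1 ≫ j.1 = (m.i q).1 ≫ S.inc.map k.1 ≫ (S.inc.unit U).1 := by
  obtain ⟨q, φ, hφ⟩ := X.isCok.ess x ⟨(finv (m.p x)).1 ≫ S.proj.map j.1 ≫ (S.proj.unit U).1,
    by simp⟩
  let χ : S.E.FHom (S.inc.obj (H.obj q)) (S.inc.obj (Q'.zero U)) :=
    ⟨(finv (m.i q)).1 ≫ m.F.map φ.1 ≫ j.1 ≫ (finv (S.inc.unit U)).1, by simp⟩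
  have hχ : (m.i q).1 ≫ χ.1 ≫ (S.inc.unit U).1 = m.F.map φ.1 ≫ j.1 := by simp [χ]
  obtain ⟨k, hk, -⟩ := S.isCok.full (H.obj q) (Q'.zero U) χ (by
    haveI := isIso_val (S.proj.fmap (m.i q))
    rw [← cancel_epi (S.proj.fmap (m.i q)).1]
    change S.proj.map (m.i q).1 ≫ S.proj.map χ.1 ≫ _ = S.proj.map (m.i q).1 ≫ _
    rw [← m.p_nul, AddFunctor.nul_zero, ← hφ, ← Category.assoc (m.p (X.inc.obj q)).1, ← m.p_natural]
    simp only [Category.assoc, fhom_finv_assoc]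
    have := congrArg S.proj.map hχ
    simp only [S.proj.map_comp] at this
    simpa only [Category.assoc] using congrArg (· ≫ (S.proj.unit U).1) this)
  exact ⟨q, k, φ, by rw [hk, hχ]⟩

theorem isCok_kerNul (m : OverMor X S H) (hH : H.EssSurj) : IsCok m.kerNul J where
  surj := m.locEssSurj hH
  full {U} q q' φ h := by
    obtain ⟨ψ, hψ, hu, h2⟩ := m.full_aux q.iso q'.iso φ
      (((congrArg (_ ≫ ·) (m.kerNul_app q').symm).trans h).trans (m.kerNul_app q))
    refine ⟨⟨⟨ψ.1, ⟨𝟙 U⟩, ψ.2, h2.trans ((Category.comp_id _).symm.trans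
      (congrArg (_ ≫ ·) (Q'.zeroMap_id U).symm))⟩, ψ.2⟩, hψ, fun χ hχ => ?_⟩
    exact fhom_eq (FibHom.ext (congrArg FHom.val (hu ⟨FibHom.fst χ.1, χ.2⟩ hχ))
      (ULift.ext _ _ ((FibHom.eq χ.1).symm.trans χ.2)))
  ess {U} x j := by
    obtain ⟨q, k, φ, h⟩ := m.ess_aux x j
    exact ⟨⟨q, ⟨⟩, k⟩, φ, h.trans (m.kerNul_app (U := U) ⟨q, ⟨⟩, k⟩).symm⟩

end OverMor

end Extension

end OverMorphisms

end PicardStacks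

namespace PicardStacks

open FibGpd PicardFib AddFunctor

section OverUniqueness

namespace Extension

variable {C : Type u} [Category.{v} C] {J : GrothendieckTopology C}
  {P Q Q' : PicardStack.{w} J} {H : AddFunctor Q.toPicardFib Q'.toPicardFib}

namespace OverMor

variable {X : Extension P Q} {S₁ S₂ : Extension P Q'}

theorem exists_projIso (m₁ : OverMor X S₁ H) (m₂ : OverMor X S₂ H) (hH : H.EssSurj)
    (B : AddFunctor S₁.E.toPicardFib S₂.E.toPicardFib) (η : AddFunctor.Hom (B.comp m₁.F) m₂.F)
    (hη : ∀ {U : C} (q : Q.Obj U) (j : Q'.FHom (H.obj q) (Q'.zero U)),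
      B.map ((m₁.i q).1 ≫ S₁.inc.map j.1 ≫ (S₁.inc.unit U).1) ≫ (B.unit U).1 =
        (η.app (X.inc.obj q)).1 ≫ (m₂.i q).1 ≫ S₂.inc.map j.1 ≫ (S₂.inc.unit U).1) :
    ∃ θ : AddFunctor.Hom (S₂.proj.comp B) S₁.proj, ∀ {U : C} (x : X.E.Obj U),
      (θ.app (m₁.F.obj x)).1 = S₂.proj.map (η.app x).1 ≫ (m₂.p x).1 ≫ (finv (m₁.p x)).1 := by
  let e {U : C} (x : X.E.Obj U) : S₂.E.FHom (B.obj (m₁.F.obj x)) (m₂.F.obj x) := η.app x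
  let ζ : AddFunctor.Hom ((S₂.proj.comp B).comp m₁.F) (S₁.proj.comp m₁.F) :=
    (((compAssoc S₂.proj B m₁.F).trans (η.whiskerLeft S₂.proj)).trans m₂.projIso).trans
      m₁.projIso.symm
  have hζ {U : C} (x : X.E.Obj U) : (ζ.app x).1 =
      S₂.proj.map (e x).1 ≫ (m₂.p x).1 ≫ (finv (m₁.p x)).1 := by
    refine Eq.trans ?_ (Category.assoc _ _ _)
    exact congrArg (· ≫ _) (congrArg (· ≫ _) (Category.id_comp _))
  have key {U : C} (q : Q.Obj U) (j : Q'.FHom (H.obj q) (Q'.zero U)) :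
      S₂.proj.map (B.map ((m₁.i q).1 ≫ S₁.inc.map j.1 ≫ (S₁.inc.unit U).1)) ≫
        S₂.proj.map (B.unit U).1 ≫ (S₂.proj.unit U).1 =
      (S₂.proj.map (e (X.inc.obj q)).1 ≫ (m₂.p (X.inc.obj q)).1 ≫
        (finv (m₁.p (X.inc.obj q))).1) ≫
        S₁.proj.map ((m₁.i q).1 ≫ S₁.inc.map j.1 ≫ (S₁.inc.unit U).1) ≫ (S₁.proj.unit U).1 := by
    have h : B.map ((m₁.i q).1 ≫ S₁.inc.map j.1 ≫ (S₁.inc.unit U).1) ≫ (B.unit U).1 =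
        (e (X.inc.obj q)).1 ≫ (m₂.i q).1 ≫ S₂.inc.map j.1 ≫ (S₂.inc.unit U).1 := hη q j
    rw [m₁.proj_i, ← Category.assoc, ← S₂.proj.map_comp, h, S₂.proj.map_comp, Category.assoc,
      m₂.proj_i]
    simp
  obtain ⟨θ, hθ⟩ := (m₁.isCok_kerNul hH).exists_hom P.isStack.isPrestack ζ fun {U} q => by
    refine (congrArg₂ (fun s t => S₂.proj.map (B.map s) ≫ t) (m₁.kerNul_app q)
      (comp_unit S₂.proj B U)).trans ((key q.fst q.iso).trans ?_)
    exact congrArg₂ (fun s t => s ≫ S₁.proj.map t ≫ _) (hζ _).symm (m₁.kerNul_app q).symm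
  exact ⟨θ, fun x => (hθ x).trans (hζ x)⟩

theorem exists_incIso (m₁ : OverMor X S₁ H) (m₂ : OverMor X S₂ H) (hH : H.EssSurj)
    (B : AddFunctor S₁.E.toPicardFib S₂.E.toPicardFib) (η : AddFunctor.Hom (B.comp m₁.F) m₂.F)
    (hη : ∀ {U : C} (q : Q.Obj U) (j : Q'.FHom (H.obj q) (Q'.zero U)),
      B.map ((m₁.i q).1 ≫ S₁.inc.map j.1 ≫ (S₁.inc.unit U).1) ≫ (B.unit U).1 =
        (η.app (X.inc.obj q)).1 ≫ (m₂.i q).1 ≫ S₂.inc.map j.1 ≫ (S₂.inc.unit U).1) :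
    ∃ ι : AddFunctor.Hom (B.comp S₁.inc) S₂.inc, ∀ {U : C} (q : Q.Obj U),
      B.map (m₁.i q).1 ≫ (ι.app (H.obj q)).1 = (η.app (X.inc.obj q)).1 ≫ (m₂.i q).1 := by
  let e {U : C} (x : X.E.Obj U) : S₂.E.FHom (B.obj (m₁.F.obj x)) (m₂.F.obj x) := η.app x
  let ζ : AddFunctor.Hom ((B.comp S₁.inc).comp H) (S₂.inc.comp H) :=
    ((((compAssoc B S₁.inc H).trans (m₁.incIso.symm.whiskerLeft B)).trans
      (compAssocInv B m₁.F X.inc)).trans (η.whiskerRight X.inc)).trans m₂.incIso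
  have hζ {U : C} (q : Q.Obj U) : (ζ.app q).1 =
      B.map (finv (m₁.i q)).1 ≫ (e (X.inc.obj q)).1 ≫ (m₂.i q).1 := by
    refine Eq.trans ?_ (Category.assoc _ _ _)
    exact congrArg (· ≫ _) (congrArg (· ≫ _) ((Category.comp_id _).trans (Category.id_comp _)))
  have hf {U : C} (q : Q.Obj U) : B.map (m₁.i q).1 ≫ B.map (finv (m₁.i q)).1 = 𝟙 _ := by
    rw [← B.map_comp, fhom_finv, B.map_id]
  have hf' {U : C} (q : Q.Obj U) : B.map (finv (m₁.i q)).1 ≫ B.map (m₁.i q).1 = 𝟙 _ := by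
    rw [← B.map_comp, finv_fhom, B.map_id]
  have key {U : C} (q : Q.Obj U) (j : Q'.FHom (H.obj q) (Q'.zero U)) :
      B.map (S₁.inc.map j.1) ≫ B.map (S₁.inc.unit U).1 ≫ (B.unit U).1 =
      (B.map (finv (m₁.i q)).1 ≫ (e (X.inc.obj q)).1 ≫ (m₂.i q).1) ≫
        S₂.inc.map j.1 ≫ (S₂.inc.unit U).1 := by
    have h : B.map ((m₁.i q).1 ≫ S₁.inc.map j.1 ≫ (S₁.inc.unit U).1) ≫ (B.unit U).1 =
        (e (X.inc.obj q)).1 ≫ (m₂.i q).1 ≫ S₂.inc.map j.1 ≫ (S₂.inc.unit U).1 := hη q j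
    rw [Category.assoc, Category.assoc, ← h, B.map_comp, B.map_comp, Category.assoc,
      ← Category.assoc (B.map (finv (m₁.i q)).1), hf', Category.id_comp, Category.assoc]
  obtain ⟨ι, hι⟩ := (isCok_kernelNul (J := J) H hH.locEssSurj).exists_hom
    S₂.E.isStack.isPrestack ζ fun {U} q => by
    refine (congrArg (B.map (S₁.inc.map q.iso.1) ≫ ·) (comp_unit B S₁.inc U)).trans
      ((key q.fst q.iso).trans ?_)
    exact congrArg (· ≫ S₂.inc.map q.iso.1 ≫ (S₂.inc.unit U).1) (hζ q.fst).symm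
  refine ⟨ι, fun q => ?_⟩
  refine (congrArg (_ ≫ ·) ((hι q).trans (hζ q))).trans ((Category.assoc _ _ _).symm.trans ?_)
  exact (congrArg (· ≫ _) (hf q)).trans (Category.id_comp _)

/-- Extensions receiving morphisms from the same extension over the same essentially surjective
functor are equivalent. -/
theorem equivalent_of_essSurj (m₁ : OverMor X S₁ H) (m₂ : OverMor X S₂ H) (hH : H.EssSurj) :
    Equivalent S₁ S₂ := by
  obtain ⟨B, η, hη⟩ := (m₁.isCok_kerNul hH).exists_desc S₂.E.isStack.isPrestack
    S₂.E.isStack.hasGluing m₂.kerNul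
  have hη' {U : C} (q : Q.Obj U) (j : Q'.FHom (H.obj q) (Q'.zero U)) :
      B.map ((m₁.i q).1 ≫ S₁.inc.map j.1 ≫ (S₁.inc.unit U).1) ≫ (B.unit U).1 =
        (η.app (X.inc.obj q)).1 ≫ (m₂.i q).1 ≫ S₂.inc.map j.1 ≫ (S₂.inc.unit U).1 :=
    (congrArg (fun t => B.map t ≫ _) (m₁.kerNul_app (U := U) ⟨q, ⟨⟩, j⟩).symm).trans
      ((hη (U := U) ⟨q, ⟨⟩, j⟩).trans (congrArg (_ ≫ ·) (m₂.kerNul_app (U := U) ⟨q, ⟨⟩, j⟩)))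
  obtain ⟨θ, hθ⟩ := m₁.exists_projIso m₂ hH B η hη'
  obtain ⟨ι, hι⟩ := m₁.exists_incIso m₂ hH B η hη'
  let e {U : C} (x : X.E.Obj U) : S₂.E.FHom (B.obj (m₁.F.obj x)) (m₂.F.obj x) := η.app x
  let t {U : C} (x : S₁.E.Obj U) : P.FHom (S₂.proj.obj (B.obj x)) (S₁.proj.obj x) := θ.app x
  let s {U : C} (q : Q'.Obj U) : S₂.E.FHom (B.obj (S₁.inc.obj q)) (S₂.inc.obj q) := ι.app q
  have ht {U V : C} {x : S₁.E.Obj U} {y : S₁.E.Obj V} (φ : S₁.E.Hom x y) :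
    S₂.proj.map (B.map φ) ≫ (t y).1 = (t x).1 ≫ S₁.proj.map φ := θ.naturality φ
  have hs {U V : C} {x : Q'.Obj U} {y : Q'.Obj V} (φ : Q'.Hom x y) :
    B.map (S₁.inc.map φ) ≫ (s y).1 = (s x).1 ≫ S₂.inc.map φ := ι.naturality φ
  have hθ' {U : C} (x : X.E.Obj U) :
    (t (m₁.F.obj x)).1 = S₂.proj.map (e x).1 ≫ (m₂.p x).1 ≫ (finv (m₁.p x)).1 := hθ x
  have hι' {U : C} (q : Q.Obj U) :
    B.map (m₁.i q).1 ≫ (s (H.obj q)).1 = (e (X.inc.obj q)).1 ≫ (m₂.i q).1 := hι q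
  have key {U : C} (q : Q.Obj U) :
      (t (S₁.inc.obj (H.obj q))).1 ≫ (AddFunctor.nul S₁.nul (H.obj q)).1 =
        S₂.proj.map (s (H.obj q)).1 ≫ (AddFunctor.nul S₂.nul (H.obj q)).1 := by
    haveI := isIso_val (S₂.proj.fmap (B.fmap (m₁.i q)))
    rw [← cancel_epi (S₂.proj.fmap (B.fmap (m₁.i q))).1]
    change S₂.proj.map (B.map (m₁.i q).1) ≫ _ = S₂.proj.map (B.map (m₁.i q).1) ≫ _
    have h1 := congrArg S₂.proj.map (hι' q)
    simp only [S₂.proj.map_comp] at h1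
    rw [← Category.assoc, ht, hθ', ← Category.assoc (S₂.proj.map (B.map (m₁.i q).1)), h1]
    simp only [Category.assoc]
    rw [← m₁.p_nul, ← m₂.p_nul]
    simp
  have key' {U : C} (q' : Q'.Obj U) :
      (t (S₁.inc.obj q')).1 ≫ (AddFunctor.nul S₁.nul q').1 =
        S₂.proj.map (s q').1 ≫ (AddFunctor.nul S₂.nul q').1 := by
    obtain ⟨q, ⟨β⟩⟩ := hH q'
    haveI := isIso_val (S₂.proj.fmap (B.fmap (S₁.inc.fmap β)))
    rw [← cancel_epi (S₂.proj.fmap (B.fmap (S₁.inc.fmap β))).1]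
    change S₂.proj.map (B.map (S₁.inc.map β.1)) ≫ _ = S₂.proj.map (B.map (S₁.inc.map β.1)) ≫ _
    rw [← Category.assoc, ht, Category.assoc, AddFunctor.nul_map_fiber, key, ← Category.assoc,
      ← S₂.proj.map_comp, hs, S₂.proj.map_comp, Category.assoc, AddFunctor.nul_map_fiber]
  exact equivalent (E := S₁) (E' := S₂) ⟨B, θ, ι.trans (compIdInv S₂.inc), fun {U} q' =>
    (key' q').trans (congrArg (fun r => S₂.proj.map r ≫ _) (Category.comp_id _).symm)⟩

end OverMor

theorem _root_.PicardStacks.AddFunctor.essSurj_id (A : PicardFib.{w} C) :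
    (AddFunctor.id A).EssSurj := fun q => ⟨q, ⟨⟨𝟙 _, A.π_id _⟩⟩⟩

theorem Equivalent.symm {E E' : Extension P Q} (h : Equivalent E E') : Equivalent E' E := by
  obtain ⟨m⟩ := h.exists_overMor
  exact m.equivalent_of_essSurj (OverMor.refl E) (essSurj_id _)

end Extension

end OverUniqueness

end PicardStacks

namespace PicardStacks

open FibGpd PicardFib AddFunctor

section FiberedProductTools

namespace AddFunctor

variable {C : Type u} [Category.{v} C]

section

variable {P P' Q O : PicardFib.{w} C} {G : AddFunctor P Q} {F : AddFunctor P' Q}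

theorem _root_.PicardStacks.FibGpd.eq_comp_finv {P : FibGpd.{w} C} {U V : C} {a : P.Obj V}
    {b c : P.Obj U} {f : P.Hom a b} {g : P.FHom b c} {k : P.Hom a c} (h : f ≫ g.1 = k) :
    f = k ≫ (finv g).1 := by
  rw [← h, Category.assoc, fhom_finv, Category.comp_id]

theorem pr₁_unit (U : C) : ((pr₁ G F).unit U).1 = 𝟙 _ := by
  have key : (⟨𝟙 _, P.π_id _⟩ : P.FHom (P.zero U) (P.zero U)) = (pr₁ G F).unit U := by
    apply (pr₁ G F).unit_unique
    change 𝟙 _ ≫ P.addMap (𝟙 _) (𝟙 (Tot.mk (P.zero U))) _ ≫ (P.zeroAdd (P.zero U)).1 = _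
    rw [P.addMap_id, Category.id_comp, Category.id_comp]
    rfl
  exact congrArg FHom.val key.symm

theorem zero_iso (U : C) : (FibObj.iso (G := G) (F := F) ((fibProd G F).zero U)).1 =
    (G.unit U).1 ≫ (finv (F.unit U)).1 := by
  have h := congrArg FHom.val (isoZero_unitF (G := G) (F := F) (U := U))
  have h' : (FibObj.iso (G := G) (F := F) ((fibProd G F).zero U)).1 ≫ (F.unit U).1 =
    (G.unit U).1 := h
  exact eq_comp_finv h'

variable {A B : AddFunctor O (fibProd G F)}

/-- A morphism of additive functors to a fibered product, given by its components. -/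
def Hom.mkFib (a : Hom ((pr₁ G F).comp A) ((pr₁ G F).comp B))
    (b : Hom ((pr₂ G F).comp A) ((pr₂ G F).comp B))
    (h : ∀ {U : C} (x : O.Obj U), G.map (a.app x).1 ≫ (FibObj.iso (B.obj x)).1 =
      (FibObj.iso (A.obj x)).1 ≫ F.map (b.app x).1) : Hom A B where
  app x := ⟨⟨(a.app x).1, (b.app x).1, (FHom.property _).trans (FHom.property _).symm, h x⟩,
    (a.app x).2⟩
  naturality φ := FibHom.ext (a.naturality φ) (b.naturality φ)
  app_add x y := by
    have e1 := a.app_add x y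
    have e2 := b.app_add x y
    refine FibHom.ext ?_ ?_
    · refine (congrArg (_ ≫ ·) (Category.comp_id _)).symm.trans (e1.trans ?_)
      exact congrArg (· ≫ _) (Category.comp_id _)
    · refine (congrArg (_ ≫ ·) (Category.comp_id _)).symm.trans (e2.trans ?_)
      exact congrArg (· ≫ _) (Category.comp_id _)

/-- The first component of an additive functor to a fibered product. -/
noncomputable def liftFst (H : AddFunctor O P) (K : AddFunctor O P') (e : Hom (G.comp H) (F.comp K)) :
    Hom ((pr₁ G F).comp (lift H K e)) H where
  app x := ⟨𝟙 _, P.π_id _⟩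
  naturality φ := (Category.comp_id _).trans (Category.id_comp _).symm
  app_add x y := (Category.id_comp _).trans ((congrArg₂ (· ≫ ·) (Category.comp_id _)
    (P.addMap_id _ _)).trans (Category.comp_id _)).symm

/-- The second component of an additive functor to a fibered product. -/
noncomputable def liftSnd (H : AddFunctor O P) (K : AddFunctor O P') (e : Hom (G.comp H) (F.comp K)) :
    Hom ((pr₂ G F).comp (lift H K e)) K where
  app x := ⟨𝟙 _, P'.π_id _⟩
  naturality φ := (Category.comp_id _).trans (Category.id_comp _).symm
  app_add x y := (Category.id_comp _).trans ((congrArg₂ (· ≫ ·) (Category.comp_id _)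
    (P'.addMap_id _ _)).trans (Category.comp_id _)).symm

end

section

variable {P Q O : PicardFib.{w} C} {G : AddFunctor P Q}

/-- The morphisms of additive functors to the terminal Picard category. -/
def Hom.toOne (A B : AddFunctor O (PicardFib.one.{w} C)) : Hom A B where
  app {U} _ := ⟨⟨𝟙 U⟩, rfl⟩
  naturality φ := ULift.ext _ _ ((Category.comp_id _).trans
    ((A.π_map φ).trans ((B.π_map φ).symm.trans (Category.id_comp _).symm)))
  app_add x y := ULift.ext _ _ ((Category.id_comp _).trans ((B.sum x y).2.trans
    ((A.sum x y).2.symm.trans (Category.comp_id _).symm)))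

/-- A morphism of additive functors to a kernel. -/
noncomputable def Hom.mkKernel {A B : AddFunctor O (kernel G)}
    (a : Hom ((kernelInc G).comp A) ((kernelInc G).comp B))
    (h : ∀ {U : C} (x : O.Obj U), G.map (a.app x).1 ≫ (FibObj.iso (B.obj x)).1 =
      (FibObj.iso (A.obj x)).1) : Hom A B :=
  Hom.mkFib a (Hom.toOne _ _) fun {U} x => (h x).trans ((Category.comp_id _).symm.trans
    (congrArg (_ ≫ ·) (Q.zeroMap_id U).symm))

theorem kernel_zero_iso (U : C) : (FibObj.iso (G := G)
    (F := zero (PicardFib.one.{w} C) Q) ((kernel G).zero U)).1 = (G.unit U).1 := by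
  refine (zero_iso U).trans ?_
  have : (finv ((zero (PicardFib.one.{w} C) Q).unit U)).1 = 𝟙 _ :=
    finv_eq ((congrArg (· ≫ _) (zero_unit U)).trans (Category.comp_id _))
  exact (congrArg (_ ≫ ·) this).trans (Category.comp_id _)

end

/-- Cokernels of functors precomposed with an equivalence. -/
theorem IsCok.nulComp {J : GrothendieckTopology C} {Q Q' Y T : PicardFib.{w} C}
    {K : AddFunctor Q Y} {L : AddFunctor Y T} {n : Hom (L.comp K) (zero Q T)} (h : IsCok n J)
    {B : AddFunctor Q' Q} (hB : ∀ {U : C} {q q' : Q'.Obj U} (ψ : Q.FHom (B.obj q) (B.obj q')),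
      ∃! χ : Q'.FHom q q', B.map χ.1 = ψ.1) (hB' : B.EssSurj) : IsCok (nulComp n B) J where
  surj := h.surj
  full {U} q q' φ hφ := by
    obtain ⟨ψ, hψ, hu⟩ := h.full (B.obj q) (B.obj q') φ hφ
    obtain ⟨χ, hχ, hu'⟩ := hB ψ
    exact ⟨χ, (congrArg K.map hχ).trans hψ, fun χ' h' =>
      hu' χ' (congrArg FHom.val (hu (B.fmap χ') h'))⟩
  ess {U} y i := by
    obtain ⟨q, φ, hφ⟩ := h.ess y i
    obtain ⟨q', ⟨b⟩⟩ := hB' q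
    refine ⟨q', ⟨K.map b.1 ≫ φ.1, π_comp_val φ ((K.π_map _).trans b.2)⟩, ?_⟩
    change L.map (K.map b.1 ≫ φ.1) ≫ i.1 = (nul n (B.obj q')).1
    rw [L.map_comp, Category.assoc, hφ]
    exact nul_map_fiber n b

end AddFunctor

end FiberedProductTools

end PicardStacks

namespace PicardStacks

open FibGpd PicardFib AddFunctor

section PushDownExistence

variable {C : Type u} [Category.{v} C] {J : GrothendieckTopology C}

namespace AddFunctor

section

variable {Q Q' Y T S : PicardFib.{w} C} {I : AddFunctor Q Y} {B : AddFunctor Y S}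
  {H : AddFunctor Q Q'} {L : AddFunctor Y T} {JT : AddFunctor T S}

/-- The composite `JT ∘ L ∘ I` vanishes if `B ≅ JT ∘ L` and `B ∘ I ≅ 0`. -/
noncomputable def descNul (η : Hom (JT.comp L) B) (m : Hom (B.comp I) (zero Q S)) :
    Hom (JT.comp (L.comp I)) (zero Q S) :=
  ((compAssocInv JT L I).trans (η.whiskerRight I)).trans m

theorem descNul_app (η : Hom (JT.comp L) B) (m : Hom (B.comp I) (zero Q S)) {U : C}
    (q : Q.Obj U) : (nul (descNul η m) q).1 = (η.app (I.obj q)).1 ≫ (nul m q).1 :=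
  congrArg (· ≫ (nul m q).1) (Category.id_comp _)

/-- The functor from `Q` to the kernel of `JT`. -/
noncomputable abbrev descKer (η : Hom (JT.comp L) B) (m : Hom (B.comp I) (zero Q S)) :
    AddFunctor Q (kernel JT) := toKer (descNul η m)

theorem descKer_iso (η : Hom (JT.comp L) B) (m : Hom (B.comp I) (zero Q S)) {U : C}
    (q : Q.Obj U) : (FibObj.iso (G := JT) (F := zero (PicardFib.one.{w} C) S)
      ((descKer η m).obj q)).1 = (η.app (I.obj q)).1 ≫ (nul m q).1 := descNul_app η m q

/-- The vanishing of the first component of `descKer` on the kernel of `H`. -/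
noncomputable def descKerNulFst (η : Hom (JT.comp L) B) (m : Hom (B.comp I) (zero Q S))
    (n : Hom (L.comp (I.comp (kernelInc H))) (zero (kernel H) T)) :
    Hom ((kernelInc JT).comp ((descKer η m).comp (kernelInc H)))
      ((kernelInc JT).comp (zero (kernel H) (kernel JT))) :=
  ((((compAssocInv (kernelInc JT) (descKer η m) (kernelInc H)).trans
    ((liftFst (L.comp I) _ _).whiskerRight (kernelInc H))).trans
      (compAssoc L I (kernelInc H))).trans n).trans (zeroComp (kernel H) (kernelInc JT))

theorem descKerNulFst_app (η : Hom (JT.comp L) B) (m : Hom (B.comp I) (zero Q S))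
    (n : Hom (L.comp (I.comp (kernelInc H))) (zero (kernel H) T)) {U : C}
    (q : (kernel H).Obj U) : ((descKerNulFst η m n).app q).1 = (nul n q).1 := by
  have e1 : (finv ((kernelInc JT).unit U)).1 = 𝟙 _ :=
    finv_eq ((congrArg (· ≫ _) (pr₁_unit U)).trans (Category.comp_id _))
  refine (congrArg₂ (· ≫ ·) ?_ e1).trans (Category.comp_id _)
  refine (congrArg (· ≫ (nul n q).1) ?_).trans (Category.id_comp _)
  exact (congrArg (· ≫ _) (Category.id_comp _)).trans (Category.comp_id _)

/-- The vanishing of `descKer` on the kernel of `H`. -/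
noncomputable def descKerNul (η : Hom (JT.comp L) B) (m : Hom (B.comp I) (zero Q S))
    (n : Hom (L.comp (I.comp (kernelInc H))) (zero (kernel H) T))
    (h : ∀ {U : C} (q : (kernel H).Obj U), JT.map (nul n q).1 ≫ (JT.unit U).1 =
      (η.app (I.obj q.fst)).1 ≫ (nul m q.fst).1) :
    Hom ((descKer η m).comp (kernelInc H)) (zero (kernel H) (kernel JT)) :=
  Hom.mkKernel (descKerNulFst η m n) fun {U} q =>
    (congrArg₂ (fun s t => JT.map s ≫ t) (descKerNulFst_app η m n q) (kernel_zero_iso U)).trans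
      ((h q).trans (descKer_iso η m q.fst).symm)

theorem exists_descKer_hom (η : Hom (JT.comp L) B) {m : Hom (B.comp I) (zero Q S)}
    (hm : IsCok m J) {U V : C} {t : T.Obj U} (i : S.FHom (JT.obj t) (S.zero U)) {y : Y.Obj V}
    (φ : T.Hom (L.obj y) t) : ∃ (q : Q.Obj V) (ψ : T.Hom (L.obj (I.obj q)) t),
      T.π ψ = T.π φ ∧ JT.map ψ ≫ i.1 = ((η.app (I.obj q)).1 ≫ (nul m q).1) ≫ S.zeroMap (T.π φ) := by
  let e (y : Y.Obj V) : S.FHom (JT.obj (L.obj y)) (B.obj y) := η.app y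
  have he {a b : Y.Obj V} (k : Y.Hom a b) : JT.map (L.map k) ≫ (e b).1 = (e a).1 ≫ B.map k :=
    η.naturality k
  let g : S.FHom (JT.obj (L.obj y)) (S.zero V) :=
    facF (JT.map φ ≫ i.1) (S.zeroMap (T.π φ)) (by simp)
  obtain ⟨q, χ, hχ⟩ := hm.ess y ⟨(finv (e y)).1 ≫ g.1, by simp⟩
  refine ⟨q, L.map χ.1 ≫ φ, by simp, ?_⟩
  change _ = ((e (I.obj q)).1 ≫ (nul m q).1) ≫ _
  have hg : JT.map φ ≫ i.1 = g.1 ≫ S.zeroMap (T.π φ) := (facF_comp _ _ _).symm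
  rw [← hχ, JT.map_comp, Category.assoc, hg, ← Category.assoc (e (I.obj q)).1, ← he]
  simp

theorem descKer_locEssSurj (η : Hom (JT.comp L) B) {m : Hom (B.comp I) (zero Q S)}
    (hm : IsCok m J) (hL : L.LocEssSurj J) : (descKer η m).LocEssSurj J := fun {U} t => by
  obtain ⟨R, hR, h⟩ := hL t.fst
  refine ⟨R, hR, fun {V} f hf => ?_⟩
  obtain ⟨y, φ, hφ⟩ := h f hf
  obtain ⟨q, ψ, h1, h2⟩ := exists_descKer_hom η hm t.iso φ
  exact ⟨q, ⟨ψ, ⟨f⟩, h1.trans hφ, h2.trans (congrArg₂ (fun a b => a ≫ S.zeroMap b)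
    (descKer_iso η m q).symm hφ)⟩, h1.trans hφ⟩

theorem exists_kernel_hom (η : Hom (JT.comp L) B) {m : Hom (B.comp I) (zero Q S)}
    (hm : IsCok m J) {n : Hom (L.comp (I.comp (kernelInc H))) (zero (kernel H) T)} (hn : IsCok n J)
    (h : ∀ {U : C} (q : (kernel H).Obj U), JT.map (nul n q).1 ≫ (JT.unit U).1 =
      (η.app (I.obj q.fst)).1 ≫ (nul m q.fst).1) {U : C} (y : Q.Obj U)
    (i : T.FHom (L.obj (I.obj y)) (T.zero U))
    (hi : JT.map i.1 ≫ (JT.unit U).1 = (η.app (I.obj y)).1 ≫ (nul m y).1) :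
    ∃ (q : (kernel H).Obj U) (φ : Q.FHom q.fst y), L.map (I.map φ.1) ≫ i.1 = (nul n q).1 := by
  obtain ⟨q, φ, hφ⟩ := hn.ess (I.obj y) i
  let e (y : Y.Obj U) : S.FHom (JT.obj (L.obj y)) (B.obj y) := η.app y
  have he {a b : Y.Obj U} (k : Y.Hom a b) : JT.map (L.map k) ≫ (e b).1 = (e a).1 ≫ B.map k :=
    η.naturality k
  have key (q₀ : Q.Obj U) (ν : T.FHom (L.obj (I.obj q₀)) (T.zero U))
      (φ₀ : Y.FHom (I.obj q₀) (I.obj y)) (h₀ : L.map φ₀.1 ≫ i.1 = ν.1)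
      (h' : JT.map ν.1 ≫ (JT.unit U).1 = (e (I.obj q₀)).1 ≫ (nul m q₀).1) :
      B.map φ₀.1 ≫ (nul m y).1 = (nul m q₀).1 := by
    have hi' : JT.map i.1 ≫ (JT.unit U).1 = (e (I.obj y)).1 ≫ (nul m y).1 := hi
    rw [← cancel_epi (e (I.obj q₀)).1, ← h', ← h₀, ← Category.assoc, ← he, Category.assoc,
      ← hi', JT.map_comp, Category.assoc]
  obtain ⟨ψ, hψ, -⟩ := hm.full q.fst y φ (key q.fst (nul n q) φ hφ (h q))
  exact ⟨q, ψ, (congrArg (fun t => L.map t ≫ i.1) hψ).trans hφ⟩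

theorem isCok_descKerNul (η : Hom (JT.comp L) B) {m : Hom (B.comp I) (zero Q S)}
    (hm : IsCok m J) {n : Hom (L.comp (I.comp (kernelInc H))) (zero (kernel H) T)} (hn : IsCok n J)
    (h : ∀ {U : C} (q : (kernel H).Obj U), JT.map (nul n q).1 ≫ (JT.unit U).1 =
      (η.app (I.obj q.fst)).1 ≫ (nul m q.fst).1) : IsCok (descKerNul η m n h) J where
  surj := descKer_locEssSurj η hm hn.surj
  full {U} q q' φ hφ := by
    have h1 : L.map (I.map φ.1) ≫ (nul n q').1 = (nul n q).1 := by
      refine (congrArg (_ ≫ ·) (descKerNulFst_app η m n q').symm).trans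
        (Eq.trans ?_ (descKerNulFst_app η m n q))
      exact congrArg FibHom.fst hφ
    obtain ⟨ψ, hψ, hu⟩ := hn.full q q' (I.fmap φ) h1
    refine ⟨ψ, ?_, fun χ hχ => hu χ (congrArg I.map hχ)⟩
    have h2 (a b : Q.Obj U) (f g : Q.FHom a b) (hfg : I.map f.1 = I.map g.1) : f.1 = g.1 := by
      obtain ⟨_, -, hu⟩ := hm.full a b (I.fmap f) (nul_map_fiber m f)
      exact congrArg FHom.val ((hu f rfl).trans (hu g hfg.symm).symm)
    exact h2 _ _ ((kernelInc H).fmap ψ) φ hψ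
  ess {U} y i := by
    have hi : JT.map (FibHom.fst i.1) ≫ (JT.unit U).1 = (η.app (I.obj y)).1 ≫ (nul m y).1 := by
      refine (congrArg (_ ≫ ·) (kernel_zero_iso U).symm).trans ((FibHom.comm i.1).trans ?_)
      refine Eq.trans ?_ (descKer_iso η m y)
      refine (congrArg (fun t => _ ≫ S.zeroMap t) ((FibHom.eq i.1).symm.trans i.2)).trans ?_
      exact (congrArg (_ ≫ ·) (S.zeroMap_id U)).trans (Category.comp_id _)
    obtain ⟨q, φ, hφ⟩ := exists_kernel_hom η hm hn h y ⟨FibHom.fst i.1, i.2⟩ hi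
    refine ⟨q, φ, FibHom.ext (hφ.trans (descKerNulFst_app η m n q).symm) (ULift.ext _ _ ?_)⟩
    exact (FibHom.eq _).symm.trans ((FHom.property (FHom.comp ((descKer η m).fmap φ) i)).trans
      (FHom.property (nul (descKerNul η m n h) q)).symm |>.trans (FibHom.eq _))

end

end AddFunctor

namespace Extension

variable {P Q Q' : PicardStack.{w} J}

theorem inc_comp_faithful (E : Extension P Q) (H : AddFunctor Q.toPicardFib Q'.toPicardFib) :
    (E.inc.comp (kernelInc H)).Faithful := fun {U q q'} u u' h => by
  have h2 (a b : Q.Obj U) (f g : Q.FHom a b) (hfg : E.inc.map f.1 = E.inc.map g.1) :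
      f.1 = g.1 := by
    obtain ⟨_, -, hu⟩ := E.isCok.full a b (E.inc.fmap f) (AddFunctor.nul_map_fiber E.nul f)
    exact congrArg FHom.val ((hu f rfl).trans (hu g hfg.symm).symm)
  exact fhom_eq (FibHom.ext (h2 _ _ ((kernelInc H).fmap u) ((kernelInc H).fmap u') h)
    (ULift.ext _ _ ((FibHom.eq u.1).symm.trans (u.2.trans (u'.2.symm.trans (FibHom.eq u'.1))))))

/-- An extension can be pushed down along an essentially surjective functor. -/
theorem exists_overMor (E : Extension P Q) {H : AddFunctor Q.toPicardFib Q'.toPicardFib}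
    (hH : H.EssSurj) : ∃ S : Extension P Q', Nonempty (OverMor E S H) := by
  obtain ⟨T, L, n, hn⟩ := AddFunctor.Faithful.exists_isCok
    (Q := PicardStack.fibProd H (zero (PicardStack.one.{w} J).toPicardFib Q'.toPicardFib))
    (E.inc_comp_faithful H)
  have hn : IsCok (Q := kernel H) n J := hn
  obtain ⟨JT, η, hη⟩ := hn.exists_desc P.isStack.isPrestack P.isStack.hasGluing
    (nulComp E.nul (kernelInc H))
  have hc := isCok_descKerNul (H := H) η E.isCok hn hη
  obtain ⟨B, B', ζ, -, ⟨α⟩, ⟨β⟩⟩ := (isCok_kernelNul (J := J) H hH.locEssSurj).exists_comparison hc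
    Q'.isStack (PicardStack.fibProd JT
      (zero (PicardStack.one.{w} J).toPicardFib P.toPicardFib)).isStack
  have hJT : JT.LocEssSurj J := fun {U} p => by
    obtain ⟨R, hR, h⟩ := E.surj p
    refine ⟨R, hR, fun {V} f hf => ?_⟩
    obtain ⟨x, φ, hφ⟩ := h f hf
    exact ⟨L.obj x, (η.app x).1 ≫ φ, π_val_comp _ hφ⟩
  have hS := (isCok_kernelNul (J := J) JT hJT).nulComp (Hom.existsUnique_map_eq α β) (Hom.essSurj β)
  refine ⟨ofIsCok hS, ⟨⟨L, η, ((((liftFst (L.comp E.inc) _ _).symm).trans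
    (ζ.symm.whiskerLeft (kernelInc JT))).trans (compAssocInv (kernelInc JT) B H)), ?_⟩⟩⟩
  intro U q
  let k := finv (ζ.app q)
  have e1 : (FibHom.fst k.1 : T.Hom _ _) = (((((liftFst (L.comp E.inc) _ _).symm).trans
    (ζ.symm.whiskerLeft (kernelInc JT))).trans
      (compAssocInv (kernelInc JT) B H)).app q).1 := by
    refine Eq.trans ?_ (Category.comp_id _).symm
    refine (Category.id_comp _).symm.trans (congrArg (· ≫ _) ?_)
    exact (AddFunctor.finv_eq (Category.comp_id _)).symm
  have e2 : JT.map (FibHom.fst k.1) ≫ (AddFunctor.nul (nulComp (kernelNul JT) B) (H.obj q)).1 =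
      (η.app (E.inc.obj q)).1 ≫ (AddFunctor.nul E.nul q).1 := by
    refine (FibHom.comm k.1).trans (Eq.trans ?_ (descKer_iso η E.nul q))
    refine (congrArg (fun t => _ ≫ P.zeroMap t) ((FibHom.eq k.1).symm.trans k.2)).trans ?_
    exact (congrArg (_ ≫ ·) (P.zeroMap_id U)).trans (Category.comp_id _)
  exact e2.symm.trans (congrArg (fun t => JT.map t ≫ _) e1)

end Extension

end PushDownExistence

end PicardStacks

namespace PicardStacks

open FibGpd PicardFib AddFunctor MonoidalCategory

section FiberedSumOfExtension

variable {C : Type u} [Category.{v} C] {J : GrothendieckTopology C}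

namespace AddFunctor

section

variable {Q Y T : PicardFib.{w} C} {K : AddFunctor Q Y} {L : AddFunctor Y T}
  (n : Hom (L.comp K) (zero Q T))

theorem nul_add {U : C} (q r : Q.Obj U) : (nul n (Q.add q r)).1 =
    L.map (K.sum q r).1 ≫ (L.sum (K.obj q) (K.obj r)).1 ≫
      T.addMap (nul n q).1 (nul n r).1 (by simp) ≫ (T.zeroAdd (T.zero U)).1 := by
  have h : (nul n (Q.add q r)).1 ≫ (finv (T.zeroAdd (T.zero U))).1 =
      (L.map (K.sum q r).1 ≫ (L.sum (K.obj q) (K.obj r)).1) ≫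
        T.addMap (nul n q).1 (nul n r).1 (by simp) := n.app_add q r
  have h' := congrArg (· ≫ (T.zeroAdd (T.zero U)).1) h
  simpa using h'

theorem kappa_rho_aux {D : Type*} [Category D] [MonoidalCategory D] {z₀ z₁ w a b c x : D}
    (k : z₀ ⟶ z₁) (s₀ : z₀ ⟶ a ⊗ x) (s₁ : z₁ ⟶ w ⊗ c) (s₂ : w ⟶ a ⊗ b) (t : x ⟶ b ⊗ c)
    (m : b ⟶ 𝟙_ D) (m' : c ⟶ 𝟙_ D)
    (h : k ≫ s₁ ≫ s₂ ▷ c = s₀ ≫ a ◁ t ≫ (α_ a b c).inv) :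
    k ≫ (s₁ ≫ w ◁ m' ≫ (ρ_ w).hom) ≫ (s₂ ≫ a ◁ m ≫ (ρ_ a).hom) =
      s₀ ≫ a ◁ (t ≫ (m ⊗ₘ m') ≫ (λ_ (𝟙_ D)).hom) ≫ (ρ_ a).hom := by
  have e1 : w ◁ m' ≫ (ρ_ w).hom ≫ s₂ = s₂ ▷ c ≫ (a ⊗ b) ◁ m' ≫ (ρ_ (a ⊗ b)).hom := by
    rw [← rightUnitor_naturality, whisker_exchange_assoc]
  simp only [Category.assoc]
  rw [reassoc_of% e1, reassoc_of% h, tensorHom_def']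
  simp

theorem map_whiskerLeft_associator_inv (L : AddFunctor Y T) {U : C} {a b c x : Y.Obj U}
    (s : x ⟶ b ⊗ c) : (L.fiberFunctor U).map (a ◁ s ≫ (α_ a b c).inv) ≫ L.sumF (a ⊗ b) c ≫
      L.sumF a b ▷ (L.fiberFunctor U).obj c = L.sumF a x ≫ (L.fiberFunctor U).obj a ◁
        ((L.fiberFunctor U).map s ≫ L.sumF b c) ≫ (α_ _ _ _).inv := by
  have e1 : (L.fiberFunctor U).map (α_ a b c).inv ≫ L.sumF (a ⊗ b) c ≫
      L.sumF a b ▷ (L.fiberFunctor U).obj c = L.sumF a (b ⊗ c) ≫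
        (L.fiberFunctor U).obj a ◁ L.sumF b c ≫ (α_ _ _ _).inv := by
    rw [← cancel_epi ((L.fiberFunctor U).map (α_ a b c).hom), ← Functor.map_comp_assoc,
      Iso.hom_inv_id, CategoryTheory.Functor.map_id, Category.id_comp, reassoc_of% L.sumF_assoc a b c]
    simp
  have e2 : (L.fiberFunctor U).map (a ◁ s) ≫ L.sumF a (b ⊗ c) =
      L.sumF a x ≫ (L.fiberFunctor U).obj a ◁ (L.fiberFunctor U).map s := by
    have := L.sumF_tensor (𝟙 a) s
    rw [CategoryTheory.Functor.map_id, id_tensorHom, id_tensorHom] at this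
    exact this
  rw [Functor.map_comp, Category.assoc, e1, reassoc_of% e2]
  simp

theorem kappa_rho {U : C} (y : Y.Obj U) (q r : Q.Obj U) :
    L.map (kappa K y q r).1 ≫ (rho n (Y.add y (K.obj q)) r).1 ≫ (rho n y q).1 =
      (rho n y (Q.add q r)).1 := by
  have h1 := L.map_whiskerLeft_associator_inv (a := y) (K.sumF q r)
  have h2 := congrArg FHom.val (kappa_rho_aux _ _ _ _ _
    (nul n q : (L.fiberFunctor U).obj (K.obj q) ⟶ 𝟙_ (T.Obj U))
    (nul n r : (L.fiberFunctor U).obj (K.obj r) ⟶ 𝟙_ (T.Obj U)) h1)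
  refine (congrArg (fun k => L.map (FHom.val k) ≫ _) (kappa_eq_tensor K y q r)).trans
    (h2.trans ?_)
  rw [rho_eq]
  refine congrArg (fun f => (L.sum y (K.obj (Q.add q r))).1 ≫ f ≫ (T.addZero (L.obj y)).1) ?_
  refine T.addMap_congr _ rfl (Eq.trans ?_ (nul_add n q r).symm)
  exact Category.assoc _ _ _

end

section

variable {P P' Q X : PicardFib.{w} C} {G : AddFunctor Q P} {F : AddFunctor Q P'}
  {K : AddFunctor P X} {K' : AddFunctor P' X}

theorem swap_aux {U : C} {a b c d z z' : X.Obj U} (s : X.FHom z (X.add b d)) (θ : X.FHom d c)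
    (t : X.FHom z z') (s' : X.FHom z' (X.add d b)) (h : t.1 ≫ s'.1 = s.1 ≫ (X.τ b d).1) :
    X.addMap (𝟙 (Tot.mk a)) s.1 (by simp) ≫ X.addMap (𝟙 _) (X.addMap (𝟙 _) θ.1 (by simp)) (by simp) ≫
      X.addMap (𝟙 _) (X.τ b c).1 (by simp) ≫ (finv (X.σ a c b)).1 =
    X.addMap (𝟙 (Tot.mk a)) t.1 (by simp) ≫ X.addMap (𝟙 _) s'.1 (by simp) ≫
      (finv (X.σ a d b)).1 ≫ X.addMap (X.addMap (𝟙 _) θ.1 (by simp)) (𝟙 _) (by simp) := by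
  have e1 : (finv (X.σ a d b)).1 ≫ X.addMap (X.addMap (𝟙 _) θ.1 (by simp)) (𝟙 _) (by simp) =
      X.addMap (𝟙 _) (X.addMap θ.1 (𝟙 _) (by simp)) (by simp) ≫ (finv (X.σ a c b)).1 := by
    rw [← cancel_mono (X.σ a c b).1, ← cancel_epi (X.σ a d b).1]
    simp only [Category.assoc, finv_fhom, fhom_finv_assoc, Category.comp_id]
    rw [X.σ_natural]
  rw [e1, addMap_addMap_assoc, addMap_addMap_assoc, addMap_addMap_assoc, addMap_addMap_assoc]
  refine congrArg (· ≫ _) (X.addMap_congr _ (by simp) ?_)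
  rw [Category.assoc, X.τ_natural (𝟙 (Tot.mk b)) θ.1 (by simp), h, Category.assoc]

variable (θ : Hom (K.comp G) (K'.comp F)) {U : C}

/-- The morphism `K p₁ + K' (F q) → K p₂` given by `α : p₁ + G q → p₂`. -/
noncomputable def shiftMap {p₁ p₂ : P.Obj U} (q : Q.Obj U) (α : P.FHom (P.add p₁ (G.obj q)) p₂) :
    X.FHom (X.add (K.obj p₁) (K'.obj (F.obj q))) (K.obj p₂) :=
  let i : X.FHom (K.obj (G.obj q)) (K'.obj (F.obj q)) := θ.app q
  ⟨X.addMap (𝟙 _) (finv i).1 (by simp) ≫ (finv (K.sum p₁ (G.obj q))).1 ≫ K.map α.1, by simp⟩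

/-- The morphism `K p₁ + K' (p' + F q) → K p₂ + K' p'` given by `α : p₁ + G q → p₂`. -/
noncomputable def shift {p₁ p₂ : P.Obj U} (q : Q.Obj U) (α : P.FHom (P.add p₁ (G.obj q)) p₂)
    (p' : P'.Obj U) : X.FHom (X.add (K.obj p₁) (K'.obj (P'.add p' (F.obj q))))
      (X.add (K.obj p₂) (K'.obj p')) :=
  ⟨X.addMap (𝟙 _) (K'.map (P'.τ p' (F.obj q)).1) (by simp) ≫
    (kappa K' (K.obj p₁) (F.obj q) p').1 ≫ X.addMap (shiftMap θ q α).1 (𝟙 _) (by simp), by simp⟩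

theorem _root_.PicardStacks.Triplet.hom_eq {x y : (P.prod P').Obj U} (t : Triplet G F x y) :
    (t.hom θ).1 = X.addMap (𝟙 _) (K'.map t.β.1) (by simp) ≫ (shift θ t.q t.α y.2).1 := by
  let i : X.FHom (K.obj (G.obj t.q)) (K'.obj (F.obj t.q)) := θ.app t.q
  have h := swap_aux (a := K.obj x.1) (K'.sum y.2 (F.obj t.q)) (finv i)
    (K'.fmap (P'.τ y.2 (F.obj t.q))) (K'.sum (F.obj t.q) y.2) (K'.map_τ _ _)
  have e1 : X.addMap (shiftMap θ t.q t.α).1 (𝟙 (Tot.mk (K'.obj y.2))) (by simp) =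
      X.addMap (X.addMap (𝟙 _) (finv i).1 (by simp)) (𝟙 _) (by simp) ≫
        X.addMap (finv (K.sum x.1 (G.obj t.q))).1 (𝟙 _) (by simp) ≫
          X.addMap (K.map t.α.1) (𝟙 _) (by simp) := by
    rw [addMap_addMap, addMap_addMap]
    exact X.addMap_congr _ rfl (by simp)
  have e2 := congrArg (· ≫ X.addMap (finv (K.sum x.1 (G.obj t.q))).1 (𝟙 _) (by simp) ≫
    X.addMap (K.map t.α.1) (𝟙 (Tot.mk (K'.obj y.2))) (by simp)) h
  refine congrArg (X.addMap (𝟙 (Tot.mk (K.obj x.1))) (K'.map t.β.1) (by simp) ≫ ·) (Eq.trans ?_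
    (e2.trans ?_))
  · simp only [Category.assoc]
    rfl
  · change _ = X.addMap (𝟙 _) (K'.map (P'.τ y.2 (F.obj t.q)).1) _ ≫ (kappa K' _ _ _).1 ≫ _
    rw [e1, kappa_eq]
    simp only [Category.assoc]
    rfl

theorem shiftMap_natural {p₁ p₂ : P.Obj U} {q₁ q₂ : Q.Obj U} (u : Q.FHom q₁ q₂)
    (α₁ : P.FHom (P.add p₁ (G.obj q₁)) p₂) (α₂ : P.FHom (P.add p₁ (G.obj q₂)) p₂)
    (h : P.addMap (𝟙 _) (G.map u.1) (by simp) ≫ α₂.1 = α₁.1) :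
    X.addMap (𝟙 _) (K'.map (F.map u.1)) (by simp) ≫ (shiftMap θ q₂ α₂).1 =
      (shiftMap θ q₁ α₁).1 := by
  let i (q : Q.Obj U) : X.FHom (K.obj (G.obj q)) (K'.obj (F.obj q)) := θ.app q
  have hi : K.map (G.map u.1) ≫ (i q₂).1 = (i q₁).1 ≫ K'.map (F.map u.1) := θ.naturality u.1
  have hi' : K'.map (F.map u.1) ≫ (finv (i q₂)).1 = (finv (i q₁)).1 ≫ K.map (G.map u.1) := by
    rw [← cancel_mono (i q₂).1, ← cancel_epi (i q₁).1]
    simp [hi]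
  have hs : X.addMap (𝟙 _) (K.map (G.map u.1)) (by simp) ≫ (finv (K.sum p₁ (G.obj q₂))).1 =
      (finv (K.sum p₁ (G.obj q₁))).1 ≫ K.map (P.addMap (𝟙 _) (G.map u.1) (by simp)) := by
    rw [← cancel_mono (K.sum p₁ (G.obj q₂)).1, ← cancel_epi (K.sum p₁ (G.obj q₁)).1]
    simp only [Category.assoc, finv_fhom, fhom_finv_assoc, Category.comp_id]
    rw [K.sum_natural]
    refine congrArg _ (X.addMap_congr _ (by simp) rfl)
  change _ ≫ X.addMap (𝟙 _) (finv (i q₂)).1 _ ≫ (finv (K.sum p₁ (G.obj q₂))).1 ≫ K.map α₂.1 =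
    X.addMap (𝟙 _) (finv (i q₁)).1 _ ≫ (finv (K.sum p₁ (G.obj q₁))).1 ≫ K.map α₁.1
  rw [← h, K.map_comp, ← reassoc_of% hs, addMap_addMap_assoc, addMap_addMap_assoc]
  exact congrArg (· ≫ _) (X.addMap_congr _ rfl hi')

theorem shift_natural {p₁ p₂ : P.Obj U} {q₁ q₂ : Q.Obj U} (u : Q.FHom q₁ q₂)
    (α₁ : P.FHom (P.add p₁ (G.obj q₁)) p₂) (α₂ : P.FHom (P.add p₁ (G.obj q₂)) p₂)
    (h : P.addMap (𝟙 _) (G.map u.1) (by simp) ≫ α₂.1 = α₁.1) (p' : P'.Obj U) :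
    X.addMap (𝟙 _) (K'.map (P'.addMap (𝟙 _) (F.map u.1) (by simp))) (by simp) ≫
      (shift θ q₂ α₂ p').1 = (shift θ q₁ α₁ p').1 := by
  have e1 := kappa_natural K' (𝟙 (Tot.mk (K.obj p₁))) (F.map u.1) (𝟙 (Tot.mk p')) (by simp)
    (by simp)
  have e2 : K'.map (P'.addMap (𝟙 _) (F.map u.1) (by simp)) ≫ K'.map (P'.τ p' (F.obj q₂)).1 =
      K'.map (P'.τ p' (F.obj q₁)).1 ≫ K'.map (P'.addMap (F.map u.1) (𝟙 _) (by simp)) := by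
    rw [← K'.map_comp, P'.τ_natural, K'.map_comp]
  have e3 : X.addMap (X.addMap (𝟙 (Tot.mk (K.obj p₁))) (K'.map (F.map u.1)) (by simp))
      (K'.map (𝟙 (Tot.mk p'))) (by simp) ≫ X.addMap (shiftMap θ q₂ α₂).1 (𝟙 _) (by simp) =
      X.addMap (shiftMap θ q₁ α₁).1 (𝟙 _) (by simp) := by
    rw [addMap_addMap]
    exact X.addMap_congr _ (shiftMap_natural θ u α₁ α₂ h) (by simp)
  change _ ≫ X.addMap (𝟙 _) (K'.map (P'.τ p' (F.obj q₂)).1) _ ≫ (kappa K' _ _ _).1 ≫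
    X.addMap (shiftMap θ q₂ α₂).1 (𝟙 _) _ = X.addMap (𝟙 _) (K'.map (P'.τ p' (F.obj q₁)).1) _ ≫
      (kappa K' _ _ _).1 ≫ X.addMap (shiftMap θ q₁ α₁).1 (𝟙 _) _
  rw [← e3, ← reassoc_of% e1, addMap_addMap_assoc, addMap_addMap_assoc]
  exact congrArg (· ≫ _) (X.addMap_congr _ rfl e2)

end

end AddFunctor

namespace Extension

theorem exists_translate_iso {P Q : PicardStack.{w} J} (E : Extension P Q) {U : C}
    {x y : E.E.Obj U} {q₁ q₂ : Q.Obj U} (α₁ : E.E.FHom (E.E.add x (E.inc.obj q₁)) y)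
    (α₂ : E.E.FHom (E.E.add x (E.inc.obj q₂)) y) (γ : P.FHom (E.proj.obj x) (E.proj.obj y))
    (h₁ : E.proj.map α₁.1 = (rho E.nul x q₁).1 ≫ γ.1)
    (h₂ : E.proj.map α₂.1 = (rho E.nul x q₂).1 ≫ γ.1) :
    ∃ u : Q.FHom q₁ q₂, E.E.addMap (𝟙 _) (E.inc.map u.1) (by simp) ≫ α₂.1 = α₁.1 := by
  have e1 : E.proj.map (α₁.1 ≫ (finv α₂).1) ≫ (rho E.nul x q₂).1 =
      (rho E.nul x q₁).1 ≫ E.proj.map (𝟙 _) := by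
    have e2 : E.proj.map (finv α₂).1 ≫ E.proj.map α₂.1 = 𝟙 _ := by
      rw [← E.proj.map_comp, finv_fhom, E.proj.map_id]
    rw [← cancel_mono γ.1, Category.assoc, ← h₂, E.proj.map_comp, Category.assoc, e2, h₁]
    simp
  obtain ⟨u, hu, e⟩ := E.isCok.exists_translate_map (α₁.1 ≫ (finv α₂).1) (𝟙 (Tot.mk x)) (by simp) e1
  exact ⟨⟨u, by rw [← hu]; simp⟩, (congrArg (· ≫ α₂.1) e).trans (by simp)⟩

theorem inc_hom_ext {P Q : PicardStack.{w} J} (S : Extension P Q) {U : C} {a z : S.E.Obj U}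
    {r r' : Q.Obj U} (k k' : Q.FHom r r') (ψ : S.E.FHom (S.E.add a (S.inc.obj r')) z)
    (h : S.E.addMap (𝟙 _) (S.inc.map k.1) (by simp) ≫ ψ.1 =
      S.E.addMap (𝟙 _) (S.inc.map k'.1) (by simp) ≫ ψ.1) : k = k' := by
  have h6 : S.inc.map k.1 = S.inc.map k'.1 := congrArg FHom.val
    (addMap_id_left_inj (f := S.inc.fmap k) (g := S.inc.fmap k') ((cancel_mono ψ.1).1 h))
  obtain ⟨_, -, hu⟩ := S.isCok.full _ _ (S.inc.fmap k) (AddFunctor.nul_map_fiber S.nul k)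
  exact (hu k rfl).trans (hu k' h6.symm).symm

namespace OverMor

variable {P Q Q' : PicardStack.{w} J} {H : AddFunctor Q.toPicardFib Q'.toPicardFib}
  {E : Extension P Q} {S : Extension P Q'}

theorem p_add (m : OverMor E S H) {U : C} (x y : E.E.Obj U) :
    (m.p (E.E.add x y)).1 ≫ (E.proj.sum x y).1 = S.proj.map (m.F.sum x y).1 ≫
      (S.proj.sum (m.F.obj x) (m.F.obj y)).1 ≫ P.addMap (m.p x).1 (m.p y).1 (by simp) :=
  (m.projIso.app_add x y).trans (Category.assoc _ _ _)

theorem p_rho (m : OverMor E S H) {U : C} (x : E.E.Obj U) (q : Q.Obj U) :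
    (m.p (E.E.add x (E.inc.obj q))).1 ≫ (rho E.nul x q).1 = S.proj.map (m.F.sum x (E.inc.obj q)).1 ≫
      S.proj.map (S.E.addMap (𝟙 _) (m.i q).1 (by simp)) ≫
        (rho S.nul (m.F.obj x) (H.obj q)).1 ≫ (m.p x).1 := by
  have h1 := P.addZero_natural (m.p x).1 (𝟙 U) (by simp)
  rw [rho_eq, rho_eq, reassoc_of% m.p_add, Category.assoc, Category.assoc, ← h1]
  simp only [addMap_addMap_assoc]
  rw [AddFunctor.sum_natural_assoc, addMap_addMap_assoc]
  congr 3
  exact P.addMap_congr _ (by simp) (by rw [m.p_nul]; simp)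

theorem proj_shiftMap (m : OverMor E S H) {U : C} {x y : E.E.Obj U} (q : Q.Obj U)
    (α : E.E.FHom (E.E.add x (E.inc.obj q)) y) (γ : P.FHom (E.proj.obj x) (E.proj.obj y))
    (h : E.proj.map α.1 = (rho E.nul x q).1 ≫ γ.1) :
    S.proj.map (shiftMap m.incIso q α).1 ≫ (m.p y).1 =
      (rho S.nul (m.F.obj x) (H.obj q)).1 ≫ (m.p x).1 ≫ γ.1 := by
  have e : (shiftMap m.incIso q α).1 = S.E.addMap (𝟙 _) (finv (m.i q)).1 (by simp) ≫
    (finv (m.F.sum x (E.inc.obj q))).1 ≫ m.F.map α.1 := rfl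
  have e1 : S.proj.map (finv (m.F.sum x (E.inc.obj q))).1 ≫ S.proj.map (m.F.sum x (E.inc.obj q)).1 =
      𝟙 _ := by rw [← S.proj.map_comp, finv_fhom, S.proj.map_id]
  have e2 : S.proj.map (S.E.addMap (𝟙 (Tot.mk (m.F.obj x))) (finv (m.i q)).1 (by simp)) ≫
      S.proj.map (S.E.addMap (𝟙 _) (m.i q).1 (by simp)) = 𝟙 _ := by
    rw [← S.proj.map_comp, addMap_addMap, ← S.proj.map_id, ← S.E.addMap_id]
    exact congrArg S.proj.map (S.E.addMap_congr _ (by simp) (by simp))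
  rw [e, S.proj.map_comp, S.proj.map_comp, Category.assoc, Category.assoc, m.p_natural, h,
    ← Category.assoc (m.p _).1, m.p_rho]
  simp only [Category.assoc]
  rw [reassoc_of% e1, reassoc_of% e2]

theorem proj_shift (m : OverMor E S H) {U : C} {x y : E.E.Obj U} (q : Q.Obj U)
    (α : E.E.FHom (E.E.add x (E.inc.obj q)) y) (γ : P.FHom (E.proj.obj x) (E.proj.obj y))
    (h : E.proj.map α.1 = (rho E.nul x q).1 ≫ γ.1) (q' : Q'.Obj U) :
    S.proj.map (shift m.incIso q α q').1 ≫ (rho S.nul (m.F.obj y) q').1 ≫ (m.p y).1 =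
      (rho S.nul (m.F.obj x) (Q'.add q' (H.obj q))).1 ≫ (m.p x).1 ≫ γ.1 := by
  have e : (shift m.incIso q α q').1 = S.E.addMap (𝟙 _) (S.inc.map (Q'.τ q' (H.obj q)).1) (by simp) ≫
    (kappa S.inc (m.F.obj x) (H.obj q) q').1 ≫
      S.E.addMap (shiftMap m.incIso q α).1 (𝟙 _) (by simp) := rfl
  have e1 := AddFunctor.rho_natural S.nul (shiftMap m.incIso q α).1 (𝟙 (Tot.mk q')) (by simp)
  have e2 := AddFunctor.rho_natural S.nul (𝟙 (Tot.mk (m.F.obj x))) (Q'.τ q' (H.obj q)).1 (by simp)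
  have e3 : S.E.addMap (shiftMap m.incIso q α).1 (𝟙 (Tot.mk (S.inc.obj q'))) (by simp) =
    S.E.addMap (shiftMap m.incIso q α).1 (S.inc.map (𝟙 (Tot.mk q'))) (by simp) :=
      S.E.addMap_congr _ rfl (by simp)
  rw [e, e3, S.proj.map_comp, S.proj.map_comp, Category.assoc, Category.assoc, reassoc_of% e1,
    m.proj_shiftMap q α γ h, reassoc_of% (kappa_rho S.nul (m.F.obj x) (H.obj q) q'),
    reassoc_of% e2]
  simp

theorem proj_hom (m : OverMor E S H) {U : C} {x y : (E.E.prod Q').Obj U}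
    (t : Triplet E.inc H x y) (γ : P.FHom (E.proj.obj x.1) (E.proj.obj y.1))
    (h : E.proj.map t.α.1 = (rho E.nul x.1 t.q).1 ≫ γ.1) :
    S.proj.map (t.hom m.incIso).1 ≫ (rho S.nul (m.F.obj y.1) y.2).1 ≫ (m.p y.1).1 =
      (rho S.nul (m.F.obj x.1) x.2).1 ≫ (m.p x.1).1 ≫ γ.1 := by
  have e1 := AddFunctor.rho_natural S.nul (𝟙 (Tot.mk (m.F.obj x.1))) t.β.1 (by simp)
  refine (congrArg (fun f => S.proj.map f ≫ _) (t.hom_eq m.incIso)).trans ?_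
  refine (congrArg (· ≫ _) (S.proj.map_comp _ _)).trans ((Category.assoc _ _ _).trans ?_)
  refine (congrArg (_ ≫ ·) (m.proj_shift t.q t.α γ h y.2)).trans ?_
  exact (Category.assoc _ _ _).symm.trans ((congrArg (· ≫ _) e1).trans (congrArg (· ≫ _)
    ((congrArg (_ ≫ ·) (S.proj.map_id _)).trans (Category.comp_id _))))

theorem exists_triplet (m : OverMor E S H) {U : C} (x y : (E.E.prod Q').Obj U)
    (φ : S.E.FHom (S.E.add (m.F.obj x.1) (S.inc.obj x.2)) (S.E.add (m.F.obj y.1) (S.inc.obj y.2))) :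
    ∃ t : Triplet E.inc H x y, (t.hom m.incIso).1 = φ.1 := by
  let γ : P.FHom (E.proj.obj x.1) (E.proj.obj y.1) :=
    ⟨(finv (m.p x.1)).1 ≫ (finv (rho S.nul (m.F.obj x.1) x.2)).1 ≫ S.proj.map φ.1 ≫
      (rho S.nul (m.F.obj y.1) y.2).1 ≫ (m.p y.1).1, by simp⟩
  obtain ⟨q, α, hα⟩ := E.isCok.exists_translate (finv γ)
  have hα' : E.proj.map α.1 = (rho E.nul x.1 q).1 ≫ γ.1 := by rw [← hα]; simp
  have hs := m.proj_shift q α γ hα' y.2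
  let ψ := shift m.incIso q α y.2
  have e1 : S.proj.map (φ.1 ≫ (finv ψ).1) ≫ (rho S.nul (m.F.obj x.1) (Q'.add y.2 (H.obj q))).1 =
      (rho S.nul (m.F.obj x.1) x.2).1 ≫ S.proj.map (𝟙 _) := by
    have e2 : S.proj.map (finv ψ).1 ≫ S.proj.map ψ.1 = 𝟙 _ := by
      rw [← S.proj.map_comp, finv_fhom, S.proj.map_id]
    have hγ : (m.p x.1).1 ≫ γ.1 = (finv (rho S.nul (m.F.obj x.1) x.2)).1 ≫ S.proj.map φ.1 ≫
      (rho S.nul (m.F.obj y.1) y.2).1 ≫ (m.p y.1).1 := fhom_finv_assoc _ _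
    haveI := isIso_val (FHom.comp (m.p x.1) γ)
    rw [← cancel_mono (FHom.comp (m.p x.1) γ).1]
    change (_ ≫ _) ≫ (m.p x.1).1 ≫ γ.1 = (_ ≫ _) ≫ (m.p x.1).1 ≫ γ.1
    rw [Category.assoc, ← hs, hγ, S.proj.map_comp, Category.assoc, reassoc_of% e2]
    simp
  obtain ⟨β, hβ, e⟩ := S.isCok.exists_translate_map (φ.1 ≫ (finv ψ).1) (𝟙 (Tot.mk (m.F.obj x.1)))
    (by simp) e1
  refine ⟨⟨q, α, ⟨β, by rw [← hβ]; simp⟩⟩, (Triplet.hom_eq m.incIso _).trans ?_⟩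
  refine (congrArg (· ≫ ψ.1) e).trans ?_
  simp

theorem exists_triplet_iso (m : OverMor E S H) {U : C} {x y : (E.E.prod Q').Obj U}
    (t₁ t₂ : Triplet E.inc H x y) (h : t₁.hom m.incIso = t₂.hom m.incIso) :
    ∃ u : Q.FHom t₁.q t₂.q, E.E.addMap (𝟙 _) (E.inc.map u.1) (by simp) ≫ t₂.α.1 = t₁.α.1 ∧
      t₁.β.1 ≫ Q'.addMap (𝟙 _) (H.map u.1) (by simp) = t₂.β.1 := by
  let γ (t : Triplet E.inc H x y) : P.FHom (E.proj.obj x.1) (E.proj.obj y.1) :=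
    ⟨(finv (rho E.nul x.1 t.q)).1 ≫ E.proj.map t.α.1, by simp⟩
  have hγ (t : Triplet E.inc H x y) : E.proj.map t.α.1 = (rho E.nul x.1 t.q).1 ≫ (γ t).1 :=
    (fhom_finv_assoc _ _).symm
  have h1 := m.proj_hom t₁ (γ t₁) (hγ t₁)
  have h2 := m.proj_hom t₂ (γ t₂) (hγ t₂)
  have h3 : (γ t₁).1 = (γ t₂).1 := by
    refine (cancel_epi (m.p x.1).1).1 ((cancel_epi (rho S.nul (m.F.obj x.1) x.2).1).1 ?_)
    rw [← h1, ← h2, h]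
  obtain ⟨u, hα⟩ := E.exists_translate_iso t₁.α t₂.α (γ t₁) (hγ t₁)
    ((hγ t₂).trans (congrArg (_ ≫ ·) h3.symm))
  refine ⟨u, hα, ?_⟩
  have h4 := ((t₁.hom_eq m.incIso).symm.trans (congrArg FHom.val h)).trans (t₂.hom_eq m.incIso)
  have h5 := (congrArg (_ ≫ ·) (shift_natural m.incIso u t₁.α t₂.α hα y.2)).trans h4
  refine congrArg FHom.val (S.inc_hom_ext (a := m.F.obj x.1)
    ⟨t₁.β.1 ≫ Q'.addMap (𝟙 _) (H.map u.1) (by simp), by simp⟩ t₂.β (shift m.incIso t₂.q t₂.α y.2)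
      (Eq.trans ?_ h5))
  refine Eq.trans (congrArg (· ≫ _) ?_) (Category.assoc _ _ _)
  rw [addMap_addMap]
  exact S.E.addMap_congr _ (by simp) (by simp)

theorem exists_pair (m : OverMor E S H) {U : C} (z : S.E.Obj U) : ∃ R ∈ J U,
    ∀ {V : C} (f : V ⟶ U), R f → ∃ (x : E.E.Obj V) (q' : Q'.Obj V)
      (φ : S.E.Hom (S.E.add (m.F.obj x) (S.inc.obj q')) z), S.E.π φ = f := by
  obtain ⟨R, hR, h⟩ := E.surj (S.proj.obj z)
  refine ⟨R, hR, fun {V} f hf => ?_⟩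
  obtain ⟨x, φ, hφ⟩ := h f hf
  let γ : P.FHom (S.proj.obj (S.E.pull f z)) (S.proj.obj (m.F.obj x)) :=
    finv ⟨(m.p x).1 ≫ (facF φ (S.proj.map (pullHom f z)) (by simp [hφ])).1, by simp⟩
  obtain ⟨q', α, -⟩ := S.isCok.exists_translate γ
  exact ⟨x, q', α.1 ≫ pullHom f z, by simp⟩

theorem _root_.PicardStacks.Triplet.exists_isRestriction {P P' Q : PicardFib.{w} C}
    {G : AddFunctor Q P} {F : AddFunctor Q P'} {U V : C} {x y : (P.prod P').Obj U}
    {x' y' : (P.prod P').Obj V} (a : (P.prod P').Hom x' x) (b : (P.prod P').Hom y' y)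
    (h : (P.prod P').π a = (P.prod P').π b) (t₁ t₂ : Triplet G F x y) (u : Q.FHom t₁.q t₂.q)
    (hα : P.addMap (𝟙 _) (G.map u.1) (by simp) ≫ t₂.α.1 = t₁.α.1)
    (hβ : t₁.β.1 ≫ P'.addMap (𝟙 _) (F.map u.1) (by simp) = t₂.β.1) :
    ∃ t : Triplet G F x' y', t.IsRestriction a b t₁ ∧ t.IsRestriction a b t₂ := by
  let k := pullHom (P.π (ProdHom.fst a)) t₁.q
  have hk : Q.π k = P.π (ProdHom.fst a) := π_pullHom _ _
  have ha : P.π (ProdHom.fst a) = P.π (G.map k) := by rw [G.π_map, hk]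
  have h : P.π (ProdHom.fst a) = P.π (ProdHom.fst b) := h
  have h' : P'.π (ProdHom.snd b) = P.π (ProdHom.fst a) := (ProdHom.eq b).symm.trans h.symm
  have hb : P'.π (ProdHom.snd b) = P'.π (F.map k) := by rw [F.π_map, hk, h']
  have eα : P.π (P.addMap (ProdHom.fst a) (G.map k) ha ≫ t₁.α.1) = P.π (ProdHom.fst b) :=
    π_comp_val _ ((P.π_addMap _ _ _).trans h)
  have eβ : P'.π (ProdHom.snd a ≫ t₁.β.1) = P'.π (P'.addMap (ProdHom.snd b) (F.map k) hb) :=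
    π_comp_val _ ((ProdHom.eq a).symm.trans (h'.symm.trans (P'.π_addMap _ _ _).symm))
  let t : Triplet G F x' y' := ⟨Q.pull (P.π (ProdHom.fst a)) t₁.q,
    facF _ _ eα, facF _ _ eβ⟩
  have h1 : t.α.1 ≫ ProdHom.fst b = P.addMap (ProdHom.fst a) (G.map k) ha ≫ t₁.α.1 :=
    facF_comp _ _ eα
  have h2 : t.β.1 ≫ P'.addMap (ProdHom.snd b) (F.map k) hb = ProdHom.snd a ≫ t₁.β.1 :=
    facF_comp _ _ eβ
  have ha' : P.π (ProdHom.fst a) = P.π (G.map (k ≫ u.1)) :=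
    ha.trans (by rw [G.π_map, G.π_map, π_comp_val u rfl])
  have hb' : P'.π (ProdHom.snd b) = P'.π (F.map (k ≫ u.1)) :=
    hb.trans (by rw [F.π_map, F.π_map, π_comp_val u rfl])
  refine ⟨t, ⟨k, ha, hb, h1.symm, h2⟩, k ≫ u.1, ha', hb', ?_, ?_⟩
  · refine Eq.trans ?_ h1.symm
    rw [← hα, addMap_addMap_assoc]
    exact congrArg (· ≫ t₂.α.1) (P.addMap_congr _ (Category.comp_id _).symm (G.map_comp _ _))
  · rw [← hβ, ← reassoc_of% h2, addMap_addMap]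
    exact congrArg (t.β.1 ≫ ·) (P'.addMap_congr _ (Category.comp_id _).symm (F.map_comp _ _))

/-- The target of a morphism of extensions over `H` is the fibered sum of its source and the target
of `H`. -/
theorem isFiberedSum (m : OverMor E S H) : IsFiberedSum E.inc H m.F S.inc m.incIso where
  essSurj {U} z := by
    obtain ⟨R, hR, h⟩ := m.exists_pair z
    refine ⟨R, hR, fun {V} f hf => ?_⟩
    obtain ⟨x, q', φ, hφ⟩ := h f hf
    exact ⟨(x, q'), φ, hφ⟩
  full {U} x y φ := by
    refine ⟨⊤, J.top_mem U, fun {V} f _ => ?_⟩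
    let a := pullHom f x
    let b := pullHom f y
    have ha : (E.E.prod Q').π a = f := π_pullHom _ _
    have hb : (E.E.prod Q').π b = f := π_pullHom _ _
    have h : S.E.π ((m.F.sumOf S.inc).map a ≫ φ.1) = S.E.π ((m.F.sumOf S.inc).map b) :=
      (π_comp_val _ ((AddFunctor.π_map _ _).trans ha)).trans
        ((AddFunctor.π_map _ _).trans hb).symm
    obtain ⟨t, ht⟩ := m.exists_triplet _ _ (facF _ _ h)
    exact ⟨_, _, a, b, t, ha, hb, (congrArg (· ≫ _) ht).trans (facF_comp _ _ h)⟩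
  faithful {U} x y t₁ t₂ h := by
    obtain ⟨u, hα, hβ⟩ := m.exists_triplet_iso t₁ t₂ h
    refine ⟨⊤, J.top_mem U, fun {V} f _ => ?_⟩
    have ha : (E.E.prod Q').π (pullHom f x) = f := π_pullHom _ _
    have hb : (E.E.prod Q').π (pullHom f y) = f := π_pullHom _ _
    obtain ⟨t, h1, h2⟩ := Triplet.exists_isRestriction (pullHom f x) (pullHom f y)
      (ha.trans hb.symm) t₁ t₂ u hα hβ
    exact ⟨_, _, pullHom f x, pullHom f y, t, ha, hb, h1, h2⟩

theorem isPushDown (m : OverMor E S H) : IsPushDown E H S := ⟨m.toMor, m.isFiberedSum⟩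

end OverMor

end Extension

end FiberedSumOfExtension

end PicardStacks

namespace PicardStacks

open FibGpd PicardFib AddFunctor

section ProductsOverBase

variable {C : Type u} [Category.{v} C] {J : GrothendieckTopology C}

namespace AddFunctor

/-- The isomorphism between the two composites of a fibered product. -/
noncomputable def fibIso {P P' Q : PicardFib.{w} C} (G : AddFunctor P Q) (F : AddFunctor P' Q) :
    Hom (G.comp (pr₁ G F)) (F.comp (pr₂ G F)) where
  app x := x.iso
  naturality φ := FibHom.comm φ
  app_add x y := by
    have h := congrArg FHom.val (isoAdd_sumF (G := G) (F := F) x.iso y.iso)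
    refine Eq.trans ?_ (h.trans ?_)
    · exact congrArg (_ ≫ ·) ((congrArg (· ≫ _) (F.map_id _)).trans (Category.id_comp _))
    · exact congrArg (· ≫ _) ((congrArg (· ≫ _) (G.map_id _)).trans (Category.id_comp _)).symm

/-- The zero functor precomposed with a functor. -/
noncomputable def zeroPrecomp {O P R : PicardFib.{w} C} (H : AddFunctor O P) :
    Hom (zero O R) ((zero P R).comp H) where
  app {U} _ := ⟨𝟙 _, R.π_id _⟩
  naturality φ := (Category.comp_id _).trans ((congrArg R.zeroMap (H.π_map φ)).symm.trans
    (Category.id_comp _).symm)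
  app_add {U} x y := by
    refine (Category.id_comp _).trans ?_
    refine Eq.trans ?_ (congrArg (_ ≫ ·) (R.addMap_id _ _)).symm
    refine Eq.trans ?_ (Category.comp_id _).symm
    exact (congrArg (· ≫ _) ((congrArg R.zeroMap (H.sum x y).2).trans (R.zeroMap_id U))).trans
      (Category.id_comp _)

end AddFunctor

namespace Extension

variable {P P' Q Q' : PicardStack.{w} J}

theorem pullback_inc_iso (E : Extension P Q) (G : AddFunctor P'.toPicardFib P.toPicardFib) {U : C}
    (q : Q.Obj U) : (FibObj.iso (G := E.proj) (F := G) ((E.pullback G).inc.obj q)).1 =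
      (AddFunctor.nul E.nul q).1 ≫ (finv (G.unit U)).1 := rfl

section toPullback

variable {W : Extension P' Q} {E : Extension P Q'} {G : AddFunctor P'.toPicardFib P.toPicardFib}
  {H : AddFunctor Q.toPicardFib Q'.toPicardFib}

/-- The first component of `Mor.toPullback`. -/
noncomputable def Mor.toPullbackFst (m : Mor W E G H) :
    AddFunctor.Hom ((pr₁ E.proj G).comp ((lift m.F W.proj m.projIso).comp W.inc))
      ((pr₁ E.proj G).comp ((E.pullback G).inc.comp H)) :=
  ((((compAssocInv _ _ _).trans ((liftFst m.F W.proj m.projIso).whiskerRight W.inc)).trans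
    m.incIso).trans ((liftFst E.inc _ _).symm.whiskerRight H)).trans (compAssoc _ _ _)

theorem Mor.toPullbackFst_app (m : Mor W E G H) {U : C} (q : Q.Obj U) :
    (m.toPullbackFst.app q).1 = (m.incIso.app q).1 := by
  refine (Category.comp_id _).trans ?_
  refine (congrArg (_ ≫ ·) (finv_eq (Category.comp_id _))).trans ((Category.comp_id _).trans ?_)
  exact (congrArg (· ≫ _) (Category.comp_id _)).trans (Category.id_comp _)

/-- The second component of `Mor.toPullback`. -/
noncomputable def Mor.toPullbackSnd (m : Mor W E G H) :
    AddFunctor.Hom ((pr₂ E.proj G).comp ((lift m.F W.proj m.projIso).comp W.inc))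
      ((pr₂ E.proj G).comp ((E.pullback G).inc.comp H)) :=
  (((((compAssocInv _ _ _).trans ((liftSnd m.F W.proj m.projIso).whiskerRight W.inc)).trans
    W.nul).trans (zeroPrecomp H)).trans ((liftSnd E.inc _ _).symm.whiskerRight H)).trans
      (compAssoc _ _ _)

theorem Mor.toPullbackSnd_app (m : Mor W E G H) {U : C} (q : Q.Obj U) :
    (m.toPullbackSnd.app q).1 = (W.nul.app q).1 := by
  refine (Category.comp_id _).trans ?_
  refine (congrArg (_ ≫ ·) (finv_eq (Category.comp_id _))).trans ((Category.comp_id _).trans ?_)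
  refine (Category.comp_id _).trans ?_
  exact (congrArg (· ≫ _) (Category.comp_id _)).trans (Category.id_comp _)

/-- The morphism to the pull-back given by a morphism over `G`. -/
noncomputable def Mor.toPullback (m : Mor W E G H) : OverMor W (E.pullback G) H where
  F := lift m.F W.proj m.projIso
  projIso := liftSnd m.F W.proj m.projIso
  incIso := Hom.mkFib m.toPullbackFst m.toPullbackSnd fun {U} q => by
    have h := m.compat q
    let a : P.FHom (G.obj (P'.zero U)) (P.zero U) := G.unit U
    refine (congrArg₂ (fun s t => E.proj.map s ≫ t) (m.toPullbackFst_app q)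
      (pullback_inc_iso E G (H.obj q))).trans (Eq.trans ?_
        (congrArg (fun s => (m.projIso.app (W.inc.obj q)).1 ≫ G.map s)
          (m.toPullbackSnd_app q)).symm)
    refine (Category.assoc _ _ _).symm.trans ((congrArg (· ≫ (finv a).1) h.symm).trans ?_)
    refine (Category.assoc _ _ _).trans (congrArg (_ ≫ ·) ?_)
    exact (Category.assoc _ _ _).trans ((congrArg (_ ≫ ·) (fhom_finv a)).trans (Category.comp_id _))
  compat {U} q := by
    refine (Category.id_comp _).trans (Eq.trans ?_ (Category.comp_id _).symm)
    exact (m.toPullbackSnd_app q).symm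

end toPullback

/-- The morphism over `G` from a pull-back. -/
noncomputable def OverMor.ofPullback {E : Extension P Q} {E' : Extension P Q'}
    {H : AddFunctor Q.toPicardFib Q'.toPicardFib} (m : OverMor E E' H)
    (G : AddFunctor P'.toPicardFib P.toPicardFib) : Mor (E.pullback G) E' G H where
  F := m.F.comp (pr₁ E.proj G)
  projIso := ((compAssocInv _ _ _).trans (m.projIso.whiskerRight (pr₁ E.proj G))).trans
    (fibIso E.proj G)
  incIso := ((compAssoc _ _ _).trans ((liftFst E.inc _ _).whiskerLeft m.F)).trans m.incIso
  compat {U} q := by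
    let a : P.FHom (G.obj (P'.zero U)) (P.zero U) := G.unit U
    let n : P.FHom (E.proj.obj (E.inc.obj q)) (P.zero U) := E.nul.app q
    have e1 : (G.map (𝟙 (Tot.mk (P'.zero U)))) ≫ a.1 = a.1 :=
      (congrArg (· ≫ a.1) (G.map_id _)).trans (Category.id_comp _)
    have e2 : ((𝟙 _ ≫ (m.p (E.inc.obj q)).1) ≫ n.1 ≫ (finv a).1) ≫
        (G.map (𝟙 (Tot.mk (P'.zero U)))) ≫ a.1 = (m.p (E.inc.obj q)).1 ≫ n.1 := by
      rw [e1]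
      simp
    refine e2.trans ((m.p_nul q).trans (congrArg (fun t => E'.proj.map t ≫ _) ?_))
    refine ((congrArg (· ≫ _) ((Category.id_comp _).trans (m.F.map_id _))).trans
      (Category.id_comp _)).symm

section Pairing

variable {Q₁ Q₂ : PicardStack.{w} J}

/-- The product of two extensions of `P`, as extensions of `P`. -/
noncomputable abbrev prodOver (A : Extension P Q₁) (B : Extension P Q₂) :
    Extension P (Q₁.prod Q₂) := (A.prod B).pullback (diag P.toPicardFib)

theorem _root_.PicardStacks.AddFunctor.diag_unit (A : PicardFib.{w} C) (U : C) :
    ((diag A).unit U).1 = 𝟙 _ := by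
  have key : (⟨𝟙 _, FibGpd.π_id _ _⟩ : (A.prod A).FHom ((diag A).obj (A.zero U))
      ((A.prod A).zero U)) = (diag A).unit U := by
    apply (diag A).unit_unique
    have h : 𝟙 _ ≫ A.addMap (𝟙 (Tot.mk (A.zero U))) (𝟙 (Tot.mk (A.zero U))) (by simp) ≫
        (A.zeroAdd (A.zero U)).1 = (A.zeroAdd (A.zero U)).1 := by simp
    exact ProdHom.ext h h
  exact congrArg FHom.val key.symm

section

variable {W : Extension P Q} {A : Extension P Q₁} {B : Extension P Q₂}
  {H₁ : AddFunctor Q.toPicardFib Q₁.toPicardFib} {H₂ : AddFunctor Q.toPicardFib Q₂.toPicardFib}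

/-- The morphism over the diagonal given by two morphisms. -/
def OverMor.pairDiag (m₁ : OverMor W A H₁) (m₂ : OverMor W B H₂) :
    Mor W (A.prod B) (diag P.toPicardFib) (AddFunctor.pair H₁ H₂) where
  F := AddFunctor.pair m₁.F m₂.F
  projIso :=
    { app := fun x => ⟨⟨(m₁.p x).1, (m₂.p x).1, (FHom.property _).trans (FHom.property _).symm⟩,
        (m₁.p x).2⟩
      naturality := fun φ => ProdHom.ext (m₁.p_natural φ) (m₂.p_natural φ)
      app_add := fun x y => ProdHom.ext
        ((congrArg (_ ≫ ·) (Category.comp_id _)).trans (m₁.projIso.app_add x y))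
        ((congrArg (_ ≫ ·) (Category.comp_id _)).trans (m₂.projIso.app_add x y)) }
  incIso :=
    { app := fun q => ⟨⟨(m₁.i q).1, (m₂.i q).1, (FHom.property _).trans (FHom.property _).symm⟩,
        (m₁.i q).2⟩
      naturality := fun φ => ProdHom.ext (m₁.i_natural φ) (m₂.i_natural φ)
      app_add := fun x y => ProdHom.ext (m₁.incIso.app_add x y) (m₂.incIso.app_add x y) }
  compat {U} q := by
    have h : ((diag P.toPicardFib).map (W.nul.app q).1) ≫ ((diag P.toPicardFib).unit U).1 =
        (diag P.toPicardFib).map (W.nul.app q).1 :=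
      (congrArg (_ ≫ ·) (diag_unit P.toPicardFib U)).trans (Category.comp_id _)
    exact (congrArg (_ ≫ ·) h).trans (ProdHom.ext (m₁.p_nul q) (m₂.p_nul q))

/-- The morphism to the product over `P` given by two morphisms. -/
noncomputable def OverMor.pair (m₁ : OverMor W A H₁) (m₂ : OverMor W B H₂) :
    OverMor W (prodOver A B) (AddFunctor.pair H₁ H₂) := (m₁.pairDiag m₂).toPullback

end

variable (A : Extension P Q₁) (B : Extension P Q₂)

theorem prodOver_nul_unit (U : C) : (finv ((diag P.toPicardFib).unit U)).1 = 𝟙 _ :=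
  finv_eq ((congrArg (· ≫ _) (diag_unit P.toPicardFib U)).trans (Category.comp_id _))

/-- The first projection of the product over `P`. -/
noncomputable def prodOverFst : OverMor (prodOver A B) A
    (fst Q₁.toPicardFib Q₂.toPicardFib) where
  F := (fst A.E.toPicardFib B.E.toPicardFib).comp (pr₁ _ _)
  projIso :=
    { app := fun x => ⟨ProdHom.fst (FibObj.iso x).1, (FibObj.iso x).2⟩
      naturality := fun φ => congrArg ProdHom.fst (FibHom.comm φ)
      app_add := fun x y => by
        have h := (fibIso (AddFunctor.prodMap A.proj B.proj) (diag P.toPicardFib)).app_add x y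
        refine (congrArg (_ ≫ ·) (Category.comp_id _).symm).trans
          ((congrArg ProdHom.fst h).trans (congrArg (· ≫ _) (congrArg (· ≫ _) ?_)))
        exact congrArg A.proj.map (Category.comp_id _).symm }
  incIso :=
    { app := fun q => ⟨𝟙 _, A.E.π_id _⟩
      naturality := fun φ => (Category.comp_id _).trans (Category.id_comp _).symm
      app_add := fun x y => by
        refine (Category.id_comp _).trans (Eq.trans ?_ (congrArg (_ ≫ ·) (A.E.addMap_id _ _)).symm)
        refine ((congrArg (· ≫ _) (A.inc.map_id _)).trans (Category.id_comp _)).trans ?_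
        exact ((Category.comp_id _).trans ((congrArg (_ ≫ ·) (Category.comp_id _)).trans
          (Category.comp_id _))).symm }
  compat {U} q := by
    refine (Category.comp_id _).trans (Eq.trans ?_ ((congrArg (· ≫ _) (A.proj.map_id _)).trans
      (Category.id_comp _)).symm)
    exact congrArg ProdHom.fst ((congrArg (((A.prod B).nul.app q).1 ≫ ·)
      (prodOver_nul_unit U)).trans (Category.comp_id _))

/-- The second projection of the product over `P`. -/
noncomputable def prodOverSnd : OverMor (prodOver A B) B
    (snd Q₁.toPicardFib Q₂.toPicardFib) where
  F := (snd A.E.toPicardFib B.E.toPicardFib).comp (pr₁ _ _)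
  projIso :=
    { app := fun x => ⟨ProdHom.snd (FibObj.iso x).1, (ProdHom.eq (FibObj.iso x).1).symm.trans (FibObj.iso x).2⟩
      naturality := fun φ => congrArg ProdHom.snd (FibHom.comm φ)
      app_add := fun x y => by
        have h := (fibIso (AddFunctor.prodMap A.proj B.proj) (diag P.toPicardFib)).app_add x y
        refine (congrArg (_ ≫ ·) (Category.comp_id _).symm).trans
          ((congrArg ProdHom.snd h).trans (congrArg (· ≫ _) (congrArg (· ≫ _) ?_)))
        exact congrArg B.proj.map (Category.comp_id _).symm }
  incIso :=
    { app := fun q => ⟨𝟙 _, B.E.π_id _⟩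
      naturality := fun φ => (Category.comp_id _).trans (Category.id_comp _).symm
      app_add := fun x y => by
        refine (Category.id_comp _).trans (Eq.trans ?_ (congrArg (_ ≫ ·) (B.E.addMap_id _ _)).symm)
        refine ((congrArg (· ≫ _) (B.inc.map_id _)).trans (Category.id_comp _)).trans ?_
        exact ((Category.comp_id _).trans ((congrArg (_ ≫ ·) (Category.comp_id _)).trans
          (Category.comp_id _))).symm }
  compat {U} q := by
    refine (Category.comp_id _).trans (Eq.trans ?_ ((congrArg (· ≫ _) (B.proj.map_id _)).trans
      (Category.id_comp _)).symm)
    exact congrArg ProdHom.snd ((congrArg (((A.prod B).nul.app q).1 ≫ ·)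
      (prodOver_nul_unit U)).trans (Category.comp_id _))

end Pairing

end Extension

end ProductsOverBase

end PicardStacks

namespace PicardStacks

open FibGpd PicardFib AddFunctor

section Sums

variable {C : Type u} [Category.{v} C] {J : GrothendieckTopology C}

namespace AddFunctor

section PointwiseSums

open MonoidalCategory

variable {O P Q A B : PicardFib.{w} C}

/-- A functor to a product is the pair of its components. -/
def pairEta (k : AddFunctor O (A.prod B)) :
    Hom (pair ((fst A B).comp k) ((snd A B).comp k)) k where
  app x := ⟨𝟙 _, (A.prod B).π_id _⟩
  naturality φ := (Category.comp_id _).trans (Category.id_comp _).symm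
  app_add x y := by
    refine (Category.id_comp _).trans ?_
    refine Eq.trans ?_ (congrArg (_ ≫ ·) ((A.prod B).addMap_id _ _)).symm
    refine Eq.trans ?_ (Category.comp_id _).symm
    exact ProdHom.ext (Category.comp_id _).symm (Category.comp_id _).symm

/-- The sum of the components of a functor to `Q × Q`. -/
noncomputable def paddComponents (k : AddFunctor O (Q.prod Q)) :
    Hom (((fst Q Q).comp k).padd ((snd Q Q).comp k)) ((addition Q).comp k) :=
  (pairEta k).whiskerLeft (addition Q)

/-- The sum of the two projections is the addition. -/
noncomputable def paddFstSnd (Q : PicardFib.{w} C) :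
    Hom ((fst Q Q).padd (snd Q Q)) (addition Q) :=
  (paddCongr (compIdInv _) (compIdInv _)).trans
    ((paddComponents (AddFunctor.id (Q.prod Q))).trans (compId _))

theorem paddComm_aux {D : Type*} [Category D] [MonoidalCategory D] [SymmetricCategory D]
    {p r a b c d : D} (s : p ⟶ a ⊗ b) (t : r ⟶ c ⊗ d) :
    (β_ p r).hom ≫ (t ⊗ₘ s) ≫ tensorμ c d a b =
      ((s ⊗ₘ t) ≫ tensorμ a b c d) ≫ ((β_ a c).hom ⊗ₘ (β_ b d).hom) := by
  have h : tensorμ a b c d ≫ ((β_ a c).hom ⊗ₘ (β_ b d).hom) =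
      (β_ (a ⊗ b) (c ⊗ d)).hom ≫ tensorμ c d a b := by
    have h1 := congrArg (fun z => tensorμ a b c d ≫ z ≫ tensorμ c d a b)
      (tensorμ_braid a b c d)
    have h2 := congrArg (fun z => (tensorμ a b c d ≫ ((β_ a c).hom ⊗ₘ (β_ b d).hom)) ≫ z)
      (tensorμ_tensorμ c a d b)
    have h3 := tensorμ_tensorμ a b c d
    simp only [Category.assoc] at h1 h2
    rw [reassoc_of% h3] at h1
    rw [← h1, h2, Category.comp_id]
  rw [Category.assoc, h, BraidedCategory.braiding_naturality_assoc]

/-- Pointwise sums are commutative. -/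
noncomputable def paddComm (F G : AddFunctor O P) : Hom (F.padd G) (G.padd F) where
  app x := P.τ (F.obj x) (G.obj x)
  naturality φ := P.τ_natural (F.map φ) (G.map φ) (by simp)
  app_add {U} x y := congrArg FHom.val
    (paddComm_aux (D := P.Obj U) (F.sumF x y) (G.sumF x y))

/-- Pointwise sums commute with precomposition. -/
noncomputable def paddPrecomp (F G : AddFunctor P Q) (K : AddFunctor O P) :
    Hom ((F.padd G).comp K) ((F.comp K).padd (G.comp K)) := compAssoc _ _ _

variable (Q) in
theorem essSurj_addition : (addition Q).EssSurj := fun {U} q =>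
  ⟨(Q.zero U, q), ⟨Q.zeroAdd q⟩⟩

end PointwiseSums

end AddFunctor

namespace Extension

variable {P P' Q Q' R : PicardStack.{w} J}

/-- The extensions to which the product over `P` maps over the addition of `Q`. -/
def IsAddTarget (E E' S : Extension P Q) : Prop :=
  Nonempty (OverMor (prodOver E E') S (addition Q.toPicardFib))

theorem IsSum.isAddTarget {E E' S : Extension P Q} (h : IsSum E E' S) : IsAddTarget E E' S := by
  obtain ⟨T, ⟨m, -⟩, h⟩ := h
  obtain ⟨k⟩ := h.exists_overMor
  exact ⟨(k.comp (Mor.toPullback (m.toOver.ofPullback (diag P.toPicardFib)))).congr (idComp _)⟩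

theorem exists_isSum (E E' : Extension P Q) : ∃ S, IsSum E E' S := by
  obtain ⟨T, ⟨m⟩⟩ := (E.prod E').exists_overMor (essSurj_addition Q.toPicardFib)
  exact ⟨_, T, m.isPushDown, equivalent_refl _⟩

/-- Targets of morphisms over isomorphic surjective functors are equivalent. -/
theorem OverMor.equivalent_of_hom {W : Extension P Q} {S S' : Extension P Q'}
    {H H' : AddFunctor Q.toPicardFib Q'.toPicardFib} (m : OverMor W S H) (m' : OverMor W S' H')
    (a : AddFunctor.Hom H H') (hH : H'.EssSurj) : Equivalent S S' :=
  (m.congr a).equivalent_of_essSurj m' hH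

namespace IsAddTarget

variable {E E' S : Extension P Q}

theorem exists_overMor (h : IsAddTarget E E' S) {W : Extension P R}
    {H H' : AddFunctor R.toPicardFib Q.toPicardFib} (m : OverMor W E H) (m' : OverMor W E' H') :
    Nonempty (OverMor W S (H.padd H')) :=
  h.map fun k => k.comp (m.pair m')

theorem unique {F F' T : Extension P Q} (h : IsAddTarget E E' S) (h' : IsAddTarget F F' T)
    (hE : Equivalent E F) (hE' : Equivalent E' F') : Equivalent S T := by
  obtain ⟨k⟩ := hE.exists_overMor
  obtain ⟨k'⟩ := hE'.exists_overMor
  obtain ⟨m⟩ := h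
  obtain ⟨m'⟩ := h'.exists_overMor ((k.comp (prodOverFst E E')).congr (idComp _))
    ((k'.comp (prodOverSnd E E')).congr (idComp _))
  exact m.equivalent_of_hom (m'.congr (paddFstSnd _)) (Hom.refl _) (essSurj_addition _)

theorem comm {T : Extension P Q} (h : IsAddTarget E E' S) (h' : IsAddTarget E' E T) :
    Equivalent S T := by
  obtain ⟨m⟩ := h
  obtain ⟨m'⟩ := h'.exists_overMor (prodOverSnd E E') (prodOverFst E E')
  exact m.equivalent_of_hom (m'.congr ((paddComm _ _).trans (paddFstSnd _))) (Hom.refl _)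
    (essSurj_addition _)

theorem assoc {E₁ E₂ E₃ S₁₂ S₂₃ S T : Extension P Q} (h₁₂ : IsAddTarget E₁ E₂ S₁₂)
    (h : IsAddTarget S₁₂ E₃ S) (h₂₃ : IsAddTarget E₂ E₃ S₂₃) (h' : IsAddTarget E₁ S₂₃ T) :
    Equivalent S T := by
  let W := prodOver (prodOver E₁ E₂) E₃
  let m₁ : OverMor W E₁ _ := (prodOverFst E₁ E₂).comp (prodOverFst _ E₃)
  let m₂ : OverMor W E₂ _ := (prodOverSnd E₁ E₂).comp (prodOverFst _ E₃)
  let m₃ : OverMor W E₃ _ := prodOverSnd _ E₃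
  obtain ⟨m₁₂⟩ := h₁₂.exists_overMor m₁ m₂
  obtain ⟨m⟩ := h.exists_overMor m₁₂ m₃
  obtain ⟨m₂₃⟩ := h₂₃.exists_overMor m₂ m₃
  obtain ⟨m'⟩ := h'.exists_overMor m₁ m₂₃
  refine m.equivalent_of_hom m' (paddAssoc _ _ _) fun {U} q => ?_
  refine ⟨((Q.zero U, Q.zero U), q), ⟨?_⟩⟩
  exact (Q.zeroAdd _).comp (Q.zeroAdd q)

end IsAddTarget

end Extension

end Sums

end PicardStacks

namespace PicardStacks

open FibGpd PicardFib AddFunctor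

section Twist

variable {C : Type u} [Category.{v} C] {J : GrothendieckTopology C}

/-- The second component of a pair. -/
def AddFunctor.pairSnd {O A B : PicardFib.{w} C} (F : AddFunctor O A) (G : AddFunctor O B) :
    Hom ((snd A B).comp (AddFunctor.pair F G)) G where
  app x := ⟨𝟙 _, B.π_id _⟩
  naturality φ := (Category.comp_id _).trans (Category.id_comp _).symm
  app_add x y := by
    refine (Category.id_comp _).trans ?_
    refine Eq.trans ?_ (congrArg (_ ≫ ·) (B.addMap_id _ _)).symm
    exact ((Category.comp_id _).trans (Category.comp_id _)).symm

namespace Extension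

variable {P Q Q' : PicardStack.{w} J}

section

variable {W : Extension P Q} {E : Extension P Q'} {H : AddFunctor Q.toPicardFib Q'.toPicardFib}

theorem OverMor.twist_compat (m : OverMor W E H) {U : C} (q : Q.Obj U) (r : Q'.Obj U) :
    ((E.proj.sum (m.F.obj (W.inc.obj q)) (E.inc.obj r)).1 ≫
        P.addMap (m.p (W.inc.obj q)).1 (AddFunctor.nul E.nul r).1 (by simp) ≫
          (P.addZero (W.proj.obj (W.inc.obj q))).1) ≫ (AddFunctor.nul W.nul q).1 =
      E.proj.map (E.E.addMap (m.i q).1 (𝟙 _) (by simp) ≫ (finv (E.inc.sum (H.obj q) r)).1) ≫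
        (AddFunctor.nul E.nul (Q'.add (H.obj q) r)).1 := by
  have h1 := P.addZero_natural (AddFunctor.nul W.nul q).1 (𝟙 U) (by simp)
  have h2 := E.proj.map_comp (finv (E.inc.sum (H.obj q) r)).1 (E.inc.sum (H.obj q) r).1
  rw [finv_fhom, E.proj.map_id] at h2
  replace h2 := h2.symm
  rw [AddFunctor.nul_add, E.proj.map_comp]
  simp only [Category.assoc]
  rw [reassoc_of% h2, E.proj.sum_natural_assoc, ← h1, P.addMap_addMap_assoc,
    P.addMap_addMap_assoc, P.addZero_zero]
  refine congrArg (_ ≫ ·) (congrArg (· ≫ _) (P.addMap_congr _ (m.p_nul q) ?_))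
  rw [P.zeroMap_id, E.proj.map_id, Category.id_comp, Category.comp_id]

/-- A morphism of extensions twisted by an additive functor to `Q'`. -/
noncomputable def OverMor.twist (m : OverMor W E H)
    (c : AddFunctor W.E.toPicardFib Q'.toPicardFib) : OverMor W E (H.padd (c.comp W.inc)) where
  F := m.F.padd (E.inc.comp c)
  projIso := (compPadd E.proj m.F (E.inc.comp c)).trans
    ((paddCongr m.projIso (nulComp E.nul c)).trans (paddZero _))
  incIso := (paddPrecomp _ _ _).trans
    ((paddCongr m.incIso (compAssoc E.inc c W.inc)).trans (compPadd E.inc H (c.comp W.inc)).symm)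
  compat {U} q := (m.twist_compat q (c.obj (W.inc.obj q))).trans
    (congrArg (fun t => E.proj.map t ≫ _) (Category.id_comp _).symm)

end

/-- Adding the split extension does not change the equivalence class. -/
theorem IsAddTarget.split_add {E S : Extension P Q} (h : IsAddTarget (split P Q) E S) :
    Equivalent S E := by
  obtain ⟨m⟩ := h
  let c : AddFunctor (prodOver (split P Q) E).E.toPicardFib Q.toPicardFib :=
    (snd P.toPicardFib Q.toPicardFib).comp (prodOverFst (split P Q) E).F
  let a : AddFunctor.Hom (c.comp (prodOver (split P Q) E).inc)
      (fst Q.toPicardFib Q.toPicardFib) :=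
    (compAssoc _ _ _).trans (((prodOverFst (split P Q) E).incIso.whiskerLeft _).trans
      ((compAssocInv _ _ _).trans (((pairSnd _ _).whiskerRight _).trans (idComp _))))
  exact m.equivalent_of_hom (((prodOverSnd (split P Q) E).twist c).congr
    ((paddCongr (Hom.refl _) a).trans ((paddComm _ _).trans (paddFstSnd _)))) (Hom.refl _)
      (essSurj_addition _)

end Extension

end Twist

end PicardStacks

namespace PicardStacks

open FibGpd PicardFib AddFunctor

section Inverses

variable {C : Type u} [Category.{v} C] {J : GrothendieckTopology C}

namespace AddFunctor

/-- The first component of a pair. -/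
def pairFst {O A B : PicardFib.{w} C} (F : AddFunctor O A) (G : AddFunctor O B) :
    Hom ((fst A B).comp (AddFunctor.pair F G)) F where
  app x := ⟨𝟙 _, A.π_id _⟩
  naturality φ := (Category.comp_id _).trans (Category.id_comp _).symm
  app_add x y := by
    refine (Category.id_comp _).trans ?_
    refine Eq.trans ?_ (congrArg (_ ≫ ·) (A.addMap_id _ _)).symm
    exact ((Category.comp_id _).trans (Category.comp_id _)).symm

section Opposites

variable (Q : PicardFib.{w} C)

/-- The first component of a pair of opposite objects. -/
noncomputable abbrev oppFst : AddFunctor (kernel (addition Q)) Q :=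
  (fst Q Q).comp (kernelInc (addition Q))

/-- The second component of a pair of opposite objects. -/
noncomputable abbrev oppSnd : AddFunctor (kernel (addition Q)) Q :=
  (snd Q Q).comp (kernelInc (addition Q))

/-- The sum of opposite objects is zero. -/
noncomputable def oppSum :
    Hom ((oppFst Q).padd (oppSnd Q)) (zero (kernel (addition Q)) Q) :=
  (paddComponents (kernelInc (addition Q))).trans (kernelNul (addition Q))

theorem essSurj_oppFst : (oppFst Q).EssSurj := fun {U} q => by
  obtain ⟨y, ⟨i⟩⟩ := Q.exists_neg q
  exact ⟨⟨(q, y), ⟨⟩, i⟩, ⟨⟨𝟙 _, Q.π_id _⟩⟩⟩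

theorem essSurj_oppSnd : (oppSnd Q).EssSurj := fun {U} q => by
  obtain ⟨y, ⟨i⟩⟩ := Q.exists_neg q
  exact ⟨⟨(y, q), ⟨⟩, (Q.τ y q).comp i⟩, ⟨⟨𝟙 _, Q.π_id _⟩⟩⟩

variable {Q} in
theorem exists_completion {U : C} {a b a' b' : Q.Obj U} (i : Q.FHom (Q.add a b) (Q.zero U))
    (i' : Q.FHom (Q.add a' b') (Q.zero U)) (φ : Q.FHom a a') :
    ∃ ψ : Q.FHom b b', Q.addMap φ.1 ψ.1 (by simp) ≫ i'.1 = i.1 ∧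
      ∀ ψ' : Q.FHom b b', Q.addMap φ.1 ψ'.1 (by simp) ≫ i'.1 = i.1 → ψ' = ψ := by
  have key (ψ : Q.FHom b b') : Q.addMap φ.1 ψ.1 (by simp) =
      Q.addMap φ.1 (𝟙 _) (by simp) ≫ Q.addMap (𝟙 _) ψ.1 (by simp) := by
    rw [addMap_addMap]
    exact Q.addMap_congr _ (Category.comp_id _).symm (Category.id_comp _).symm
  let u : Q.FHom (Q.add a b) (Q.add a' b) := ⟨Q.addMap φ.1 (𝟙 _) (by simp), by simp⟩
  obtain ⟨ψ, hψ⟩ := exists_addMap_id_left (P := Q) (x := a') (y := b) (z := b')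
    ⟨(finv u).1 ≫ i.1 ≫ (finv i').1, by simp⟩
  have h : Q.addMap φ.1 ψ.1 (by simp) ≫ i'.1 = i.1 := by
    rw [key, hψ]
    change (u.1 ≫ (finv u).1 ≫ i.1 ≫ (finv i').1) ≫ i'.1 = i.1
    simp
  refine ⟨ψ, h, fun ψ' h' => ?_⟩
  have e := h'.trans h.symm
  rw [cancel_mono i'.1, key, key] at e
  have e' : Q.addMap (𝟙 (Tot.mk a')) ψ'.1 (by simp) = Q.addMap (𝟙 (Tot.mk a')) ψ.1 (by simp) :=
    haveI := isIso_val u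
    (cancel_epi u.1).1 e
  exact addMap_id_left_inj e'

theorem existsUnique_oppFst {U : C} {x y : (kernel (addition Q)).Obj U}
    (φ : Q.FHom ((oppFst Q).obj x) ((oppFst Q).obj y)) :
    ∃! χ : (kernel (addition Q)).FHom x y, (oppFst Q).map χ.1 = φ.1 := by
  obtain ⟨ψ, h, hu⟩ := exists_completion (Q := Q) x.iso y.iso φ
  refine ⟨⟨⟨⟨φ.1, ψ.1, φ.2.trans ψ.2.symm⟩, ⟨𝟙 U⟩, φ.2, h.trans ?_⟩, φ.2⟩, rfl, fun χ hχ => ?_⟩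
  · exact ((congrArg (_ ≫ ·) (Q.zeroMap_id U)).trans (Category.comp_id _)).symm
  · have e1 : (FibHom.snd χ.1).down = 𝟙 U := (FibHom.eq χ.1).symm.trans χ.2
    have e2 := hu ⟨ProdHom.snd (FibHom.fst χ.1), (ProdHom.eq (FibHom.fst χ.1)).symm.trans χ.2⟩ (by
      refine (congrArg (· ≫ _) (Q.addMap_congr _ hχ.symm rfl)).trans
        ((FibHom.comm χ.1).trans ?_)
      exact (congrArg (_ ≫ ·) ((congrArg Q.zeroMap e1).trans (Q.zeroMap_id U))).trans
        (Category.comp_id _))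
    exact fhom_eq (FibHom.ext (ProdHom.ext hχ (congrArg FHom.val e2)) (ULift.ext _ _ e1))

end Opposites

end AddFunctor

namespace Extension

variable {P Q N : PicardStack.{w} J}

/-- The target of a morphism over a zero functor is split. -/
theorem OverMor.equivalent_split {W : Extension P N} {S : Extension P Q}
    (m : OverMor W S (zero N.toPicardFib Q.toPicardFib)) : Equivalent (split P Q) S := by
  let n' : AddFunctor.Hom (m.F.comp W.inc) (zero N.toPicardFib S.E.toPicardFib) :=
    m.incIso.trans (zeroComp N.toPicardFib S.inc).symm
  have hn' {U : C} (q : N.Obj U) : (AddFunctor.nul n' q).1 = (m.i q).1 ≫ (S.inc.unit U).1 :=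
    congrArg (fun z : S.E.Hom (S.inc.obj (Q.zero U)) (S.E.zero U) => (m.i q).1 ≫ z)
      (finv_finv (S.inc.unit U))
  obtain ⟨s, η, hη⟩ := W.isCok.exists_desc S.E.isStack.isPrestack S.E.isStack.hasGluing n'
  obtain ⟨t, -⟩ := W.isCok.exists_hom_id P.isStack.isPrestack (B := S.proj.comp s)
    ((compAssoc S.proj s W.proj).trans ((η.whiskerLeft S.proj).trans m.projIso)) (by
      intro U q
      have key (e : S.E.FHom (s.obj (W.proj.obj (W.inc.obj q))) (m.F.obj (W.inc.obj q)))
          (i : S.E.FHom (m.F.obj (W.inc.obj q)) (S.inc.obj (Q.zero U)))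
          (h1 : (m.p (W.inc.obj q)).1 ≫ (AddFunctor.nul W.nul q).1 =
            S.proj.map i.1 ≫ (AddFunctor.nul S.nul (Q.zero U)).1)
          (h2 : s.map (AddFunctor.nul W.nul q).1 ≫ (s.unit U).1 =
            e.1 ≫ i.1 ≫ (S.inc.unit U).1) :
          S.proj.map (s.map (AddFunctor.nul W.nul q).1) ≫ S.proj.map (s.unit U).1 ≫
            (S.proj.unit U).1 = S.proj.map e.1 ≫ (m.p (W.inc.obj q)).1 ≫
              (AddFunctor.nul W.nul q).1 := by
        have h3 := congrArg S.proj.map h2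
        rw [S.proj.map_comp, S.proj.map_comp, S.proj.map_comp] at h3
        rw [h1, AddFunctor.nul_zero, reassoc_of% h3]
      refine (congrArg (_ ≫ ·) (comp_unit S.proj s U)).trans ((key (η.app (W.inc.obj q)) (m.i q) (m.p_nul q)
        ((hη q).trans (congrArg (_ ≫ ·) (hn' q)))).trans ?_)
      refine (Category.assoc _ _ _).symm.trans (congrArg (· ≫ _) ?_)
      exact (Category.id_comp _).symm)
  let k : OverMor (split P Q) S (zero Q.toPicardFib Q.toPicardFib) :=
    { F := s.comp (fst P.toPicardFib Q.toPicardFib)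
      projIso := (compAssocInv _ _ _).trans ((t.whiskerRight _).trans (idComp _))
      incIso := (compAssoc _ _ _).trans (((pairFst _ _).whiskerLeft s).trans
        ((zeroComp Q.toPicardFib s).symm.trans (zeroComp Q.toPicardFib S.inc)))
      compat := fun {U} q => by
        let a : S.E.FHom (S.inc.obj (Q.zero U)) (S.E.zero U) := S.inc.unit U
        have h1 : (t.app (P.zero U)).1 = S.proj.map (s.unit U).1 ≫ (S.proj.unit U).1 := by
          have h := t.app_zero U
          rw [comp_unit, id_unit] at h
          exact (Category.comp_id _).symm.trans h
        have h2 : S.proj.map (finv a).1 ≫ (AddFunctor.nul S.nul (Q.zero U)).1 =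
            (S.proj.unit U).1 := by
          rw [AddFunctor.nul_zero, ← Category.assoc, ← S.proj.map_comp]
          exact (congrArg (fun z => S.proj.map z ≫ _) (finv_fhom a)).trans
            ((congrArg (· ≫ _) (S.proj.map_id _)).trans (Category.id_comp _))
        have h3 : (finv (finv (s.unit U))).1 = (s.unit U).1 := finv_finv _
        have h4 : S.proj.map ((finv (finv (s.unit U))).1 ≫ (finv a).1) ≫
            (AddFunctor.nul S.nul (Q.zero U)).1 = (t.app (P.zero U)).1 := by
          rw [h1, h3, S.proj.map_comp, Category.assoc, h2]
        refine (Category.comp_id _).trans ((Category.id_comp _).trans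
          ((Category.comp_id _).trans (h4.symm.trans ?_)))
        refine congrArg (fun z => S.proj.map z ≫ _) ?_
        exact ((Category.id_comp _).trans ((congrArg (· ≫ _) (s.map_id _)).trans
          (Category.id_comp _))).symm }
  let a : AddFunctor.Hom ((zero Q.toPicardFib Q.toPicardFib).padd
      ((snd P.toPicardFib Q.toPicardFib).comp (split P Q).inc)) (AddFunctor.id Q.toPicardFib) :=
    (paddCongr (Hom.refl _) (pairSnd _ _)).trans ((paddComm _ _).trans (paddZero _))
  exact ((k.twist (snd P.toPicardFib Q.toPicardFib)).congr a).equivalent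

theorem exists_neg (E : Extension P Q) : ∃ E' : Extension P Q, ∀ S : Extension P Q,
    IsAddTarget E E' S → Equivalent (split P Q) S := by
  let N : PicardStack.{w} J := PicardStack.fibProd (P := Q.prod Q) (P' := PicardStack.one.{w} J)
    (addition Q.toPicardFib) (zero (PicardStack.one.{w} J).toPicardFib Q.toPicardFib)
  have h := E.isCok.nulComp (B := oppFst Q.toPicardFib) (existsUnique_oppFst Q.toPicardFib)
    (essSurj_oppFst Q.toPicardFib)
  let W : Extension P N := ofIsCok h
  let m : OverMor W E (oppFst Q.toPicardFib) :=
    { F := AddFunctor.id _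
      projIso := compId _
      incIso := idComp _
      compat := fun {U} q => (Category.id_comp _).trans
        ((congrArg (· ≫ _) (E.proj.map_id _)).trans (Category.id_comp _)).symm }
  obtain ⟨E', ⟨m'⟩⟩ := W.exists_overMor (H := oppSnd Q.toPicardFib) (essSurj_oppSnd Q.toPicardFib)
  refine ⟨E', fun S hS => ?_⟩
  obtain ⟨k⟩ := hS.exists_overMor m m'
  exact (k.congr (oppSum Q.toPicardFib)).equivalent_split

end Extension

end Inverses

end PicardStacks

namespace PicardStacks

open FibGpd PicardFib AddFunctor

section GroupOfClasses

variable {C : Type u} [Category.{v} C] {J : GrothendieckTopology C}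

namespace Extension

variable {P Q : PicardStack.{w} J}

/-- A sum of two extensions. -/
noncomputable def someSum (E E' : Extension P Q) : Extension P Q := (exists_isSum E E').choose

theorem isAddTarget_someSum (E E' : Extension P Q) : IsAddTarget E E' (someSum E E') :=
  (exists_isSum E E').choose_spec.isAddTarget

theorem cls_eq {E E' : Extension P Q} (h : Equivalent E E') : E.cls = E'.cls := Quot.sound h

namespace Class

/-- The sum of classes of extensions. -/
noncomputable def add : Class P Q → Class P Q → Class P Q :=
  Quot.map₂ someSum
    (fun E F F' h => (isAddTarget_someSum E F).unique (isAddTarget_someSum E F')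
      (equivalent_refl E) h)
    (fun E E' F h => (isAddTarget_someSum E F).unique (isAddTarget_someSum E' F) h
      (equivalent_refl F))

theorem add_cls {E E' S : Extension P Q} (h : IsAddTarget E E' S) : add E.cls E'.cls = S.cls :=
  cls_eq ((isAddTarget_someSum E E').unique h (equivalent_refl E) (equivalent_refl E'))

theorem exists_add_eq_zero (x : Class P Q) : ∃ y : Class P Q, add x y = (split P Q).cls := by
  induction x using Quot.ind with
  | mk E =>
    obtain ⟨E', h⟩ := exists_neg E
    exact ⟨E'.cls, (add_cls (isAddTarget_someSum E E')).trans
      (cls_eq (h _ (isAddTarget_someSum E E'))).symm⟩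

/-- The opposite of a class of extensions. -/
noncomputable def neg (x : Class P Q) : Class P Q := (exists_add_eq_zero x).choose

protected theorem add_comm (x y : Class P Q) : add x y = add y x := by
  induction x using Quot.ind with
  | mk E =>
    induction y using Quot.ind with
    | mk F => exact cls_eq ((isAddTarget_someSum E F).comm (isAddTarget_someSum F E))

protected theorem add_assoc (x y z : Class P Q) : add (add x y) z = add x (add y z) := by
  induction x using Quot.ind with
  | mk E =>
    induction y using Quot.ind with
    | mk F =>
      induction z using Quot.ind with
      | mk G => exact cls_eq ((isAddTarget_someSum E F).assoc (isAddTarget_someSum _ G)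
          (isAddTarget_someSum F G) (isAddTarget_someSum E _))

protected theorem zero_add (x : Class P Q) : add (split P Q).cls x = x := by
  induction x using Quot.ind with
  | mk E => exact cls_eq (isAddTarget_someSum (split P Q) E).split_add

/-- The group of classes of extensions. -/
@[reducible] noncomputable def addCommGroup (P Q : PicardStack.{w} J) :
    AddCommGroup (Class P Q) where
  add := add
  zero := (split P Q).cls
  neg := neg
  add_assoc := Class.add_assoc
  zero_add := Class.zero_add
  add_zero x := (Class.add_comm x _).trans (Class.zero_add x)
  neg_add_cancel x := (Class.add_comm (neg x) x).trans (exists_add_eq_zero x).choose_spec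
  add_comm := Class.add_comm
  nsmul := @nsmulRec _ ⟨(split P Q).cls⟩ ⟨add⟩
  zsmul := @zsmulRec _ ⟨(split P Q).cls⟩ ⟨add⟩ ⟨neg⟩ (@nsmulRec _ ⟨(split P Q).cls⟩ ⟨add⟩)

end Class

end Extension

end GroupOfClasses

end PicardStacks

theorem lemma4p5 {C : Type u} [CategoryTheory.Category.{v} C]
    (J : CategoryTheory.GrothendieckTopology C) (P Q : PicardStacks.PicardStack.{w} J) :
    _root_.Equivalence (PicardStacks.Extension.Equivalent (P := P) (Q := Q)) ∧
    (∀ E E' : PicardStacks.Extension P Q,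
      ∃ S : PicardStacks.Extension P Q, PicardStacks.Extension.IsSum E E' S) ∧
    ∃ _ : AddCommGroup (PicardStacks.Extension.Class P Q),
      (∀ E E' S : PicardStacks.Extension P Q,
        PicardStacks.Extension.IsSum E E' S → E.cls + E'.cls = S.cls) ∧
      (PicardStacks.Extension.split P Q).cls = 0 := by
  refine ⟨⟨PicardStacks.Extension.equivalent_refl, PicardStacks.Extension.Equivalent.symm,
    PicardStacks.Extension.Equivalent.trans⟩, PicardStacks.Extension.exists_isSum,
    PicardStacks.Extension.Class.addCommGroup P Q, fun E E' S h => ?_, rfl⟩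
  exact PicardStacks.Extension.Class.add_cls h.isAddTarget
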